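/- **Setting.** Let $M$ be a smooth manifold (Hausdorff, $\sigma$-compact) with a Poisson bracket $\{\cdot,\cdot\}$ on $C^\infty(M)=C^\infty(M,\mathbb C)$, and let $f\star g=fg+\sum_{r\ge1}\nu^rC_r(f,g)$ be a star product on $M$: the $C_r$ are bidifferential operators, $\star$ is associative on $C^\infty(M)[[\nu]]$, the constant $1$ is its unit, and $C_1(f,g)-C_1(g,f)=\{f,g\}$. It is called *natural* if for every $r\ge1$ the operator $C_r$ has order at most $r$ in each argument. **Formal oscillatory integrals.** Let $N$ be a manifold and $x_0\in N$. A *phase-density pair* at $x_0$ consists of a formal phase $\varphi=\nu^{-1}\varphi_{-1}+\varphi_0+\nu\varphi_1+\cdots$ with $\varphi_k\in C^\infty(N,\mathbb C)$, such that $x_0$ is a nondegenerate critical point of $\varphi_{-1}$ with $\varphi_{-1}(x_0)=0$, and of a formal complex density $\rho=\rho_0+\nu\rho_1+\cdots$, smooth near $x_0$, with $\rho_0(x_0)\ne0$. A formal distribution $\Lambda=\Lambda_0+\nu\Lambda_1+\cdots$ on $N$ supported at $x_0$ is a *formal oscillatory integral* (FOI) at $x_0$ if $\Lambda_0\neq0$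 and, for some phase-density pair $(\varphi,\rho)$ at $x_0$, $$\Lambda\bigl(vf+(v\varphi+\mathrm{div}_\rho v)f\bigr)=0$$ for all vector fields $v$ and all smooth functions $f$ on $N$, where $\mathrm{div}_\rho v=\mathbb L_v\rho/\rho$. **Fedosov star products.** Let $\omega$ be a symplectic form on $M$ and $\pi=-\omega^{-1}$ its Poisson tensor, $\{f,g\}=\pi^{ij}\partial_if\,\partial_jg$. Sections of the Weyl bundle are formal series $a(x,y,\nu)$ in $\nu$ and in the fibre coordinates $y^i$ of $TM$, with the fibrewise product $a\circ b=\exp\bigl(\tfrac{\nu}{2}\pi^{ij}\partial_{y^i}\partial_{z^j}\bigr)a(y)b(z)|_{z=y}$; the degree is given by $\deg y^i=1$, $\deg\nu=2$. Let $\nabla$ be a torsion-free connection with $\nabla\omega=0$ and curvature $R^i{}_{jkl}$, put $\partial_ka=\frac{\partial a}{\partial x^k}-\Gamma^i_{kj}y^j\frac{\partial a}{\partial y^i}$, and let $\Omega=\nu\Omega_1+\nu^2\Omega_2+\cdots$ be a formal closed complex $2$-form. Let $r=r_k\,dx^k$ be the Weyl-bundle-valued $1$-form of degree at least $3$ with $y^kr_k=0$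 such that, for $\gamma_k=\omega_{ki}y^i+r_k$, $$-\tfrac12\,\omega_{pi}R^i{}_{jkl}\,y^py^j+\partial_k\gamma_l-\partial_l\gamma_k+\tfrac1\nu[\gamma_k,\gamma_l]_\circ=\omega_{kl}+\Omega_{kl}.$$ For $f\in C^\infty(M)$ let $\tau(f)$ be the section with $\partial_k\tau(f)+\tfrac1\nu[\gamma_k,\tau(f)]_\circ=0$ and $\tau(f)|_{y=0}=f$. The Fedosov star product of $(\nabla,\Omega)$ is $f\star g=(\tau(f)\circ\tau(g))|_{y=0}$. **Proposition.** 1. Suppose that $\star$ is natural. There is exactly one complex contravariant $2$-tensor $K$ on $M$ such that $C_1(f,g)=K^{ij}\,\partial_if\,\partial_jg$ for all $f,g$. For each $x\in M$ there is exactly one formal distribution $\Lambda$ on $M\times M$ supported at $(x,x)$ such that $\Lambda(f\otimes g)=(f\star g)(x)$ for all $f,g\in C^\infty(M)$, and $\Lambda$ is a FOI at $(x,x)$ if and only if the bilinear form $K^{ij}(x)$ on the complexified cotangent space at $x$ is nondegenerate. 2. Suppose that $\{\cdot,\cdot\}$ is the Poisson bracket of a symplectic form on $M$. (a) If $\star$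 is natural and $C_1(f,g)=\tfrac12\{f,g\}$, then $K^{ij}(x)$ is nondegenerate and the distribution $f\otimes g\mapsto(f\star g)(x)$ is a FOI at $(x,x)$, for every $x\in M$. (b) If $\star$ is a Fedosov star product, then the distribution $f\otimes g\mapsto(f\star g)(x)$ is a FOI at $(x,x)$ for every $x\in M$. -/

import Mathlib

open scoped Manifold ContDiff Topology Matrix

noncomputable section

namespace StarFOI

/-! ### Smooth functions, formal distributions, vector fields and densities -/

section General

variable {E : Type*} [NormedAddCommGroup E] [NormedSpace ℝ E]
  {H : Type*} [TopologicalSpace H] (J : ModelWithCorners ℝ E H)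
  (N : Type*) [TopologicalSpace N] [ChartedSpace H N]

/-- The ring `C^∞(N)` of smooth complex-valued functions on the real manifold `N`. -/
abbrev SmoothFn := C^∞⟮J, N; 𝓘(ℝ, ℂ), ℂ⟯

/-- `ℂ` is a smooth ring as a real manifold. -/
instance instContMDiffRingComplex : ContMDiffRing 𝓘(ℝ, ℂ) ∞ ℂ :=
  { instNormedSpaceLieAddGroup with
    contMDiff_mul := by
      have h : ContMDiff 𝓘(ℝ, ℂ × ℂ) 𝓘(ℝ, ℂ) ∞ (fun p : ℂ × ℂ => p.1 * p.2) :=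
        contDiff_mul.contMDiff
      rw [modelWithCornersSelf_prod, ← chartedSpaceSelf_prod] at h
      exact h }

/-- Constant functions, as a ring homomorphism `ℂ → C^∞(N)`. -/
def constHom : ℂ →+* SmoothFn J N where
  toFun c := ContMDiffMap.const c
  map_one' := rfl
  map_mul' _ _ := rfl
  map_zero' := rfl
  map_add' _ _ := rfl

/-- `C^∞(N)` is a complex algebra, through the constant functions. -/
instance instAlgebraSmoothFn : Algebra ℂ (SmoothFn J N) := (constHom J N).toAlgebra

/-- A formal distribution `Λ = Λ₀ + ν Λ₁ + …`, as the sequence of its components. -/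
abbrev FormalFunctional := ℕ → (SmoothFn J N →ₗ[ℂ] ℂ)

variable {J N}

/-- The vanishing ideal of the point `x`. -/
def vanishingIdeal (x : N) : Ideal (SmoothFn J N) :=
  RingHom.ker (ContMDiffMap.evalRingHom (n := ∞) (I := J) (I' := 𝓘(ℝ, ℂ)) (R := ℂ) x)

/-- `f` has a zero of order at least `k` at `x`. -/
def VanishesToOrder (k : ℕ) (f : SmoothFn J N) (x : N) : Prop :=
  f ∈ (vanishingIdeal x : Ideal (SmoothFn J N)) ^ k

/-- Every component of `Λ` is a distribution supported at `x`, that is, a linear functional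
of some finite order which only depends on the jet at `x`. -/
def SupportedAt (x : N) (Λ : FormalFunctional J N) : Prop :=
  ∀ r, ∃ k : ℕ, ∀ f : SmoothFn J N, VanishesToOrder (k + 1) f x → Λ r f = 0

/-- The differential of `f` at `x`, an element of the complexified cotangent space. -/
def differential (f : SmoothFn J N) (x : N) : TangentSpace J x →L[ℝ] ℂ :=
  mfderiv J 𝓘(ℝ, ℂ) f x

variable [IsManifold J ∞ N]

variable (J N) in
/-- Smooth (real) vector fields on `N`. -/
abbrev SmoothVectorField := Cₛ^∞⟮J; E, (TangentSpace J : N → Type _)⟯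

/-- The function `v f`. -/
def lieFn (v : SmoothVectorField J N) (f : SmoothFn J N) : SmoothFn J N :=
  ⟨fun x => differential f x (v x), by
    have h1 := (f.contMDiff.contMDiff_tangentMap (m := ∞) (by simp)).comp v.contMDiff
    exact (contMDiff_snd_tangentBundle_modelSpace ℂ 𝓘(ℝ, ℂ)).comp h1⟩

variable (J N) in
/-- A complex density on `N`: a function of frames which is multiplied by `|det A|` when
the frame is transformed by `A`. Smoothness is imposed separately. -/
structure Density where
  toFun : ∀ x : N, (Fin (Module.finrank ℝ E) → TangentSpace J x) → ℂ
  map_det : ∀ (x : N) (A : TangentSpace J x →ₗ[ℝ] TangentSpace J x)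
    (u : Fin (Module.finrank ℝ E) → TangentSpace J x),
    toFun x (fun i => A (u i)) = ((|LinearMap.det A| : ℝ) : ℂ) * toFun x u

variable [FiniteDimensional ℝ E]

/-- The coefficient of the density `ρ` with respect to the coordinates of the preferred chart
at `x₀` : its value on the coordinate frame. -/
def Density.coeff (ρ : Density J N) (x₀ : N) (y : E) : ℂ :=
  ρ.toFun ((extChartAt J x₀).symm y)
    (fun i => mfderiv 𝓘(ℝ, E) J (extChartAt J x₀).symm y (Module.finBasis ℝ E i))

/-- The components of the vector field `v` in the preferred chart at `x₀`. -/
def vectorInChart (v : SmoothVectorField J N) (x₀ : N) (y : E) : E :=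
  mfderiv J 𝓘(ℝ, E) (extChartAt J x₀) ((extChartAt J x₀).symm y) (v ((extChartAt J x₀).symm y))

/-- The coefficient of the Lie derivative `𝕃_v ρ`, that is `∂_i (v^i ρ)`. -/
def Density.lieCoeff (ρ : Density J N) (v : SmoothVectorField J N) (x₀ : N) (y : E) : ℂ :=
  fderiv ℝ (ρ.coeff x₀) y (vectorInChart v x₀ y) +
    ρ.coeff x₀ y * ((LinearMap.trace ℝ E (fderiv ℝ (vectorInChart v x₀) y : E →ₗ[ℝ] E) : ℝ) : ℂ)

/-- The Hessian matrix at `x₀` of `f` in the coordinates of the preferred chart at `x₀`. -/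
def hessian (f : SmoothFn J N) (x₀ : N) :
    Matrix (Fin (Module.finrank ℝ E)) (Fin (Module.finrank ℝ E)) ℂ :=
  Matrix.of fun i j =>
    fderiv ℝ (fderiv ℝ (fun y => f ((extChartAt J x₀).symm y))) (extChartAt J x₀ x₀)
      (Module.finBasis ℝ E i) (Module.finBasis ℝ E j)

/-- `(φ, ρ)` is a phase-density pair at `x₀`. Here `φ k` is the coefficient of `ν ^ (k - 1)`
of the phase `ν⁻¹ φ₋₁ + φ₀ + …`, and `ρ k` is the coefficient of `ν ^ k` of the density. The
density has to be smooth on the domain of the preferred chart at `x₀`. -/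
structure IsPhaseDensityPair (x₀ : N) (φ : ℕ → SmoothFn J N) (ρ : ℕ → Density J N) : Prop where
  value : φ 0 x₀ = 0
  critical : differential (φ 0) x₀ = 0
  nondegenerate : (hessian (φ 0) x₀).det ≠ 0
  smooth : ∀ k, ContDiffOn ℝ ∞ ((ρ k).coeff x₀) (extChartAt J x₀).target
  nonvanishing : (ρ 0).coeff x₀ (extChartAt J x₀ x₀) ≠ 0

/-- `d = d₀ + ν d₁ + …` represents near `x₀` the divergence `div_ρ v = 𝕃_v ρ / ρ`, that is,
`d ρ = 𝕃_v ρ` near `x₀` in every order in `ν`. -/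
def IsDivergence (ρ : ℕ → Density J N) (v : SmoothVectorField J N) (x₀ : N)
    (d : ℕ → SmoothFn J N) : Prop :=
  ∀ k, ∀ᶠ y in 𝓝 (extChartAt J x₀ x₀),
    ∑ p ∈ Finset.HasAntidiagonal.antidiagonal k, d p.1 ((extChartAt J x₀).symm y) * (ρ p.2).coeff x₀ y =
      (ρ k).lieCoeff v x₀ y

/-- The coefficient of `ν ^ (k - 1)` of `v f + (v φ + d) f`. -/
def integrand (φ : ℕ → SmoothFn J N) (d : ℕ → SmoothFn J N) (v : SmoothVectorField J N)
    (f : SmoothFn J N) : ℕ → SmoothFn J N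
  | 0 => lieFn v (φ 0) * f
  | 1 => lieFn v f + (lieFn v (φ 1) + d 0) * f
  | (k + 2) => (lieFn v (φ (k + 2)) + d (k + 1)) * f

/-- `Λ` is a formal oscillatory integral at `x₀` associated with `(φ, ρ)` : it is supported at
`x₀`, `Λ₀ ≠ 0`, and `Λ (v f + (v φ + div_ρ v) f) = 0` for all `v` and `f`. The coefficient of
`ν ^ (m - 1)` of the left-hand side is written out. -/
structure IsFOIFor (x₀ : N) (φ : ℕ → SmoothFn J N) (ρ : ℕ → Density J N)
    (Λ : FormalFunctional J N) : Prop where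
  supported : SupportedAt x₀ Λ
  leading : Λ 0 ≠ 0
  integral_lie : ∀ (v : SmoothVectorField J N) (f : SmoothFn J N) (d : ℕ → SmoothFn J N),
    IsDivergence ρ v x₀ d →
      ∀ m, ∑ p ∈ Finset.HasAntidiagonal.antidiagonal m, Λ p.1 (integrand φ d v f p.2) = 0

/-- `Λ` is a formal oscillatory integral at `x₀`. -/
def IsFOI (x₀ : N) (Λ : FormalFunctional J N) : Prop :=
  ∃ (φ : ℕ → SmoothFn J N) (ρ : ℕ → Density J N),
    IsPhaseDensityPair x₀ φ ρ ∧ IsFOIFor x₀ φ ρ Λ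

end General

/-! ### Poisson brackets and star products -/

section Star

variable {E : Type*} [NormedAddCommGroup E] [NormedSpace ℝ E]
  {H : Type*} [TopologicalSpace H] (J : ModelWithCorners ℝ E H)
  (M : Type*) [TopologicalSpace M] [ChartedSpace H M]

/-- A Poisson structure on `M`, as a Poisson bracket on the complex-valued functions. -/
structure PoissonBracket where
  bracket : SmoothFn J M →ₗ[ℂ] SmoothFn J M →ₗ[ℂ] SmoothFn J M
  skew : ∀ f g, bracket f g = - bracket g f
  leibniz : ∀ f g h, bracket f (g * h) = bracket f g * h + g * bracket f h
  jacobi : ∀ f g h, bracket f (bracket g h) + bracket g (bracket h f) + bracket h (bracket f g) = 0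

variable {J M}

/-- A star product `f ⋆ g = f g + ∑_{r ≥ 1} ν ^ r C r f g` on a Poisson manifold. -/
structure StarProduct (P : PoissonBracket J M) where
  C : ℕ → (SmoothFn J M →ₗ[ℂ] SmoothFn J M →ₗ[ℂ] SmoothFn J M)
  /-- Every `C r` is bidifferential, of locally finite order. -/
  bidifferential : ∀ (r : ℕ) (x : M), ∃ k : ℕ, ∀ᶠ y in 𝓝 x, ∀ f g : SmoothFn J M,
    (VanishesToOrder (k + 1) f y ∨ VanishesToOrder (k + 1) g y) → C r f g y = 0
  C_zero : ∀ f g, C 0 f g = f * g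
  one_left : ∀ r f, 1 ≤ r → C r 1 f = 0
  one_right : ∀ r f, 1 ≤ r → C r f 1 = 0
  assoc : ∀ (m : ℕ) (f g h : SmoothFn J M),
    ∑ p ∈ Finset.HasAntidiagonal.antidiagonal m, C p.1 (C p.2 f g) h =
      ∑ p ∈ Finset.HasAntidiagonal.antidiagonal m, C p.1 f (C p.2 g h)
  poisson : ∀ f g, C 1 f g - C 1 g f = P.bracket f g

/-- `⋆` is natural: `C r` has order at most `r` in both arguments, for every `r ≥ 1`. -/
def StarProduct.IsNatural {P : PoissonBracket J M} (S : StarProduct P) : Prop :=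
  ∀ (r : ℕ), 1 ≤ r → ∀ (x : M) (f g : SmoothFn J M),
    (VanishesToOrder (r + 1) f x ∨ VanishesToOrder (r + 1) g x) → S.C r f g x = 0

variable (J M) in
/-- Complex contravariant 2-tensors on `M`: at each `x` a bilinear form on the complexified
cotangent space. -/
abbrev ContravariantTensor := ∀ x : M, LinearMap.BilinForm ℂ (TangentSpace J x →L[ℝ] ℂ)

/-- `C₁(f, g) = K^{ij} ∂_i f ∂_j g`. -/
def StarProduct.IsFirstTensor {P : PoissonBracket J M} (S : StarProduct P)
    (K : ContravariantTensor J M) : Prop :=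
  ∀ (f g : SmoothFn J M) (x : M), S.C 1 f g x = K x (differential f x) (differential g x)

/-- The function `f ⊗ g` on `M × M`, that is `(x, y) ↦ f x * g y`. -/
def tensorFn (f g : SmoothFn J M) : SmoothFn (J.prod J) (M × M) :=
  f.comp ContMDiffMap.fst * g.comp ContMDiffMap.snd

/-- `Λ` is the formal distribution `f ⊗ g ↦ (f ⋆ g)(x)` on `M × M` supported at `(x, x)`. -/
def StarProduct.IsPointDistribution {P : PoissonBracket J M} (S : StarProduct P) (x : M)
    (Λ : FormalFunctional (J.prod J) (M × M)) : Prop :=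
  SupportedAt (x, x) Λ ∧ ∀ (r : ℕ) (f g : SmoothFn J M), Λ r (tensorFn f g) = S.C r f g x

end Star

/-! ### Symplectic manifolds -/

section Symplectic

variable {n : ℕ} {M : Type*} [TopologicalSpace M] [ChartedSpace (EuclideanSpace ℝ (Fin n)) M]

/-- The standard basis of `ℝ ^ n`. -/
def stdVec (i : Fin n) : EuclideanSpace ℝ (Fin n) := EuclideanSpace.single i 1

variable (n M) in
/-- Differential 2-forms on `M` with values in `F` (smoothness is imposed separately). -/
abbrev TwoForm (F : Type*) [NormedAddCommGroup F] [NormedSpace ℝ F] :=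
  ∀ x : M, TangentSpace (𝓡 n) x [⋀^Fin 2]→L[ℝ] F

variable {F : Type*} [NormedAddCommGroup F] [NormedSpace ℝ F]

/-- The 2-form `α` in the preferred chart at `x₀`. -/
def TwoForm.inChart (α : TwoForm n M F) (x₀ : M) (y : EuclideanSpace ℝ (Fin n)) :
    EuclideanSpace ℝ (Fin n) [⋀^Fin 2]→L[ℝ] F :=
  (α ((extChartAt (𝓡 n) x₀).symm y)).compContinuousLinearMap
    (mfderiv 𝓘(ℝ, EuclideanSpace ℝ (Fin n)) (𝓡 n) (extChartAt (𝓡 n) x₀).symm y)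

/-- The components `α_{ij}` in the preferred chart at `x₀`. -/
def TwoForm.comp (α : TwoForm n M F) (x₀ : M) (y : EuclideanSpace ℝ (Fin n)) (i j : Fin n) : F :=
  α.inChart x₀ y ![stdVec i, stdVec j]

/-- `α` is smooth and closed. -/
structure TwoForm.IsClosedForm (α : TwoForm n M F) : Prop where
  smooth : ∀ x₀, ContDiffOn ℝ ∞ (α.inChart x₀) (extChartAt (𝓡 n) x₀).target
  closed : ∀ x₀, ∀ y ∈ (extChartAt (𝓡 n) x₀).target, extDeriv (α.inChart x₀) y = 0

/-- `ω` is a symplectic form: a closed nondegenerate 2-form. -/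
structure IsSymplectic (ω₀ : TwoForm n M ℝ) : Prop extends ω₀.IsClosedForm where
  nondegenerate : ∀ (x : M) (u : TangentSpace (𝓡 n) x), (∀ w, ω₀ x ![u, w] = 0) → u = 0

/-- The Poisson tensor `π = - ω⁻¹` as a matrix, from the matrix of `ω` in the same frame. With
`ω = ∑ dq ∧ dp` this gives `{q, p} = 1`. -/
def poissonMatrix (w : Fin n → Fin n → ℝ) : Matrix (Fin n) (Fin n) ℝ := -(Matrix.of w)⁻¹

/-- The Poisson bracket of `P` is the one of the symplectic form `ω`. -/
def PoissonBracket.IsInducedBy (P : PoissonBracket (𝓡 n) M) (ω₀ : TwoForm n M ℝ) : Prop :=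
  ∀ (f g : SmoothFn (𝓡 n) M) (x : M), P.bracket f g x =
    ∑ i, ∑ j, (poissonMatrix (fun i j => ω₀ x ![stdVec i, stdVec j]) i j : ℂ) *
      differential f x (stdVec i) * differential g x (stdVec j)

end Symplectic

/-! ### Fedosov star products -/

section Weyl

/-- The formal Weyl algebra `ℂ[[y¹, …, yⁿ]][[ν]]` (its elements; the product is `moyal`). -/
abbrev FormalWeyl (n : ℕ) := PowerSeries (MvPowerSeries (Fin n) ℂ)

variable {n : ℕ}

/-- The coefficient of `ν ^ m y ^ μ`. -/
def wcoeff (m : ℕ) (μ : Fin n →₀ ℕ) (a : FormalWeyl n) : ℂ :=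
  MvPowerSeries.coeff μ (PowerSeries.coeff m a)

/-- Scalars `c ∈ ℂ` in the Weyl algebra. -/
def wconst (c : ℂ) : FormalWeyl n := PowerSeries.C (MvPowerSeries.C c)

/-- The generator `y ^ i`. -/
def wvar (i : Fin n) : FormalWeyl n := PowerSeries.C (MvPowerSeries.X i)

/-- The iterated derivative `∂_{i 0} ⋯ ∂_{i (s - 1)}` in the variables `y`. -/
def iterPderiv {s : ℕ} (i : Fin s → Fin n) (a : MvPowerSeries (Fin n) ℂ) :
    MvPowerSeries (Fin n) ℂ :=
  (List.ofFn i).foldr (fun k b => MvPowerSeries.pderiv ℂ k b) a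

/-- The fibrewise Moyal-Weyl product
`a ∘ b = exp ((ν / 2) π^{ij} ∂_{y^i} ∂_{z^j}) a(y) b(z) |_{z = y}`. -/
def moyal (π : Matrix (Fin n) (Fin n) ℝ) (a b : FormalWeyl n) : FormalWeyl n :=
  PowerSeries.mk fun m => ∑ p ∈ Finset.HasAntidiagonal.antidiagonal m, ∑ q ∈ Finset.HasAntidiagonal.antidiagonal p.2,
    ((1 : ℂ) / (2 ^ p.1 * (p.1.factorial : ℂ))) • ∑ i : Fin p.1 → Fin n, ∑ j : Fin p.1 → Fin n,
      (∏ t, (π (i t) (j t) : ℂ)) •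
        (iterPderiv i (PowerSeries.coeff q.1 a) * iterPderiv j (PowerSeries.coeff q.2 b))

/-- The commutator of `moyal`. -/
def wcomm (π : Matrix (Fin n) (Fin n) ℝ) (a b : FormalWeyl n) : FormalWeyl n :=
  moyal π a b - moyal π b a

/-- `∂_{y^i}` on the Weyl algebra. -/
def wpderiv (i : Fin n) (a : FormalWeyl n) : FormalWeyl n :=
  PowerSeries.mk fun m => MvPowerSeries.pderiv ℂ i (PowerSeries.coeff m a)

/-- The derivative of a Weyl algebra valued function in the direction of the base
coordinate `x^k`, coefficient by coefficient. -/
def baseDeriv (k : Fin n) (a : EuclideanSpace ℝ (Fin n) → FormalWeyl n)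
    (x : EuclideanSpace ℝ (Fin n)) : FormalWeyl n :=
  PowerSeries.mk fun m => (fun μ => fderiv ℝ (fun z => wcoeff m μ (a z)) x (stdVec k) :
    MvPowerSeries (Fin n) ℂ)

/-- All coefficients of `a` are smooth on `U`. -/
def WSmoothOn (a : EuclideanSpace ℝ (Fin n) → FormalWeyl n)
    (U : Set (EuclideanSpace ℝ (Fin n))) : Prop :=
  ∀ m μ, ContDiffOn ℝ ∞ (fun z => wcoeff m μ (a z)) U

/-- The covariant derivative `∂_k a = ∂a/∂x^k - Γ^i_{kj} y^j ∂a/∂y^i` of a section of the Weyl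
bundle; `G x k j i` is `Γ^i_{kj}(x)`. -/
def covWeyl (G : EuclideanSpace ℝ (Fin n) → Fin n → Fin n → Fin n → ℝ) (k : Fin n)
    (a : EuclideanSpace ℝ (Fin n) → FormalWeyl n) (x : EuclideanSpace ℝ (Fin n)) : FormalWeyl n :=
  baseDeriv k a x - ∑ i, ∑ j, wconst (G x k j i : ℂ) * wvar j * wpderiv i (a x)

/-- The curvature `R^i_{jkl}`, with `R(∂_k, ∂_l) ∂_j = R^i_{jkl} ∂_i`. -/
def curvatureCoeff (G : EuclideanSpace ℝ (Fin n) → Fin n → Fin n → Fin n → ℝ)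
    (x : EuclideanSpace ℝ (Fin n)) (i j k l : Fin n) : ℝ :=
  fderiv ℝ (fun z => G z l j i) x (stdVec k) - fderiv ℝ (fun z => G z k j i) x (stdVec l) +
    ∑ m, (G x k m i * G x l j m - G x l m i * G x k j m)

/-- The curvature `- (1/2) ω_{pi} R^i_{jkl} y^p y^j` as an element of the Weyl algebra. Its
commutator divided by `ν` is the commutator of `∂_k` and `∂_l`. -/
def curvatureWeyl (w : Fin n → Fin n → ℝ)
    (G : EuclideanSpace ℝ (Fin n) → Fin n → Fin n → Fin n → ℝ)
    (x : EuclideanSpace ℝ (Fin n)) (k l : Fin n) : FormalWeyl n :=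
  ∑ p, ∑ j, ∑ i, wconst (-(1 / 2) * (w p i : ℂ) * (curvatureCoeff G x i j k l : ℂ)) *
    wvar p * wvar j

end Weyl

section Fedosov

variable {n : ℕ} {M : Type*} [TopologicalSpace M] [ChartedSpace (EuclideanSpace ℝ (Fin n)) M]
  [IsManifold (𝓡 n) ∞ M]

variable (n M) in
/-- Connections on the tangent bundle of `M`. -/
abbrev Connection := CovariantDerivative (𝓡 n) (EuclideanSpace ℝ (Fin n))
  (TangentSpace (𝓡 n) : M → Type _)

/-- The `i`-th coordinate vector field of the preferred chart at `x₀`. -/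
def coordField (x₀ : M) (i : Fin n) (x : M) : TangentSpace (𝓡 n) x :=
  mfderiv 𝓘(ℝ, EuclideanSpace ℝ (Fin n)) (𝓡 n) (extChartAt (𝓡 n) x₀).symm
    (extChartAt (𝓡 n) x₀ x) (stdVec i)

/-- The Christoffel symbols in the preferred chart at `x₀` : `christoffel D x₀ y k j i` is
`Γ^i_{kj}`, where `∇_{∂_k} ∂_j = Γ^i_{kj} ∂_i`. -/
def christoffel (D : Connection n M) (x₀ : M) (y : EuclideanSpace ℝ (Fin n)) (k j i : Fin n) : ℝ :=
  let u : EuclideanSpace ℝ (Fin n) :=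
    mfderiv (𝓡 n) 𝓘(ℝ, EuclideanSpace ℝ (Fin n)) (extChartAt (𝓡 n) x₀)
      ((extChartAt (𝓡 n) x₀).symm y)
      (D (coordField x₀ j) ((extChartAt (𝓡 n) x₀).symm y)
        (coordField x₀ k ((extChartAt (𝓡 n) x₀).symm y)))
  u i

/-- `D` is a symplectic connection: smooth, torsion-free, and `∇ ω = 0`. -/
structure IsSymplecticConnection (ω₀ : TwoForm n M ℝ) (D : Connection n M) : Prop where
  smooth : CovariantDerivative.ContMDiffCovariantDerivative D ∞
  torsion : D.torsion = 0
  parallel : ∀ x₀, ∀ y ∈ (extChartAt (𝓡 n) x₀).target, ∀ k i j,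
    fderiv ℝ (fun z => ω₀.comp x₀ z i j) y (stdVec k) =
      ∑ l, (christoffel D x₀ y k i l * ω₀.comp x₀ y l j + christoffel D x₀ y k j l * ω₀.comp x₀ y i l)

/-- The Poisson tensor of `ω` in the preferred chart at `x₀`. -/
def poissonInChart (ω₀ : TwoForm n M ℝ) (x₀ : M) (y : EuclideanSpace ℝ (Fin n)) :
    Matrix (Fin n) (Fin n) ℝ := poissonMatrix (ω₀.comp x₀ y)

/-- The components `γ_k = ω_{ki} y^i + r_k` of the Weyl algebra valued 1-form which together
with `∂` defines the Fedosov connection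
`D_k = ∂_k + ν⁻¹ [γ_k, ·] = - ∂/∂y^k + ∂_k + ν⁻¹ [r_k, ·]`. -/
def fedosovForm (ω₀ : TwoForm n M ℝ) (x₀ : M) (r : Fin n → EuclideanSpace ℝ (Fin n) → FormalWeyl n)
    (k : Fin n) (y : EuclideanSpace ℝ (Fin n)) : FormalWeyl n :=
  ∑ i, wconst (ω₀.comp x₀ y k i : ℂ) * wvar i + r k y

/-- `r` is, in the preferred chart at `x₀`, the 1-form with values in the Weyl bundle determined
by Fedosov's construction from the connection `D` and the formal closed 2-form
`Ω = ν Ω₁ + ν² Ω₂ + …` (where `Ω m` is the coefficient of `ν ^ (m + 1)`). -/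
structure IsFedosovForm (ω₀ : TwoForm n M ℝ) (D : Connection n M) (Ω : ℕ → TwoForm n M ℂ) (x₀ : M)
    (r : Fin n → EuclideanSpace ℝ (Fin n) → FormalWeyl n) : Prop where
  smooth : ∀ k, WSmoothOn (r k) (extChartAt (𝓡 n) x₀).target
  /-- `r` has degree at least 3, where `ν` has degree 2 and every `y^i` has degree 1. -/
  degree : ∀ y ∈ (extChartAt (𝓡 n) x₀).target, ∀ k m (μ : Fin n →₀ ℕ), 2 * m + μ.degree < 3 →
    wcoeff m μ (r k y) = 0
  /-- The normalization `δ⁻¹ r = 0`, that is `y^k r_k = 0`. -/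
  normalized : ∀ y ∈ (extChartAt (𝓡 n) x₀).target, ∑ k, wvar k * r k y = 0
  /-- The Weyl curvature `R + ∂ γ + ν⁻¹ γ ∘ γ` is the scalar form `ω + Ω` (both sides are
  multiplied by `ν`). -/
  curvature : ∀ y ∈ (extChartAt (𝓡 n) x₀).target, ∀ k l,
    PowerSeries.X * (curvatureWeyl (ω₀.comp x₀ y) (christoffel D x₀) y k l +
        covWeyl (christoffel D x₀) k (fedosovForm ω₀ x₀ r l) y -
        covWeyl (christoffel D x₀) l (fedosovForm ω₀ x₀ r k) y) +
      wcomm (poissonInChart ω₀ x₀ y) (fedosovForm ω₀ x₀ r k y) (fedosovForm ω₀ x₀ r l y) =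
    PowerSeries.X * (wconst (ω₀.comp x₀ y k l : ℂ) +
      PowerSeries.X * PowerSeries.mk fun m => MvPowerSeries.C ((Ω m).comp x₀ y k l))

/-- `a` is, in the preferred chart at `x₀`, the flat section of the Weyl bundle whose restriction
to `y = 0` is the function `f`. -/
structure IsFlatLift (ω₀ : TwoForm n M ℝ) (D : Connection n M) (x₀ : M)
    (r : Fin n → EuclideanSpace ℝ (Fin n) → FormalWeyl n) (f : SmoothFn (𝓡 n) M)
    (a : EuclideanSpace ℝ (Fin n) → FormalWeyl n) : Prop where
  smooth : WSmoothOn a (extChartAt (𝓡 n) x₀).target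
  /-- `∂_k a + ν⁻¹ [γ_k, a] = 0`, multiplied by `ν`. -/
  flat : ∀ y ∈ (extChartAt (𝓡 n) x₀).target, ∀ k,
    PowerSeries.X * covWeyl (christoffel D x₀) k a y +
      wcomm (poissonInChart ω₀ x₀ y) (fedosovForm ω₀ x₀ r k y) (a y) = 0
  symbol : ∀ y ∈ (extChartAt (𝓡 n) x₀).target, ∀ m,
    wcoeff m 0 (a y) = if m = 0 then f ((extChartAt (𝓡 n) x₀).symm y) else 0

/-- `⋆` is a Fedosov star product on the symplectic manifold `(M, ω)` : for some symplectic
connection and some formal closed 2-form `Ω`, the function `f ⋆ g` is the restriction to `y = 0`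
of the fibrewise product of the flat lifts of `f` and `g`. Since `r` and the flat lifts
are unique in every chart, it is enough to describe them in charts. -/
def StarProduct.IsFedosov {P : PoissonBracket (𝓡 n) M} (S : StarProduct P)
    (ω₀ : TwoForm n M ℝ) : Prop :=
  ∃ (D : Connection n M) (Ω : ℕ → TwoForm n M ℂ),
    IsSymplecticConnection ω₀ D ∧ (∀ m, (Ω m).IsClosedForm) ∧
    ∀ x₀ : M, ∃ r : Fin n → EuclideanSpace ℝ (Fin n) → FormalWeyl n,
      IsFedosovForm ω₀ D Ω x₀ r ∧
      ∀ f g : SmoothFn (𝓡 n) M, ∃ a b : EuclideanSpace ℝ (Fin n) → FormalWeyl n,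
        IsFlatLift ω₀ D x₀ r f a ∧ IsFlatLift ω₀ D x₀ r g b ∧
        ∀ y ∈ (extChartAt (𝓡 n) x₀).target, ∀ m,
          S.C m f g ((extChartAt (𝓡 n) x₀).symm y) =
            wcoeff m 0 (moyal (poissonInChart ω₀ x₀ y) (a y) (b y))

end Fedosov

end StarFOI

end

noncomputable section

namespace StarFOI

/-! ### Filtered surjectivity -/

/-! Fix a point `x`. Taylor series in the preferred chart turn a natural star product into a formal
star product on `ℂ[[x]]` (`FormalStar`), and the distribution `Λ` into functionals `lam q` on power
series in two copies of the coordinates. Naturality makes `lam q` vanish on series of order at least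
`2q + 1`. For the FOI property it is enough to find a formal series `ψ` with `Λ(∂_a F + ν⁻¹ (∂_a ψ)
F) = 0` for all coordinates `a` and all `F` (`isFOI_of_phase`): Borel's lemma turns `ψ` into smooth
functions, and the Lebesgue density of the chart serves as density.

The phase is found by Fourier transform. The transform of `Λ` is the value at the origin of `G =
e^{ξx} ⋆ e^{ηx}` (`hat_lam`). The heart of the proof is `exists_regular_logDeriv`: the logarithmic
derivatives of `G` in `ξ` and `η` are regular, that is, `ν` occurs in each monomial at least as
often as the variables `ξ, η` together. To see this, solve `a_i ⋆ e^{ξx} = x_i e^{ξx}`, with `a_i`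
regular; by associativity `∂_{ξ_i} G = a_i ⋆ G`. Conjugating by `G` replaces `∂_{x_k}` by `∂_{x_k} +
V_k` with `V_k = G⁻¹ ∂_{x_k} G`. If `V_k` has at worst weight `-1`, an operator of order `r` loses
at most `r` in weight, and the factor `ν^r` in front of `C_r` gives this back; so `G⁻¹ (a_i ⋆ G)` is
regular. The compatibility `∂_ξ V = ∂_x U` of the logarithmic derivatives carries the bound on `V`
to the next degree in `ξ`, and an induction closes. This is where naturality and associativity enter
together.

After division by the transform of `1`, multiplication by `z_a` becomes `∂_{ζ_a} + u_a`, where `u_a`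
is the regular logarithmic derivative. Its leading part is `ν ∑_c λ_1(z_a z_c) ζ_c`. When the matrix
of second moments `λ_1(z_a z_c)` is invertible, successive approximation shows that all regular
series are attained (`exists_hat_eq`). In particular `ν ζ_a`, the symbol of `ν ∂_a`, is attained,
which gives `h_a` with `Λ(h_a F) = Λ(ν ∂_a F)`. The operators `ν ∂_a` commute and no nonzero series
annihilates `Λ`, so the family `h_a` is closed, and the formal Poincaré lemma yields `ψ` with `∂_a ψ
= -h_a` (`exists_formal_phase`).

The second moments form the block matrix with off-diagonal blocks `K` and `Kᵀ`, because `C_1(·, 1) =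
C_1(1, ·) = 0`. Hence nondegeneracy of `K` suffices. It is necessary because the lowest nontrivial
order of the integral identity, applied to coordinate functions, makes the Hessian of the phase a
negative inverse of the second moments (`IsFOI.exists_inverse`).

In the symplectic case with `C_1 = {·,·}/2`, `K` is half the Poisson tensor, hence invertible. For a
Fedosov product the flatness equation is a recursion in the degree `2m + |μ|`; it shows that the
coefficient of `ν^m y^μ` in the flat lift of `f` involves at most `m + |μ|` derivatives of `f`
(`IsFlatLift.germGE`). This gives naturality, and the first-order term is `{·,·}/2`. -/

theorem exists_preimage_of_graded {ι B Y : Type*} [AddCommGroup B] [AddCommGroup Y] (d : ι → ℕ)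
    (Φ : (ι → B) →+ Y) (F : ℕ → AddSubgroup Y) (hsep : ∀ y, (∀ D, y ∈ F D) → y = 0)
    (hΦ : ∀ D f, (∀ i, d i < D → f i = 0) → Φ f ∈ F D)
    (hgr : ∀ D, ∀ y ∈ F D, ∃ f : ι → B, (∀ i, d i < D → f i = 0) ∧ y - Φ f ∈ F (D + 1))
    {y : Y} (hy : y ∈ F 0) : ∃ f, Φ f = y := by
  choose! g hg0 hg using hgr
  -- The residual after `D` corrections, bundled with its membership in `F D`, which is what allows
  -- the next correction.
  let s : ∀ D : ℕ, F D := fun D => Nat.rec (motive := fun D => F D) ⟨y, hy⟩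
    (fun D z => ⟨z.1 - Φ (g D z.1), hg D z.1 z.2⟩) D
  have hs : ∀ D, (s D : Y) = y - Φ (∑ k ∈ Finset.range D, g k (s k)) := by
    intro D
    induction D with
    | zero => simp [s]
    | succ D ih =>
      have : (s (D + 1) : Y) = s D - Φ (g D (s D)) := rfl
      rw [this, Finset.sum_range_succ, map_add, ih]
      abel
  -- The infinite sum of all corrections: the `k`-th one vanishes at indices of degree less than
  -- `k`, so at `i` only `k ≤ d i` count.
  let f : ι → B := fun i => ∑ k ∈ Finset.range (d i + 1), g k (s k) i
  have hf : ∀ D i, d i < D → (f - ∑ k ∈ Finset.range D, g k (s k)) i = 0 := by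
    intro D i hi
    simp only [f, Pi.sub_apply, Finset.sum_apply]
    rw [sub_eq_zero]
    refine Finset.sum_subset (Finset.range_mono (by omega)) fun k _ hk => ?_
    exact hg0 k _ (s k).2 i (by simpa using hk)
  refine ⟨f, ?_⟩
  rw [← sub_eq_zero, ← neg_eq_zero, neg_sub]
  refine hsep _ fun D => ?_
  have h1 := hΦ D _ (hf D)
  have h2 : y - Φ f = s D - Φ (f - ∑ k ∈ Finset.range D, g k (s k)) := by
    rw [hs D, map_sub]; abel
  rw [h2]
  exact (F D).sub_mem (s D).2 h1

/-! ### Weight filtrations of power series -/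

section Filt

variable {τ B : Type*} [CommRing B]

/-- Power series whose coefficients of weight less than `k` vanish at the exponents
satisfying `P`. -/
def Filt (P : (τ →₀ ℕ) → Prop) (w : (τ →₀ ℕ) → ℤ) (k : ℤ) : AddSubgroup (MvPowerSeries τ B) where
  carrier := {f | ∀ γ, P γ → w γ < k → MvPowerSeries.coeff γ f = 0}
  add_mem' := by
    intro f g hf hg γ h1 h2
    rw [map_add, hf γ h1 h2, hg γ h1 h2, add_zero]
  zero_mem' := by intro γ _ _; simp
  neg_mem' := by
    intro f hf γ h1 h2
    rw [map_neg, hf γ h1 h2, neg_zero]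

variable {P : (τ →₀ ℕ) → Prop} {w : (τ →₀ ℕ) → ℤ} {k l : ℤ}

theorem filt_mono (h : l ≤ k) {f : MvPowerSeries τ B} (hf : f ∈ Filt P w k) : f ∈ Filt P w l :=
  fun γ h1 h2 => hf γ h1 (h2.trans_le h)

/-- The condition `P` passes to divisors of an exponent, so both factors of a contributing term may
be tested, and one of them must have too small a weight. -/
theorem filt_mul (hP : ∀ a b, P (a + b) → P a ∧ P b) (hw : ∀ a b, w (a + b) = w a + w b)
    {f g : MvPowerSeries τ B} (hf : f ∈ Filt P w k) (hg : g ∈ Filt P w l) :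
    f * g ∈ Filt P w (k + l) := by
  classical
  intro γ h1 h2
  rw [MvPowerSeries.coeff_mul]
  refine Finset.sum_eq_zero fun p hp => ?_
  rw [Finset.HasAntidiagonal.mem_antidiagonal] at hp
  rw [← hp] at h1 h2
  rw [hw] at h2
  obtain ⟨ha, hb⟩ := hP _ _ h1
  by_cases h : w p.1 < k
  · rw [hf _ ha h, zero_mul]
  · rw [hg _ hb (by omega), mul_zero]

/-- The sum `∑ τ ^ γ * Ψ γ`. -/
def shiftSum (Ψ : (τ →₀ ℕ) → MvPowerSeries τ B) : MvPowerSeries τ B :=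
  fun θ => by
    classical exact ∑ p ∈ Finset.HasAntidiagonal.antidiagonal θ, MvPowerSeries.coeff p.2 (Ψ p.1)

theorem coeff_shiftSum [DecidableEq τ] (Ψ : (τ →₀ ℕ) → MvPowerSeries τ B) (θ : τ →₀ ℕ) :
    MvPowerSeries.coeff θ (shiftSum Ψ) =
      ∑ p ∈ Finset.HasAntidiagonal.antidiagonal θ, MvPowerSeries.coeff p.2 (Ψ p.1) := by
  unfold shiftSum
  change (∑ p ∈ _, _) = _
  congr!

theorem mul_shiftSum (H : MvPowerSeries τ B) (Ψ : (τ →₀ ℕ) → MvPowerSeries τ B) :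
    H * shiftSum Ψ = shiftSum fun γ => H * Ψ γ := by
  classical
  ext θ
  simp only [coeff_shiftSum, MvPowerSeries.coeff_mul, Finset.mul_sum, Finset.sum_sigma']
  apply Finset.sum_nbij' (fun ⟨⟨i, _j⟩, ⟨k, l⟩⟩ ↦ ⟨(k, i + l), (i, l)⟩)
    (fun ⟨⟨i, _j⟩, ⟨k, l⟩⟩ ↦ ⟨(k, i + l), (i, l)⟩)
  · rintro ⟨⟨i, j⟩, ⟨k, l⟩⟩ h
    simp only [Finset.mem_sigma, Finset.HasAntidiagonal.mem_antidiagonal] at h ⊢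
    obtain ⟨h1, h2⟩ := h
    refine ⟨?_, trivial⟩
    rw [← h1, ← h2]; abel
  · rintro ⟨⟨i, j⟩, ⟨k, l⟩⟩ h
    simp only [Finset.mem_sigma, Finset.HasAntidiagonal.mem_antidiagonal] at h ⊢
    obtain ⟨h1, h2⟩ := h
    refine ⟨?_, trivial⟩
    rw [← h1, ← h2]; abel
  · rintro ⟨⟨i, j⟩, ⟨k, l⟩⟩ h
    simp only [Finset.mem_sigma, Finset.HasAntidiagonal.mem_antidiagonal] at h ⊢
    obtain ⟨h1, h2⟩ := h
    subst h2; rfl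
  · rintro ⟨⟨i, j⟩, ⟨k, l⟩⟩ h
    simp only [Finset.mem_sigma, Finset.HasAntidiagonal.mem_antidiagonal] at h ⊢
    obtain ⟨h1, h2⟩ := h
    subst h2; rfl
  · rintro ⟨⟨i, j⟩, ⟨k, l⟩⟩ h
    rfl

theorem shiftSum_mem_filt (hP : ∀ a b, P (a + b) → P a ∧ P b)
    (hw : ∀ a b, w (a + b) = w a + w b) {Ψ : (τ →₀ ℕ) → MvPowerSeries τ B}
    (h : ∀ γ, P γ → Ψ γ ∈ Filt P w (k - w γ)) : shiftSum Ψ ∈ Filt P w k := by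
  classical
  intro θ h1 h2
  rw [coeff_shiftSum]
  refine Finset.sum_eq_zero fun p hp => ?_
  rw [Finset.HasAntidiagonal.mem_antidiagonal] at hp
  rw [← hp] at h1 h2
  rw [hw] at h2
  obtain ⟨ha, hb⟩ := hP _ _ h1
  exact h _ ha _ hb (by omega)

end Filt

/-! ### Differential operators on formal power series -/

section DiffOp

variable {σ : Type*}

open MvPowerSeries

/-- The series without terms of degree less than `k`. -/
abbrev orderGE (σ : Type*) (k : ℤ) : AddSubgroup (MvPowerSeries σ ℂ) :=
  Filt (fun _ => True) (fun α => (α.degree : ℤ)) k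

theorem orderGE_mul {k l : ℤ} {f g : MvPowerSeries σ ℂ} (hf : f ∈ orderGE σ k)
    (hg : g ∈ orderGE σ l) : f * g ∈ orderGE σ (k + l) :=
  filt_mul (fun _ _ _ => ⟨trivial, trivial⟩) (fun a b => by simp) hf hg

theorem orderGE_zero (f : MvPowerSeries σ ℂ) : f ∈ orderGE σ 0 := by
  intro γ _ h
  simp only at h
  omega

theorem orderGE_mul_left {k : ℤ} {f g : MvPowerSeries σ ℂ} (hg : g ∈ orderGE σ k) :
    f * g ∈ orderGE σ k := by
  simpa using orderGE_mul (orderGE_zero f) hg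

theorem orderGE_pderiv {k : ℤ} {f : MvPowerSeries σ ℂ} (hf : f ∈ orderGE σ k) (i : σ) :
    pderiv ℂ i f ∈ orderGE σ (k - 1) := by
  intro γ _ h
  rw [coeff_pderiv, hf _ trivial, zero_mul]
  simp only at h
  simp only [map_add, Finsupp.degree_single, Nat.cast_add, Nat.cast_one]
  omega

theorem X_mem_orderGE (i : σ) : (X i : MvPowerSeries σ ℂ) ∈ orderGE σ 1 := by
  classical
  intro γ _ h
  rw [coeff_X, if_neg]
  rintro rfl
  simp at h

theorem eq_zero_of_forall_orderGE {f : MvPowerSeries σ ℂ} (h : ∀ k : ℕ, f ∈ orderGE σ k) :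
    f = 0 := by
  ext α
  exact h (α.degree + 1) α trivial (by push_cast; omega)

variable (σ) in
/-- Linear operators on formal power series. -/
abbrev Op := Module.End ℂ (MvPowerSeries σ ℂ)

/-- Multiplication operators. -/
def mulOp (f : MvPowerSeries σ ℂ) : Op σ := LinearMap.mulLeft ℂ f

/-- Partial derivatives as operators. -/
def pdOp (i : σ) : Op σ := (pderiv ℂ i).toLinearMap

@[simp] theorem mulOp_apply (f g : MvPowerSeries σ ℂ) : mulOp f g = f * g := rfl
@[simp] theorem pdOp_apply (i : σ) (g : MvPowerSeries σ ℂ) : pdOp i g = pderiv ℂ i g := rfl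

/-- The commutator with the coordinate `X i`. -/
def adX (i : σ) (D : Op σ) : Op σ := D * mulOp (X i) - mulOp (X i) * D

theorem adX_apply (i : σ) (D : Op σ) (f : MvPowerSeries σ ℂ) :
    adX i D f = D (X i * f) - X i * D f := rfl

theorem adX_mul (i : σ) (A B : Op σ) : adX i (A * B) = A * adX i B + adX i A * B := by
  simp only [adX, mul_sub, sub_mul, mul_assoc]; abel

theorem adX_sub (i : σ) (A B : Op σ) : adX i (A - B) = adX i A - adX i B := by
  simp only [adX, sub_mul, mul_sub]; abel

theorem adX_sum {κ : Type*} (i : σ) (s : Finset κ) (A : κ → Op σ) :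
    adX i (∑ k ∈ s, A k) = ∑ k ∈ s, adX i (A k) := by
  simp only [adX, Finset.sum_mul, Finset.mul_sum, Finset.sum_sub_distrib]

theorem adX_smul (i : σ) (c : ℂ) (A : Op σ) : adX i (c • A) = c • adX i A := by
  simp only [adX, smul_mul_assoc, mul_smul_comm, smul_sub]

theorem adX_comm (i k : σ) (D : Op σ) : adX i (adX k D) = adX k (adX i D) := by
  ext1 f
  simp only [adX_apply]
  rw [mul_left_comm (X k) (X i) f]
  ring

theorem adX_pdOp [DecidableEq σ] (i k : σ) : adX i (pdOp k) = if k = i then 1 else 0 := by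
  ext1 f
  simp only [adX_apply, pdOp_apply, Derivation.leibniz, smul_eq_mul]
  split_ifs with h
  · subst h; simp
  · rw [pderiv_X_of_ne (fun h' => h h'.symm)]; simp

/-- `D` has order less than `r` : all `r`-fold commutators with coordinates vanish. -/
def OrderLT : ℕ → Op σ → Prop
  | 0, D => D = 0
  | r + 1, D => ∀ i, OrderLT r (adX i D)

/-- Differential operators of order at most `r`. -/
inductive IsDiffOp : ℕ → Op σ → Prop
  | mulOp (r : ℕ) (f : MvPowerSeries σ ℂ) : IsDiffOp r (mulOp f)
  | comp_pdOp {r : ℕ} {D : Op σ} (k : σ) : IsDiffOp r D → IsDiffOp (r + 1) (D * pdOp k)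
  | add {r : ℕ} {D D' : Op σ} : IsDiffOp r D → IsDiffOp r D' → IsDiffOp r (D + D')

theorem IsDiffOp.mono {r : ℕ} {D : Op σ} (h : IsDiffOp r D) {s : ℕ} (hs : r ≤ s) :
    IsDiffOp s D := by
  induction h generalizing s with
  | mulOp r f => exact .mulOp s f
  | comp_pdOp k _ ih =>
    obtain ⟨s, rfl⟩ : ∃ t, s = t + 1 := ⟨s - 1, by omega⟩
    exact .comp_pdOp k (ih (by omega))
  | add _ _ ih1 ih2 => exact .add (ih1 hs) (ih2 hs)

theorem IsDiffOp.zero (r : ℕ) : IsDiffOp r (0 : Op σ) := by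
  have : (0 : Op σ) = StarFOI.mulOp 0 := by ext1 f; simp
  rw [this]; exact .mulOp r 0

theorem IsDiffOp.smul {r : ℕ} {D : Op σ} (h : IsDiffOp r D) (c : ℂ) : IsDiffOp r (c • D) := by
  induction h with
  | mulOp r f =>
    have : c • StarFOI.mulOp f = StarFOI.mulOp (c • f) := by ext1 g; simp
    rw [this]; exact .mulOp r _
  | comp_pdOp k _ ih => rw [← smul_mul_assoc]; exact .comp_pdOp k ih
  | add _ _ ih1 ih2 => rw [smul_add]; exact .add ih1 ih2

theorem IsDiffOp.sum {κ : Type*} {r : ℕ} (s : Finset κ) (D : κ → Op σ)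
    (h : ∀ k ∈ s, IsDiffOp r (D k)) : IsDiffOp r (∑ k ∈ s, D k) := by
  classical
  induction s using Finset.induction_on with
  | empty => simpa using IsDiffOp.zero r
  | insert a s ha ih =>
    rw [Finset.sum_insert ha]
    exact .add (h a (by simp)) (ih fun k hk => h k (by simp [hk]))

/-- `D` lowers the order of series by at most a fixed amount. -/
def IsContOp (D : Op σ) : Prop :=
  ∃ s : ℕ, ∀ (j : ℕ) (f : MvPowerSeries σ ℂ), f ∈ orderGE σ (j + s : ℕ) → D f ∈ orderGE σ j

theorem IsContOp.mono_shift {D : Op σ} {s : ℕ}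
    (h : ∀ (j : ℕ) (f : MvPowerSeries σ ℂ), f ∈ orderGE σ (j + s : ℕ) → D f ∈ orderGE σ j) {t : ℕ}
    (ht : s ≤ t) (j : ℕ) (f : MvPowerSeries σ ℂ) (hf : f ∈ orderGE σ (j + t : ℕ)) :
    D f ∈ orderGE σ j :=
  h j f (filt_mono (by push_cast; omega) hf)

theorem IsContOp.add {D D' : Op σ} (h : IsContOp D) (h' : IsContOp D') : IsContOp (D + D') := by
  obtain ⟨s, hs⟩ := h
  obtain ⟨t, ht⟩ := h'
  refine ⟨max s t, fun j f hf => ?_⟩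
  exact AddSubgroup.add_mem _ (IsContOp.mono_shift hs (le_max_left _ _) j f hf)
    (IsContOp.mono_shift ht (le_max_right _ _) j f hf)

theorem IsContOp.sub {D D' : Op σ} (h : IsContOp D) (h' : IsContOp D') : IsContOp (D - D') := by
  obtain ⟨s, hs⟩ := h
  obtain ⟨t, ht⟩ := h'
  refine ⟨max s t, fun j f hf => ?_⟩
  exact AddSubgroup.sub_mem _ (IsContOp.mono_shift hs (le_max_left _ _) j f hf)
    (IsContOp.mono_shift ht (le_max_right _ _) j f hf)

theorem orderGE_smul {k : ℤ} (c : ℂ) {f : MvPowerSeries σ ℂ} (hf : f ∈ orderGE σ k) :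
    c • f ∈ orderGE σ k := by
  intro γ h1 h2
  simp [hf γ h1 h2]

theorem IsContOp.smul {D : Op σ} (h : IsContOp D) (c : ℂ) : IsContOp (c • D) := by
  obtain ⟨s, hs⟩ := h
  exact ⟨s, fun j f hf => orderGE_smul c (hs j f hf)⟩

theorem IsContOp.adX {D : Op σ} (h : IsContOp D) (i : σ) : IsContOp (adX i D) := by
  obtain ⟨s, hs⟩ := h
  refine ⟨s, fun j f hf => ?_⟩
  rw [adX_apply]
  exact AddSubgroup.sub_mem _ (hs j _ (orderGE_mul_left hf)) (orderGE_mul_left (hs j _ hf))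

theorem IsContOp.mul_pdOp {D : Op σ} (h : IsContOp D) (i : σ) : IsContOp (D * pdOp i) := by
  obtain ⟨s, hs⟩ := h
  refine ⟨s + 1, fun j f hf => hs j _ ?_⟩
  exact filt_mono (by push_cast; omega) (orderGE_pderiv hf i)

theorem IsContOp.zero : IsContOp (0 : Op σ) := ⟨0, fun j f _ => by simp⟩

variable [Fintype σ]

/-- The operator `∑ k, [D, X k] ∂ k`. -/
def eulerOp (D : Op σ) : Op σ := ∑ k, adX k D * pdOp k

/-- The operator `∑ [D, X_k] ∂_k` is the Euler field in the symbol variables: it multiplies the part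
of degree `r` in the derivatives by `r`. A commutator with a coordinate lowers that degree by one,
whence the extra term. -/
theorem adX_eulerOp (i : σ) (D : Op σ) : adX i (eulerOp D) = eulerOp (adX i D) + adX i D := by
  classical
  simp only [eulerOp, adX_sum, adX_mul, adX_pdOp, Finset.sum_add_distrib, mul_ite, mul_one,
    mul_zero, Finset.sum_ite_eq', Finset.mem_univ, if_true]
  rw [add_comm]
  congr 1
  refine Finset.sum_congr rfl fun k _ => ?_
  rw [adX_comm]

/-- Euler's identity on the principal symbol: on the part of order exactly `r` the Euler operator
acts as `r`, so the difference drops the order. -/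
theorem OrderLT.eulerOp_sub (r : ℕ) (D : Op σ) (h : OrderLT (r + 1) D) :
    OrderLT r (eulerOp D - (r : ℂ) • D) := by
  induction r generalizing D with
  | zero =>
    have h' : ∀ i, adX i D = 0 := h
    change _ = _
    simp [eulerOp, h']
  | succ r ih =>
    intro i
    have := ih (adX i D) (h i)
    rw [adX_sub, adX_eulerOp, adX_smul]
    convert this using 1
    push_cast
    rw [add_smul, one_smul]
    abel

theorem IsContOp.eulerOp {D : Op σ} (h : IsContOp D) : IsContOp (eulerOp D) := by
  classical
  unfold StarFOI.eulerOp
  refine Finset.sum_induction _ _ (fun _ _ => IsContOp.add) IsContOp.zero fun k _ => ?_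
  exact (h.adX k).mul_pdOp k

theorem sub_truncTotal_mem_orderGE (k : ℕ) (f : MvPowerSeries σ ℂ) :
    f - (f.truncTotal k : MvPolynomial σ ℂ) ∈ orderGE σ k := by
  intro γ _ h
  rw [map_sub, MvPolynomial.coeff_coe, coeff_truncTotal _ (by simp only at h; exact_mod_cast h), sub_self]

/-- Commuting with the coordinates gives linearity over polynomials only. The bound on the loss of
order extends it to all power series by truncation. -/
theorem eq_mulOp_of_adX {D : Op σ} (hD : ∀ i, adX i D = 0) (hc : IsContOp D) :
    D = mulOp (D 1) := by
  have hX : ∀ i f, D (X i * f) = X i * D f := by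
    intro i f
    have := congrArg (fun A : Op σ => A f) (hD i)
    rw [← sub_eq_zero]
    exact this
  have hp : ∀ (p : MvPolynomial σ ℂ) f, D ((p : MvPowerSeries σ ℂ) * f) = p * D f := by
    intro p
    induction p using MvPolynomial.induction_on with
    | C a =>
      intro f
      rw [MvPolynomial.coe_C, ← smul_eq_C_mul, ← smul_eq_C_mul, map_smul]
    | add p q hp hq => intro f; rw [MvPolynomial.coe_add, add_mul, map_add, hp, hq, add_mul]
    | mul_X p i hp =>
      intro f
      rw [MvPolynomial.coe_mul, MvPolynomial.coe_X, mul_assoc, hp, hX, mul_assoc]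
  obtain ⟨s, hs⟩ := hc
  ext1 f
  rw [mulOp_apply, ← sub_eq_zero]
  refine eq_zero_of_forall_orderGE fun k => ?_
  have h1 := sub_truncTotal_mem_orderGE (k + s) f
  have h2 := hs k _ h1
  have h3 := orderGE_mul_left (f := D 1) (filt_mono (l := k) (by push_cast; omega) h1)
  have h4 := hp (f.truncTotal (k + s)) 1
  rw [mul_one] at h4
  have : D f - D 1 * f = D (f - (f.truncTotal (k + s) : MvPolynomial σ ℂ)) -
      D 1 * (f - (f.truncTotal (k + s) : MvPolynomial σ ℂ)) := by
    rw [map_sub, h4]; ring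
  rw [this]
  exact AddSubgroup.sub_mem _ h2 h3

/-- Grothendieck's commutator definition implies the explicit form: `r D = eulerOp D - (eulerOp D -
r D)`, where the first term is built from commutators of lower order followed by a derivative, and
the second has lower order by Euler's identity. -/
theorem isDiffOp_of_orderLT (r : ℕ) (D : Op σ) (h : OrderLT (r + 1) D) (hc : IsContOp D) :
    IsDiffOp r D := by
  induction r generalizing D with
  | zero =>
    rw [eq_mulOp_of_adX h hc]
    exact .mulOp _ _
  | succ r ih =>
    have h1 := ih _ (OrderLT.eulerOp_sub (r + 1) D h) (hc.eulerOp.sub (hc.smul _))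
    have h2 : IsDiffOp (r + 1) (eulerOp D) :=
      IsDiffOp.sum _ _ fun k _ => .comp_pdOp k (ih _ (h k) (hc.adX k))
    have hr : ((r + 1 : ℕ) : ℂ) ≠ 0 := by exact_mod_cast Nat.succ_ne_zero r
    have h3 : D = (((r + 1 : ℕ) : ℂ)⁻¹) • (eulerOp D +
        (-1 : ℂ) • (eulerOp D - ((r + 1 : ℕ) : ℂ) • D)) := by
      ext1 f
      simp only [LinearMap.smul_apply, LinearMap.add_apply, LinearMap.sub_apply]
      rw [neg_one_smul, neg_sub, add_sub_cancel, smul_smul, inv_mul_cancel₀ hr, one_smul]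
    rw [h3]
    exact (h2.add ((h1.mono (by omega)).smul _)).smul _

end DiffOp

end StarFOI

end

noncomputable section

namespace StarFOI

open MvPowerSeries Finset.HasAntidiagonal

/-! ### Sums over antidiagonals and the Leibniz rule -/

section ShiftSum

variable {τ B : Type*} [CommRing B]

/-- Terms with zero exponent at `t` carry the factor zero, and the others are shifted by one. This
is the coefficient form of differentiating the monomial factor in a product. -/
theorem sum_antidiagonal_add_single [DecidableEq τ] {N : Type*} [AddCommMonoid N] (t : τ)
    (θ : τ →₀ ℕ) (f : (τ →₀ ℕ) → (τ →₀ ℕ) → N) :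
    ∑ p ∈ (antidiagonal (θ + Finsupp.single t 1) : Finset ((τ →₀ ℕ) × (τ →₀ ℕ))),
      p.1 t • f p.1 p.2 = ∑ p ∈ (antidiagonal θ : Finset ((τ →₀ ℕ) × (τ →₀ ℕ))),
        (p.1 t + 1) • f (p.1 + Finsupp.single t 1) p.2 := by
  symm
  refine Finset.sum_bij_ne_zero (fun p _ _ => (p.1 + Finsupp.single t 1, p.2)) ?_ ?_ ?_ ?_
  · intro p hp _
    rw [mem_antidiagonal] at hp ⊢
    rw [← hp, add_right_comm]
  · intro p _ _ q _ _ h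
    simp only [Prod.mk.injEq, add_left_inj] at h
    exact Prod.ext h.1 h.2
  · intro p hp h0
    rw [mem_antidiagonal] at hp
    have h1 : p.1 t ≠ 0 := fun h => h0 (by rw [h, zero_smul])
    have hle : Finsupp.single t 1 ≤ p.1 := by
      rw [Finsupp.single_le_iff]; omega
    have h2 : p.1 - Finsupp.single t 1 + Finsupp.single t 1 = p.1 := tsub_add_cancel_of_le hle
    refine ⟨(p.1 - Finsupp.single t 1, p.2), ?_, ?_, ?_⟩
    · rw [mem_antidiagonal]
      have : p.1 - Finsupp.single t 1 + p.2 + Finsupp.single t 1 = θ + Finsupp.single t 1 := by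
        rw [add_right_comm, h2, hp]
      exact add_right_cancel this
    · simp only [h2]
      have : (p.1 - Finsupp.single t 1 : τ →₀ ℕ) t + 1 = p.1 t := by
        simp only [Finsupp.coe_tsub, Pi.sub_apply, Finsupp.single_eq_same]; omega
      rw [this]; exact h0
    · simp only [h2]
  · intro p _ _
    simp

theorem sum_antidiagonal_swap [DecidableEq τ] {N : Type*} [AddCommMonoid N] (θ : τ →₀ ℕ)
    (f : (τ →₀ ℕ) → (τ →₀ ℕ) → N) :
    ∑ p ∈ antidiagonal θ, f p.1 p.2 = ∑ p ∈ antidiagonal θ, f p.2 p.1 :=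
  Finset.sum_nbij' Prod.swap Prod.swap
    (fun p hp => by rw [mem_antidiagonal] at hp ⊢; rw [← hp]; exact add_comm _ _)
    (fun p hp => by rw [mem_antidiagonal] at hp ⊢; rw [← hp]; exact add_comm _ _)
    (fun p _ => rfl) (fun p _ => rfl) (fun p _ => rfl)

/-- Leibniz rule for `∑ τ^γ Ψ γ`: the derivative falls on `Ψ γ` or on `τ^γ`; the second sum is
reindexed. -/
theorem pderiv_shiftSum (t : τ) (Ψ : (τ →₀ ℕ) → MvPowerSeries τ B) :
    pderiv B t (shiftSum Ψ) = shiftSum (fun γ => pderiv B t (Ψ γ)) +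
      shiftSum (fun γ => (γ t + 1) • Ψ (γ + Finsupp.single t 1)) := by
  classical
  ext θ
  rw [map_add, coeff_pderiv, coeff_shiftSum, coeff_shiftSum, coeff_shiftSum]
  have h1 : ∀ p ∈ antidiagonal (θ + Finsupp.single t 1),
      coeff p.2 (Ψ p.1) * ((θ t : B) + 1) =
        p.1 t • coeff p.2 (Ψ p.1) + p.2 t • coeff p.2 (Ψ p.1) := by
    intro p hp
    rw [mem_antidiagonal] at hp
    have : p.1 t + p.2 t = θ t + 1 := by
      have := congrArg (fun q : τ →₀ ℕ => q t) hp
      simpa using this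
    rw [← add_smul, this, nsmul_eq_mul, mul_comm]
    push_cast; ring
  rw [Finset.sum_mul, Finset.sum_congr rfl h1, Finset.sum_add_distrib,
    sum_antidiagonal_add_single t θ (fun a b => coeff b (Ψ a)), add_comm]
  congr 1
  · have h2 := sum_antidiagonal_add_single t θ (fun a b => coeff a (Ψ b))
    rw [sum_antidiagonal_swap _ (fun a b => b t • coeff b (Ψ a)),
      sum_antidiagonal_swap θ (fun a b => coeff b (pderiv B t (Ψ a)))]
    refine h2.trans ?_
    refine Finset.sum_congr rfl fun p _ => ?_
    simp only [coeff_pderiv]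
    rw [nsmul_eq_mul, mul_comm]; push_cast; ring

theorem shiftSum_add (Ψ Ψ' : (τ →₀ ℕ) → MvPowerSeries τ B) :
    shiftSum (fun γ => Ψ γ + Ψ' γ) = shiftSum Ψ + shiftSum Ψ' := by
  classical
  ext θ
  simp only [coeff_shiftSum, map_add, Finset.sum_add_distrib]

theorem shiftSum_sub (Ψ Ψ' : (τ →₀ ℕ) → MvPowerSeries τ B) :
    shiftSum (fun γ => Ψ γ - Ψ' γ) = shiftSum Ψ - shiftSum Ψ' := by
  classical
  ext θ
  simp only [coeff_shiftSum, map_sub, Finset.sum_sub_distrib]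

theorem shiftSum_C (y : MvPowerSeries τ B) : shiftSum (fun γ => C (coeff γ y)) = y := by
  classical
  ext θ
  rw [coeff_shiftSum, Finset.sum_eq_single (θ, 0)]
  · simp
  · rintro ⟨a, b⟩ hp hne
    rw [mem_antidiagonal] at hp
    rw [coeff_C, if_neg]
    rintro rfl
    simp only [add_zero] at hp
    exact hne (by rw [hp])
  · intro h
    exact absurd (by simp [mem_antidiagonal]) h

theorem shiftSum_single (F : MvPowerSeries τ B) (Ψ : (τ →₀ ℕ) → MvPowerSeries τ B)
    (h0 : Ψ 0 = F) (h : ∀ γ, γ ≠ 0 → Ψ γ = 0) : shiftSum Ψ = F := by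
  classical
  ext θ
  rw [coeff_shiftSum, Finset.sum_eq_single (0, θ)]
  · rw [h0]
  · rintro ⟨a, b⟩ hp hne
    rw [mem_antidiagonal] at hp
    rw [h a, map_zero]
    rintro rfl
    simp only [zero_add] at hp
    exact hne (by rw [hp])
  · intro h
    exact absurd (by simp [mem_antidiagonal]) h

end ShiftSum

/-! ### Symbols: power series in `ν`, `ξ`, `η` with coefficients in `ℂ[[x]]` -/

section Symbols

variable {σ : Type*}

variable (σ) in
/-- The formal parameters: `none` is `ν`, `some (inl i)` is `ξ i` and `some (inr i)` is `η i`. -/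
abbrev Par := Option (σ ⊕ σ)

variable (σ) in
/-- Power series in the parameters with coefficients in `ℂ[[x]]`. -/
abbrev Sym := MvPowerSeries (Par σ) (MvPowerSeries σ ℂ)

/-- An operator on `ℂ[[x]]` applied to every coefficient. -/
def liftOp (D : Op σ) : Sym σ →ₗ[ℂ] Sym σ where
  toFun G := fun γ => D (coeff γ G)
  map_add' F G := by ext1 γ; exact (congrArg D (map_add _ F G)).trans (map_add D _ _)
  map_smul' c G := by ext1 γ; exact map_smul D c (coeff γ G)

@[simp] theorem coeff_liftOp (D : Op σ) (G : Sym σ) (γ : Par σ →₀ ℕ) :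
    coeff γ (liftOp D G) = D (coeff γ G) := rfl

theorem liftOp_mulOp (f : MvPowerSeries σ ℂ) (G : Sym σ) : liftOp (mulOp f) G = C f * G := by
  ext1 γ; rw [coeff_liftOp, coeff_C_mul, mulOp_apply]

theorem liftOp_add (D D' : Op σ) (G : Sym σ) : liftOp (D + D') G = liftOp D G + liftOp D' G := by
  ext1 γ; rfl

theorem liftOp_mul (D D' : Op σ) (G : Sym σ) : liftOp (D * D') G = liftOp D (liftOp D' G) := by
  ext1 γ; rfl

theorem pderiv_liftOp (t : Par σ) (D : Op σ) (G : Sym σ) :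
    pderiv _ t (liftOp D G) = liftOp D (pderiv _ t G) := by
  ext1 γ
  rw [coeff_pderiv, coeff_liftOp, coeff_liftOp, coeff_pderiv]
  have : ∀ f : MvPowerSeries σ ℂ, f * ((γ t : MvPowerSeries σ ℂ) + 1) = (γ t + 1) • f := by
    intro f; rw [nsmul_eq_mul, mul_comm]; push_cast; ring
  rw [this, this, map_nsmul]

/-- The derivative in the direction of the base coordinate `x k`. -/
def dX (k : σ) : Sym σ →ₗ[ℂ] Sym σ := liftOp (pdOp k)

theorem dX_mul (k : σ) (F G : Sym σ) : dX k (F * G) = dX k F * G + F * dX k G := by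
  classical
  ext1 γ
  simp only [dX, coeff_liftOp, map_add, coeff_mul, pdOp_apply, map_sum, Derivation.leibniz,
    smul_eq_mul, Finset.sum_add_distrib]
  rw [add_comm]
  congr 1
  refine Finset.sum_congr rfl fun p _ => mul_comm _ _

theorem pderiv_dX (t : Par σ) (k : σ) (G : Sym σ) : pderiv _ t (dX k G) = dX k (pderiv _ t G) :=
  pderiv_liftOp t _ G

theorem liftOp_mem_filt {P : (Par σ →₀ ℕ) → Prop} {w : (Par σ →₀ ℕ) → ℤ} {k : ℤ} (D : Op σ)
    {G : Sym σ} (hG : G ∈ Filt P w k) : liftOp D G ∈ Filt P w k := by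
  intro γ h1 h2
  rw [coeff_liftOp, hG γ h1 h2, map_zero]

theorem C_mem_filt {τ B : Type*} [CommRing B] {P : (τ →₀ ℕ) → Prop} {w : (τ →₀ ℕ) → ℤ}
    (hw : 0 ≤ w 0) (f : B) : (C f : MvPowerSeries τ B) ∈ Filt P w 0 := by
  classical
  intro γ _ h2
  rw [coeff_C, if_neg]
  rintro rfl; omega

/-- Conjugation by `G` turns `∂_k` into `∂_k + G⁻¹ ∂_k G`, which lowers the weight by at most one,
while multiplications by series in `x` are unaffected. So an operator of order `r` loses at most
`r`. -/
theorem conj_liftOp_mem_filt {P : (Par σ →₀ ℕ) → Prop} {w : (Par σ →₀ ℕ) → ℤ}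
    (hP : ∀ a b, P (a + b) → P a ∧ P b) (hw : ∀ a b, w (a + b) = w a + w b)
    {G G' : Sym σ} (hG : G' * G = 1) (hV : ∀ k, G' * dX k G ∈ Filt P w (-1))
    {r : ℕ} {D : Op σ} (hD : IsDiffOp r D) (j : ℤ) (p : Sym σ) (hp : p ∈ Filt P w j) :
    G' * liftOp D (G * p) ∈ Filt P w (j - r) := by
  have hw0 : w 0 = 0 := by have := hw 0 0; simp at this; exact this
  induction hD generalizing j p with
  | mulOp r f =>
    have : G' * liftOp (mulOp f) (G * p) = C f * p := by
      rw [liftOp_mulOp]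
      calc G' * (C f * (G * p)) = (G' * G) * (C f * p) := by ring
        _ = _ := by rw [hG, one_mul]
    rw [this]
    refine filt_mono (by omega) (filt_mul hP hw (C_mem_filt hw0.ge f) hp) (k := 0 + j)
  | comp_pdOp k _ ih =>
    rename_i r D _
    have h1 : dX k (G * p) = G * (G' * dX k G * p + dX k p) := by
      rw [dX_mul]
      calc dX k G * p + G * dX k p = (G' * G) * (dX k G * p) + G * dX k p := by rw [hG, one_mul]
        _ = _ := by ring
    rw [liftOp_mul]
    change G' * liftOp D (dX k (G * p)) ∈ _
    rw [h1]
    have h2 := ih (j - 1) (G' * dX k G * p + dX k p) (AddSubgroup.add_mem _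
      (filt_mono (by omega) (filt_mul hP hw (hV k) hp))
      (filt_mono (by omega) (liftOp_mem_filt _ hp)))
    convert h2 using 2
    push_cast; ring
  | add _ _ ih1 ih2 =>
    rw [liftOp_add, mul_add]
    exact AddSubgroup.add_mem _ (ih1 j p hp) (ih2 j p hp)

end Symbols

/-! ### Formal star products -/

theorem eq_single_none {σ : Type*} {ρ : Par σ →₀ ℕ} (h : ∀ a, ρ (some a) = 0) :
    ρ = Finsupp.single none (ρ none) := by
  ext t
  rcases t with _ | a
  · simp
  · simp [h]

variable {σ : Type*} [Fintype σ]

variable (σ) in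
/-- A natural star product on `ℂ[[x]]`. -/
structure FormalStar where
  C : ℕ → (MvPowerSeries σ ℂ →ₗ[ℂ] MvPowerSeries σ ℂ →ₗ[ℂ] MvPowerSeries σ ℂ)
  C_zero : ∀ f g, C 0 f g = f * g
  one_left : ∀ r f, 1 ≤ r → C r 1 f = 0
  one_right : ∀ r f, 1 ≤ r → C r f 1 = 0
  assoc : ∀ (m : ℕ) (f g h : MvPowerSeries σ ℂ),
    ∑ p ∈ antidiagonal m, C p.1 (C p.2 f g) h = ∑ p ∈ antidiagonal m, C p.1 f (C p.2 g h)
  diffOp : ∀ r f, IsDiffOp r (C r f)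

namespace FormalStar

variable (S : FormalStar σ)

open Classical in
/-- The operators `C r`, indexed by the multi-indices `r ν`. -/
def Ct (ρ : Par σ →₀ ℕ) : MvPowerSeries σ ℂ →ₗ[ℂ] MvPowerSeries σ ℂ →ₗ[ℂ] MvPowerSeries σ ℂ :=
  if ∀ a, ρ (some a) = 0 then S.C (ρ none) else 0

theorem Ct_of_ne {ρ : Par σ →₀ ℕ} {a : σ ⊕ σ} (h : ρ (some a) ≠ 0) : S.Ct ρ = 0 :=
  if_neg fun h' => h (h' a)

theorem Ct_single (r : ℕ) : S.Ct (Finsupp.single none r) = S.C r := by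
  rw [Ct, if_pos (by intro a; simp)]; simp

theorem Ct_cases (ρ : Par σ →₀ ℕ) :
    (∃ r, ρ = Finsupp.single none r ∧ S.Ct ρ = S.C r) ∨ S.Ct ρ = 0 := by
  by_cases h : ∀ a, ρ (some a) = 0
  · left
    refine ⟨ρ none, eq_single_none h, ?_⟩
    rw [Ct, if_pos h]
  · right
    exact if_neg h

theorem Ct_assoc [DecidableEq σ] (ρ : Par σ →₀ ℕ) (f g h : MvPowerSeries σ ℂ) :
    ∑ p ∈ antidiagonal ρ, S.Ct p.1 (S.Ct p.2 f g) h =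
      ∑ p ∈ antidiagonal ρ, S.Ct p.1 f (S.Ct p.2 g h) := by
  by_cases hρ : ∀ a, ρ (some a) = 0
  · rw [eq_single_none hρ, Finsupp.antidiagonal_single, Finset.sum_map, Finset.sum_map]
    simp only [Function.Embedding.coe_prodMap, Function.Embedding.coeFn_mk, Prod.map_fst,
      Prod.map_snd, Ct_single]
    exact S.assoc _ f g h
  · push Not at hρ
    obtain ⟨a, ha⟩ := hρ
    have key : ∀ p ∈ antidiagonal ρ, S.Ct p.1 = 0 ∨ S.Ct p.2 = 0 := by
      intro p hp
      rw [mem_antidiagonal] at hp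
      by_cases h1 : p.1 (some a) = 0
      · right
        refine S.Ct_of_ne (a := a) fun h2 => ha ?_
        rw [← hp]; simp [h1, h2]
      · left; exact S.Ct_of_ne h1
    refine Finset.sum_congr rfl fun p hp => ?_
    rcases key p hp with h | h <;> simp [h]

/-- Left multiplication by `f` in the star product. -/
def left (f : MvPowerSeries σ ℂ) (G : Sym σ) : Sym σ := shiftSum fun ρ => liftOp (S.Ct ρ f) G

/-- The star product of symbols. -/
def star (a G : Sym σ) : Sym σ := shiftSum fun γ => S.left (coeff γ a) G

theorem coeff_star [DecidableEq σ] (a G : Sym σ) (θ : Par σ →₀ ℕ) :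
    coeff θ (S.star a G) = ∑ p ∈ antidiagonal θ, ∑ q ∈ antidiagonal p.2,
      S.Ct q.1 (coeff p.1 a) (coeff q.2 G) := by
  simp only [star, left, coeff_shiftSum, coeff_liftOp]

theorem star_assoc (a b c : Sym σ) : S.star (S.star a b) c = S.star a (S.star b c) := by
  classical
  ext1 θ
  simp only [coeff_star, map_sum, LinearMap.sum_apply]
  -- Both bracketings are reindexed to a sum with the coefficients of `a`, `b`, `c` outermost and
  -- the pair of orders innermost, where associativity of the operators applies term by term.
  let T : MvPowerSeries σ ℂ := ∑ p ∈ antidiagonal θ, ∑ q ∈ antidiagonal p.2,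
    ∑ s ∈ antidiagonal q.2, ∑ t ∈ antidiagonal s.2,
      S.Ct t.1 (S.Ct t.2 (coeff p.1 a) (coeff q.1 b)) (coeff s.1 c)
  have hT : T = ∑ p ∈ antidiagonal θ, ∑ q ∈ antidiagonal p.2,
    ∑ s ∈ antidiagonal q.2, ∑ t ∈ antidiagonal s.2,
      S.Ct t.1 (coeff p.1 a) (S.Ct t.2 (coeff q.1 b) (coeff s.1 c)) := by
    refine Finset.sum_congr rfl fun p _ => Finset.sum_congr rfl fun q _ =>
      Finset.sum_congr rfl fun s _ => S.Ct_assoc _ _ _ _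
  trans T
  · simp only [T]
    simp only [Finset.sum_sigma']
    apply Finset.sum_nbij'
      (fun ⟨⟨_γ, _κ⟩, ⟨⟨ρ1, χ⟩, ⟨⟨α, _κ2⟩, ⟨ρ2, β⟩⟩⟩⟩ ↦
        ⟨(α, β + (χ + (ρ1 + ρ2))), ⟨(β, χ + (ρ1 + ρ2)), ⟨(χ, ρ1 + ρ2), (ρ1, ρ2)⟩⟩⟩)
      (fun ⟨⟨α, _⟩, ⟨⟨β, _⟩, ⟨⟨χ, _⟩, ⟨ρ1, ρ2⟩⟩⟩⟩ ↦
        ⟨(α + (ρ2 + β), ρ1 + χ), ⟨(ρ1, χ), ⟨(α, ρ2 + β), (ρ2, β)⟩⟩⟩)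
    · rintro ⟨⟨γ, κ⟩, ⟨⟨ρ1, χ⟩, ⟨⟨α, κ2⟩, ⟨ρ2, β⟩⟩⟩⟩ h
      simp only [Finset.mem_sigma, mem_antidiagonal] at h ⊢
      obtain ⟨h1, h2, h3, h4⟩ := h
      refine ⟨?_, trivial, trivial, trivial⟩
      rw [← h1, ← h2, ← h3, ← h4]; abel
    · rintro ⟨⟨α, m⟩, ⟨⟨β, m'⟩, ⟨⟨χ, m''⟩, ⟨ρ1, ρ2⟩⟩⟩⟩ h
      simp only [Finset.mem_sigma, mem_antidiagonal] at h ⊢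
      obtain ⟨h1, h2, h3, h4⟩ := h
      refine ⟨?_, trivial, trivial, trivial⟩
      rw [← h1, ← h2, ← h3, ← h4]; abel
    · rintro ⟨⟨γ, κ⟩, ⟨⟨ρ1, χ⟩, ⟨⟨α, κ2⟩, ⟨ρ2, β⟩⟩⟩⟩ h
      simp only [Finset.mem_sigma, mem_antidiagonal] at h ⊢
      obtain ⟨h1, h2, h3, h4⟩ := h
      subst h4; subst h3; subst h2; rfl
    · rintro ⟨⟨α, m⟩, ⟨⟨β, m'⟩, ⟨⟨χ, m''⟩, ⟨ρ1, ρ2⟩⟩⟩⟩ h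
      simp only [Finset.mem_sigma, mem_antidiagonal] at h ⊢
      obtain ⟨h1, h2, h3, h4⟩ := h
      subst h4; subst h3; subst h2; rfl
    · rintro ⟨⟨γ, κ⟩, ⟨⟨ρ1, χ⟩, ⟨⟨α, κ2⟩, ⟨ρ2, β⟩⟩⟩⟩ h
      rfl
  · rw [hT]
    simp only [Finset.sum_sigma']
    symm
    apply Finset.sum_nbij'
      (fun ⟨⟨α, _κ⟩, ⟨⟨ρ1, _μ⟩, ⟨⟨β, _κ2⟩, ⟨ρ2, χ⟩⟩⟩⟩ ↦
        ⟨(α, β + (χ + (ρ1 + ρ2))), ⟨(β, χ + (ρ1 + ρ2)), ⟨(χ, ρ1 + ρ2), (ρ1, ρ2)⟩⟩⟩)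
      (fun ⟨⟨α, _⟩, ⟨⟨β, _⟩, ⟨⟨χ, _⟩, ⟨ρ1, ρ2⟩⟩⟩⟩ ↦
        ⟨(α, ρ1 + (β + (ρ2 + χ))), ⟨(ρ1, β + (ρ2 + χ)), ⟨(β, ρ2 + χ), (ρ2, χ)⟩⟩⟩)
    · rintro ⟨⟨α, κ⟩, ⟨⟨ρ1, μ⟩, ⟨⟨β, κ2⟩, ⟨ρ2, χ⟩⟩⟩⟩ h
      simp only [Finset.mem_sigma, mem_antidiagonal] at h ⊢
      obtain ⟨h1, h2, h3, h4⟩ := h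
      refine ⟨?_, trivial, trivial, trivial⟩
      rw [← h1, ← h2, ← h3, ← h4]; abel
    · rintro ⟨⟨α, m⟩, ⟨⟨β, m'⟩, ⟨⟨χ, m''⟩, ⟨ρ1, ρ2⟩⟩⟩⟩ h
      simp only [Finset.mem_sigma, mem_antidiagonal] at h ⊢
      obtain ⟨h1, h2, h3, h4⟩ := h
      refine ⟨?_, trivial, trivial, trivial⟩
      rw [← h1, ← h2, ← h3, ← h4]; abel
    · rintro ⟨⟨α, κ⟩, ⟨⟨ρ1, μ⟩, ⟨⟨β, κ2⟩, ⟨ρ2, χ⟩⟩⟩⟩ h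
      simp only [Finset.mem_sigma, mem_antidiagonal] at h ⊢
      obtain ⟨h1, h2, h3, h4⟩ := h
      subst h4; subst h3; subst h2; subst h1; rfl
    · rintro ⟨⟨α, m⟩, ⟨⟨β, m'⟩, ⟨⟨χ, m''⟩, ⟨ρ1, ρ2⟩⟩⟩⟩ h
      simp only [Finset.mem_sigma, mem_antidiagonal] at h ⊢
      obtain ⟨h1, h2, h3, h4⟩ := h
      subst h4; subst h3; subst h2; subst h1; rfl
    · rintro ⟨⟨α, κ⟩, ⟨⟨ρ1, μ⟩, ⟨⟨β, κ2⟩, ⟨ρ2, χ⟩⟩⟩⟩ h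
      rfl

theorem left_add (f g : MvPowerSeries σ ℂ) (G : Sym σ) :
    S.left (f + g) G = S.left f G + S.left g G := by
  rw [left, left, left, ← shiftSum_add]
  congr 1; ext1 ρ; rw [map_add, liftOp_add]

theorem left_zero (G : Sym σ) : S.left 0 G = 0 := by
  have := S.left_add 0 0 G
  rw [add_zero] at this
  exact left_eq_add.mp this

theorem left_nsmul (n : ℕ) (f : MvPowerSeries σ ℂ) (G : Sym σ) :
    S.left (n • f) G = n • S.left f G := by
  induction n with
  | zero => simp [left_zero]
  | succ n ih => rw [succ_nsmul, left_add, ih, succ_nsmul]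

theorem star_add (a b G : Sym σ) : S.star (a + b) G = S.star a G + S.star b G := by
  rw [star, star, star, ← shiftSum_add]
  congr 1; ext1 γ; rw [map_add, left_add]

/-- Among the parameters, the operators of the star product bring in only `ν`; derivatives in `ξ`
and `η` therefore pass through. -/
theorem pderiv_left (t : σ ⊕ σ) (f : MvPowerSeries σ ℂ) (G : Sym σ) :
    pderiv _ (some t) (S.left f G) = S.left f (pderiv _ (some t) G) := by
  rw [left, pderiv_shiftSum]
  have : (fun γ : Par σ →₀ ℕ => (γ (some t) + 1) •
      liftOp (S.Ct (γ + Finsupp.single (some t) 1) f) G) = fun _ => 0 := by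
    ext1 γ
    rw [S.Ct_of_ne (a := t) (by simp)]
    have : liftOp ((0 : MvPowerSeries σ ℂ →ₗ[ℂ] MvPowerSeries σ ℂ →ₗ[ℂ] MvPowerSeries σ ℂ) f) G =
        0 := by ext1 θ; rfl
    rw [this, smul_zero]
  rw [this]
  have h0 : shiftSum (fun _ => (0 : Sym σ)) = 0 := shiftSum_single _ _ rfl fun _ _ => rfl
  rw [h0, add_zero, left]
  congr 1; ext1 ρ
  rw [pderiv_liftOp]

theorem pderiv_star (t : σ ⊕ σ) (a G : Sym σ) : pderiv _ (some t) (S.star a G) =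
    S.star (pderiv _ (some t) a) G + S.star a (pderiv _ (some t) G) := by
  rw [star, pderiv_shiftSum, add_comm]
  congr 1
  · rw [star]
    congr 1; ext1 γ
    rw [coeff_pderiv, ← left_nsmul, nsmul_eq_mul, mul_comm]
    push_cast; rfl
  · rw [star]
    congr 1; ext1 γ
    rw [pderiv_left]

end FormalStar

end StarFOI

end

noncomputable section

namespace StarFOI

open MvPowerSeries Finset.HasAntidiagonal

variable {σ : Type*} [Fintype σ]

/-! ### Exponentials -/

section Exp

open Classical in
/-- The exponential `exp (∑ i, ξ (ι i) x i)`. -/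
def expS (ι : σ → Par σ) : Sym σ := fun γ =>
  if ∀ t, t ∉ Set.range ι → γ t = 0 then
    ∏ i, ((((γ (ι i)).factorial : ℂ)⁻¹) • (X i : MvPowerSeries σ ℂ) ^ (γ (ι i))) else 0

variable (ι : σ → Par σ)

open Classical in
theorem coeff_expS (γ : Par σ →₀ ℕ) : coeff γ (expS ι) =
    if ∀ t, t ∉ Set.range ι → γ t = 0 then
      ∏ i, ((((γ (ι i)).factorial : ℂ)⁻¹) • (X i : MvPowerSeries σ ℂ) ^ (γ (ι i))) else 0 := rfl

theorem coeff_zero_expS : coeff 0 (expS ι) = 1 := by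
  rw [coeff_expS, if_pos (by simp)]
  simp

theorem pderiv_expS_of_notMem {t : Par σ} (ht : t ∉ Set.range ι) :
    pderiv _ t (expS ι) = 0 := by
  ext1 γ
  rw [coeff_pderiv, coeff_expS, if_neg, zero_mul, map_zero]
  intro h
  simpa using h t ht

theorem pderiv_expS (hι : Function.Injective ι) (i : σ) :
    pderiv _ (ι i) (expS ι) = C (X i) * expS ι := by
  classical
  ext1 γ
  rw [coeff_pderiv, coeff_C_mul, coeff_expS, coeff_expS]
  have hiff : (∀ t, t ∉ Set.range ι → (γ + Finsupp.single (ι i) 1 : Par σ →₀ ℕ) t = 0) ↔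
      ∀ t, t ∉ Set.range ι → γ t = 0 := by
    refine forall₂_congr fun t ht => ?_
    have : ι i ≠ t := fun h => ht ⟨i, h⟩
    simp [this]
  simp only [hiff]
  split_ifs with h
  · rw [← Finset.mul_prod_erase _ _ (Finset.mem_univ i),
      ← Finset.mul_prod_erase Finset.univ (fun j => ((((γ (ι j)).factorial : ℂ)⁻¹) •
        (X j : MvPowerSeries σ ℂ) ^ (γ (ι j)))) (Finset.mem_univ i)]
    have h1 : ∀ j ∈ Finset.univ.erase i, (γ + Finsupp.single (ι i) 1 : Par σ →₀ ℕ) (ι j) = γ (ι j) := by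
      intro j hj
      have : ι i ≠ ι j := fun h => (Finset.ne_of_mem_erase hj) (hι h).symm
      simp [this]
    rw [Finset.prod_congr rfl fun j hj => by rw [h1 j hj]]
    have h2 : (γ + Finsupp.single (ι i) 1 : Par σ →₀ ℕ) (ι i) = γ (ι i) + 1 := by simp
    rw [h2]
    have h3 : ((((γ (ι i) + 1).factorial : ℂ)⁻¹) • (X i : MvPowerSeries σ ℂ) ^ (γ (ι i) + 1)) *
        ((γ (ι i) : MvPowerSeries σ ℂ) + 1) =
        X i * ((((γ (ι i)).factorial : ℂ)⁻¹) • (X i : MvPowerSeries σ ℂ) ^ (γ (ι i))) := by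
      have hc : ((γ (ι i) : MvPowerSeries σ ℂ) + 1) = C ((γ (ι i) : ℂ) + 1) := by simp
      rw [hc, mul_comm, ← smul_eq_C_mul, smul_smul, mul_smul_comm, ← pow_succ']
      congr 1
      rw [Nat.factorial_succ]
      have h4 : ((γ (ι i) : ℂ) + 1) ≠ 0 := Nat.cast_add_one_ne_zero _
      push_cast
      rw [mul_inv, ← mul_assoc, mul_inv_cancel₀ h4, one_mul]
    rw [mul_right_comm, h3, mul_assoc]
  · simp

theorem exists_inv_of_coeff_zero {τ B : Type*} [CommRing B] {F : MvPowerSeries τ B}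
    (h : coeff 0 F = 1) : ∃ F', F' * F = 1 := by
  have : IsUnit F := by
    rw [isUnit_iff_constantCoeff, ← coeff_zero_eq_constantCoeff_apply, h]
    exact isUnit_one
  exact this.exists_left_inv

theorem eq_zero_of_pderiv_eq_zero {σ τ : Type*} {F : MvPowerSeries τ (MvPowerSeries σ ℂ)}
    (h : ∀ t, pderiv _ t F = 0) (h0 : coeff 0 F = 0) : F = 0 := by
  ext1 γ
  by_cases hγ : γ = 0
  · rw [hγ, h0, map_zero]
  obtain ⟨t, ht : γ t ≠ 0⟩ := Finsupp.ne_iff.mp hγ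
  have hle : Finsupp.single t 1 ≤ γ := by rw [Finsupp.single_le_iff]; omega
  have h1 := congrArg (coeff (γ - Finsupp.single t 1)) (h t)
  rw [coeff_pderiv, tsub_add_cancel_of_le hle, map_zero] at h1
  have hc : (((γ - Finsupp.single t 1 : τ →₀ ℕ) t : MvPowerSeries σ ℂ) + 1) =
      C (((γ - Finsupp.single t 1 : τ →₀ ℕ) t : ℂ) + 1) := by simp
  have h2 : (((γ - Finsupp.single t 1 : τ →₀ ℕ) t : ℂ) + 1) ≠ 0 := Nat.cast_add_one_ne_zero _
  rw [hc, mul_comm, ← smul_eq_C_mul] at h1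
  rw [map_zero]
  exact (smul_eq_zero.mp h1).resolve_left h2

/-- The difference `F` of the two sides satisfies the same equations `∂ F = x_i F` in the parameters
as the exponential and has no constant term; dividing by the exponential gives a series with
vanishing derivatives, hence zero. -/
theorem dX_expS (hι : Function.Injective ι) (k : σ) :
    dX k (expS ι) = X (ι k) * expS ι := by
  classical
  obtain ⟨E', hE'⟩ := exists_inv_of_coeff_zero (coeff_zero_expS ι)
  rw [← sub_eq_zero]
  set F := dX k (expS ι) - X (ι k) * expS ι with hF
  have hdC : ∀ i, dX k (C (X i) : Sym σ) = if i = k then 1 else 0 := by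
    intro i
    ext1 γ
    rw [dX, coeff_liftOp, coeff_C]
    split_ifs with h1 h2 h2
    · subst h1; subst h2; simp
    · rw [pdOp_apply, pderiv_X_of_ne h2]; simp
    · rw [map_zero, coeff_one, if_neg h1]
    · simp
  have h1 : ∀ i, pderiv _ (ι i) F = C (X i) * F := by
    intro i
    rw [hF, map_sub, pderiv_dX, pderiv_expS ι hι, dX_mul, hdC, Derivation.leibniz,
      pderiv_expS ι hι, smul_eq_mul, smul_eq_mul]
    by_cases h : i = k
    · subst h
      rw [pderiv_X_self, if_pos rfl]; ring
    · rw [if_neg h, pderiv_X_of_ne (fun h' => h (hι h').symm)]; ring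
  have h2 : ∀ t, t ∉ Set.range ι → pderiv _ t F = 0 := by
    intro t ht
    rw [hF, map_sub, pderiv_dX, pderiv_expS_of_notMem ι ht, Derivation.leibniz,
      pderiv_expS_of_notMem ι ht, pderiv_X_of_ne (fun h' => ht ⟨k, h'⟩)]
    simp
  have h3 : F = expS ι * (E' * F) := by
    rw [← mul_assoc, mul_comm (expS ι), hE', one_mul]
  have h4 : E' * F = 0 := by
    refine eq_zero_of_pderiv_eq_zero (fun t => ?_) ?_
    · have h5 : expS ι * pderiv _ t (E' * F) = 0 := by
        have := congrArg (pderiv _ t) h3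
        rw [Derivation.leibniz, smul_eq_mul, smul_eq_mul] at this
        by_cases ht : t ∈ Set.range ι
        · obtain ⟨i, rfl⟩ := ht
          rw [h1, pderiv_expS ι hι] at this
          have h6 : C (X i) * F = (E' * F) * (C (X i) * expS ι) := by
            rw [h3]
            linear_combination (-(C (X i) * expS ι * E' * F)) * hE'
          rw [h6] at this
          exact left_eq_add.mp (this.trans (add_comm _ _))
        · rw [h2 t ht, pderiv_expS_of_notMem ι ht, mul_zero, add_zero] at this
          exact this.symm
      calc pderiv _ t (E' * F) = E' * (expS ι * pderiv _ t (E' * F)) := by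
            rw [← mul_assoc, hE', one_mul]
        _ = 0 := by rw [h5, mul_zero]
    · rw [coeff_zero_eq_constantCoeff_apply, map_mul]
      have : constantCoeff F = 0 := by
        rw [hF, map_sub, map_mul, constantCoeff_X, zero_mul, sub_zero,
          ← coeff_zero_eq_constantCoeff_apply, dX, coeff_liftOp, coeff_zero_expS]
        exact pderiv_one
      rw [this, mul_zero]
  rw [h3, h4, mul_zero]

end Exp

/-! ### Weights -/

section Weight

variable {ι : Type*} [Fintype ι]

/-- The weight: the exponent of `ν` minus the degree in the other parameters. -/
def wt (γ : Option ι →₀ ℕ) : ℤ := (γ none : ℤ) - ∑ a, (γ (some a) : ℤ)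

theorem wt_add (a b : Option ι →₀ ℕ) : wt (a + b) = wt a + wt b := by
  simp only [wt, Finsupp.add_apply, Nat.cast_add, Finset.sum_add_distrib]; ring

theorem wt_zero : wt (0 : Option ι →₀ ℕ) = 0 := by simp [wt]

theorem wt_single_none (r : ℕ) : wt (Finsupp.single none r : Option ι →₀ ℕ) = r := by
  simp [wt]

theorem wt_single_some (a : ι) : wt (Finsupp.single (some a) 1 : Option ι →₀ ℕ) = -1 := by
  classical
  simp [wt, Finsupp.single_apply]

theorem X_mem_filt {B : Type*} [CommRing B] {P : (Option ι →₀ ℕ) → Prop} (a : ι) :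
    (X (some a) : MvPowerSeries (Option ι) B) ∈ Filt P wt (-1) := by
  classical
  intro γ _ h
  rw [coeff_X, if_neg]
  rintro rfl
  rw [wt_single_some] at h
  omega

end Weight

/-- The degree in `ξ`. -/
def xiDeg (γ : Par σ →₀ ℕ) : ℤ := ∑ i, (γ (some (Sum.inl i)) : ℤ)

theorem xiDeg_add (a b : Par σ →₀ ℕ) : xiDeg (a + b) = xiDeg a + xiDeg b := by
  simp only [xiDeg, Finsupp.add_apply, Nat.cast_add, Finset.sum_add_distrib]

theorem xiDeg_nonneg (a : Par σ →₀ ℕ) : 0 ≤ xiDeg a := Finset.sum_nonneg fun _ _ => by positivity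

theorem xiDeg_zero : xiDeg (0 : Par σ →₀ ℕ) = 0 := by simp [xiDeg]

theorem xiDeg_single_inl (i : σ) :
    xiDeg (Finsupp.single (some (Sum.inl i)) 1 : Par σ →₀ ℕ) = 1 := by
  classical
  simp [xiDeg, Finsupp.single_apply]

theorem xiDeg_lt_add (d : ℤ) (a b : Par σ →₀ ℕ) (h : xiDeg (a + b) < d) :
    xiDeg a < d ∧ xiDeg b < d := by
  rw [xiDeg_add] at h
  have := xiDeg_nonneg a
  have := xiDeg_nonneg b
  omega

/-- Integration in `ξ`: an exponent containing some `ξ_i` is read off from the derivative in `ξ_i`.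
Since `ξ_i` has weight `-1`, integrating costs one unit of weight and gains one `ξ`-degree. -/
theorem filt_of_pderiv {P : (Par σ →₀ ℕ) → Prop} (hP : ∀ a b, P (a + b) → P a ∧ P b) {k d : ℤ}
    {F : Sym σ}
    (h : ∀ i, pderiv _ (some (Sum.inl i)) F ∈ Filt (fun γ => P γ ∧ xiDeg γ < d) wt (k + 1))
    (h0 : F ∈ Filt (fun γ => P γ ∧ xiDeg γ < 1) wt k) :
    F ∈ Filt (fun γ => P γ ∧ xiDeg γ < d + 1) wt k := by
  intro γ hγ hk
  by_cases h1 : xiDeg γ < 1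
  · exact h0 γ ⟨hγ.1, h1⟩ hk
  obtain ⟨i, hi⟩ : ∃ i, γ (some (Sum.inl i)) ≠ 0 := by
    by_contra! hne
    exact h1 (by simp [xiDeg, hne])
  have hle : Finsupp.single (some (Sum.inl i)) 1 ≤ γ := by rw [Finsupp.single_le_iff]; omega
  obtain ⟨β, rfl⟩ : ∃ β, γ = β + Finsupp.single (some (Sum.inl i)) 1 :=
    ⟨_, (tsub_add_cancel_of_le hle).symm⟩
  have h2 := h i β ⟨(hP _ _ hγ.1).1, by
    have := hγ.2; rw [xiDeg_add, xiDeg_single_inl] at this; omega⟩ (by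
    rw [wt_add, wt_single_some] at hk; omega)
  rw [coeff_pderiv] at h2
  have hc : ((β (some (Sum.inl i)) : MvPowerSeries σ ℂ) + 1) =
      C ((β (some (Sum.inl i)) : ℂ) + 1) := by simp
  rw [hc, mul_comm, ← smul_eq_C_mul] at h2
  exact (smul_eq_zero.mp h2).resolve_left (Nat.cast_add_one_ne_zero _)

namespace FormalStar

variable (S : FormalStar σ)

theorem liftOp_zero {σ : Type*} (G : Sym σ) : liftOp (0 : Op σ) G = 0 := by ext1 γ; rfl

/-- `C_r f` has order at most `r` and loses at most `r` in weight under conjugation, which the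
accompanying `ν^r` exactly compensates. -/
theorem conj_left_mem {P : (Par σ →₀ ℕ) → Prop} (hP : ∀ a b, P (a + b) → P a ∧ P b)
    {G G' : Sym σ} (hG : G' * G = 1) (hV : ∀ k, G' * dX k G ∈ Filt P wt (-1))
    (f : MvPowerSeries σ ℂ) : G' * S.left f G ∈ Filt P wt 0 := by
  rw [left, mul_shiftSum]
  refine shiftSum_mem_filt hP wt_add fun γ _ => ?_
  rcases S.Ct_cases γ with ⟨r, hr, hC⟩ | hC
  · rw [hC, hr, wt_single_none]
    have := conj_liftOp_mem_filt hP wt_add hG hV (S.diffOp r f) 0 1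
      (by have := C_mem_filt (P := P) wt_zero.ge (1 : MvPowerSeries σ ℂ); rwa [map_one] at this)
    rwa [mul_one] at this
  · rw [hC, LinearMap.zero_apply, liftOp_zero, mul_zero]
    exact AddSubgroup.zero_mem _

theorem conj_star_mem {P : (Par σ →₀ ℕ) → Prop} (hP : ∀ a b, P (a + b) → P a ∧ P b)
    {G G' : Sym σ} (hG : G' * G = 1) (hV : ∀ k, G' * dX k G ∈ Filt P wt (-1))
    {a : Sym σ} (ha : a ∈ Filt P wt 0) : G' * S.star a G ∈ Filt P wt 0 := by
  rw [star, mul_shiftSum]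
  refine shiftSum_mem_filt hP wt_add fun γ hγ => ?_
  by_cases h : wt γ < 0
  · rw [ha γ hγ h, left_zero, mul_zero]
    exact AddSubgroup.zero_mem _
  · exact filt_mono (by omega) (S.conj_left_mem hP hG hV _)

theorem coeff_zero_left (f : MvPowerSeries σ ℂ) (G : Sym σ) :
    coeff 0 (S.left f G) = f * coeff 0 G := by
  classical
  rw [left, coeff_shiftSum, Finset.HasAntidiagonal.antidiagonal_zero, Finset.sum_singleton,
    coeff_liftOp]
  have := S.Ct_single 0
  rw [Finsupp.single_zero] at this
  simp only [this, C_zero]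

theorem left_mem_filt {P : (Par σ →₀ ℕ) → Prop} (hP : ∀ a b, P (a + b) → P a ∧ P b)
    {w : (Par σ →₀ ℕ) → ℤ} (hw : ∀ a b, w (a + b) = w a + w b) (hw' : ∀ r, 0 ≤ w (Finsupp.single none r))
    {k : ℤ} (f : MvPowerSeries σ ℂ) {G : Sym σ}
    (hG : G ∈ Filt P w k) : S.left f G ∈ Filt P w k := by
  refine shiftSum_mem_filt hP hw fun γ _ => ?_
  rcases S.Ct_cases γ with ⟨r, hr, hC⟩ | hC
  · rw [hr]
    exact filt_mono (by have := hw' r; omega) (liftOp_mem_filt _ hG)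
  · rw [hC, LinearMap.zero_apply, liftOp_zero]
    exact AddSubgroup.zero_mem _

theorem left_sub (f : MvPowerSeries σ ℂ) (F G : Sym σ) :
    S.left f (F - G) = S.left f F - S.left f G := by
  rw [left, left, left, ← shiftSum_sub]
  congr 1; ext1 ρ; rw [map_sub]

theorem left_one (f : MvPowerSeries σ ℂ) : S.left f 1 = MvPowerSeries.C f := by
  classical
  refine shiftSum_single _ _ ?_ fun γ hγ => ?_
  · have := S.Ct_single 0
    rw [Finsupp.single_zero] at this
    ext1 θ
    rw [this, coeff_liftOp, C_zero, coeff_one, coeff_C]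
    split_ifs <;> simp
  · ext1 θ
    rw [coeff_liftOp, coeff_one]
    rcases S.Ct_cases γ with ⟨r, hr, hC⟩ | hC
    · have hr1 : 1 ≤ r := by
        rcases Nat.eq_zero_or_pos r with h | h
        · exact absurd (by rw [hr, h, Finsupp.single_zero]) hγ
        · exact h
      rw [hC]
      split_ifs
      · rw [S.one_right r f hr1]; simp
      · simp
    · rw [hC]; simp

theorem left_one_fun (G : Sym σ) : S.left 1 G = G := by
  classical
  refine shiftSum_single _ _ ?_ fun γ hγ => ?_
  · have := S.Ct_single 0
    rw [Finsupp.single_zero] at this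
    ext1 θ
    rw [this, coeff_liftOp, C_zero, one_mul]
  · ext1 θ
    rw [coeff_liftOp]
    rcases S.Ct_cases γ with ⟨r, hr, hC⟩ | hC
    · have hr1 : 1 ≤ r := by
        rcases Nat.eq_zero_or_pos r with h | h
        · exact absurd (by rw [hr, h, Finsupp.single_zero]) hγ
        · exact h
      rw [hC, S.one_left r _ hr1]; simp
    · rw [hC]; simp

/-- In leading order of the total parameter degree, `a ↦ a ⋆ E` is the identity because `E` starts
with `1`; successive approximation applies. -/
theorem exists_star_eq {E : Sym σ} (hE : coeff 0 E = 1) (y : Sym σ) : ∃ a, S.star a E = y := by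
  classical
  let Φ : ((Par σ →₀ ℕ) → MvPowerSeries σ ℂ) →+ Sym σ :=
    { toFun := fun a => S.star a E
      map_zero' := by
        have : (fun γ : Par σ →₀ ℕ => S.left (coeff γ (0 : Sym σ)) E) = fun _ => 0 := by
          ext1 γ; rw [map_zero, left_zero]
        change shiftSum (fun γ : Par σ →₀ ℕ => S.left (coeff γ (0 : Sym σ)) E) = 0
        rw [this]
        exact shiftSum_single _ _ rfl fun _ _ => rfl
      map_add' := fun a b => S.star_add a b E }
  have hP : ∀ a b : Par σ →₀ ℕ, True → True ∧ True := fun _ _ _ => ⟨trivial, trivial⟩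
  have hw : ∀ a b : Par σ →₀ ℕ, ((a + b).degree : ℤ) = (a.degree : ℤ) + (b.degree : ℤ) := by
    intro a b; simp
  have key : ∀ f, S.left f E ∈ Filt (fun _ => True) (fun γ : Par σ →₀ ℕ => (γ.degree : ℤ)) 0 :=
    fun f => by intro γ _ h; simp only at h; omega
  refine exists_preimage_of_graded (fun γ : Par σ →₀ ℕ => γ.degree) Φ
    (fun D => Filt (fun _ => True) (fun γ => (γ.degree : ℤ)) D) ?_ ?_ ?_ ?_
  · intro y hy
    ext1 γ
    exact hy (γ.degree + 1) γ trivial (by push_cast; omega)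
  · intro D f hf
    change shiftSum (fun γ => S.left (coeff γ (f : Sym σ)) E) ∈ _
    refine shiftSum_mem_filt (P := fun _ => True) (w := fun γ => (γ.degree : ℤ)) hP hw fun γ _ => ?_
    by_cases h : γ.degree < D
    · have : coeff γ (f : Sym σ) = 0 := hf γ h
      rw [this, left_zero]
      exact AddSubgroup.zero_mem _
    · exact filt_mono (by omega) (key _)
  · intro D y hy
    refine ⟨y, fun γ h => hy γ trivial (Nat.cast_lt.mpr h), ?_⟩
    have : y - Φ y = shiftSum fun γ => MvPowerSeries.C (coeff γ y) - S.left (coeff γ y) E := by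
      rw [shiftSum_sub, shiftSum_C]; rfl
    rw [this]
    refine shiftSum_mem_filt (P := fun _ => True) (w := fun γ => (γ.degree : ℤ)) hP hw fun γ _ => ?_
    by_cases h : γ.degree < D
    · rw [hy γ trivial (Nat.cast_lt.mpr h), left_zero, map_zero, sub_zero]
      exact AddSubgroup.zero_mem _
    · intro θ _ hθ
      have : θ.degree = 0 := by push_cast at hθ; omega
      rw [Finsupp.degree_eq_zero_iff] at this
      rw [this, map_sub, coeff_zero_left, hE, mul_one, coeff_zero_C, sub_self]
  · intro γ _ h; simp only at h; omega

/-- The exponential in the variables `ξ`. -/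
def expXi (σ : Type*) [Fintype σ] : Sym σ := expS fun i : σ => some (Sum.inl i)

/-- The exponential in the variables `η`. -/
def expEta (σ : Type*) [Fintype σ] : Sym σ := expS fun i : σ => some (Sum.inr i)

theorem inl_injective {σ : Type*} : Function.Injective fun i : σ => (some (Sum.inl i) : Par σ) :=
  fun i j h => by simpa using h

theorem inr_injective {σ : Type*} : Function.Injective fun i : σ => (some (Sum.inr i) : Par σ) :=
  fun i j h => by simpa using h

theorem expXi_sub_one_mem : expXi σ - 1 ∈ Filt (fun _ => True) xiDeg 1 := by
  classical
  intro γ _ h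
  rw [map_sub, coeff_one, expXi, coeff_expS]
  by_cases hγ : γ = 0
  · subst hγ; simp
  rw [if_neg hγ, sub_zero, if_neg]
  intro h'
  apply hγ
  have hx : ∀ i, γ (some (Sum.inl i)) = 0 := by
    have h0 : xiDeg γ = 0 := le_antisymm (by omega) (xiDeg_nonneg γ)
    rw [xiDeg, Finset.sum_eq_zero_iff_of_nonneg (fun _ _ => by positivity)] at h0
    intro i
    exact_mod_cast h0 i (Finset.mem_univ i)
  ext t
  by_cases ht : t ∈ Set.range fun i : σ => (some (Sum.inl i) : Par σ)
  · obtain ⟨i, rfl⟩ := ht; exact hx i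
  · exact h' t ht

/-- Left star multiplication by `a` represents multiplication by `x_i` on the exponential.
Regularity follows by induction on the `ξ`-degree: modulo `ξ` the exponential is the unit `1`, so
each coefficient of `a` is determined by coefficients of lower `ξ`-degree, through series of
nonnegative weight. -/
theorem exists_regular_multiplier (i : σ) :
    ∃ a : Sym σ, S.star a (expXi σ) = MvPowerSeries.C (X i) * expXi σ ∧
      a ∈ Filt (fun _ => True) wt 0 := by
  classical
  obtain ⟨a, ha⟩ := S.exists_star_eq (E := expXi σ) (coeff_zero_expS _)
    (MvPowerSeries.C (X i) * expXi σ)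
  refine ⟨a, ha, ?_⟩
  obtain ⟨E', hE'⟩ := exists_inv_of_coeff_zero (F := expXi σ) (coeff_zero_expS _)
  have hP : ∀ a b : Par σ →₀ ℕ, True → True ∧ True := fun _ _ _ => ⟨trivial, trivial⟩
  have hV : ∀ k, E' * dX k (expXi σ) ∈ Filt (fun _ => True) wt (-1) := by
    intro k
    rw [expXi, dX_expS _ inl_injective, mul_left_comm]
    rw [expXi] at hE'
    rw [hE', mul_one]
    exact X_mem_filt _
  have hE1 : E' - 1 ∈ Filt (fun _ => True) xiDeg 1 := by
    have : E' - 1 = -(E' * (expXi σ - 1)) := by linear_combination hE'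
    rw [this]
    refine AddSubgroup.neg_mem _ (filt_mono (k := 0 + 1) (by omega) (filt_mul hP xiDeg_add ?_
      expXi_sub_one_mem))
    intro γ _ h
    exact absurd (xiDeg_nonneg γ) (by omega)
  -- The defect between pointwise and conjugated star multiplication by `f`. It has nonnegative
  -- weight (`hΨ1`) and is divisible by the variables `ξ` (`hΨ2`).
  let Ψ : MvPowerSeries σ ℂ → Sym σ := fun f => MvPowerSeries.C f - E' * S.left f (expXi σ)
  have hΨ0 : Ψ 0 = 0 := by simp [Ψ, left_zero]
  have hΨ1 : ∀ f, Ψ f ∈ Filt (fun _ => True) wt 0 := fun f =>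
    AddSubgroup.sub_mem _ (C_mem_filt wt_zero.ge f) (S.conj_left_mem hP hE' hV f)
  have hΨ2 : ∀ f, Ψ f ∈ Filt (fun _ => True) xiDeg 1 := by
    intro f
    have hz : ∀ F : Sym σ, F ∈ Filt (fun _ => True) xiDeg 0 :=
      fun F γ _ h => absurd (xiDeg_nonneg γ) (by omega)
    have h1 : S.left f (expXi σ) - MvPowerSeries.C f ∈ Filt (fun _ => True) xiDeg 1 := by
      rw [← left_one, ← left_sub]
      refine S.left_mem_filt hP xiDeg_add (fun r => xiDeg_nonneg _) f expXi_sub_one_mem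
    have : Ψ f = -(E' * (S.left f (expXi σ) - MvPowerSeries.C f)) -
        (MvPowerSeries.C f) * (E' - 1) := by simp only [Ψ]; ring
    rw [this]
    exact AddSubgroup.sub_mem _
      (AddSubgroup.neg_mem _ (filt_mono (k := 0 + 1) (by omega) (filt_mul hP xiDeg_add (hz _) h1)))
      (filt_mono (k := 0 + 1) (by omega) (filt_mul hP xiDeg_add (hz _) hE1))
  -- The equation for `a`, divided by the exponential, in fixed-point form; `Ψ` being divisible by
  -- `ξ` makes it a recursion in the `ξ`-degree.
  have hsum : a = MvPowerSeries.C (X i) + shiftSum fun γ => Ψ (coeff γ a) := by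
    have h1 : E' * S.star a (expXi σ) = MvPowerSeries.C (X i) := by
      rw [ha, mul_left_comm, hE', mul_one]
    rw [shiftSum_sub, shiftSum_C, ← mul_shiftSum]
    change a = MvPowerSeries.C (X i) + (a - E' * S.star a (expXi σ))
    rw [h1]; ring
  have step : ∀ d : ℕ, a ∈ Filt (fun γ => xiDeg γ < d) wt 0 := by
    intro d
    induction d with
    | zero => intro γ h _; exact absurd (xiDeg_nonneg γ) (by push_cast at h; omega)
    | succ d ih =>
      rw [hsum]
      refine AddSubgroup.add_mem _ (C_mem_filt wt_zero.ge _) ?_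
      intro θ h1 h2
      rw [coeff_shiftSum]
      refine Finset.sum_eq_zero fun p hp => ?_
      rw [mem_antidiagonal] at hp
      rw [← hp, xiDeg_add] at h1
      rw [← hp, wt_add] at h2
      by_cases h3 : xiDeg p.2 < 1
      · exact hΨ2 _ p.2 trivial h3
      by_cases h4 : wt p.1 < 0
      · rw [ih p.1 (by push_cast at h1; omega) h4, hΨ0, map_zero]
      · exact hΨ1 _ p.2 trivial (by omega)
  intro γ _ h
  exact step (xiDeg γ).toNat.succ γ (by have := xiDeg_nonneg γ; push_cast; omega) h

/-- The star product of the exponentials. -/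
def generating : Sym σ := S.star (expXi σ) (expEta σ)

/-- At `ξ = 0` the exponential in `ξ` becomes the unit. Hence the generating series reduces to
`e^{ηx}` modulo `ξ`, which starts the inductions below. -/
theorem star_one_mem_filt_sub (G : Sym σ) :
    S.star (expXi σ) G - G ∈ Filt (fun _ => True) xiDeg 1 := by
  have hP : ∀ a b : Par σ →₀ ℕ, True → True ∧ True := fun _ _ _ => ⟨trivial, trivial⟩
  have hz : ∀ F : Sym σ, F ∈ Filt (fun _ => True) xiDeg 0 :=
      fun F γ _ h => absurd (xiDeg_nonneg γ) (by omega)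
  have h1 : S.star (expXi σ) G - G = S.star (expXi σ - 1) G := by
    have h2 : S.star 1 G = G := by
      classical
      refine shiftSum_single _ _ ?_ fun γ hγ => ?_
      · rw [coeff_zero_one, left_one_fun]
      · rw [coeff_one, if_neg hγ, left_zero]
    have h3 := S.star_add (expXi σ - 1) 1 G
    rw [sub_add_cancel, h2] at h3
    rw [h3]; ring
  rw [h1]
  refine shiftSum_mem_filt hP xiDeg_add fun γ _ => ?_
  by_cases h : xiDeg γ < 1
  · rw [expXi_sub_one_mem γ trivial h, left_zero]
    exact AddSubgroup.zero_mem _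
  · exact filt_mono (by omega) (hz _)

theorem coeff_zero_generating : coeff 0 S.generating = 1 := by
  have h := S.star_one_mem_filt_sub (expEta σ) 0 trivial (by rw [xiDeg_zero]; omega)
  rw [map_sub, sub_eq_zero] at h
  exact h.trans (coeff_zero_expS _)

/-- With `U = G⁻¹ ∂G` in the parameters and `V = G⁻¹ ∂_x G`, the weight bounds for `V` imply those
for `U` in the directions `ξ` by the multiplier equation, and these imply the bounds for `V` in the
next `ξ`-degree by integration. The directions `η` follow by a further integration. -/
theorem exists_regular_logDeriv : ∃ U : σ ⊕ σ → Sym σ,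
    (∀ a, pderiv _ (some a) S.generating = U a * S.generating) ∧
      ∀ a, U a ∈ Filt (fun _ => True) wt 0 := by
  classical
  set G := S.generating with hGdef
  obtain ⟨G', hG⟩ := exists_inv_of_coeff_zero S.coeff_zero_generating
  rw [← hGdef] at hG
  have hP : ∀ a b : Par σ →₀ ℕ, True → True ∧ True := fun _ _ _ => ⟨trivial, trivial⟩
  have hz : ∀ F : Sym σ, F ∈ Filt (fun _ => True) xiDeg 0 :=
      fun F γ _ h => absurd (xiDeg_nonneg γ) (by omega)
  have hJ : ∀ F F' : Sym σ, F ∈ Filt (fun _ => True) xiDeg 1 → F' * F ∈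
      Filt (fun _ => True) xiDeg 1 := fun F F' h =>
    filt_mono (k := 0 + 1) (by omega) (filt_mul hP xiDeg_add (hz _) h)
  have hGE : G - expEta σ ∈ Filt (fun _ => True) xiDeg 1 := S.star_one_mem_filt_sub _
  choose a ha hareg using S.exists_regular_multiplier
  let U : σ ⊕ σ → Sym σ := fun t => G' * pderiv _ (some t) G
  let V : σ → Sym σ := fun k => G' * dX k G
  have hUG : ∀ t, pderiv _ (some t) G = U t * G := by
    intro t; simp only [U]; linear_combination (-(pderiv _ (some t) G)) * hG
  have hVG : ∀ k, dX k G = V k * G := by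
    intro t; simp only [V]; linear_combination (-(dX t G)) * hG
  have cancel : ∀ F F' : Sym σ, F * G = F' * G → F = F' := by
    intro F F' h
    linear_combination G' * h - (F - F') * hG
  -- Mixed derivatives of `G` agree, so the logarithmic derivatives are compatible; `G` is
  -- invertible and can be cancelled.
  have hUV : ∀ t k, pderiv _ (some t) (V k) = dX k (U t) := by
    intro t k
    apply cancel
    have h1 := congrArg (pderiv _ (some t)) (hVG k)
    have h2 := congrArg (dX k) (hUG t)
    rw [pderiv_dX, Derivation.leibniz, smul_eq_mul, smul_eq_mul] at h1
    rw [dX_mul] at h2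
    rw [hUG, hVG] at *
    linear_combination h2 - h1
  have hUU : ∀ s t, pderiv _ (some t) (U s) = pderiv _ (some s) (U t) := by
    intro s t
    apply cancel
    have h1 := congrArg (pderiv _ (some t)) (hUG s)
    have h2 := congrArg (pderiv _ (some s)) (hUG t)
    have h3 : pderiv _ (some t) (pderiv _ (some s) G) = pderiv _ (some s) (pderiv _ (some t) G) := by
      ext1 γ
      simp only [coeff_pderiv]
      by_cases hst : s = t
      · subst hst; rfl
      · have e1 : (Finsupp.single (some t) 1 : Par σ →₀ ℕ) (some s) = 0 := by
          simp [Ne.symm hst]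
        have e2 : (Finsupp.single (some s) 1 : Par σ →₀ ℕ) (some t) = 0 := by
          simp [hst]
        simp only [Finsupp.add_apply, e1, e2, add_zero, add_right_comm]
        ring
    rw [Derivation.leibniz, smul_eq_mul, smul_eq_mul] at h1 h2
    rw [hUG t] at h1
    rw [hUG s] at h2
    linear_combination h3 - h1 + h2
  -- `∂_{ξ_i} G = (x_i e^{ξx}) ⋆ e^{ηx} = (a_i ⋆ e^{ξx}) ⋆ e^{ηx} = a_i ⋆ G`: the one place where
  -- associativity is used.
  have hUa : ∀ i, U (Sum.inl i) = G' * S.star (a i) G := by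
    intro i
    have h1 : pderiv _ (some (Sum.inl i)) G = S.star (a i) G := by
      rw [hGdef, generating, pderiv_star]
      have h2 : pderiv _ (some (Sum.inl i)) (expEta σ) = 0 :=
        pderiv_expS_of_notMem _ (by rintro ⟨j, hj⟩; simp at hj)
      have h3 : pderiv _ (some (Sum.inl i)) (expXi σ) = MvPowerSeries.C (X i) * expXi σ :=
        pderiv_expS _ inl_injective i
      have h4 : S.star (expXi σ) 0 = 0 := by
        have : (fun γ => S.left (coeff γ (expXi σ)) 0) = fun _ => 0 := by
          ext1 γ
          have := S.left_sub (coeff γ (expXi σ)) 0 0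
          rwa [sub_zero, sub_self] at this
        rw [star, this]
        exact shiftSum_single _ _ rfl fun _ _ => rfl
      rw [h2, h3, h4, add_zero, ← ha i, star_assoc]
    simp only [U, h1]
  -- Start of the induction: modulo `ξ`, `V_k` is the logarithmic derivative of `e^{ηx}`, namely
  -- `η_k`, of weight `-1`.
  have hV0 : ∀ k, V k - X (some (Sum.inr k)) ∈ Filt (fun _ => True) xiDeg 1 := by
    intro k
    have h1 : dX k (expEta σ) = X (some (Sum.inr k)) * expEta σ := dX_expS _ inr_injective k
    have h2 : V k - X (some (Sum.inr k)) =
        G' * (dX k (G - expEta σ)) + (-(G' * X (some (Sum.inr k)))) * (G - expEta σ) := by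
      rw [map_sub, h1]; simp only [V]
      linear_combination (X (some (Sum.inr k))) * hG
    rw [h2]
    exact AddSubgroup.add_mem _ (hJ _ _ (liftOp_mem_filt _ hGE)) (hJ _ _ hGE)
  have hpd : ∀ (j : σ) (F : Sym σ), F ∈ Filt (fun _ => True) xiDeg 1 →
      pderiv _ (some (Sum.inr j)) F ∈ Filt (fun _ => True) xiDeg 1 := by
    intro j F hF γ _ h
    rw [coeff_pderiv, hF _ trivial, zero_mul]
    rw [xiDeg_add]
    have : xiDeg (Finsupp.single (some (Sum.inr j)) 1 : Par σ →₀ ℕ) = 0 := by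
      simp [xiDeg]
    omega
  have hU0 : ∀ j, U (Sum.inr j) - MvPowerSeries.C (X j) ∈ Filt (fun _ => True) xiDeg 1 := by
    intro j
    have h1 : pderiv _ (some (Sum.inr j)) (expEta σ) = MvPowerSeries.C (X j) * expEta σ :=
      pderiv_expS _ inr_injective j
    have h2 : U (Sum.inr j) - MvPowerSeries.C (X j) =
        G' * (pderiv _ (some (Sum.inr j)) (G - expEta σ)) +
          (-(G' * MvPowerSeries.C (X j))) * (G - expEta σ) := by
      rw [map_sub, h1]; simp only [U]
      linear_combination (MvPowerSeries.C (X j)) * hG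
    rw [h2]
    exact AddSubgroup.add_mem _ (hJ _ _ (hpd j _ hGE)) (hJ _ _ hGE)
  -- Induction on the `ξ`-degree. At `d = 0` there are no exponents to test; a bound for `U` below
  -- degree `d` gives one for `V` below degree `d + 1`, hence for `U` there too.
  have hreg : ∀ d : ℕ, (∀ k, V k ∈ Filt (fun γ => True ∧ xiDeg γ < d) wt (-1)) ∧
      ∀ i, U (Sum.inl i) ∈ Filt (fun γ => True ∧ xiDeg γ < d) wt 0 := by
    intro d
    have hPd : ∀ d : ℤ, ∀ a b : Par σ →₀ ℕ, (True ∧ xiDeg (a + b) < d) →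
        (True ∧ xiDeg a < d) ∧ (True ∧ xiDeg b < d) := fun d a b h =>
      ⟨⟨trivial, (xiDeg_lt_add d a b h.2).1⟩, ⟨trivial, (xiDeg_lt_add d a b h.2).2⟩⟩
    have hVU : ∀ d : ℤ, (∀ k, V k ∈ Filt (fun γ => True ∧ xiDeg γ < d) wt (-1)) →
        ∀ i, U (Sum.inl i) ∈ Filt (fun γ => True ∧ xiDeg γ < d) wt 0 := by
      intro d h i
      rw [hUa]
      exact S.conj_star_mem (hPd d) hG h (fun γ _ h => hareg i γ trivial h)
    induction d with
    | zero =>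
      have h : ∀ k, V k ∈ Filt (fun γ => True ∧ xiDeg γ < (0 : ℕ)) wt (-1) :=
        fun k γ h _ => absurd (xiDeg_nonneg γ) (by have := h.2; push_cast at this; omega)
      exact ⟨h, hVU _ h⟩
    | succ d ih =>
      have h : ∀ k, V k ∈ Filt (fun γ => True ∧ xiDeg γ < (d + 1 : ℕ)) wt (-1) := by
        intro k
        push_cast
        refine filt_of_pderiv (fun _ _ _ => ⟨trivial, trivial⟩) (fun i => ?_) ?_
        · rw [hUV]
          exact liftOp_mem_filt _ (ih.2 i)
        · intro γ hγ h
          have h1 := hV0 k γ trivial hγ.2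
          rw [map_sub, sub_eq_zero] at h1
          rw [h1]
          exact X_mem_filt (P := fun _ => True) _ γ trivial h
      exact ⟨h, hVU _ h⟩
  have hUl : ∀ i, U (Sum.inl i) ∈ Filt (fun _ => True) wt 0 := by
    intro i γ _ h
    exact (hreg (xiDeg γ).toNat.succ).2 i γ ⟨trivial, by
      have := xiDeg_nonneg γ; push_cast; omega⟩ h
  refine ⟨U, hUG, ?_⟩
  rintro (i | j)
  · exact hUl i
  -- The directions `η`: at `ξ = 0` the logarithmic derivative is `x_j`, of weight zero, and its
  -- `ξ_i`-derivative equals the `η_j`-derivative of the regular `U_{ξ_i}`.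
  · have h : ∀ d : ℤ, U (Sum.inr j) ∈ Filt (fun γ => True ∧ xiDeg γ < d + 1) wt 0 := by
      intro d
      refine filt_of_pderiv (fun _ _ _ => ⟨trivial, trivial⟩) (fun i => ?_) ?_
      · rw [hUU]
        intro γ _ h
        rw [coeff_pderiv, hUl i _ trivial, zero_mul]
        rw [wt_add, wt_single_some]; omega
      · intro γ hγ h
        have h1 := hU0 j γ trivial hγ.2
        rw [map_sub, sub_eq_zero] at h1
        rw [h1]
        exact C_mem_filt (P := fun _ => True) wt_zero.ge _ γ trivial h
    intro γ _ hγ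
    exact h (xiDeg γ) γ ⟨trivial, by omega⟩ hγ

end FormalStar

end StarFOI

end

noncomputable section

namespace StarFOI

open MvPowerSeries Finset.HasAntidiagonal

/-! ### Formal functionals and their Fourier transforms -/

section Functional

variable {ι : Type*}

/-- The coefficient of `ν ^ r` of a series in `ν` (the variable `none`) and `z`. -/
def comp (r : ℕ) : MvPowerSeries (Option ι) ℂ →ₗ[ℂ] MvPowerSeries ι ℂ where
  toFun h := fun β => coeff (β.optionElim r) h
  map_add' F G := by ext1 β; exact map_add (coeff (β.optionElim r)) F G
  map_smul' c G := by ext1 β; exact map_smul (coeff (β.optionElim r)) c G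

@[simp] theorem coeff_comp (r : ℕ) (h : MvPowerSeries (Option ι) ℂ) (β : ι →₀ ℕ) :
    coeff β (comp r h) = coeff (β.optionElim r) h := rfl

theorem optionElim_some_eq (γ : Option ι →₀ ℕ) : γ.some.optionElim (γ none) = γ := by
  ext t; rcases t with _ | a
  · rw [Finsupp.optionElim_apply_none]
  · rw [Finsupp.optionElim_apply_some, Finsupp.some_apply]

theorem optionElim_add_single_some (r : ℕ) (β : ι →₀ ℕ) (a : ι) :
    (β + Finsupp.single a 1).optionElim r = β.optionElim r + Finsupp.single (some a) 1 := by
  classical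
  ext t; rcases t with _ | b
  · simp
  · simp [Finsupp.single_apply]

theorem optionElim_succ (r : ℕ) (β : ι →₀ ℕ) :
    β.optionElim (r + 1) = β.optionElim r + Finsupp.single none 1 := by
  classical
  ext t; rcases t with _ | b
  · simp
  · simp

theorem degree_optionElim (r : ℕ) (β : ι →₀ ℕ) : (β.optionElim r).degree = β.degree + r := by
  classical
  induction β using Finsupp.induction_linear with
  | zero =>
    have : (0 : ι →₀ ℕ).optionElim r = Finsupp.single none r := by
      ext t; rcases t with _ | b
      · simp
      · simp
    rw [this]; simp
  | add f g hf hg =>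
    have h : (f + g).optionElim r + (0 : ι →₀ ℕ).optionElim r =
        f.optionElim r + g.optionElim r := by
      ext t; rcases t with _ | b
      · simp
      · simp
    have h0 : ((0 : ι →₀ ℕ).optionElim r).degree = r := by
      have : (0 : ι →₀ ℕ).optionElim r = Finsupp.single none r := by
        ext t; rcases t with _ | b
        · simp
        · simp
      rw [this]; simp
    have h1 := congrArg Finsupp.degree h
    rw [map_add, map_add, hf, hg, h0] at h1
    rw [map_add]; omega
  | single a b =>
    have : (Finsupp.single a b).optionElim r =
        Finsupp.single (some a) b + Finsupp.single none r := by
      ext t; rcases t with _ | c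
      · simp
      · simp [Finsupp.single_apply]
    rw [this]; simp

theorem coeff_X_mul_add_single {τ B : Type*} [CommRing B] (t : τ) (γ : τ →₀ ℕ)
    (h : MvPowerSeries τ B) : coeff (γ + Finsupp.single t 1) (X t * h) = coeff γ h := by
  rw [X_def, add_comm, coeff_add_monomial_mul, one_mul]

theorem coeff_X_mul_of_eq_zero {τ B : Type*} [CommRing B] {t : τ} {γ : τ →₀ ℕ} (hγ : γ t = 0)
    (h : MvPowerSeries τ B) : coeff γ (X t * h) = 0 := by
  classical
  rw [X_def, coeff_monomial_mul, if_neg]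
  rw [Finsupp.single_le_iff]; omega

theorem exists_eq_add_single {τ : Type*} {t : τ} {γ : τ →₀ ℕ} (hγ : γ t ≠ 0) :
    ∃ β, γ = β + Finsupp.single t 1 :=
  ⟨γ - Finsupp.single t 1, (tsub_add_cancel_of_le (by rw [Finsupp.single_le_iff]; omega)).symm⟩

theorem comp_X_some_mul (r : ℕ) (a : ι) (h : MvPowerSeries (Option ι) ℂ) :
    comp r (X (some a) * h) = X a * comp r h := by
  ext1 β
  rw [coeff_comp]
  by_cases hβ : β a = 0
  · rw [coeff_X_mul_of_eq_zero hβ, coeff_X_mul_of_eq_zero (by rwa [Finsupp.optionElim_apply_some])]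
  · obtain ⟨β, rfl⟩ := exists_eq_add_single hβ
    rw [optionElim_add_single_some, coeff_X_mul_add_single, coeff_X_mul_add_single, coeff_comp]

theorem comp_succ_X_none_mul (r : ℕ) (h : MvPowerSeries (Option ι) ℂ) :
    comp (r + 1) (X none * h) = comp r h := by
  ext1 β
  rw [coeff_comp, optionElim_succ, coeff_X_mul_add_single, coeff_comp]

theorem comp_zero_X_none_mul (h : MvPowerSeries (Option ι) ℂ) : comp 0 (X none * h) = 0 := by
  ext1 β
  rw [coeff_comp, coeff_X_mul_of_eq_zero (by rw [Finsupp.optionElim_apply_none]), map_zero]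

theorem comp_pderiv (r : ℕ) (a : ι) (h : MvPowerSeries (Option ι) ℂ) :
    comp r (pderiv ℂ (some a) h) = pderiv ℂ a (comp r h) := by
  ext1 β
  rw [coeff_comp, coeff_pderiv, coeff_pderiv, coeff_comp, optionElim_add_single_some,
    Finsupp.optionElim_apply_some]

/-- A series in `z`, seen as a series in `ν` and `z`. -/
def embZ (F : MvPowerSeries ι ℂ) : MvPowerSeries (Option ι) ℂ := fun γ =>
  if γ none = 0 then coeff γ.some F else 0

theorem coeff_embZ (F : MvPowerSeries ι ℂ) (γ : Option ι →₀ ℕ) :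
    coeff γ (embZ F) = if γ none = 0 then coeff γ.some F else 0 := rfl

theorem comp_mul_embZ (r : ℕ) (h : MvPowerSeries (Option ι) ℂ) (F : MvPowerSeries ι ℂ) :
    comp r (h * embZ F) = comp r h * F := by
  classical
  ext1 β
  rw [coeff_comp, coeff_mul, coeff_mul]
  symm
  refine Finset.sum_bij_ne_zero (fun p _ _ => (p.1.optionElim r, p.2.optionElim 0)) ?_ ?_ ?_ ?_
  · intro p hp _
    rw [mem_antidiagonal] at hp ⊢
    rw [← hp]
    ext t; rcases t with _ | b
    · simp
    · simp
  · intro p _ _ q _ _ h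
    simp only [Prod.mk.injEq] at h
    refine Prod.ext ?_ ?_
    · ext a
      have := congrArg (fun γ : Option ι →₀ ℕ => γ (some a)) h.1
      simpa [Finsupp.optionElim_apply_some] using this
    · ext a
      have := congrArg (fun γ : Option ι →₀ ℕ => γ (some a)) h.2
      simpa [Finsupp.optionElim_apply_some] using this
  · intro p hp h0
    rw [mem_antidiagonal] at hp
    have h1 : p.2 none = 0 := by
      by_contra hne
      exact h0 (by rw [coeff_embZ, if_neg hne, mul_zero])
    have h2 : p.1 none = r := by
      have := congrArg (fun γ : Option ι →₀ ℕ => γ none) hp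
      simpa [Finsupp.optionElim_apply_none, h1] using this
    have e1 : p.1.some.optionElim r = p.1 := by rw [← h2]; exact optionElim_some_eq _
    have e2 : p.2.some.optionElim 0 = p.2 := by rw [← h1]; exact optionElim_some_eq _
    refine ⟨(p.1.some, p.2.some), ?_, ?_, ?_⟩
    · rw [mem_antidiagonal]
      ext a
      have := congrArg (fun γ : Option ι →₀ ℕ => γ (some a)) hp
      simpa [Finsupp.optionElim_apply_some] using this
    · simp only [coeff_comp, e1]
      rwa [coeff_embZ, if_pos h1] at h0
    · simp only [e1, e2]
  · intro p _ _
    rw [coeff_comp, coeff_embZ, if_pos (Finsupp.optionElim_apply_none _ _)]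
    congr 3
    ext a
    rw [Finsupp.some_apply, Finsupp.optionElim_apply_some]

theorem pderiv_embZ (a : ι) (F : MvPowerSeries ι ℂ) :
    pderiv ℂ (some a) (embZ F) = embZ (pderiv ℂ a F) := by
  classical
  ext1 γ
  rw [coeff_pderiv, coeff_embZ, coeff_embZ, coeff_pderiv]
  have h1 : (γ + Finsupp.single (some a) 1 : Option ι →₀ ℕ) none = γ none := by simp
  have h2 : (γ + Finsupp.single (some a) 1).some = γ.some + Finsupp.single a 1 := by
    ext b; simp [Finsupp.single_apply]
  rw [h1, h2]
  split_ifs <;> simp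

/-- The `ν`-linear extension of a sequence of functionals to series in `ν` and `z`. -/
def extend (lam : ℕ → MvPowerSeries ι ℂ →ₗ[ℂ] ℂ) (p : ℕ) : MvPowerSeries (Option ι) ℂ →ₗ[ℂ] ℂ :=
  ∑ q ∈ antidiagonal p, lam q.1 ∘ₗ comp q.2

theorem extend_apply (lam : ℕ → MvPowerSeries ι ℂ →ₗ[ℂ] ℂ) (p : ℕ)
    (h : MvPowerSeries (Option ι) ℂ) :
    extend lam p h = ∑ q ∈ antidiagonal p, lam q.1 (comp q.2 h) := by
  simp [extend, LinearMap.sum_apply]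

theorem extend_succ_X_none_mul (lam : ℕ → MvPowerSeries ι ℂ →ₗ[ℂ] ℂ) (p : ℕ)
    (h : MvPowerSeries (Option ι) ℂ) : extend lam (p + 1) (X none * h) = extend lam p h := by
  rw [extend_apply, extend_apply, Finset.Nat.sum_antidiagonal_succ', comp_zero_X_none_mul,
    map_zero, zero_add]
  refine Finset.sum_congr rfl fun q _ => ?_
  rw [comp_succ_X_none_mul]

theorem extend_zero_X_none_mul (lam : ℕ → MvPowerSeries ι ℂ →ₗ[ℂ] ℂ)
    (h : MvPowerSeries (Option ι) ℂ) : extend lam 0 (X none * h) = 0 := by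
  rw [extend_apply, Finset.HasAntidiagonal.antidiagonal_zero, Finset.sum_singleton,
    comp_zero_X_none_mul, map_zero]

/-- The part of the monomial `γ` in the variables `z`. -/
def zmon (γ : Option ι →₀ ℕ) : MvPowerSeries (Option ι) ℂ := monomial (γ.some.optionElim 0) 1

theorem zmon_add_single (γ : Option ι →₀ ℕ) (a : ι) :
    zmon (γ + Finsupp.single (some a) 1) = X (some a) * zmon γ := by
  classical
  have h : (γ + Finsupp.single (some a) 1).some.optionElim 0 =
      Finsupp.single (some a) 1 + γ.some.optionElim 0 := by
    ext t; rcases t with _ | b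
    · simp
    · simp [Finsupp.single_apply, add_comm]
  rw [zmon, zmon, X_def, monomial_mul_monomial, one_mul, h]

theorem zmon_add_single_none (γ : Option ι →₀ ℕ) : zmon (γ + Finsupp.single none 1) = zmon γ := by
  rw [zmon, zmon]
  congr 2
  ext a; simp

theorem zmon_zero : zmon (0 : Option ι →₀ ℕ) = 1 := by
  rw [zmon]
  have : (0 : Option ι →₀ ℕ).some.optionElim 0 = 0 := by
    ext t; rcases t with _ | b
    · simp
    · simp
  rw [this, monomial_zero_one]

variable [Fintype ι]

/-- The product of the factorials of the exponents of `z`. -/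
def fct (γ : Option ι →₀ ℕ) : ℂ := ∏ a, ((γ (some a)).factorial : ℂ)

theorem fct_ne_zero (γ : Option ι →₀ ℕ) : fct γ ≠ 0 :=
  Finset.prod_ne_zero_iff.mpr fun a _ => by exact_mod_cast Nat.factorial_ne_zero _

theorem fct_add_single (γ : Option ι →₀ ℕ) (a : ι) :
    fct (γ + Finsupp.single (some a) 1) = (γ (some a) + 1) * fct γ := by
  classical
  rw [fct, fct, ← Finset.mul_prod_erase _ _ (Finset.mem_univ a),
    ← Finset.mul_prod_erase Finset.univ (fun a => ((γ (some a)).factorial : ℂ))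
      (Finset.mem_univ a), ← mul_assoc]
  congr 1
  · have : (γ + Finsupp.single (some a) 1 : Option ι →₀ ℕ) (some a) = γ (some a) + 1 := by simp
    rw [this, Nat.factorial_succ]; push_cast; ring
  · refine Finset.prod_congr rfl fun b hb => ?_
    have : (γ + Finsupp.single (some a) 1 : Option ι →₀ ℕ) (some b) = γ (some b) := by
      simp [(Finset.ne_of_mem_erase hb).symm]
    rw [this]

theorem fct_add_single_none (γ : Option ι →₀ ℕ) : fct (γ + Finsupp.single none 1) = fct γ := by
  refine Finset.prod_congr rfl fun b hb => ?_
  simp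

/-- The Fourier transform of the functional `F ↦ L (h F)`. -/
def hat (L : ℕ → MvPowerSeries (Option ι) ℂ →ₗ[ℂ] ℂ) :
    MvPowerSeries (Option ι) ℂ →ₗ[ℂ] MvPowerSeries (Option ι) ℂ where
  toFun h := fun γ => (fct γ)⁻¹ * L (γ none) (h * zmon γ)
  map_add' h h' := by
    ext1 γ
    change (fct γ)⁻¹ * L (γ none) ((h + h') * zmon γ) =
      (fct γ)⁻¹ * L (γ none) (h * zmon γ) + (fct γ)⁻¹ * L (γ none) (h' * zmon γ)
    rw [add_mul, map_add, mul_add]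
  map_smul' c h := by
    ext1 γ
    change (fct γ)⁻¹ * L (γ none) (c • h * zmon γ) = c * ((fct γ)⁻¹ * L (γ none) (h * zmon γ))
    rw [smul_mul_assoc, map_smul, smul_eq_mul]; ring

theorem coeff_hat (L : ℕ → MvPowerSeries (Option ι) ℂ →ₗ[ℂ] ℂ) (h : MvPowerSeries (Option ι) ℂ)
    (γ : Option ι →₀ ℕ) : coeff γ (hat L h) = (fct γ)⁻¹ * L (γ none) (h * zmon γ) := rfl

/-- The transform is formally `h ↦ L(h e^{ζz})`, whose derivative in `ζ_a` brings down a factor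
`z_a`; the factorials in `fct` account for the exponential. -/
theorem pderiv_hat (L : ℕ → MvPowerSeries (Option ι) ℂ →ₗ[ℂ] ℂ) (h : MvPowerSeries (Option ι) ℂ)
    (a : ι) : pderiv ℂ (some a) (hat L h) = hat L (X (some a) * h) := by
  ext1 γ
  rw [coeff_pderiv, coeff_hat, coeff_hat, fct_add_single, zmon_add_single]
  have h1 : (γ + Finsupp.single (some a) 1 : Option ι →₀ ℕ) none = γ none := by simp
  have h2 : (γ (some a) + 1 : ℂ) ≠ 0 := Nat.cast_add_one_ne_zero _
  rw [h1, mul_inv, mul_left_comm h, mul_assoc (X (some a)) h]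
  field_simp

theorem hat_X_none_mul (lam : ℕ → MvPowerSeries ι ℂ →ₗ[ℂ] ℂ) (h : MvPowerSeries (Option ι) ℂ) :
    hat (extend lam) (X none * h) = X none * hat (extend lam) h := by
  ext1 γ
  by_cases hγ : γ none = 0
  · rw [coeff_X_mul_of_eq_zero hγ, coeff_hat, hγ, mul_assoc, extend_zero_X_none_mul, mul_zero]
  · obtain ⟨γ, rfl⟩ := exists_eq_add_single hγ
    have : (γ + Finsupp.single none 1 : Option ι →₀ ℕ) none = γ none + 1 := by simp
    rw [coeff_X_mul_add_single, coeff_hat, coeff_hat, this, mul_assoc, extend_succ_X_none_mul,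
      fct_add_single_none, zmon_add_single_none]

end Functional

end StarFOI

end

noncomputable section

namespace StarFOI

open MvPowerSeries Finset.HasAntidiagonal

/-! ### Reconstruction of the phase -/

section Phase

variable {ι : Type*}

theorem filt_pderiv {τ : Type*} {w : (τ →₀ ℕ) → ℤ} (hw : ∀ a b, w (a + b) = w a + w b) {k : ℤ}
    {F : MvPowerSeries τ ℂ} (hF : F ∈ Filt (fun _ => True) w k) (t : τ) :
    pderiv ℂ t F ∈ Filt (fun _ => True) w (k - w (Finsupp.single t 1)) := by
  intro γ _ h
  rw [coeff_pderiv, hF _ trivial (by rw [hw]; omega), zero_mul]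

theorem monomial_mem_filt {τ : Type*} {w : (τ →₀ ℕ) → ℤ} {k : ℤ} {γ : τ →₀ ℕ} (h : k ≤ w γ)
    (c : ℂ) : (monomial γ c : MvPowerSeries τ ℂ) ∈ Filt (fun _ => True) w k := by
  classical
  intro β _ hβ
  rw [coeff_monomial, if_neg]
  rintro rfl
  omega

theorem filt_mul' {τ : Type*} {w : (τ →₀ ℕ) → ℤ} (hw : ∀ a b, w (a + b) = w a + w b) {k l m : ℤ}
    {f g : MvPowerSeries τ ℂ} (hf : f ∈ Filt (fun _ => True) w k)
    (hg : g ∈ Filt (fun _ => True) w l) (hm : m ≤ k + l) : f * g ∈ Filt (fun _ => True) w m :=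
  filt_mono hm (filt_mul (fun _ _ _ => ⟨trivial, trivial⟩) hw hf hg)

theorem filt_smul {τ : Type*} {w : (τ →₀ ℕ) → ℤ} {k : ℤ} {f : MvPowerSeries τ ℂ}
    (hf : f ∈ Filt (fun _ => True) w k) (c : ℂ) : c • f ∈ Filt (fun _ => True) w k := by
  intro γ _ h
  rw [coeff_smul, hf γ trivial h, mul_zero]

/-- A sequence of functionals on power series which has the order and the leading term of a
formal oscillatory integral. -/
structure IsPointFunctional (lam : ℕ → MvPowerSeries ι ℂ →ₗ[ℂ] ℂ) : Prop where
  zero : ∀ f, lam 0 f = constantCoeff f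
  order : ∀ (q : ℕ) (f), f ∈ orderGE ι (2 * q + 1 : ℕ) → lam q f = 0

variable {lam : ℕ → MvPowerSeries ι ℂ →ₗ[ℂ] ℂ}

theorem IsPointFunctional.extend_zero (H : IsPointFunctional lam)
    (h : MvPowerSeries (Option ι) ℂ) : extend lam 0 h = coeff 0 h := by
  rw [extend_apply, Finset.HasAntidiagonal.antidiagonal_zero, Finset.sum_singleton, H.zero,
    ← coeff_zero_eq_constantCoeff_apply, coeff_comp]
  congr 2
  ext t; rcases t with _ | a <;> simp

theorem comp_one (r : ℕ) : comp r (1 : MvPowerSeries (Option ι) ℂ) = if r = 0 then 1 else 0 := by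
  classical
  ext1 β
  rw [coeff_comp, coeff_one]
  have h : β.optionElim r = 0 ↔ r = 0 ∧ β = 0 := by
    constructor
    · intro h
      refine ⟨by simpa using congrArg (fun γ : Option ι →₀ ℕ => γ none) h, ?_⟩
      ext a
      simpa using congrArg (fun γ : Option ι →₀ ℕ => γ (some a)) h
    · rintro ⟨rfl, rfl⟩
      ext t; rcases t with _ | a <;> simp
  by_cases hr : r = 0
  · subst hr
    simp [h, coeff_one]
  · rw [if_neg hr, if_neg (fun h' => hr (h.mp h').1), map_zero]

variable [Fintype ι]

/-- The degree with `deg ν = 2` and `deg z = 1`. -/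
def srcDeg (γ : Option ι →₀ ℕ) : ℕ := 2 * γ none + ∑ a, γ (some a)

/-- The degree with `deg ν = 2` and `deg z = -1`. -/
def tgtDeg (γ : Option ι →₀ ℕ) : ℤ := wt γ + γ none

theorem tgtDeg_add (a b : Option ι →₀ ℕ) : tgtDeg (a + b) = tgtDeg a + tgtDeg b := by
  rw [tgtDeg, tgtDeg, tgtDeg, wt_add, Finsupp.add_apply]; push_cast; ring

theorem srcDeg_add (a b : Option ι →₀ ℕ) : srcDeg (a + b) = srcDeg a + srcDeg b := by
  simp only [srcDeg, Finsupp.add_apply, Finset.sum_add_distrib]; ring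

theorem srcDeg_single_some (a : ι) : srcDeg (Finsupp.single (some a) 1 : Option ι →₀ ℕ) = 1 := by
  classical
  simp [srcDeg, Finsupp.single_apply]

theorem srcDeg_single_none : srcDeg (Finsupp.single none 1 : Option ι →₀ ℕ) = 2 := by
  simp [srcDeg]

theorem tgtDeg_single_some (a : ι) : tgtDeg (Finsupp.single (some a) 1 : Option ι →₀ ℕ) = -1 := by
  rw [tgtDeg, wt_single_some]; simp

theorem tgtDeg_single_none : tgtDeg (Finsupp.single none 1 : Option ι →₀ ℕ) = 2 := by
  rw [tgtDeg, wt_single_none]; simp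

theorem wt_add_sum (γ : Option ι →₀ ℕ) : wt γ + ((∑ a, γ (some a) : ℕ) : ℤ) = γ none := by
  rw [wt]; push_cast; ring

theorem degree_option (γ : Option ι →₀ ℕ) : γ.degree = γ none + ∑ a, γ (some a) := by
  rw [Finsupp.degree_eq_sum, Fintype.sum_option]

theorem eq_zero_of_sum_eq_zero {γ : Option ι →₀ ℕ} (h : γ none = 0) (h' : ∑ a, γ (some a) = 0) :
    γ = 0 := by
  rw [Finset.sum_eq_zero_iff] at h'
  ext t; rcases t with _ | a
  · exact h
  · exact h' a (Finset.mem_univ a)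

variable (ι) in
/-- The series in `ν` and `z` of source degree at least `k`. -/
abbrev srcGE (k : ℤ) : AddSubgroup (MvPowerSeries (Option ι) ℂ) :=
  Filt (fun _ => True) (fun γ => (srcDeg γ : ℤ)) k

variable (ι) in
/-- The regular series in `ν` and `ζ` of target degree at least `k`. -/
abbrev tgtGE (k : ℤ) : AddSubgroup (MvPowerSeries (Option ι) ℂ) :=
  Filt (fun _ => True) wt 0 ⊓ Filt (fun _ => True) tgtDeg k

theorem srcDeg_add_cast (a b : Option ι →₀ ℕ) :
    ((srcDeg (a + b) : ℕ) : ℤ) = (srcDeg a : ℤ) + (srcDeg b : ℤ) := by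
  rw [srcDeg_add]; push_cast; rfl

theorem srcGE_zero (h : MvPowerSeries (Option ι) ℂ) : h ∈ srcGE ι 0 := by
  intro γ _ h
  simp only at h; omega

theorem srcGE_mul_left {k : ℤ} {f : MvPowerSeries (Option ι) ℂ} (h : MvPowerSeries (Option ι) ℂ)
    (hf : f ∈ srcGE ι k) : h * f ∈ srcGE ι k :=
  filt_mul' srcDeg_add_cast (srcGE_zero h) hf (by omega)

theorem srcGE_of_orderGE {k : ℤ} {f : MvPowerSeries (Option ι) ℂ} (hf : f ∈ orderGE (Option ι) k) :
    f ∈ srcGE ι k := by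
  intro γ _ h
  refine hf γ trivial ?_
  simp only [srcDeg] at h
  simp only [degree_option]
  push_cast at h ⊢; omega

theorem X_some_mem_srcGE (a : ι) : (X (some a) : MvPowerSeries (Option ι) ℂ) ∈ srcGE ι 1 :=
  srcGE_of_orderGE (X_mem_orderGE _)

theorem tgtGE_mono {k l : ℤ} (h : l ≤ k) {F : MvPowerSeries (Option ι) ℂ} (hF : F ∈ tgtGE ι k) :
    F ∈ tgtGE ι l := ⟨hF.1, filt_mono h hF.2⟩

theorem tgtGE_mul {k l m : ℤ} {F G : MvPowerSeries (Option ι) ℂ} (hF : F ∈ tgtGE ι k)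
    (hG : G ∈ tgtGE ι l) (hm : m ≤ k + l) : F * G ∈ tgtGE ι m :=
  ⟨filt_mul' wt_add hF.1 hG.1 (by omega), filt_mul' tgtDeg_add hF.2 hG.2 hm⟩

theorem tgtGE_smul {k : ℤ} {F : MvPowerSeries (Option ι) ℂ} (hF : F ∈ tgtGE ι k) (c : ℂ) :
    c • F ∈ tgtGE ι k := ⟨filt_smul hF.1 c, filt_smul hF.2 c⟩

theorem tgtGE_pderiv {k m : ℤ} {F : MvPowerSeries (Option ι) ℂ} (hF : F ∈ tgtGE ι k) (a : ι)
    (hm : m ≤ k + 1) : pderiv ℂ (some a) F ∈ tgtGE ι m := by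
  refine ⟨filt_mono ?_ (filt_pderiv wt_add hF.1 (some a)),
    filt_mono ?_ (filt_pderiv tgtDeg_add hF.2 (some a))⟩
  · rw [wt_single_some]; omega
  · rw [tgtDeg_single_some]; omega

theorem monomial_mem_tgtGE {k : ℤ} {γ : Option ι →₀ ℕ} (h0 : 0 ≤ wt γ) (h : k ≤ tgtDeg γ) (c : ℂ) :
    (monomial γ c : MvPowerSeries (Option ι) ℂ) ∈ tgtGE ι k :=
  ⟨monomial_mem_filt h0 c, monomial_mem_filt h c⟩

theorem X_none_mem_tgtGE : (X none : MvPowerSeries (Option ι) ℂ) ∈ tgtGE ι 2 := by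
  refine monomial_mem_tgtGE ?_ ?_ 1
  · rw [wt_single_none]; omega
  · rw [tgtDeg_single_none]

theorem comp_mem_orderGE {k : ℤ} {h : MvPowerSeries (Option ι) ℂ} (hh : h ∈ srcGE ι k) (r : ℕ) :
    comp r h ∈ orderGE ι (k - 2 * r) := by
  intro β _ hβ
  rw [coeff_comp]
  refine hh _ trivial ?_
  simp only at hβ
  have h1 := degree_optionElim r β
  rw [degree_option] at h1
  simp only [Finsupp.optionElim_apply_none] at h1
  simp only [srcDeg, Finsupp.optionElim_apply_none]
  zify at h1
  push_cast at h1 ⊢; omega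

theorem IsPointFunctional.extend_eq_zero (H : IsPointFunctional lam) {p : ℕ}
    {h : MvPowerSeries (Option ι) ℂ} (hh : h ∈ srcGE ι (2 * p + 1)) : extend lam p h = 0 := by
  rw [extend_apply]
  refine Finset.sum_eq_zero fun q hq => H.order _ _ ?_
  rw [mem_antidiagonal] at hq
  exact filt_mono (by push_cast; omega) (comp_mem_orderGE hh q.2)

/-- The coefficient at `ν^p ζ^β` involves `λ(h z^β)` at order `p`. A factor `z^β` raises the source
degree by `|β|`, and at order `p` everything of source degree above `2p` is killed; so the
coefficient vanishes when `2p - |β|` is below the source degree of `h`. -/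
theorem hat_coeff_eq_zero (H : IsPointFunctional lam) {k : ℤ} {h : MvPowerSeries (Option ι) ℂ}
    (hh : h ∈ srcGE ι k) : hat (extend lam) h ∈ Filt (fun _ => True) tgtDeg k := by
  intro γ _ hγ
  rw [coeff_hat, H.extend_eq_zero, mul_zero]
  have h1 : zmon γ ∈ srcGE ι (γ none - wt γ) := by
    refine monomial_mem_filt ?_ 1
    have h2 := wt_add_sum γ
    simp only [srcDeg, Finsupp.optionElim_apply_none, Finsupp.optionElim_apply_some,
      Finsupp.some_apply]
    push_cast at h2 ⊢; omega
  refine filt_mul' srcDeg_add_cast hh h1 ?_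
  rw [tgtDeg] at hγ
  omega

theorem coeff_zero_hat_one (H : IsPointFunctional lam) : coeff 0 (hat (extend lam) 1) = 1 := by
  rw [coeff_hat, zmon_zero, Finsupp.zero_apply, H.extend_zero]
  simp [fct]

/-- `λ_0` is evaluation at the origin, so the part of the transform without `ν` is constant in `ζ`.
-/
theorem coeff_hat_of_none (H : IsPointFunctional lam) {γ : Option ι →₀ ℕ} (h0 : γ none = 0)
    (h : MvPowerSeries (Option ι) ℂ) (hγ : γ ≠ 0) : coeff γ (hat (extend lam) h) = 0 := by
  classical
  rw [coeff_hat, h0, H.extend_zero, zmon, ← h0, optionElim_some_eq, coeff_mul_monomial, if_neg,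
    mul_zero]
  intro h
  exact hγ (le_antisymm h zero_le)

variable {u : ι → MvPowerSeries (Option ι) ℂ}

/-- The only regular exponent of target degree below `1` is zero, and the constant term of `u_a` is
the coefficient of `ζ_a` in the transform of `1`, which has no `ν` and therefore vanishes. -/
theorem logDeriv_mem_tgtGE (H : IsPointFunctional lam)
    (hu : ∀ a, pderiv ℂ (some a) (hat (extend lam) 1) = u a * hat (extend lam) 1)
    (hr : ∀ a, u a ∈ Filt (fun _ => True) wt 0) (a : ι) : u a ∈ tgtGE ι 1 := by
  refine ⟨hr a, fun γ _ hγ => ?_⟩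
  by_cases h0 : wt γ < 0
  · exact hr a γ trivial h0
  have h1 := wt_add_sum γ
  have h2 : γ = 0 := by
    rw [tgtDeg] at hγ
    apply eq_zero_of_sum_eq_zero <;> omega
  subst h2
  have h3 := congrArg (coeff 0) (hu a)
  rw [coeff_zero_eq_constantCoeff_apply, coeff_zero_eq_constantCoeff_apply, map_mul,
    ← coeff_zero_eq_constantCoeff_apply, ← coeff_zero_eq_constantCoeff_apply,
    ← coeff_zero_eq_constantCoeff_apply, coeff_zero_hat_one H, mul_one, coeff_pderiv,
    coeff_hat_of_none H (by simp) _ (by simp)] at h3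
  rw [← h3, zero_mul]

/-- The regular exponents of target degree exactly `1` are `ν ζ_c`. Comparing coefficients in `∂_a
hat 1 = u_a hat 1` identifies that part of `u_a` with the second moments. -/
theorem logDeriv_sub_mem_tgtGE (H : IsPointFunctional lam)
    (hu : ∀ a, pderiv ℂ (some a) (hat (extend lam) 1) = u a * hat (extend lam) 1)
    (hr : ∀ a, u a ∈ Filt (fun _ => True) wt 0) (a : ι) :
    u a - ∑ c, lam 1 (X a * X c) • monomial (Finsupp.single none 1 + Finsupp.single (some c) 1) 1
      ∈ tgtGE ι 2 := by
  classical
  have hu1 := logDeriv_mem_tgtGE H hu hr a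
  have hm : ∀ c : ι, (monomial (Finsupp.single none 1 + Finsupp.single (some c) 1) 1 :
      MvPowerSeries (Option ι) ℂ) ∈ tgtGE ι 1 := by
    intro c
    refine monomial_mem_tgtGE ?_ ?_ 1
    · rw [wt_add, wt_single_none, wt_single_some]; omega
    · rw [tgtDeg_add, tgtDeg_single_none, tgtDeg_single_some]; omega
  have h1 : u a - ∑ c, lam 1 (X a * X c) •
      monomial (Finsupp.single none 1 + Finsupp.single (some c) 1) 1 ∈ tgtGE ι 1 :=
    AddSubgroup.sub_mem _ hu1 (AddSubgroup.sum_mem _ fun c _ => tgtGE_smul (hm c) _)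
  refine ⟨h1.1, fun γ _ hγ => ?_⟩
  by_cases h0 : wt γ < 0
  · exact h1.1 γ trivial h0
  by_cases h2 : tgtDeg γ < 1
  · exact h1.2 γ trivial h2
  have h3 := wt_add_sum γ
  rw [tgtDeg] at hγ h2
  have hs : ∑ c, γ (some c) = 1 ∨ (∑ c, γ (some c) = 0 ∧ wt γ = 1 ∧ γ none = 1) := by omega
  rcases hs with hs | ⟨hs, hw, hn⟩
  swap
  · omega
  have hn : γ none = 1 := by omega
  obtain ⟨c, hc⟩ : ∃ c, γ (some c) ≠ 0 := by
    by_contra! hne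
    rw [Finset.sum_eq_zero (fun c _ => hne c)] at hs
    omega
  obtain ⟨β, rfl⟩ := exists_eq_add_single hc
  have hβ : β = Finsupp.single none 1 := by
    have e1 : β none = 1 := by simpa using hn
    have e2 : ∑ c, β (some c) = 0 := by
      simp only [Finsupp.add_apply, Finset.sum_add_distrib, Finsupp.single_apply,
        Option.some.injEq, Finset.sum_ite_eq, Finset.mem_univ, if_true] at hs
      omega
    rw [Finset.sum_eq_zero_iff] at e2
    ext t; rcases t with _ | b
    · simpa using e1
    · simpa using e2 b (Finset.mem_univ b)
  subst hβ
  rw [map_sub, map_sum, Finset.sum_eq_single c]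
  rotate_left
  · intro b _ hb
    rw [coeff_smul, coeff_monomial, if_neg, mul_zero]
    intro h
    have := congrArg (fun γ : Option ι →₀ ℕ => γ (some b)) h
    simp [hb] at this
  · intro h; exact absurd (Finset.mem_univ c) h
  rw [coeff_smul, coeff_monomial_same, mul_one, sub_eq_zero]
  have h4 := congrArg (coeff (Finsupp.single none 1 + Finsupp.single (some c) 1)) (hu a)
  -- Every monomial of `u_a` already uses the single available `ν`, so its cofactor comes from the
  -- part of the transform without `ν`, which is constant.
  rw [pderiv_hat, mul_one, coeff_mul, Finset.sum_eq_single
    ((Finsupp.single none 1 + Finsupp.single (some c) 1 : Option ι →₀ ℕ), 0)] at h4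
  rotate_left
  · rintro ⟨p, q⟩ hpq hne
    rw [mem_antidiagonal] at hpq
    simp only at hpq ⊢
    by_cases hwp : wt p < 0
    · rw [hr a p trivial hwp, zero_mul]
    by_cases hp1 : tgtDeg p < 1
    · rw [hu1.2 p trivial hp1, zero_mul]
    have hq : q ≠ 0 := by
      rintro rfl
      exact hne (by rw [← hpq, add_zero])
    have hq0 : q none = 0 := by
      have e := congrArg (fun γ : Option ι →₀ ℕ => γ none) hpq
      have e' := wt_add_sum p
      simp at e
      rw [tgtDeg] at hp1
      omega
    rw [coeff_hat_of_none H hq0 _ hq, mul_zero]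
  · intro h; exact absurd (mem_antidiagonal.mpr (by simp)) h
  rw [coeff_zero_hat_one H, mul_one] at h4
  rw [← h4, coeff_hat]
  have e1 : fct (Finsupp.single none 1 + Finsupp.single (some c) 1 : Option ι →₀ ℕ) = 1 := by
    rw [fct_add_single]; simp [fct]
  have e2 : zmon (Finsupp.single none 1 + Finsupp.single (some c) 1 : Option ι →₀ ℕ) =
      X (some c) := by
    rw [zmon_add_single]
    have := zmon_add_single_none (0 : Option ι →₀ ℕ)
    rw [zero_add] at this
    rw [this, zmon_zero, mul_one]
  have e3 : (Finsupp.single none 1 + Finsupp.single (some c) 1 : Option ι →₀ ℕ) none = 1 := by simp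
  rw [e1, e2, e3, extend_apply, Finset.Nat.sum_antidiagonal_succ']
  simp only [Finset.HasAntidiagonal.antidiagonal_zero, Finset.sum_singleton]
  have e4 : ∀ r, comp r (X (some a) * X (some c)) = X a * (X c * comp r 1) := by
    intro r
    rw [← mul_one (X (some c)), comp_X_some_mul, comp_X_some_mul]
  simp [e4, comp_one]

end Phase

end StarFOI

end

noncomputable section

namespace StarFOI

open MvPowerSeries Finset.HasAntidiagonal

/-! ### The conjugated Fourier transform as a filtered map onto regular series -/

section Phase

variable {ι : Type*} [Fintype ι] {lam : ℕ → MvPowerSeries ι ℂ →ₗ[ℂ] ℂ}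
  {u : ι → MvPowerSeries (Option ι) ℂ} {G' : MvPowerSeries (Option ι) ℂ}

/-- Write the transform of `h` as `hat 1` times the conjugated transform and apply Leibniz: the
derivative in `ζ_a` becomes `∂_a + u_a` after division by `hat 1`. -/
theorem mul_hat_X_some (hG : G' * hat (extend lam) 1 = 1)
    (hu : ∀ a, pderiv ℂ (some a) (hat (extend lam) 1) = u a * hat (extend lam) 1) (a : ι)
    (h : MvPowerSeries (Option ι) ℂ) : G' * hat (extend lam) (X (some a) * h) =
      pderiv ℂ (some a) (G' * hat (extend lam) h) + u a * (G' * hat (extend lam) h) := by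
  have h1 : hat (extend lam) h = hat (extend lam) 1 * (G' * hat (extend lam) h) := by
    rw [← mul_assoc, mul_comm (hat (extend lam) 1), hG, one_mul]
  rw [← pderiv_hat]
  nth_rewrite 1 [h1]
  rw [Derivation.leibniz, hu, smul_eq_mul, smul_eq_mul, mul_add, ← mul_assoc, hG, one_mul]
  congr 1
  linear_combination (u a * (G' * hat (extend lam) h)) * hG

theorem monomial_zero_eq_smul {τ : Type*} (c : ℂ) :
    (monomial 0 c : MvPowerSeries τ ℂ) = c • 1 := by
  rw [← monomial_zero_one, ← map_smul, smul_eq_mul, mul_one]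

theorem monomial_add_single {τ : Type*} (γ : τ →₀ ℕ) (t : τ) (c : ℂ) :
    (monomial (γ + Finsupp.single t 1) c : MvPowerSeries τ ℂ) = X t * monomial γ c := by
  rw [X_def, monomial_mul_monomial, one_mul, add_comm]

/-- Each `z_a` acts as `∂_a + u_a`, and both summands raise the target degree by at least one, since
`ζ_a` has degree `-1`; each `ν` raises it by two. All these operations preserve regularity. -/
theorem mul_hat_monomial_mem (H : IsPointFunctional lam) (hG : G' * hat (extend lam) 1 = 1)
    (hu : ∀ a, pderiv ℂ (some a) (hat (extend lam) 1) = u a * hat (extend lam) 1)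
    (hr : ∀ a, u a ∈ Filt (fun _ => True) wt 0) (γ : Option ι →₀ ℕ) (c : ℂ) :
    G' * hat (extend lam) (monomial γ c) ∈ tgtGE ι (srcDeg γ) := by
  induction n : γ.degree generalizing γ with
  | zero =>
    rw [Finsupp.degree_eq_zero_iff] at n
    subst n
    rw [monomial_zero_eq_smul, map_smul, mul_smul_comm, hG]
    refine tgtGE_smul ?_ c
    rw [← monomial_zero_one]
    exact monomial_mem_tgtGE (by rw [wt_zero]) (by simp [tgtDeg, wt_zero, srcDeg]) 1
  | succ n ih =>
    have hne : γ ≠ 0 := by rintro rfl; simp at n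
    obtain ⟨t, ht⟩ := Finsupp.ne_iff.mp hne
    obtain ⟨β, rfl⟩ := exists_eq_add_single ht
    have hβ := ih β (by rw [map_add, Finsupp.degree_single] at n; omega)
    rw [monomial_add_single]
    rcases t with _ | a
    · rw [hat_X_none_mul, mul_left_comm]
      refine tgtGE_mul X_none_mem_tgtGE hβ ?_
      rw [srcDeg_add, srcDeg_single_none]; push_cast; omega
    · rw [mul_hat_X_some hG hu]
      refine AddSubgroup.add_mem _ (tgtGE_pderiv hβ a ?_)
        (tgtGE_mul (logDeriv_mem_tgtGE H hu hr a) hβ ?_) <;>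
      · rw [srcDeg_add, srcDeg_single_some]; push_cast; omega

theorem mul_hat_coe_mem (H : IsPointFunctional lam) (hG : G' * hat (extend lam) 1 = 1)
    (hu : ∀ a, pderiv ℂ (some a) (hat (extend lam) 1) = u a * hat (extend lam) 1)
    (hr : ∀ a, u a ∈ Filt (fun _ => True) wt 0) {D : ℤ} (p : MvPolynomial (Option ι) ℂ)
    (hp : (p : MvPowerSeries (Option ι) ℂ) ∈ srcGE ι D) :
    G' * hat (extend lam) (p : MvPowerSeries (Option ι) ℂ) ∈ tgtGE ι D := by
  have h1 : (p : MvPowerSeries (Option ι) ℂ) = ∑ γ ∈ p.support, monomial γ (p.coeff γ) := by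
    conv_lhs => rw [p.as_sum]
    rw [← MvPolynomial.coeToMvPowerSeries.ringHom_apply, map_sum]
    simp
  rw [h1, map_sum, Finset.mul_sum]
  refine AddSubgroup.sum_mem _ fun γ hγ => ?_
  refine tgtGE_mono ?_ (mul_hat_monomial_mem H hG hu hr γ _)
  by_contra hlt
  have := hp γ trivial (by simp only; omega)
  rw [MvPolynomial.coeff_coe] at this
  exact MvPolynomial.mem_support_iff.mp hγ this

/-- Continuity in the `ν`-adic sense: for an arbitrary cofactor, large source degree forces a large
power of `ν`, because the target degree is at most twice the exponent of `ν`. This reduces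
statements about series to polynomial truncations. -/
theorem mul_hat_mem_none (H : IsPointFunctional lam) (G' : MvPowerSeries (Option ι) ℂ) {k : ℤ}
    {h : MvPowerSeries (Option ι) ℂ} (hh : h ∈ srcGE ι (2 * k)) :
    G' * hat (extend lam) h ∈ Filt (fun _ => True) (fun γ => (γ none : ℤ)) k := by
  have h1 : hat (extend lam) h ∈ Filt (fun _ => True) (fun γ => (γ none : ℤ)) k := by
    intro γ _ hγ
    refine hat_coeff_eq_zero H hh γ trivial ?_
    have := wt_add_sum γ
    simp only at hγ
    rw [tgtDeg]; omega
  refine filt_mul' (fun a b => by simp) (k := 0) ?_ h1 (by omega)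
  intro γ _ h
  simp only at h; omega

theorem truncTotal_mem_filt {τ : Type*} [Fintype τ] {w : (τ →₀ ℕ) → ℤ} {k : ℤ}
    {h : MvPowerSeries τ ℂ} (hh : h ∈ Filt (fun _ => True) w k) (n : ℕ) :
    (h.truncTotal n : MvPowerSeries τ ℂ) ∈ Filt (fun _ => True) w k := by
  intro γ _ hγ
  rw [MvPolynomial.coeff_coe]
  by_cases hn : γ.degree < n
  · rw [coeff_truncTotal _ hn, hh γ trivial hγ]
  · exact coeff_truncTotal_eq_zero _ (by omega)

theorem mul_hat_mem (H : IsPointFunctional lam) (hG : G' * hat (extend lam) 1 = 1)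
    (hu : ∀ a, pderiv ℂ (some a) (hat (extend lam) 1) = u a * hat (extend lam) 1)
    (hr : ∀ a, u a ∈ Filt (fun _ => True) wt 0) {D : ℤ} {h : MvPowerSeries (Option ι) ℂ}
    (hh : h ∈ srcGE ι D) : G' * hat (extend lam) h ∈ tgtGE ι D := by
  have key : ∀ γ : Option ι →₀ ℕ, ∃ p ∈ tgtGE ι D,
      coeff γ (G' * hat (extend lam) h) = coeff γ p := by
    intro γ
    let n := 2 * (γ none + 1)
    refine ⟨_, mul_hat_coe_mem H hG hu hr (h.truncTotal n) (truncTotal_mem_filt hh n), ?_⟩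
    have h1 := mul_hat_mem_none H G' (k := γ none + 1)
      (h := h - (h.truncTotal n : MvPowerSeries (Option ι) ℂ))
      (filt_mono (by simp only [n]; push_cast; omega)
        (srcGE_of_orderGE (sub_truncTotal_mem_orderGE n h))) γ trivial (by simp only; omega)
    rw [map_sub, mul_sub, map_sub, sub_eq_zero] at h1
    exact h1
  refine ⟨fun γ _ hγ => ?_, fun γ _ hγ => ?_⟩
  · obtain ⟨p, hp, h⟩ := key γ
    rw [h, hp.1 γ trivial hγ]
  · obtain ⟨p, hp, h⟩ := key γ
    rw [h, hp.2 γ trivial hγ]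

theorem pderiv_monomial_eq {τ : Type*} (γ : τ →₀ ℕ) (t : τ) (c : ℂ) :
    pderiv ℂ t (monomial (γ + Finsupp.single t 1) c : MvPowerSeries τ ℂ) =
      monomial γ (c * (γ t + 1)) := by
  classical
  ext1 β
  rw [coeff_pderiv, coeff_monomial, coeff_monomial]
  by_cases h : β = γ
  · subst h; simp
  · rw [if_neg h, if_neg (fun h' => h (add_right_cancel h')), zero_mul]

theorem pderiv_monomial_of_eq_zero {τ : Type*} {γ : τ →₀ ℕ} {t : τ} (h : γ t = 0) (c : ℂ) :
    pderiv ℂ t (monomial γ c : MvPowerSeries τ ℂ) = 0 := by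
  classical
  ext1 β
  rw [coeff_pderiv, coeff_monomial, if_neg, zero_mul, map_zero]
  rintro rfl
  simp at h

/-- Induction on the degree in `ζ`. In leading order `z_b` acts as `∂_b + ν ∑ λ_1(z_b z_d) ζ_d`;
regularity guarantees a `ν` next to every `ζ_a`, and inverting the moment matrix isolates `ν ζ_a`.
The terms from `∂_b` have smaller degree in `ζ` and are removed by the induction hypothesis. -/
theorem exists_leading_preimage [DecidableEq ι] (H : IsPointFunctional lam) (hG : G' * hat (extend lam) 1 = 1)
    (hu : ∀ a, pderiv ℂ (some a) (hat (extend lam) 1) = u a * hat (extend lam) 1)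
    (hr : ∀ a, u a ∈ Filt (fun _ => True) wt 0) {B' : ι → ι → ℂ}
    (hB : ∀ a c, ∑ b, B' a b * lam 1 (X b * X c) = if a = c then 1 else 0)
    (m : ℕ) (γ : Option ι →₀ ℕ) (hm : ∑ a, γ (some a) = m) (h0 : 0 ≤ wt γ) (c : ℂ) :
    ∃ h ∈ srcGE ι (tgtDeg γ),
      G' * hat (extend lam) h - monomial γ c ∈ tgtGE ι (tgtDeg γ + 1) := by
  induction m using Nat.strong_induction_on generalizing γ c with
  | _ m ih =>
  rcases Nat.eq_zero_or_pos m with rfl | hpos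
  -- Without `ζ` the monomial is a power of `ν`, which is its own preimage by `ν`-linearity.
  · have h1 : ∀ n : ℕ, ∀ c : ℂ, hat (extend lam) (monomial (Finsupp.single none n) c) =
        monomial (Finsupp.single none n) c * hat (extend lam) 1 := by
      intro n c
      induction n with
      | zero =>
        rw [Finsupp.single_zero, monomial_zero_eq_smul, map_smul, smul_mul_assoc, one_mul]
      | succ n ih =>
        rw [Finsupp.single_add, monomial_add_single, hat_X_none_mul, ih, mul_assoc]
    have h2 : γ = Finsupp.single none (γ none) := by
      rw [Finset.sum_eq_zero_iff] at hm
      ext t; rcases t with _ | b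
      · simp
      · simpa using hm b (Finset.mem_univ b)
    refine ⟨monomial γ c, monomial_mem_filt ?_ c, ?_⟩
    · have := wt_add_sum γ
      rw [hm] at this
      simp only [tgtDeg, srcDeg, hm]
      push_cast at this ⊢; omega
    · have h3 : G' * hat (extend lam) (monomial γ c) = monomial γ c := by
        rw [h2, h1, mul_left_comm, hG, mul_one]
      rw [h3, sub_self]
      exact AddSubgroup.zero_mem _
  · obtain ⟨a, ha⟩ : ∃ a, γ (some a) ≠ 0 := by
      by_contra! hne
      rw [Finset.sum_eq_zero (fun c _ => hne c)] at hm
      omega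
    have hn : γ none ≠ 0 := by
      have := wt_add_sum γ
      rw [hm] at this; omega
    obtain ⟨β, rfl⟩ := exists_eq_add_single ha
    have hn' : β none ≠ 0 := by simpa using hn
    obtain ⟨δ, rfl⟩ := exists_eq_add_single hn'
    have hδ : ∑ a, δ (some a) + 1 = m := by
      rw [← hm]
      simp [Finset.sum_add_distrib, Finsupp.single_apply]
    have hw : wt (δ + Finsupp.single none 1 + Finsupp.single (some a) 1) = wt δ := by
      rw [wt_add, wt_add, wt_single_none, wt_single_some]; push_cast; omega
    have ht : tgtDeg (δ + Finsupp.single none 1 + Finsupp.single (some a) 1) = tgtDeg δ + 1 := by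
      rw [tgtDeg_add, tgtDeg_add, tgtDeg_single_none, tgtDeg_single_some]; omega
    rw [hw] at h0
    rw [ht]
    obtain ⟨h', hh', e'⟩ := ih _ (by omega) δ rfl h0 c
    -- The unwanted term `∂_b` of the remaining monomial has two fewer variables `ζ` than the target
    -- monomial and the same target degree, so it has a preimage already.
    have hpd : ∀ b, ∃ k ∈ srcGE ι (tgtDeg δ + 1), G' * hat (extend lam) k -
        pderiv ℂ (some b) (monomial δ c) ∈ tgtGE ι (tgtDeg δ + 1 + 1) := by
      intro b
      by_cases hb : δ (some b) = 0
      · refine ⟨0, AddSubgroup.zero_mem _, ?_⟩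
        rw [pderiv_monomial_of_eq_zero hb, map_zero, mul_zero, sub_zero]
        exact AddSubgroup.zero_mem _
      · obtain ⟨ε, rfl⟩ := exists_eq_add_single hb
        have hε : ∑ a, ε (some a) + 2 = m := by
          rw [← hδ]
          simp [Finset.sum_add_distrib, Finsupp.single_apply]
        rw [pderiv_monomial_eq]
        rw [wt_add, wt_single_some] at h0
        have h3 : tgtDeg (ε + Finsupp.single (some b) 1) + 1 = tgtDeg ε := by
          rw [tgtDeg_add, tgtDeg_single_some]; omega
        rw [h3]
        exact ih _ (by omega) ε rfl (by omega) _
    choose k hk ek using hpd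
    -- Multiplying the preimage of the smaller monomial by `z_b` and subtracting the preimage of its
    -- derivative leaves row `b` of the moment matrix; the row `a` of its inverse selects `ν ζ_a`.
    refine ⟨∑ b, B' a b • (X (some b) * h' - k b), ?_, ?_⟩
    · refine AddSubgroup.sum_mem _ fun b _ => filt_smul (AddSubgroup.sub_mem _ ?_ (hk b)) _
      exact filt_mul' srcDeg_add_cast (X_some_mem_srcGE b) hh' (by omega)
    · have hb : ∀ b, G' * hat (extend lam) (X (some b) * h' - k b) -
          ∑ d, lam 1 (X b * X d) •
            monomial (δ + Finsupp.single none 1 + Finsupp.single (some d) 1) c ∈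
          tgtGE ι (tgtDeg δ + 1 + 1) := by
        intro b
        have hm1 : ∀ d, (monomial (δ + Finsupp.single none 1 + Finsupp.single (some d) 1) c :
            MvPowerSeries (Option ι) ℂ) =
            monomial (Finsupp.single none 1 + Finsupp.single (some d) 1) 1 * monomial δ c := by
          intro d
          rw [monomial_mul_monomial, one_mul]
          congr 2
          abel
        have hsplit : G' * hat (extend lam) (X (some b) * h' - k b) -
          ∑ d, lam 1 (X b * X d) •
            monomial (δ + Finsupp.single none 1 + Finsupp.single (some d) 1) c =
          pderiv ℂ (some b) (G' * hat (extend lam) h' - monomial δ c) +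
          u b * (G' * hat (extend lam) h' - monomial δ c) +
          (u b - ∑ d, lam 1 (X b * X d) •
            monomial (Finsupp.single none 1 + Finsupp.single (some d) 1) 1) * monomial δ c -
          (G' * hat (extend lam) (k b) - pderiv ℂ (some b) (monomial δ c)) := by
          simp only [hm1, map_sub, mul_sub, mul_hat_X_some hG hu, sub_mul, Finset.sum_mul,
            smul_mul_assoc]
          ring
        rw [hsplit]
        have hmon : (monomial δ c : MvPowerSeries (Option ι) ℂ) ∈ tgtGE ι (tgtDeg δ) :=
          monomial_mem_tgtGE h0 le_rfl c
        refine AddSubgroup.sub_mem _ (AddSubgroup.add_mem _ (AddSubgroup.add_mem _ ?_ ?_) ?_) (ek b)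
        · exact tgtGE_pderiv e' b le_rfl
        · exact tgtGE_mul (logDeriv_mem_tgtGE H hu hr b) e' (by omega)
        · exact tgtGE_mul (logDeriv_sub_mem_tgtGE H hu hr b) hmon (by omega)
      have hfin : G' * hat (extend lam) (∑ b, B' a b • (X (some b) * h' - k b)) -
          monomial (δ + Finsupp.single none 1 + Finsupp.single (some a) 1) c =
          ∑ b, B' a b • (G' * hat (extend lam) (X (some b) * h' - k b) -
          ∑ d, lam 1 (X b * X d) •
            monomial (δ + Finsupp.single none 1 + Finsupp.single (some d) 1) c) := by
        rw [map_sum, Finset.mul_sum]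
        simp only [map_smul, mul_smul_comm]
        simp only [smul_sub (B' a _) (G' * _), Finset.sum_sub_distrib]
        congr 1
        simp only [Finset.smul_sum, smul_smul]
        rw [Finset.sum_comm]
        simp only [← Finset.sum_smul, hB]
        simp
      rw [hfin]
      exact AddSubgroup.sum_mem _ fun b _ => tgtGE_smul (hb b) _

end Phase

end StarFOI

end

noncomputable section

namespace StarFOI

open MvPowerSeries Finset.HasAntidiagonal

/-! ### Annihilators, closedness and integration of the phase -/

section Phase

variable {ι : Type*} {lam : ℕ → MvPowerSeries ι ℂ →ₗ[ℂ] ℂ}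

theorem monomial_eq_pow_mul (γ : Option ι →₀ ℕ) :
    (monomial γ 1 : MvPowerSeries (Option ι) ℂ) = X none ^ γ none * zmon γ := by
  rw [X_pow_eq, zmon, monomial_mul_monomial, one_mul]
  congr 2
  ext t; rcases t with _ | a <;> simp

theorem pderiv_X_none_mul (a : ι) (F : MvPowerSeries (Option ι) ℂ) :
    pderiv ℂ (some a) (X none * F) = X none * pderiv ℂ (some a) F := by
  rw [Derivation.leibniz, pderiv_X_of_ne (by simp), smul_zero, add_zero, smul_eq_mul]

theorem pderiv_X_none_pow_mul (a : ι) (n : ℕ) (F : MvPowerSeries (Option ι) ℂ) :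
    pderiv ℂ (some a) (X none ^ n * F) = X none ^ n * pderiv ℂ (some a) F := by
  induction n with
  | zero => simp
  | succ n ih => rw [pow_succ', mul_assoc, pderiv_X_none_mul, ih, mul_assoc]

/-- The annihilator of a formal functional vanishes. -/
theorem eq_zero_of_extend_mul (H : IsPointFunctional lam) {h : ι → MvPowerSeries (Option ι) ℂ}
    (hh : ∀ a p F, extend lam p (h a * F) = extend lam p (X none * pderiv ℂ (some a) F))
    {k : MvPowerSeries (Option ι) ℂ} (hk : ∀ p F, extend lam p (k * F) = 0) : k = 0 := by
  -- The annihilator is stable under `∂_a`: insert `k F` in the identity for `h_a` and use that `k`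
  -- annihilates both `h_a F` and `∂_a F`.
  have hd : ∀ k : MvPowerSeries (Option ι) ℂ, (∀ p F, extend lam p (k * F) = 0) →
      ∀ a p F, extend lam p (pderiv ℂ (some a) k * F) = 0 := by
    intro k hk a p F
    have h1 := hh a (p + 1) (k * F)
    rw [mul_left_comm, hk, Derivation.leibniz, smul_eq_mul, smul_eq_mul, extend_succ_X_none_mul,
      map_add, hk, zero_add, mul_comm] at h1
    exact h1.symm
  have h0 : ∀ (n : ℕ) (γ : Option ι →₀ ℕ), γ.degree = n → γ none = 0 →
      ∀ k : MvPowerSeries (Option ι) ℂ, (∀ p F, extend lam p (k * F) = 0) → coeff γ k = 0 := by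
    intro n
    induction n with
    | zero =>
      intro γ hγ _ k hk
      rw [Finsupp.degree_eq_zero_iff] at hγ
      subst hγ
      rw [← H.extend_zero, ← mul_one k, hk]
    | succ n ih =>
      intro γ hγ hn k hk
      have hne : γ ≠ 0 := by rintro rfl; simp at hγ
      obtain ⟨t, ht⟩ := Finsupp.ne_iff.mp hne
      obtain ⟨β, rfl⟩ := exists_eq_add_single ht
      rcases t with _ | a
      · simp at hn
      · have h1 := ih β (by rw [map_add, Finsupp.degree_single] at hγ; omega) (by simpa using hn)
          _ (hd k hk a)
        rw [coeff_pderiv] at h1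
        exact (mul_eq_zero.mp h1).resolve_right (Nat.cast_add_one_ne_zero _)
  -- Once all coefficients without `ν` vanish, `k` is divisible by `ν`, and the quotient is again an
  -- annihilator.
  have h1 : ∀ (n : ℕ) (γ : Option ι →₀ ℕ), γ none = n →
      ∀ k : MvPowerSeries (Option ι) ℂ, (∀ p F, extend lam p (k * F) = 0) → coeff γ k = 0 := by
    intro n
    induction n with
    | zero => intro γ hγ k hk; exact h0 _ γ rfl hγ k hk
    | succ n ih =>
      intro γ hγ k hk
      obtain ⟨k', rfl⟩ : (X none : MvPowerSeries (Option ι) ℂ) ∣ k :=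
        X_dvd_iff.mpr fun γ hγ => h0 _ γ rfl hγ k hk
      obtain ⟨β, rfl⟩ := exists_eq_add_single (t := none) (γ := γ) (by omega)
      rw [coeff_X_mul_add_single]
      refine ih β (by simpa using hγ) k' fun p F => ?_
      rw [← extend_succ_X_none_mul, ← mul_assoc, hk]
  ext1 γ
  exact h1 _ γ rfl k hk

/-- Move `ν∂_a` and `ν∂_b` across the functional in both orders. They commute, so the difference
`∂_b h_a - ∂_a h_b` annihilates the functional and must be zero. -/
theorem pderiv_eq_of_extend_mul (H : IsPointFunctional lam) {h : ι → MvPowerSeries (Option ι) ℂ}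
    (hh : ∀ a p F, extend lam p (h a * F) = extend lam p (X none * pderiv ℂ (some a) F))
    (a b : ι) : pderiv ℂ (some b) (h a) = pderiv ℂ (some a) (h b) := by
  rw [← sub_eq_zero]
  refine eq_zero_of_extend_mul H hh fun p F => ?_
  have key : ∀ a b, extend lam (p + 1) (X none * (X none * pderiv ℂ (some a) (pderiv ℂ (some b) F)))
      = extend lam (p + 1) (h b * h a * F) - extend lam p (pderiv ℂ (some b) (h a) * F) := by
    intro a b
    rw [← pderiv_X_none_mul, ← hh, mul_left_comm]
    have h1 := hh b (p + 1) (h a * F)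
    rw [Derivation.leibniz, smul_eq_mul, smul_eq_mul, mul_add, map_add] at h1
    rw [mul_assoc, h1, mul_comm F, extend_succ_X_none_mul lam p (_ * F)]
    ring
  have h1 := key a b
  have h2 := key b a
  have hc : pderiv ℂ (some a) (pderiv ℂ (some b) F) = pderiv ℂ (some b) (pderiv ℂ (some a) F) := by
    ext1 γ
    simp only [coeff_pderiv]
    by_cases hab : a = b
    · subst hab; rfl
    · rw [add_right_comm]
      simp [hab, Ne.symm hab]
      ring
  rw [hc, h2, mul_comm (h a)] at h1
  rw [sub_mul, map_sub]
  linear_combination h1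

variable [Fintype ι] {u : ι → MvPowerSeries (Option ι) ℂ}

/-- The conjugated transform is filtered and, by invertibility of the moments, surjective in leading
order; completeness of power series gives surjectivity onto regular series. -/
theorem exists_hat_eq [DecidableEq ι] (H : IsPointFunctional lam)
    (hu : ∀ a, pderiv ℂ (some a) (hat (extend lam) 1) = u a * hat (extend lam) 1)
    (hr : ∀ a, u a ∈ Filt (fun _ => True) wt 0) {B' : ι → ι → ℂ}
    (hB : ∀ a c, ∑ b, B' a b * lam 1 (X b * X c) = if a = c then 1 else 0)
    {y : MvPowerSeries (Option ι) ℂ} (hy : y ∈ tgtGE ι 0) :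
    ∃ h, hat (extend lam) h = y * hat (extend lam) 1 := by
  obtain ⟨G', hG⟩ := exists_inv_of_coeff_zero (coeff_zero_hat_one H)
  let Φ : ((Option ι →₀ ℕ) → ℂ) →+ MvPowerSeries (Option ι) ℂ :=
    (AddMonoidHom.mulLeft G').comp (hat (extend lam)).toAddMonoidHom
  have key : ∃ h : (Option ι →₀ ℕ) → ℂ, Φ h = y := by
    refine exists_preimage_of_graded (Y := MvPowerSeries (Option ι) ℂ) srcDeg Φ
      (fun D => tgtGE ι D) ?_ ?_ ?_ (by exact_mod_cast hy)
    · intro y hy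
      ext1 γ
      refine (hy ((tgtDeg γ).toNat + 1)).2 γ trivial ?_
      push_cast; omega
    · intro D f hf
      refine mul_hat_mem H hG hu hr (h := f) fun γ _ hγ => hf γ ?_
      simp only at hγ; omega
    · intro D y hy
      let p := y.truncTotal (2 * D + 1)
      have hp0 : (p : MvPowerSeries (Option ι) ℂ) ∈ tgtGE ι D :=
        ⟨truncTotal_mem_filt hy.1 _, truncTotal_mem_filt hy.2 _⟩
      -- A regular exponent of target degree at most `D` has at most `D` factors `ν` and no more
      -- variables `ζ` than `ν`; hence its total degree is at most `2D`, below the truncation.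
      have hsub : y - p ∈ tgtGE ι (D + 1) := by
        have h0 : y - p ∈ Filt (fun _ => True) wt 0 := AddSubgroup.sub_mem _ hy.1 hp0.1
        refine ⟨h0, fun γ _ hγ => ?_⟩
        by_cases hw : wt γ < 0
        · exact h0 γ trivial hw
        · refine sub_truncTotal_mem_orderGE (2 * D + 1) y γ trivial ?_
          have := wt_add_sum γ
          simp only [degree_option]
          rw [tgtDeg] at hγ
          push_cast at this ⊢; omega
      have hmon : ∀ γ ∈ p.support, ∃ h ∈ srcGE ι D,
          G' * hat (extend lam) h - monomial γ (p.coeff γ) ∈ tgtGE ι (D + 1) := by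
        intro γ hγ
        have hne : coeff γ (p : MvPowerSeries (Option ι) ℂ) ≠ 0 := by
          rw [MvPolynomial.coeff_coe]; exact MvPolynomial.mem_support_iff.mp hγ
        have hw : 0 ≤ wt γ := by
          by_contra hlt
          exact hne (hp0.1 γ trivial (by omega))
        have ht : D ≤ tgtDeg γ := by
          by_contra hlt
          exact hne (hp0.2 γ trivial (by omega))
        obtain ⟨h, h1, h2⟩ := exists_leading_preimage H hG hu hr hB _ γ rfl hw (p.coeff γ)
        exact ⟨h, filt_mono ht h1, tgtGE_mono (by omega) h2⟩
      choose! h h1 h2 using hmon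
      refine ⟨∑ γ ∈ p.support, h γ, ?_, ?_⟩
      · intro γ hγ
        exact AddSubgroup.sum_mem (srcGE ι D) h1 γ trivial (by simp only; omega)
      · have hp : (p : MvPowerSeries (Option ι) ℂ) =
            ∑ γ ∈ p.support, monomial γ (p.coeff γ) := by
          conv_lhs => rw [p.as_sum]
          rw [← MvPolynomial.coeToMvPowerSeries.ringHom_apply, map_sum]
          simp
        have : y - G' * hat (extend lam) (∑ γ ∈ p.support, h γ) = (y - p) -
            ∑ γ ∈ p.support, (G' * hat (extend lam) (h γ) - monomial γ (p.coeff γ)) := by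
          rw [Finset.sum_sub_distrib, ← hp, map_sum, Finset.mul_sum]
          ring
        change y - G' * hat (extend lam) (∑ γ ∈ p.support, h γ) ∈ _
        rw [this]
        push_cast
        exact AddSubgroup.sub_mem _ hsub (AddSubgroup.sum_mem _ h2)
  obtain ⟨h, hh⟩ := key
  have hh' : G' * hat (extend lam) h = y := hh
  exact ⟨h, by linear_combination (hat (extend lam) 1) * hh' - (hat (extend lam) h) * hG⟩

/-- Two functionals of finite order which agree on the monomials are equal. -/
theorem eq_of_eq_monomial {τ : Type*} [Fintype τ] {A A' : MvPowerSeries τ ℂ →ₗ[ℂ] ℂ} {k : ℕ}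
    (hA : ∀ f ∈ orderGE τ k, A f = A' f)
    (h : ∀ γ : τ →₀ ℕ, A (monomial γ 1) = A' (monomial γ 1)) : A = A' := by
  ext1 F
  have hp : ∀ p : MvPolynomial τ ℂ, A (p : MvPowerSeries τ ℂ) = A' (p : MvPowerSeries τ ℂ) := by
    intro p
    induction p using MvPolynomial.induction_on' with
    | monomial γ c =>
      have : (monomial γ c : MvPowerSeries τ ℂ) = c • monomial γ 1 := by
        rw [← map_smul, smul_eq_mul, mul_one]
      rw [MvPolynomial.coe_monomial, this, map_smul, map_smul, h]
    | add p q hp hq => rw [MvPolynomial.coe_add, map_add, map_add, hp, hq]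
  have h1 := hA _ (sub_truncTotal_mem_orderGE k F)
  rw [map_sub, map_sub, hp] at h1
  exact sub_left_injective h1

theorem srcGE_pderiv {k : ℤ} {h : MvPowerSeries (Option ι) ℂ} (hh : h ∈ srcGE ι k) (a : ι) :
    pderiv ℂ (some a) h ∈ srcGE ι (k - 1) := by
  have := filt_pderiv srcDeg_add_cast hh (some a)
  rwa [srcDeg_single_some] at this

/-- `ν ζ_a` is the symbol of `ν ∂_a`: equality of transforms says that the two functionals agree on
monomials in `z`. It extends to powers of `ν` by `ν`-linearity and to all series by finite order. -/
theorem extend_mul_eq_of_hat_eq (H : IsPointFunctional lam) {a : ι}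
    {h : MvPowerSeries (Option ι) ℂ}
    (hh : hat (extend lam) h = X none * X (some a) * hat (extend lam) 1) (p : ℕ)
    (F : MvPowerSeries (Option ι) ℂ) :
    extend lam p (h * F) = extend lam p (X none * pderiv ℂ (some a) F) := by
  have hz : ∀ (p : ℕ) (γ : Option ι →₀ ℕ),
      extend lam p (h * zmon γ) = extend lam p (X none * pderiv ℂ (some a) (zmon γ)) := by
    intro p γ
    -- `zmon` ignores the exponent of `ν`; setting it to `p` makes the coefficient of the transform
    -- at this index a value of `extend lam p`.
    obtain ⟨γ, rfl, hγ⟩ : ∃ γ' : Option ι →₀ ℕ, p = γ' none ∧ zmon γ = zmon γ' := by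
      refine ⟨γ.some.optionElim p, by simp, ?_⟩
      rw [zmon, zmon]
      congr 2
      ext a; simp
    rw [hγ]
    have h1 := congrArg (coeff γ) hh
    rw [mul_right_comm, ← hat_X_none_mul, mul_one, mul_comm _ (X (some a)), coeff_hat] at h1
    by_cases hγa : γ (some a) = 0
    · rw [coeff_X_mul_of_eq_zero hγa] at h1
      rw [zmon, pderiv_monomial_of_eq_zero (by simpa using hγa), mul_zero, map_zero]
      exact (mul_eq_zero.mp h1).resolve_left (inv_ne_zero (fct_ne_zero γ))
    · obtain ⟨β, rfl⟩ := exists_eq_add_single hγa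
      have hn : (β + Finsupp.single (some a) 1 : Option ι →₀ ℕ) none = β none := by simp
      have h2 : (β (some a) + 1 : ℂ) ≠ 0 := Nat.cast_add_one_ne_zero _
      have h3 : pderiv ℂ (some a) (zmon (β + Finsupp.single (some a) 1)) =
          (β (some a) + 1 : ℂ) • zmon β := by
        rw [zmon_add_single, zmon, ← monomial_add_single, pderiv_monomial_eq, one_mul, ← map_smul,
          smul_eq_mul, mul_one]
        simp
      rw [coeff_X_mul_add_single, coeff_hat, fct_add_single, hn, mul_inv] at h1
      rw [h3, hn, mul_smul_comm, map_smul, smul_eq_mul]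
      have h4 := fct_ne_zero β
      field_simp at h1
      linear_combination h1
  have hpow : ∀ (n p : ℕ) (G G' : MvPowerSeries (Option ι) ℂ),
      (∀ p, extend lam p G = extend lam p G') →
        extend lam p (X none ^ n * G) = extend lam p (X none ^ n * G') := by
    intro n
    induction n with
    | zero => intro p G G' h; simpa using h p
    | succ n ih =>
      intro p G G' h
      rw [pow_succ', mul_assoc, mul_assoc]
      cases p with
      | zero => rw [extend_zero_X_none_mul, extend_zero_X_none_mul]
      | succ p => rw [extend_succ_X_none_mul, extend_succ_X_none_mul, ih p G G' h]
  have key := eq_of_eq_monomial (k := 2 * p + 2) (A := extend lam p ∘ₗ LinearMap.mulLeft ℂ h)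
    (A' := extend lam p ∘ₗ LinearMap.mulLeft ℂ (X none) ∘ₗ (pderiv ℂ (some a)).toLinearMap) ?_ ?_
  · exact congrArg (fun A : MvPowerSeries (Option ι) ℂ →ₗ[ℂ] ℂ => A F) key
  · intro f hf
    have hf' := srcGE_of_orderGE hf
    change extend lam p (h * f) = extend lam p (X none * pderiv ℂ (some a) f)
    rw [H.extend_eq_zero (srcGE_mul_left h (filt_mono (by push_cast; omega) hf')),
      H.extend_eq_zero (srcGE_mul_left _ (filt_mono (by push_cast; omega) (srcGE_pderiv hf' a)))]
  · intro γ
    change extend lam p (h * _) = extend lam p (X none * pderiv ℂ (some a) _)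
    rw [monomial_eq_pow_mul, pderiv_X_none_pow_mul, mul_left_comm, mul_left_comm (X none)]
    exact hpow _ _ _ _ fun p => hz p γ

theorem coeff_X_mul_pderiv {τ : Type*} (t : τ) (γ : τ →₀ ℕ) (g : MvPowerSeries τ ℂ) :
    coeff γ (X t * pderiv ℂ t g) = γ t * coeff γ g := by
  by_cases h : γ t = 0
  · rw [coeff_X_mul_of_eq_zero h, h, Nat.cast_zero, zero_mul]
  · obtain ⟨β, rfl⟩ := exists_eq_add_single h
    rw [coeff_X_mul_add_single, coeff_pderiv]
    simp [mul_comm]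

/-- The formal Poincaré lemma. -/
theorem exists_pderiv_eq {h : ι → MvPowerSeries (Option ι) ℂ}
    (hc : ∀ a b, pderiv ℂ (some b) (h a) = pderiv ℂ (some a) (h b)) :
    ∃ ψ : MvPowerSeries (Option ι) ℂ, coeff 0 ψ = 0 ∧ ∀ a, pderiv ℂ (some a) ψ = h a := by
  classical
  -- The radial primitive: divide `∑ z_a h_a` by the degree in `z`. In degree zero the junk value
  -- `0⁻¹ = 0` appears, and no pure power of `ν` occurs in `ψ`.
  let ψ : MvPowerSeries (Option ι) ℂ := fun γ =>
    ((∑ a, γ (some a) : ℕ) : ℂ)⁻¹ * coeff γ (∑ a, X (some a) * h a)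
  have hψ : ∀ γ, coeff γ ψ = ((∑ a, γ (some a) : ℕ) : ℂ)⁻¹ * coeff γ (∑ a, X (some a) * h a) :=
    fun _ => rfl
  refine ⟨ψ, by rw [hψ]; simp, fun c => ?_⟩
  ext1 γ
  have h1 : coeff γ (pderiv ℂ (some c) (∑ a, X (some a) * h a)) =
      (((∑ a, γ (some a) : ℕ) : ℂ) + 1) * coeff γ (h c) := by
    have : pderiv ℂ (some c) (∑ a, X (some a) * h a) =
        ∑ a, X (some a) * pderiv ℂ (some a) (h c) + h c := by
      rw [map_sum]
      simp only [Derivation.leibniz, smul_eq_mul, hc _ c, Finset.sum_add_distrib]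
      congr 1
      rw [Finset.sum_eq_single c]
      · simp
      · intro b _ hb; rw [pderiv_X_of_ne (by simpa using hb)]; simp
      · intro h; exact absurd (Finset.mem_univ c) h
    rw [this, map_add, map_sum]
    simp only [coeff_X_mul_pderiv]
    rw [← Finset.sum_mul]
    push_cast; ring
  rw [coeff_pderiv, hψ, mul_assoc, ← coeff_pderiv, h1]
  have h2 : ∑ a, (γ + Finsupp.single (some c) 1 : Option ι →₀ ℕ) (some a) =
      ∑ a, γ (some a) + 1 := by
    simp [Finset.sum_add_distrib, Finsupp.single_apply]
  rw [h2, ← mul_assoc]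
  push_cast
  rw [inv_mul_cancel₀, one_mul]
  exact_mod_cast Nat.succ_ne_zero (∑ a, γ (some a))

/-- The series `ν⁻¹ ψ` is the formal phase with respect to the constant density: the conclusions are
the coefficients of `Λ(∂_a F + ν⁻¹ (∂_a ψ) F) = 0`, the lowest one being stated separately. -/
theorem exists_formal_phase [DecidableEq ι] (H : IsPointFunctional lam)
    (hu : ∀ a, pderiv ℂ (some a) (hat (extend lam) 1) = u a * hat (extend lam) 1)
    (hr : ∀ a, u a ∈ Filt (fun _ => True) wt 0) {B' : ι → ι → ℂ}
    (hB : ∀ a c, ∑ b, B' a b * lam 1 (X b * X c) = if a = c then 1 else 0) :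
    ∃ ψ : ℕ → MvPowerSeries ι ℂ, constantCoeff (ψ 0) = 0 ∧
      (∀ a F, lam 0 (pderiv ℂ a (ψ 0) * F) = 0) ∧
      ∀ a p F, ∑ q ∈ antidiagonal (p + 1), lam q.1 (pderiv ℂ a (ψ q.2) * F) +
        lam p (pderiv ℂ a F) = 0 := by
  have hex : ∀ a : ι, ∃ h, hat (extend lam) h = X none * X (some a) * hat (extend lam) 1 := by
    intro a
    refine exists_hat_eq H hu hr hB ?_
    rw [X_def, X_def, monomial_mul_monomial]
    refine monomial_mem_tgtGE ?_ ?_ _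
    · rw [wt_add, wt_single_none, wt_single_some]; omega
    · rw [tgtDeg_add, tgtDeg_single_none, tgtDeg_single_some]; omega
  choose h hh using hex
  have hh' := fun a => extend_mul_eq_of_hat_eq H (hh a)
  -- The sign: `Λ(h_a F) = Λ(ν ∂_a F)`, so the gradient of the phase has to be `-h_a`.
  obtain ⟨ψ, hψ0, hψ⟩ := exists_pderiv_eq (h := fun a => -h a) (fun a b => by
    rw [map_neg, map_neg, pderiv_eq_of_extend_mul H hh'])
  have hext : ∀ a p F, extend lam p (pderiv ℂ (some a) ψ * embZ F) =
      ∑ q ∈ antidiagonal p, lam q.1 (pderiv ℂ a (comp q.2 ψ) * F) := by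
    intro a p F
    rw [extend_apply]
    simp only [comp_mul_embZ, comp_pderiv]
  refine ⟨fun r => comp r ψ, ?_, fun a F => ?_, fun a p F => ?_⟩
  · rw [← coeff_zero_eq_constantCoeff_apply, coeff_comp, ← hψ0]
    congr 2
    ext t; rcases t with _ | a <;> simp
  · have h1 := hext a 0 F
    rw [Finset.HasAntidiagonal.antidiagonal_zero, Finset.sum_singleton] at h1
    rw [← h1, hψ, neg_mul, map_neg, hh', extend_zero_X_none_mul, neg_zero]
  · rw [← hext, hψ, neg_mul, map_neg, hh', extend_succ_X_none_mul, pderiv_embZ, extend_apply]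
    rw [Finset.sum_eq_single (p, 0), ← one_mul (embZ _), comp_mul_embZ, comp_one, if_pos rfl,
      one_mul, neg_add_cancel]
    · rintro ⟨q, r⟩ hq hne
      rw [mem_antidiagonal] at hq
      have hr : r ≠ 0 := by
        rintro rfl
        exact hne (by simpa using hq)
      rw [← one_mul (embZ _), comp_mul_embZ, comp_one, if_neg hr, zero_mul, map_zero]
    · intro h; exact absurd (mem_antidiagonal.mpr (by simp)) h

end Phase

end StarFOI

end

noncomputable section

namespace StarFOI

open MvPowerSeries Finset.HasAntidiagonal

/-! ### The point functional of a formal star product -/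

variable {σ : Type*}

theorem prod_X_pow_mem_orderGE {τ : Type*} (s : Finset σ) (e : σ → ℕ) (x : σ → τ) :
    ∏ i ∈ s, (X (x i) : MvPowerSeries τ ℂ) ^ e i ∈ orderGE τ ((∑ i ∈ s, e i : ℕ) : ℤ) := by
  classical
  have hpow : ∀ (t : τ) (n : ℕ), (X t : MvPowerSeries τ ℂ) ^ n ∈ orderGE τ n := by
    intro t n
    induction n with
    | zero => exact orderGE_zero _
    | succ n ih =>
      rw [pow_succ]
      exact filt_mono (by push_cast; omega) (orderGE_mul ih (X_mem_orderGE t))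
  induction s using Finset.induction_on with
  | empty => exact orderGE_zero _
  | insert a s ha ih =>
    rw [Finset.prod_insert ha, Finset.sum_insert ha]
    exact filt_mono (by push_cast; omega) (orderGE_mul (hpow _ _) ih)

theorem zmon_eq_embZ (γ : Option σ →₀ ℕ) : zmon γ = embZ (monomial γ.some 1) := by
  classical
  ext1 β
  rw [zmon, coeff_embZ, coeff_monomial, coeff_monomial]
  have h : β = γ.some.optionElim 0 ↔ β none = 0 ∧ β.some = γ.some := by
    constructor
    · rintro rfl
      refine ⟨by simp, ?_⟩
      ext a; simp
    · rintro ⟨h1, h2⟩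
      rw [← h1, ← h2, optionElim_some_eq]
  simp only [h]
  by_cases h1 : β none = 0 <;> simp [h1]

theorem extend_embZ (lam : ℕ → MvPowerSeries σ ℂ →ₗ[ℂ] ℂ) (p : ℕ) (F : MvPowerSeries σ ℂ) :
    extend lam p (embZ F) = lam p F := by
  have hc : ∀ r, comp r (embZ F) = (if r = 0 then 1 else 0) * F := by
    intro r
    rw [← one_mul (embZ F), comp_mul_embZ, comp_one]
  rw [extend_apply, Finset.sum_eq_single (p, 0)]
  · rw [hc, if_pos rfl, one_mul]
  · rintro ⟨q, r⟩ hq hne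
    rw [mem_antidiagonal] at hq
    have hr : r ≠ 0 := by
      rintro rfl
      exact hne (by simpa using hq)
    rw [hc, if_neg hr, zero_mul, map_zero]
  · intro h; exact absurd (mem_antidiagonal.mpr (by simp)) h

variable [Fintype σ]

namespace FormalStar

variable (S : FormalStar σ)

/-- The functional with value `(x ^ α ⋆ x ^ β)(0)` on the monomial of exponent `(α, β)`. -/
def lam (q : ℕ) : MvPowerSeries (σ ⊕ σ) ℂ →ₗ[ℂ] ℂ :=
  (MvPolynomial.basisMonomials (σ ⊕ σ) ℂ).constr ℂ (fun δ => constantCoeff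
    (S.C q (∏ i, X i ^ δ (Sum.inl i)) (∏ i, X i ^ δ (Sum.inr i)))) ∘ₗ truncTotal (2 * q + 1)

theorem lam_eq_zero (q : ℕ) {f : MvPowerSeries (σ ⊕ σ) ℂ}
    (hf : f ∈ orderGE (σ ⊕ σ) (2 * q + 1 : ℕ)) : S.lam q f = 0 := by
  have : truncTotal (2 * q + 1) f = 0 := by
    ext γ
    by_cases h : γ.degree < 2 * q + 1
    · rw [coeff_truncTotal _ h, hf γ trivial (by simp only; exact_mod_cast h),
        MvPolynomial.coeff_zero]
    · rw [coeff_truncTotal_eq_zero _ (by omega), MvPolynomial.coeff_zero]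
  rw [lam, LinearMap.comp_apply, this, map_zero]

/-- The operators `C r` have order at most `r` at the origin, in both arguments. -/
def IsNaturalAtZero : Prop := ∀ r f g,
  f ∈ orderGE σ (r + 1 : ℕ) ∨ g ∈ orderGE σ (r + 1 : ℕ) → constantCoeff (S.C r f g) = 0

variable {S}

/-- The truncation in `lam` discards nothing: a monomial of total degree above `2q` has degree above
`q` in one of the two groups of variables, where naturality makes `C_q` vanish at the origin. -/
theorem lam_monomial (hS : S.IsNaturalAtZero) (q : ℕ) (δ : σ ⊕ σ →₀ ℕ) : S.lam q (monomial δ 1) = constantCoeff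
    (S.C q (∏ i, X i ^ δ (Sum.inl i)) (∏ i, X i ^ δ (Sum.inr i))) := by
  by_cases h : δ.degree < 2 * q + 1
  · have : truncTotal (2 * q + 1) (monomial δ 1 : MvPowerSeries (σ ⊕ σ) ℂ) =
        MvPolynomial.basisMonomials (σ ⊕ σ) ℂ δ := by
      classical
      ext γ
      rw [coeff_truncTotal_eq_ite, MvPolynomial.coe_basisMonomials, MvPolynomial.coeff_monomial,
        coeff_monomial]
      by_cases hγ : γ = δ
      · subst hγ; simp [h]
      · simp [hγ, Ne.symm hγ]
    rw [lam, LinearMap.comp_apply, this, Module.Basis.constr_basis]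
  · have h1 : (monomial δ 1 : MvPowerSeries (σ ⊕ σ) ℂ) ∈ orderGE (σ ⊕ σ) (2 * q + 1 : ℕ) :=
      monomial_mem_filt (by push_cast; omega) 1
    rw [S.lam_eq_zero q h1, hS]
    rw [Finsupp.degree_eq_sum, Fintype.sum_sum_type] at h
    rcases (show q + 1 ≤ ∑ i, δ (Sum.inl i) ∨ q + 1 ≤ ∑ i, δ (Sum.inr i) by omega) with h2 | h2
    · exact Or.inl (filt_mono (by exact_mod_cast h2) (prod_X_pow_mem_orderGE _ _ _))
    · exact Or.inr (filt_mono (by exact_mod_cast h2) (prod_X_pow_mem_orderGE _ _ _))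

theorem isPointFunctional_lam (hS : S.IsNaturalAtZero) : IsPointFunctional S.lam := by
  classical
  refine ⟨fun f => ?_, fun q f hf => S.lam_eq_zero q hf⟩
  have key : S.lam 0 = coeff (0 : σ ⊕ σ →₀ ℕ) := by
    refine eq_of_eq_monomial (k := 1) (fun f hf => ?_) fun γ => ?_
    · rw [S.lam_eq_zero 0 (by simpa using hf), hf 0 trivial (by simp)]
    · rw [lam_monomial hS, S.C_zero, map_mul, coeff_monomial]
      by_cases h : γ = 0
      · subst h; simp
      · obtain ⟨t, ht⟩ := Finsupp.ne_iff.mp h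
        rw [if_neg (Ne.symm h), mul_eq_zero, map_prod, map_prod]
        rcases t with i | i
        · exact Or.inl (Finset.prod_eq_zero (Finset.mem_univ i) (by simpa using ht))
        · exact Or.inr (Finset.prod_eq_zero (Finset.mem_univ i) (by simpa using ht))
  rw [key, coeff_zero_eq_constantCoeff_apply]

/-- Moments within one group of variables involve `C_1` with the constant `1` and vanish; only the
mixed ones survive. -/
theorem lam_one_X_mul_X [DecidableEq σ] (hS : S.IsNaturalAtZero) (a b : σ ⊕ σ) : S.lam 1 (X a * X b) =
    Matrix.fromBlocks 0 (Matrix.of fun i j => constantCoeff (S.C 1 (X i) (X j)))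
      (Matrix.of fun i j => constantCoeff (S.C 1 (X i) (X j)))ᵀ 0 a b := by
  have hm : (X a * X b : MvPowerSeries (σ ⊕ σ) ℂ) =
      monomial (Finsupp.single a 1 + Finsupp.single b 1) 1 := by
    rw [X_def, X_def, monomial_mul_monomial, one_mul]
  rw [hm, lam_monomial hS]
  rcases a with i | i <;> rcases b with j | j <;>
    simp [Finsupp.single_apply, Finset.prod_ite_eq, pow_add, S.one_left,
      S.one_right, pow_ite]

/-- Both sides have the coefficients `C_r(x^α, x^β)(0) / (α! β!)` at `ν^r ξ^α η^β`. -/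
theorem hat_lam (hS : S.IsNaturalAtZero) : hat (extend S.lam) 1 = map constantCoeff S.generating := by
  classical
  ext1 γ
  rw [coeff_map, generating, coeff_star]
  set γL := γ.filter (fun t => t ∈ Set.range fun i : σ => (some (Sum.inl i) : Par σ)) with hL
  set γR := γ.filter (fun t => t ∈ Set.range fun i : σ => (some (Sum.inr i) : Par σ)) with hR
  set γN : Par σ →₀ ℕ := Finsupp.single none (γ none) with hN
  -- The exponentials contain only `ξ`, respectively only `η`, and the operators only `ν`; so this
  -- is the only decomposition of `γ` that contributes.
  have hsum : γL + (γN + γR) = γ := by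
    ext t
    rcases t with _ | i | i <;> simp [hL, hR, hN]
  have hXi : ∀ β : Par σ →₀ ℕ, (∃ t, t ∉ Set.range (fun i : σ => (some (Sum.inl i) : Par σ)) ∧
      β t ≠ 0) → coeff β (expXi σ) = 0 := by
    rintro β ⟨t, ht, h⟩
    rw [expXi, coeff_expS, if_neg]
    exact fun h' => h (h' t ht)
  have hEta : ∀ β : Par σ →₀ ℕ, (∃ t, t ∉ Set.range (fun i : σ => (some (Sum.inr i) : Par σ)) ∧
      β t ≠ 0) → coeff β (expEta σ) = 0 := by
    rintro β ⟨t, ht, h⟩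
    rw [expEta, coeff_expS, if_neg]
    exact fun h' => h (h' t ht)
  rw [Finset.sum_eq_single (γL, γN + γR), Finset.sum_eq_single (γN, γR)]
  · simp only
    rw [expXi, expEta, coeff_expS, coeff_expS, if_pos, if_pos, hN, Ct_single]
    · have e1 : ∀ i, γL (some (Sum.inl i)) = γ (some (Sum.inl i)) := by
        intro i; simp [hL]
      have e2 : ∀ i, γR (some (Sum.inr i)) = γ (some (Sum.inr i)) := by
        intro i; simp [hR]
      simp only [e1, e2]
      rw [Finset.prod_smul, Finset.prod_smul, map_smul (S.C (γ none)), LinearMap.smul_apply,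
        map_smul (S.C (γ none) _), smul_smul, constantCoeff_smul, smul_eq_mul, coeff_hat, one_mul, zmon_eq_embZ, extend_embZ,
        lam_monomial hS]
      simp only [Finsupp.some_apply]
      congr 1
      rw [fct, Fintype.prod_sum_type, mul_inv, ← Finset.prod_inv_distrib,
        ← Finset.prod_inv_distrib]
    · intro t ht; simp only [hR]; exact Finsupp.filter_apply_neg _ _ ht
    · intro t ht; simp only [hL]; exact Finsupp.filter_apply_neg _ _ ht
  · rintro ⟨q, q'⟩ hq hne
    rw [mem_antidiagonal] at hq
    simp only at hq ⊢
    by_cases h1 : ∃ a, q (some a) ≠ 0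
    · obtain ⟨a, ha⟩ := h1
      rw [S.Ct_of_ne ha]; rfl
    by_cases h2 : q' none = 0
    swap
    · rw [hEta q' ⟨none, by simp, h2⟩, map_zero]
    exfalso
    push Not at h1
    have h3 : q = γN := by
      ext t
      rcases t with _ | a
      · have := congrArg (fun γ : Par σ →₀ ℕ => γ none) hq
        simpa [h2, hR, hN, Finsupp.filter_apply] using this
      · simp [hN, h1 a]
    rw [h3] at hq
    exact hne (Prod.ext h3 (add_left_cancel hq))
  · intro h; exact absurd (mem_antidiagonal.mpr (by simp only)) h
  · rintro ⟨p, p'⟩ hp hne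
    rw [mem_antidiagonal] at hp
    simp only at hp ⊢
    by_cases h1 : ∃ t, t ∉ Set.range (fun i : σ => (some (Sum.inl i) : Par σ)) ∧ p t ≠ 0
    · refine Finset.sum_eq_zero fun q _ => ?_
      rw [hXi p h1, map_zero, LinearMap.zero_apply]
    push Not at h1
    obtain ⟨i, hi⟩ : ∃ i, p' (some (Sum.inl i)) ≠ 0 := by
      by_contra! hne'
      have h2 : p = γL := by
        ext t
        by_cases ht : t ∈ Set.range fun i : σ => (some (Sum.inl i) : Par σ)
        · obtain ⟨i, rfl⟩ := ht
          have := congrArg (fun γ : Par σ →₀ ℕ => γ (some (Sum.inl i))) hp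
          simpa [hL, hne' i, Finsupp.filter_apply] using this
        · rw [h1 t ht, hL, Finsupp.filter_apply_neg _ _ ht]
      have h3 : γL + p' = γL + (γN + γR) := by rw [hsum, ← hp, h2]
      exact hne (Prod.ext h2 (add_left_cancel h3))
    refine Finset.sum_eq_zero fun q hq => ?_
    rw [mem_antidiagonal] at hq
    by_cases h3 : q.1 (some (Sum.inl i)) = 0
    · rw [hEta q.2 ⟨some (Sum.inl i), by simp, ?_⟩, map_zero]
      intro h4
      apply hi
      rw [← hq]; simp [h3, h4]
    · rw [S.Ct_of_ne h3]; rfl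
  · intro h; exact absurd (mem_antidiagonal.mpr hsum) h

theorem exists_regular_hat (hS : S.IsNaturalAtZero) : ∃ u : σ ⊕ σ → MvPowerSeries (Option (σ ⊕ σ)) ℂ,
    (∀ a, pderiv ℂ (some a) (hat (extend S.lam) 1) = u a * hat (extend S.lam) 1) ∧
      ∀ a, u a ∈ Filt (fun _ => True) wt 0 := by
  obtain ⟨U, hU, hr⟩ := S.exists_regular_logDeriv
  refine ⟨fun a => map constantCoeff (U a), fun a => ?_, fun a γ _ hγ => ?_⟩
  · rw [hat_lam hS, ← map_mul, ← hU]
    ext1 γ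
    rw [coeff_pderiv, coeff_map, coeff_map, coeff_pderiv, map_mul]
    simp
  · rw [coeff_map, hr a γ trivial hγ, map_zero]

/-- The moment matrix has off-diagonal blocks `K` and `Kᵀ`; its inverse has off-diagonal blocks
`(Kᵀ)⁻¹` and `K⁻¹`. -/
theorem exists_phase [DecidableEq σ] (hS : S.IsNaturalAtZero)
    (hK : (Matrix.of fun i j => constantCoeff (S.C 1 (X i) (X j))).det ≠ 0) :
    ∃ ψ : ℕ → MvPowerSeries (σ ⊕ σ) ℂ, constantCoeff (ψ 0) = 0 ∧
      (∀ a F, S.lam 0 (pderiv ℂ a (ψ 0) * F) = 0) ∧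
      ∀ a p F, ∑ q ∈ antidiagonal (p + 1), S.lam q.1 (pderiv ℂ a (ψ q.2) * F) +
        S.lam p (pderiv ℂ a F) = 0 := by
  obtain ⟨u, hu, hr⟩ := exists_regular_hat hS
  set K := Matrix.of fun i j => constantCoeff (S.C 1 (X i) (X j)) with hKdef
  refine exists_formal_phase (isPointFunctional_lam hS) hu hr
    (B' := Matrix.fromBlocks 0 Kᵀ⁻¹ K⁻¹ 0) fun a c => ?_
  simp only [lam_one_X_mul_X hS]
  rw [← hKdef]
  have hKT : IsUnit Kᵀ.det := by rw [Matrix.det_transpose]; exact hK.isUnit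
  have : Matrix.fromBlocks 0 Kᵀ⁻¹ K⁻¹ 0 * Matrix.fromBlocks 0 K Kᵀ 0 = 1 := by
    rw [Matrix.fromBlocks_multiply]
    simp [Matrix.nonsing_inv_mul _ hK.isUnit, Matrix.nonsing_inv_mul _ hKT]
  have h2 := congrFun (congrFun this a) c
  rw [Matrix.mul_apply, Matrix.one_apply] at h2
  exact h2

end FormalStar

end StarFOI

end

noncomputable section

namespace StarFOI

open MvPowerSeries Finset.HasAntidiagonal

/-! ### Taylor series of germs -/

section Germs

variable {E : Type*} [NormedAddCommGroup E] [NormedSpace ℝ E]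
  {F : Type*} [NormedAddCommGroup F] [NormedSpace ℝ F] {y₀ : E}

/-- `g` is smooth in a neighbourhood of `y₀`. -/
def SmoothNear (y₀ : E) (g : E → F) : Prop := ∀ᶠ y in 𝓝 y₀, ContDiffAt ℝ ∞ g y

theorem SmoothNear.congr {g g' : E → F} (h : SmoothNear y₀ g) (hg : g' =ᶠ[𝓝 y₀] g) :
    SmoothNear y₀ g' := by
  filter_upwards [h, hg.eventuallyEq_nhds] with y h1 h2 using h1.congr_of_eventuallyEq h2

theorem ContDiff.smoothNear {g : E → F} (h : ContDiff ℝ ∞ g) : SmoothNear y₀ g :=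
  Filter.Eventually.of_forall fun _ => h.contDiffAt

theorem ContDiffOn.smoothNear {g : E → F} {U : Set E} (h : ContDiffOn ℝ ∞ g U) (hU : IsOpen U)
    (hy : y₀ ∈ U) : SmoothNear y₀ g := by
  filter_upwards [hU.mem_nhds hy] with y h1 using h.contDiffAt (hU.mem_nhds h1)

theorem SmoothNear.contDiffAt {g : E → F} (h : SmoothNear y₀ g) : ContDiffAt ℝ ∞ g y₀ :=
  h.self_of_nhds

theorem SmoothNear.add {g h : E → F} (hg : SmoothNear y₀ g) (hh : SmoothNear y₀ h) :
    SmoothNear y₀ (fun y => g y + h y) := by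
  filter_upwards [hg, hh] with y h1 h2 using h1.add h2

theorem SmoothNear.const (c : F) : SmoothNear y₀ (fun _ => c) :=
  ContDiff.smoothNear contDiff_const

theorem SmoothNear.mul {g h : E → ℂ} (hg : SmoothNear y₀ g) (hh : SmoothNear y₀ h) :
    SmoothNear y₀ (fun y => g y * h y) := by
  filter_upwards [hg, hh] with y h1 h2 using h1.mul h2

theorem SmoothNear.sum {κ : Type*} {s : Finset κ} {g : κ → E → F}
    (hg : ∀ k ∈ s, SmoothNear y₀ (g k)) : SmoothNear y₀ (fun y => ∑ k ∈ s, g k y) := by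
  classical
  induction s using Finset.induction_on with
  | empty => simpa using SmoothNear.const 0
  | insert a s ha ih =>
    simp only [Finset.sum_insert ha]
    exact (hg a (Finset.mem_insert_self _ _)).add
      (ih fun k hk => hg k (Finset.mem_insert_of_mem hk))

theorem SmoothNear.fderiv {g : E → F} (hg : SmoothNear y₀ g) : SmoothNear y₀ (fderiv ℝ g) := by
  filter_upwards [hg] with y h1 using h1.fderiv_right (by simp)

theorem SmoothNear.clm_apply {G : Type*} [NormedAddCommGroup G] [NormedSpace ℝ G]
    {A : E → F →L[ℝ] G} {g : E → F} (hA : SmoothNear y₀ A) (hg : SmoothNear y₀ g) :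
    SmoothNear y₀ (fun y => A y (g y)) := by
  filter_upwards [hA, hg] with y h1 h2 using h1.clm_apply h2

theorem SmoothNear.differentiableAt {g : E → F} (hg : SmoothNear y₀ g) :
    ∀ᶠ y in 𝓝 y₀, DifferentiableAt ℝ g y := by
  filter_upwards [hg] with y h1 using h1.differentiableAt (by simp)

/-- The derivative in the direction `w`. -/
def dirD (w : E) (g : E → ℂ) : E → ℂ := fun y => fderiv ℝ g y w

theorem SmoothNear.dirD {g : E → ℂ} (hg : SmoothNear y₀ g) (w : E) : SmoothNear y₀ (dirD w g) :=
  hg.fderiv.clm_apply (SmoothNear.const w)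

theorem dirD_congr {g g' : E → ℂ} (h : g =ᶠ[𝓝 y₀] g') (w : E) : dirD w g =ᶠ[𝓝 y₀] dirD w g' := by
  filter_upwards [h.fderiv (𝕜 := ℝ)] with y hy
  rw [dirD, dirD, hy]

theorem dirD_mul {g h : E → ℂ} (hg : SmoothNear y₀ g) (hh : SmoothNear y₀ h) (w : E) :
    dirD w (fun y => g y * h y) =ᶠ[𝓝 y₀] fun y => dirD w g y * h y + g y * dirD w h y := by
  filter_upwards [hg.differentiableAt, hh.differentiableAt] with y h1 h2
  rw [dirD, fderiv_fun_mul h1 h2]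
  simp [dirD]; ring

theorem dirD_add {g h : E → ℂ} (hg : SmoothNear y₀ g) (hh : SmoothNear y₀ h) (w : E) :
    dirD w (fun y => g y + h y) =ᶠ[𝓝 y₀] fun y => dirD w g y + dirD w h y := by
  filter_upwards [hg.differentiableAt, hh.differentiableAt] with y h1 h2
  rw [dirD, fderiv_fun_add h1 h2]
  simp [dirD]

theorem dirD_comm {g : E → ℂ} (hg : SmoothNear y₀ g) (w w' : E) :
    dirD w (dirD w' g) =ᶠ[𝓝 y₀] dirD w' (dirD w g) := by
  have key : ∀ w w' : E, ∀ᶠ y in 𝓝 y₀, dirD w (dirD w' g) y =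
      fderiv ℝ (fderiv ℝ g) y w w' := by
    intro w w'
    filter_upwards [hg.fderiv.differentiableAt] with y hy
    rw [dirD]
    have h1 := (hy.hasFDerivAt.clm_apply (hasFDerivAt_const w' y)).fderiv
    have h2 : dirD w' g = fun y => fderiv ℝ g y w' := rfl
    rw [h2, h1]
    simp
  filter_upwards [key w w', key w' w, hg] with y h1 h2 h3
  rw [h1, h2]
  exact (h3.isSymmSndFDerivAt (by
    rw [minSmoothness_of_isRCLikeNormedField]
    exact WithTop.coe_le_coe.mpr (le_top : (2 : ℕ∞) ≤ ⊤))) w w'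

variable {ι : Type*} (b : ι → E)

/-- Iterated directional derivatives. -/
def wordD : List ι → (E → ℂ) → E → ℂ
  | [], g => g
  | a :: l, g => dirD (b a) (wordD l g)

variable {b}

theorem SmoothNear.wordD {g : E → ℂ} (hg : SmoothNear y₀ g) (l : List ι) :
    SmoothNear y₀ (wordD b l g) := by
  induction l with
  | nil => exact hg
  | cons a l ih => exact ih.dirD _

theorem wordD_congr {g g' : E → ℂ} (h : g =ᶠ[𝓝 y₀] g') (l : List ι) :
    wordD b l g =ᶠ[𝓝 y₀] wordD b l g' := by
  induction l with
  | nil => exact h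
  | cons a l ih => exact dirD_congr ih _

theorem wordD_perm {g : E → ℂ} (hg : SmoothNear y₀ g) {l l' : List ι} (h : l.Perm l') :
    wordD b l g =ᶠ[𝓝 y₀] wordD b l' g := by
  induction h with
  | nil => exact Filter.EventuallyEq.rfl
  | cons a _ ih => exact dirD_congr ih _
  | swap a c l => exact dirD_comm (hg.wordD l) _ _
  | trans _ _ ih1 ih2 => exact ih1.trans ih2

theorem wordD_append (l : List ι) (a : ι) (g : E → ℂ) :
    wordD b (l ++ [a]) g = wordD b l (dirD (b a) g) := by
  induction l with
  | nil => rfl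
  | cons c l ih => exact congrArg (dirD (b c)) ih

theorem wordD_ofFn {g : E → ℂ} (hg : ContDiff ℝ ∞ g) (n : ℕ) (v : Fin n → ι) (y : E) :
    wordD b (List.ofFn v) g y = iteratedFDeriv ℝ n g y (fun i => b (v i)) := by
  induction n generalizing y with
  | zero => simp [wordD]
  | succ n ih =>
    have h1 : wordD b (List.ofFn fun i => v i.succ) g =
        fun y => iteratedFDeriv ℝ n g y (fun i => b (v i.succ)) := funext (ih _)
    rw [List.ofFn_succ, wordD, h1, dirD]
    have hd : DifferentiableAt ℝ (iteratedFDeriv ℝ n g) y :=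
      (hg.differentiable_iteratedFDeriv (by exact_mod_cast WithTop.coe_lt_top _)).differentiableAt
    have h2 := (hd.hasFDerivAt.continuousMultilinear_apply_const (fun i => b (v i.succ))).fderiv
    rw [h2, iteratedFDeriv_succ_apply_left]
    rfl

/-- A coefficient of degree `n + 1` is read off from a first derivative in degree `n`. This replaces
combinatorics of factorials in the proofs that Taylor expansion respects sums and products. -/
theorem coeff_eq_of_pderiv {n : ℕ} {G G' : MvPowerSeries ι ℂ}
    (h : ∀ a, ∀ γ : ι →₀ ℕ, γ.degree = n → coeff γ (pderiv ℂ a G) = coeff γ (pderiv ℂ a G'))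
    {γ : ι →₀ ℕ} (hγ : γ.degree = n + 1) : coeff γ G = coeff γ G' := by
  have hne : γ ≠ 0 := by rintro rfl; simp at hγ
  obtain ⟨a, ha⟩ := Finsupp.ne_iff.mp hne
  obtain ⟨β, rfl⟩ := exists_eq_add_single ha
  have h1 := h a β (by rw [map_add, Finsupp.degree_single] at hγ; omega)
  rw [coeff_pderiv, coeff_pderiv] at h1
  exact mul_right_cancel₀ (Nat.cast_add_one_ne_zero _) h1

theorem ext_of_pderiv {G G' : MvPowerSeries ι ℂ} (h0 : constantCoeff G = constantCoeff G')
    (h : ∀ a, pderiv ℂ a G = pderiv ℂ a G') : G = G' := by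
  ext1 γ
  cases hn : γ.degree with
  | zero =>
    rw [Finsupp.degree_eq_zero_iff] at hn
    rw [hn]; exact h0
  | succ n => exact coeff_eq_of_pderiv (fun a γ _ => by rw [h a]) hn

variable [Fintype ι]

/-- The Taylor series at `y₀` of a function on `E`, with respect to a family of vectors. -/
def taylor (b : ι → E) (y₀ : E) (g : E → ℂ) : MvPowerSeries ι ℂ := fun γ =>
  (∏ a, ((γ a).factorial : ℂ))⁻¹ * wordD b (Finsupp.toMultiset γ).toList g y₀

theorem coeff_taylor (g : E → ℂ) (γ : ι →₀ ℕ) : coeff γ (taylor b y₀ g) =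
    (∏ a, ((γ a).factorial : ℂ))⁻¹ * wordD b (Finsupp.toMultiset γ).toList g y₀ := rfl

theorem taylor_congr {g g' : E → ℂ} (h : g =ᶠ[𝓝 y₀] g') : taylor b y₀ g = taylor b y₀ g' := by
  ext1 γ
  rw [coeff_taylor, coeff_taylor, (wordD_congr h _).self_of_nhds]

theorem constantCoeff_taylor (g : E → ℂ) : constantCoeff (taylor b y₀ g) = g y₀ := by
  rw [← coeff_zero_eq_constantCoeff_apply, coeff_taylor]
  simp [wordD]

/-- Derivatives of smooth germs commute, so the new direction may be moved to the innermost place of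
the word; the factorials absorb the factor from the power series derivative. -/
theorem pderiv_taylor {g : E → ℂ} (hg : SmoothNear y₀ g) (a : ι) :
    pderiv ℂ a (taylor b y₀ g) = taylor b y₀ (dirD (b a) g) := by
  classical
  ext1 γ
  rw [coeff_pderiv, coeff_taylor, coeff_taylor, ← wordD_append]
  have h1 : ((Finsupp.toMultiset (γ + Finsupp.single a 1)).toList).Perm
      ((Finsupp.toMultiset γ).toList ++ [a]) := by
    rw [← Multiset.coe_eq_coe, Multiset.coe_toList, map_add, Finsupp.toMultiset_single, one_smul,
      ← Multiset.coe_add, Multiset.coe_toList, Multiset.coe_singleton]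
  rw [(wordD_perm hg h1).self_of_nhds]
  have h2 : (∏ c, (((γ + Finsupp.single a 1 : ι →₀ ℕ) c).factorial : ℂ)) =
      (γ a + 1) * ∏ c, ((γ c).factorial : ℂ) := by
    rw [← Finset.mul_prod_erase _ _ (Finset.mem_univ a),
      ← Finset.mul_prod_erase Finset.univ (fun c => ((γ c).factorial : ℂ)) (Finset.mem_univ a),
      ← mul_assoc]
    congr 1
    · have : (γ + Finsupp.single a 1 : ι →₀ ℕ) a = γ a + 1 := by simp
      rw [this, Nat.factorial_succ]; push_cast; ring
    · refine Finset.prod_congr rfl fun c hc => ?_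
      have : (γ + Finsupp.single a 1 : ι →₀ ℕ) c = γ c := by
        simp [(Finset.ne_of_mem_erase hc).symm]
      rw [this]
  have h3 : (γ a + 1 : ℂ) ≠ 0 := Nat.cast_add_one_ne_zero _
  rw [h2, mul_inv]
  field_simp

theorem taylor_add {g h : E → ℂ} (hg : SmoothNear y₀ g) (hh : SmoothNear y₀ h) :
    taylor b y₀ (fun y => g y + h y) = taylor b y₀ g + taylor b y₀ h := by
  have key : ∀ (n : ℕ) (g h : E → ℂ), SmoothNear y₀ g → SmoothNear y₀ h → ∀ γ : ι →₀ ℕ,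
      γ.degree = n → coeff γ (taylor b y₀ (fun y => g y + h y)) =
        coeff γ (taylor b y₀ g + taylor b y₀ h) := by
    intro n
    induction n with
    | zero =>
      intro g h _ _ γ hγ
      rw [Finsupp.degree_eq_zero_iff] at hγ
      subst hγ
      simp only [coeff_zero_eq_constantCoeff_apply, map_add, constantCoeff_taylor]
    | succ n ih =>
      intro g h hg hh γ hγ
      refine coeff_eq_of_pderiv (fun a γ hγ => ?_) hγ
      rw [map_add (pderiv ℂ a), pderiv_taylor hg, pderiv_taylor hh, pderiv_taylor (hg.add hh),
        taylor_congr (dirD_add hg hh _)]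
      exact ih _ _ (hg.dirD _) (hh.dirD _) γ hγ
  ext1 γ
  exact key _ g h hg hh γ rfl

/-- Induction on the degree of the coefficient: both sides obey the same Leibniz rule under
derivatives and have the same value at the base point. -/
theorem taylor_mul {g h : E → ℂ} (hg : SmoothNear y₀ g) (hh : SmoothNear y₀ h) :
    taylor b y₀ (fun y => g y * h y) = taylor b y₀ g * taylor b y₀ h := by
  have key : ∀ (n : ℕ) (g h : E → ℂ), SmoothNear y₀ g → SmoothNear y₀ h → ∀ γ : ι →₀ ℕ,
      γ.degree = n → coeff γ (taylor b y₀ (fun y => g y * h y)) =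
        coeff γ (taylor b y₀ g * taylor b y₀ h) := by
    intro n
    induction n with
    | zero =>
      intro g h _ _ γ hγ
      rw [Finsupp.degree_eq_zero_iff] at hγ
      subst hγ
      simp only [coeff_zero_eq_constantCoeff_apply, map_mul, constantCoeff_taylor]
    | succ n ih =>
      intro g h hg hh γ hγ
      refine coeff_eq_of_pderiv (fun a γ hγ => ?_) hγ
      rw [Derivation.leibniz, smul_eq_mul, smul_eq_mul, pderiv_taylor hg, pderiv_taylor hh,
        pderiv_taylor (hg.mul hh), taylor_congr (dirD_mul hg hh _),
        taylor_add ((hg.dirD _).mul hh) (hg.mul (hh.dirD _)), map_add, map_add,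
        ih _ _ (hg.dirD _) hh γ hγ, ih _ _ hg (hh.dirD _) γ hγ,
        mul_comm (taylor b y₀ (dirD (b a) g)), add_comm]
  ext1 γ
  exact key _ g h hg hh γ rfl

theorem taylor_const (c : ℂ) : taylor b y₀ (fun _ => c) = C c := by
  have hz : ∀ w : E, dirD w (fun _ : E => c) = fun _ => 0 := by
    intro w; ext y; simp [dirD]
  have h0 : taylor b y₀ (fun _ => (0 : ℂ)) = 0 := by
    have := taylor_add (b := b) (y₀ := y₀) (SmoothNear.const (0 : ℂ)) (SmoothNear.const (0 : ℂ))
    simpa using this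
  refine ext_of_pderiv (by rw [constantCoeff_taylor]; simp) fun a => ?_
  rw [pderiv_taylor (SmoothNear.const c), hz, h0]
  simp

theorem taylor_sum {κ : Type*} {s : Finset κ} {g : κ → E → ℂ}
    (hg : ∀ k ∈ s, SmoothNear y₀ (g k)) :
    taylor b y₀ (fun y => ∑ k ∈ s, g k y) = ∑ k ∈ s, taylor b y₀ (g k) := by
  classical
  induction s using Finset.induction_on with
  | empty => simpa using taylor_const (b := b) (y₀ := y₀) 0
  | insert a s ha ih =>
    have h1 := fun k hk => hg k (Finset.mem_insert_of_mem hk)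
    simp only [Finset.sum_insert ha]
    rw [taylor_add (hg a (Finset.mem_insert_self _ _)) (SmoothNear.sum h1), ih h1]

theorem taylor_clm (φ : E →L[ℝ] ℂ) :
    taylor b y₀ (fun y => φ (y - y₀)) = ∑ a, φ (b a) • X a := by
  classical
  have hs : SmoothNear y₀ (fun y => φ (y - y₀)) :=
    ContDiff.smoothNear (φ.contDiff.comp (contDiff_id.sub contDiff_const))
  refine ext_of_pderiv ?_ fun a => ?_
  · rw [constantCoeff_taylor, map_sum]; simp
  · have : dirD (b a) (fun y => φ (y - y₀)) = fun _ => φ (b a) := by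
      ext y
      have : HasFDerivAt (fun y => φ (y - y₀)) φ y := by
        have h0 := φ.hasFDerivAt.comp y ((hasFDerivAt_id y).sub_const y₀)
        rwa [ContinuousLinearMap.comp_id] at h0
      rw [dirD, this.fderiv]
    rw [pderiv_taylor hs, this, taylor_const, map_sum, Finset.sum_eq_single a]
    · rw [Derivation.map_smul, pderiv_X_self, smul_eq_C_mul, mul_one]
    · intro c _ hc
      rw [Derivation.map_smul, pderiv_X_of_ne hc, smul_zero]
    · intro h; exact absurd (Finset.mem_univ a) h

theorem taylor_mem_orderGE_of_iteratedFDeriv {g : E → ℂ} (hg : ContDiff ℝ ∞ g) {k : ℕ}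
    (h : ∀ j < k, iteratedFDeriv ℝ j g y₀ = 0) : taylor b y₀ g ∈ orderGE ι k := by
  intro γ _ hγ
  have hl : (Finsupp.toMultiset γ).toList.length < k := by
    simp only at hγ
    rw [Multiset.length_toList, Finsupp.card_toMultiset]
    rw [Finsupp.degree] at hγ
    exact_mod_cast hγ
  rw [coeff_taylor, ← List.ofFn_get (Finsupp.toMultiset γ).toList, wordD_ofFn hg, h _ hl]
  simp

end Germs

end StarFOI

end

noncomputable section

namespace StarFOI

open MvPowerSeries Finset.HasAntidiagonal

/-! ### The lemmas of Hadamard and Borel -/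

section Hadamard

open MeasureTheory intervalIntegral

variable {E : Type} [NormedAddCommGroup E] [NormedSpace ℝ E] [FiniteDimensional ℝ E]

/-- The average of `t ^ k • G` along the segments issuing from the origin. -/
def radialMean {F : Type} [NormedAddCommGroup F] [NormedSpace ℝ F] (k : ℕ) (G : E → F) (u : E) : F :=
  ∫ t in (0 : ℝ)..1, t ^ k • G (t • u)

theorem hasFDerivAt_radialMean {F : Type} [NormedAddCommGroup F] [NormedSpace ℝ F] (k : ℕ)
    {G : E → F} (hG : ContDiff ℝ ∞ G) (u : E) :
    HasFDerivAt (radialMean k G) (radialMean (k + 1) (fderiv ℝ G) u) u := by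
  have hG' : Continuous (fderiv ℝ G) := hG.continuous_fderiv (by simp)
  have hc' : Continuous fun p : ℝ × E => p.1 ^ (k + 1) • fderiv ℝ G (p.1 • p.2) := by fun_prop
  have hGc : Continuous G := hG.continuous
  obtain ⟨C, hC⟩ := ((isCompact_Icc (a := (0 : ℝ)) (b := 1)).prod
    (isCompact_closedBall u 1)).exists_bound_of_continuousOn hc'.continuousOn
  refine hasFDerivAt_integral_of_dominated_of_fderiv_le (bound := fun _ => C)
    (F := fun u t => t ^ k • G (t • u)) (F' := fun u t => t ^ (k + 1) • fderiv ℝ G (t • u))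
    (Metric.closedBall_mem_nhds u one_pos) ?_ ?_ ?_ ?_ ?_ ?_
  · refine Filter.Eventually.of_forall fun x => Continuous.aestronglyMeasurable (by fun_prop)
  · exact Continuous.intervalIntegrable (by fun_prop) _ _
  · exact Continuous.aestronglyMeasurable (by fun_prop)
  · refine Filter.Eventually.of_forall fun t ht x hx => hC (t, x) ⟨?_, hx⟩
    rw [Set.uIoc_of_le zero_le_one] at ht
    exact ⟨ht.1.le, ht.2⟩
  · exact continuous_const.intervalIntegrable _ _
  · refine Filter.Eventually.of_forall fun t _ x _ => ?_
    have h1 : HasFDerivAt G (fderiv ℝ G (t • x)) (t • x) :=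
      (hG.differentiable (by simp) _).hasFDerivAt
    have h2 := (h1.comp x ((hasFDerivAt_id x).const_smul t)).const_smul (t ^ k)
    have h3 : t ^ k • (fderiv ℝ G (t • x)).comp (t • ContinuousLinearMap.id ℝ E) =
        t ^ (k + 1) • fderiv ℝ G (t • x) := by
      ext w
      simp [pow_succ, smul_smul]
    rw [h3] at h2
    exact h2

/-- The derivative of a radial mean is the radial mean of the derivative with one more factor `t`,
so induction on the order works once the target space varies. -/
theorem contDiff_radialMean (n k : ℕ) {F : Type} [NormedAddCommGroup F] [NormedSpace ℝ F]
    {G : E → F} (hG : ContDiff ℝ ∞ G) : ContDiff ℝ n (radialMean k G) := by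
  induction n generalizing k F with
  | zero =>
    rw [Nat.cast_zero, contDiff_zero, continuous_iff_continuousAt]
    exact fun u => (hasFDerivAt_radialMean k hG u).continuousAt
  | succ n ih =>
    rw [Nat.cast_succ, contDiff_succ_iff_hasFDerivAt]
    exact ⟨radialMean (k + 1) (fderiv ℝ G), ih (k + 1) (hG.fderiv_right (by simp)),
      hasFDerivAt_radialMean k hG⟩

/-- Hadamard's lemma. -/
theorem exists_hadamard {ι : Type*} [Fintype ι] (b : Module.Basis ι ℝ E) (y₀ : E) {g : E → ℂ}
    (hg : ContDiff ℝ ∞ g) : ∃ h : ι → E → ℂ, (∀ a, ContDiff ℝ ∞ (h a)) ∧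
      ∀ y, g y = g y₀ + ∑ a, ((b.repr (y - y₀) a : ℝ) : ℂ) * h a y := by
  set g₀ : E → ℂ := fun u => g (u + y₀) with hg₀
  have hg₀' : ContDiff ℝ ∞ g₀ := hg.comp (contDiff_id.add contDiff_const)
  have hw : ∀ w : E, ContDiff ℝ ∞ (fun u => fderiv ℝ g₀ u w) := fun w =>
    (hg₀'.fderiv_right (by simp)).clm_apply contDiff_const
  refine ⟨fun a y => radialMean 0 (fun u => fderiv ℝ g₀ u (b a)) (y - y₀), fun a => ?_, fun y => ?_⟩
  · have h1 : ContDiff ℝ ∞ (radialMean 0 (fun u => fderiv ℝ g₀ u (b a))) :=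
      contDiff_iff_forall_nat_le.mpr fun m _ => contDiff_radialMean m 0 (hw _)
    exact h1.comp (contDiff_id.sub contDiff_const)
  · have hcont : ∀ w : E, Continuous fun t : ℝ => fderiv ℝ g₀ (t • (y - y₀)) w := fun w =>
      (hw w).continuous.comp (by fun_prop)
    have h1 : ∫ t in (0 : ℝ)..1, fderiv ℝ g₀ (t • (y - y₀)) (y - y₀) = g y - g y₀ := by
      have h2 := integral_eq_sub_of_hasDerivAt (a := 0) (b := 1)
        (f := fun t : ℝ => g₀ (t • (y - y₀)))
        (f' := fun t => fderiv ℝ g₀ (t • (y - y₀)) (y - y₀)) (fun t _ => ?_)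
        ((hcont _).intervalIntegrable _ _)
      · rw [h2]; simp [hg₀]
      · have h3 : HasFDerivAt g₀ (fderiv ℝ g₀ (t • (y - y₀))) (t • (y - y₀)) :=
          (hg₀'.differentiable (by simp) _).hasFDerivAt
        have h4 : HasDerivAt (fun t : ℝ => t • (y - y₀)) (y - y₀) t := by
          simpa using (hasDerivAt_id t).smul_const (y - y₀)
        exact HasFDerivAt.comp_hasDerivAt (l := g₀) t h3 h4
    have h5 : ∀ t : ℝ, fderiv ℝ g₀ (t • (y - y₀)) (y - y₀) =
        ∑ a, ((b.repr (y - y₀) a : ℝ) : ℂ) * fderiv ℝ g₀ (t • (y - y₀)) (b a) := by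
      intro t
      nth_rewrite 2 [← b.sum_repr (y - y₀)]
      rw [map_sum]
      simp
    rw [← sub_eq_iff_eq_add', ← h1]
    simp only [h5]
    rw [integral_finsetSum (fun a _ => ((hcont _).const_mul _).intervalIntegrable _ _)]
    simp [radialMean]

end Hadamard

section Borel

variable {E : Type} [NormedAddCommGroup E] [NormedSpace ℝ E] {ι : Type*}

theorem contDiff_aeval {z : ι → E → ℂ} (hz : ∀ a, ContDiff ℝ ∞ (z a)) (p : MvPolynomial ι ℂ) :
    ContDiff ℝ ∞ fun y => MvPolynomial.aeval (fun a => z a y) p := by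
  induction p using MvPolynomial.induction_on with
  | C c => simpa using contDiff_const
  | add p q hp hq => simpa using hp.add hq
  | mul_X p a hp => simpa using hp.mul (hz a)

/-- The coordinates with respect to a basis, as complex functionals. -/
def coordC [FiniteDimensional ℝ E] (b : Module.Basis ι ℝ E) (a : ι) : E →L[ℝ] ℂ :=
  Complex.ofRealCLM.comp (LinearMap.toContinuousLinearMap (b.coord a))

theorem coordC_apply [FiniteDimensional ℝ E] (b : Module.Basis ι ℝ E) (a : ι) (y : E) :
    coordC b a y = ((b.repr y a : ℝ) : ℂ) := rfl

variable [Fintype ι]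

theorem taylor_translate (b : ι → E) (y₀ : E) (g : E → ℂ) :
    taylor b y₀ (fun y => g (y - y₀)) = taylor b 0 g := by
  have key : ∀ l : List ι, wordD b l (fun y => g (y - y₀)) = fun y => wordD b l g (y - y₀) := by
    intro l
    induction l with
    | nil => rfl
    | cons a l ih =>
      rw [wordD, ih]
      ext y
      rw [dirD, fderiv_comp_sub (f := wordD b l g)]
      rfl
  ext1 γ
  rw [coeff_taylor, coeff_taylor, key]
  simp only [sub_self]

/-- A multilinear map is determined on basis vectors, where the iterated derivative is, up to order
and a factorial, a Taylor coefficient. -/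
theorem iteratedFDeriv_eq_zero_of_taylor (b : Module.Basis ι ℝ E) {y₀ : E} {g : E → ℂ}
    (hg : ContDiff ℝ ∞ g) {k : ℕ} (h : taylor b y₀ g ∈ orderGE ι k) {j : ℕ} (hj : j < k) :
    iteratedFDeriv ℝ j g y₀ = 0 := by
  classical
  refine ContinuousMultilinearMap.toMultilinearMap_injective
    (Module.Basis.ext_multilinear (fun _ => b) fun v => ?_)
  have h1 : wordD b (List.ofFn v) g y₀ = 0 := by
    let γ : ι →₀ ℕ := Multiset.toFinsupp (List.ofFn v : Multiset ι)
    have hγ : γ.degree < k := by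
      have h0 : γ.degree = Multiset.card (Finsupp.toMultiset γ) := by
        rw [Finsupp.card_toMultiset]; rfl
      rw [h0, Multiset.toFinsupp_toMultiset]
      simpa using hj
    have h2 := h γ trivial (by simp only; exact_mod_cast hγ)
    rw [coeff_taylor, mul_eq_zero] at h2
    have h3 := h2.resolve_left (inv_ne_zero (Finset.prod_ne_zero_iff.mpr fun a _ => by
      exact_mod_cast Nat.factorial_ne_zero _))
    rw [← h3]
    refine (wordD_perm (ContDiff.smoothNear hg) ?_).self_of_nhds
    rw [← Multiset.coe_eq_coe, Multiset.coe_toList, Multiset.toFinsupp_toMultiset]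
  rw [wordD_ofFn hg] at h1
  exact h1

theorem taylor_aeval {b : ι → E} {y₀ : E} {z : ι → E → ℂ} (hz : ∀ a, ContDiff ℝ ∞ (z a))
    (hT : ∀ a, taylor b y₀ (z a) = X a) (p : MvPolynomial ι ℂ) :
    taylor b y₀ (fun y => MvPolynomial.aeval (fun a => z a y) p) = p := by
  induction p using MvPolynomial.induction_on with
  | C c => simpa using taylor_const c
  | add p q hp hq =>
    simp only [map_add]
    rw [taylor_add (ContDiff.smoothNear (contDiff_aeval hz p))
      (ContDiff.smoothNear (contDiff_aeval hz q)), hp, hq, MvPolynomial.coe_add]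
  | mul_X p a hp =>
    simp only [map_mul, MvPolynomial.aeval_X]
    rw [taylor_mul (ContDiff.smoothNear (contDiff_aeval hz p)) (ContDiff.smoothNear (hz a)), hp,
      hT, MvPolynomial.coe_mul, MvPolynomial.coe_X]

theorem aeval_smul_of_isHomogeneous {m : ℕ} {p : MvPolynomial ι ℂ} (hp : p.IsHomogeneous m)
    (r : ℂ) (x : ι → ℂ) :
    MvPolynomial.aeval (fun a => r * x a) p = r ^ m * MvPolynomial.aeval x p := by
  simp only [MvPolynomial.aeval_def, MvPolynomial.eval₂_eq', Finset.mul_sum]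
  refine Finset.sum_congr rfl fun d hd => ?_
  have h1 : d.degree = m := by
    have := hp (MvPolynomial.mem_support_iff.mp hd)
    change Finsupp.weight (fun _ => 1) d = m at this
    rwa [← Finsupp.degree_eq_weight_one] at this
  simp only [mul_pow, Finset.prod_mul_distrib]
  rw [Finset.prod_pow_eq_pow_sum, ← Finsupp.degree_eq_sum, h1]
  ring

variable [FiniteDimensional ℝ E]

theorem taylor_coordC (b : Module.Basis ι ℝ E) (y₀ : E) (a : ι) :
    taylor b y₀ (fun y => coordC b a (y - y₀)) = X a := by
  classical
  rw [taylor_clm, Finset.sum_eq_single a]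
  · simp [coordC_apply]
  · intro c _ hc
    simp [coordC_apply, hc]
  · intro h; exact absurd (Finset.mem_univ a) h

/-- A function with a given homogeneous Taylor polynomial and small derivatives of low order. -/
theorem exists_small_homogeneous (b : Module.Basis ι ℝ E) (m : ℕ) (p : MvPolynomial ι ℂ)
    (hp : p.IsHomogeneous m) : ∃ f : E → ℂ, ContDiff ℝ ∞ f ∧ taylor b 0 f = p ∧
      ∀ j < m, ∀ y, ‖iteratedFDeriv ℝ j f y‖ ≤ (1 / 2 : ℝ) ^ m := by
  have hz : ∀ a, ContDiff ℝ ∞ fun y : E => coordC b a y := fun a => (coordC b a).contDiff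
  let P : E → ℂ := fun y => MvPolynomial.aeval (fun a => coordC b a y) p
  have hP : ContDiff ℝ ∞ P := contDiff_aeval hz p
  let χ : ContDiffBump (0 : E) := ⟨1, 2, one_pos, one_lt_two⟩
  let h : E → ℂ := fun u => (χ u : ℝ) • P u
  have hh : ContDiff ℝ ∞ h := χ.contDiff.smul hP
  have hsupp : HasCompactSupport h := χ.hasCompactSupport.smul_right
  have hbd : ∀ j, ∃ M, ∀ y, ‖iteratedFDeriv ℝ j h y‖ ≤ M := fun j =>
    (hh.continuous_iteratedFDeriv (by exact_mod_cast le_top)).bounded_above_of_compact_support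
      (hsupp.iteratedFDeriv j)
  choose M hM using hbd
  have hM0 : ∀ j, 0 ≤ M j := fun j => (norm_nonneg _).trans (hM j 0)
  let B : ℝ := ∑ j ∈ Finset.range m, M j
  have hB : ∀ j < m, M j ≤ B := fun j hj =>
    Finset.single_le_sum (fun i _ => hM0 i) (Finset.mem_range.mpr hj)
  -- Rescaling to `R⁻ᵐ h(R u)` keeps the degree `m` Taylor part and multiplies the `j`-th derivative
  -- by `R^{j-m} ≤ R⁻¹` for `j < m`; `R ≥ 2ᵐ B` gives the bound `2⁻ᵐ`.
  let R : ℝ := max 1 (2 ^ m * B)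
  have hR1 : 1 ≤ R := le_max_left _ _
  have hR0 : 0 < R := by linarith
  have hRB : 2 ^ m * B ≤ R := le_max_right _ _
  refine ⟨fun u => (R ^ m)⁻¹ • h (R • u), (hh.comp (contDiff_id.const_smul R)).const_smul _,
    ?_, fun j hj y => ?_⟩
  · have hT : taylor b 0 P = p := by
      refine taylor_aeval hz (fun a => ?_) p
      have := taylor_coordC b 0 a
      simpa using this
    rw [← hT]
    refine taylor_congr ?_
    have h1 : ∀ᶠ u in 𝓝 (0 : E), χ (R • u) = 1 := by
      have hc : Filter.Tendsto (fun u : E => R • u) (𝓝 0) (𝓝 0) := by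
        have : Continuous fun u : E => R • u := by fun_prop
        simpa using this.tendsto 0
      exact hc.eventually χ.eventuallyEq_one
    filter_upwards [h1] with u hu
    simp only [h, P, hu, one_smul]
    have h2 : (fun a => coordC b a (R • u)) = fun a => (R : ℂ) * coordC b a u := by
      ext a; simp
    rw [h2, aeval_smul_of_isHomogeneous hp, Complex.real_smul]
    have hRC : (R : ℂ) ≠ 0 := by exact_mod_cast hR0.ne'
    push_cast
    field_simp
  · have h1 : iteratedFDeriv ℝ j (fun u => (R ^ m)⁻¹ • h (R • u)) y =
        (R ^ m)⁻¹ • R ^ j • iteratedFDeriv ℝ j h (R • y) := by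
      have hj' : ContDiff ℝ j h := hh.of_le (by exact_mod_cast le_top)
      have hc : ContDiff ℝ j (fun u => h (R • u)) := hj'.comp (contDiff_id.const_smul R)
      rw [iteratedFDeriv_const_smul_apply' hc.contDiffAt]
      congr 1
      exact congrFun (iteratedFDeriv_comp_const_smul R hj') y
    rw [h1, norm_smul, norm_smul, Real.norm_of_nonneg (by positivity),
      Real.norm_of_nonneg (by positivity)]
    calc (R ^ m)⁻¹ * (R ^ j * ‖iteratedFDeriv ℝ j h (R • y)‖)
        ≤ (R ^ m)⁻¹ * (R ^ (m - 1) * B) := by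
          gcongr
          · omega
          · exact (hM j _).trans (hB j hj)
      _ ≤ (1 / 2 : ℝ) ^ m := by
          obtain ⟨k, rfl⟩ : ∃ k, m = k + 1 := ⟨m - 1, by omega⟩
          rw [Nat.add_sub_cancel, pow_succ R, one_div, inv_pow]
          rw [← div_eq_inv_mul, div_le_iff₀ (by positivity), inv_mul_eq_div,
            le_div_iff₀ (by positivity)]
          calc R ^ k * B * 2 ^ (k + 1) = R ^ k * (2 ^ (k + 1) * B) := by ring
            _ ≤ R ^ k * R := by gcongr

/-- Sum realizations of the homogeneous parts of `G` whose derivatives of order `j` are bounded by a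
geometric series once `m > j`. The sum is then smooth, and each tail vanishes to the order where it
starts. -/
theorem exists_taylor_eq_zero (b : Module.Basis ι ℝ E) (G : MvPowerSeries ι ℂ) :
    ∃ g : E → ℂ, ContDiff ℝ ∞ g ∧ taylor b 0 g = G := by
  have hp : ∀ m, (G.truncTotal (m + 1) - G.truncTotal m).IsHomogeneous m := by
    intro m γ hγ
    rw [MvPolynomial.coeff_sub, coeff_truncTotal_eq_ite, coeff_truncTotal_eq_ite] at hγ
    change Finsupp.weight (fun _ => 1) γ = m
    rw [← Finsupp.degree_eq_weight_one]
    by_contra hne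
    apply hγ
    by_cases h : γ.degree < m
    · rw [if_pos h, if_pos (by omega), sub_self]
    · rw [if_neg h, if_neg (fun h' => hne (by change γ.degree = m; omega)), sub_self]
  choose f hf hT hb using fun m => exists_small_homogeneous b m _ (hp m)
  have hgeo : Summable fun m : ℕ => (1 / 2 : ℝ) ^ m := summable_geometric_two
  have hsm : ∀ k : ℕ, ContDiff ℝ ∞ fun y => ∑' m, f (m + k) y := by
    intro k
    refine contDiff_tsum_of_eventually (N := ⊤) (v := fun _ m => (1 / 2 : ℝ) ^ m)
      (fun m => hf (m + k)) (fun _ _ => hgeo) fun j _ => ?_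
    rw [Nat.cofinite_eq_atTop]
    filter_upwards [Filter.eventually_gt_atTop j] with m hm y
    refine (hb (m + k) j (by omega) y).trans ?_
    exact pow_le_pow_of_le_one (by norm_num) (by norm_num) (by omega)
  have hsum : ∀ y, Summable fun m => f m y := by
    intro y
    rw [← summable_nat_add_iff 1]
    refine Summable.of_norm_bounded ((summable_nat_add_iff 1).mpr hgeo) fun m => ?_
    have := hb (m + 1) 0 (by omega) y
    rwa [norm_iteratedFDeriv_zero] at this
  have hsplit : ∀ k : ℕ, (fun y => ∑' m, f m y) =
      fun y => ∑ m ∈ Finset.range k, f m y + ∑' m, f (m + k) y := by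
    intro k
    ext y
    exact ((hsum y).sum_add_tsum_nat_add k).symm
  -- All derivatives of order below `k` may be taken term by term, and each term of the tail has a
  -- Taylor polynomial of degree at least `k`.
  have htail : ∀ k : ℕ, taylor b 0 (fun y => ∑' m, f (m + k) y) ∈ orderGE ι k := by
    intro k
    refine taylor_mem_orderGE_of_iteratedFDeriv (hsm k) fun j hj => ?_
    rw [iteratedFDeriv_tsum_apply (N := (j : ℕ∞)) (v := fun _ m => (1 / 2 : ℝ) ^ m)
      (fun m => (hf (m + k)).of_le (by exact_mod_cast le_top)) (fun _ _ => hgeo) ?_ le_rfl]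
    · refine (tsum_congr fun m => ?_).trans tsum_zero
      refine iteratedFDeriv_eq_zero_of_taylor b (hf _) (k := m + k) ?_ (by omega)
      rw [hT]
      intro γ _ hγ
      rw [MvPolynomial.coeff_coe]
      refine (hp (m + k)).coeff_eq_zero fun h => ?_
      simp only at hγ
      rw [h] at hγ; omega
    · intro i m y hi
      refine (hb (m + k) i ?_ y).trans
        (pow_le_pow_of_le_one (by norm_num) (by norm_num) (by omega))
      have : i ≤ j := by exact_mod_cast hi
      omega
  refine ⟨fun y => ∑' m, f m y, by simpa using hsm 0, ?_⟩
  rw [← sub_eq_zero]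
  refine eq_zero_of_forall_orderGE fun k => ?_
  have h1 : taylor b 0 (fun y => ∑' m, f m y) = (G.truncTotal k : MvPowerSeries ι ℂ) +
      taylor b 0 (fun y => ∑' m, f (m + k) y) := by
    rw [hsplit k, taylor_add (SmoothNear.sum fun m _ => ContDiff.smoothNear (hf m))
      (ContDiff.smoothNear (hsm k)), taylor_sum fun m _ => ContDiff.smoothNear (hf m)]
    congr 1
    simp only [hT]
    induction k with
    | zero =>
      rw [Finset.sum_range_zero]
      ext γ
      rw [MvPolynomial.coeff_coe, coeff_truncTotal_eq_zero _ (by omega), map_zero]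
    | succ k ih =>
      have hc := map_sub MvPolynomial.coeToMvPowerSeries.ringHom (G.truncTotal (k + 1))
        (G.truncTotal k)
      simp only [MvPolynomial.coeToMvPowerSeries.ringHom_apply] at hc
      rw [Finset.sum_range_succ, ih, hc]; ring
  rw [h1]
  have h2 := AddSubgroup.sub_mem _ (htail k) (sub_truncTotal_mem_orderGE k G)
  convert h2 using 1
  ring

/-- Borel's lemma. -/
theorem exists_taylor_eq (b : Module.Basis ι ℝ E) (y₀ : E) (G : MvPowerSeries ι ℂ) :
    ∃ g : E → ℂ, ContDiff ℝ ∞ g ∧ taylor b y₀ g = G := by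
  obtain ⟨g, hg, hT⟩ := exists_taylor_eq_zero b G
  exact ⟨fun y => g (y - y₀), hg.comp (contDiff_id.sub contDiff_const),
    (taylor_translate _ _ _).trans hT⟩

end Borel

end StarFOI

end

noncomputable section

namespace StarFOI

open MvPowerSeries Finset.HasAntidiagonal

/-! ### Jets of smooth functions on a manifold -/

section Cutoff

variable {E : Type} [NormedAddCommGroup E] [NormedSpace ℝ E] [FiniteDimensional ℝ E]

theorem SmoothNear.exists_contDiff {y₀ : E} {g : E → ℂ} (hg : SmoothNear y₀ g) :
    ∃ g' : E → ℂ, ContDiff ℝ ∞ g' ∧ g' =ᶠ[𝓝 y₀] g := by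
  obtain ⟨r, hr, hball⟩ := Metric.eventually_nhds_iff_ball.mp hg
  let χ : ContDiffBump y₀ := ⟨r / 3, r / 2, by positivity, by linarith⟩
  refine ⟨fun y => (χ y : ℝ) • g y, ?_, ?_⟩
  · rw [contDiff_iff_contDiffAt]
    intro y
    by_cases hy : y ∈ Metric.ball y₀ r
    · exact χ.contDiff.contDiffAt.smul (hball y hy)
    · have h1 : y ∉ tsupport χ := by
        rw [χ.tsupport_eq]
        intro h
        exact hy (Metric.closedBall_subset_ball (by simp only [χ]; linarith) h)
      have h2 : (fun y => (χ y : ℝ) • g y) =ᶠ[𝓝 y] fun _ => 0 := by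
        filter_upwards [notMem_tsupport_iff_eventuallyEq.mp h1] with w hw
        rw [hw]; simp
      exact contDiffAt_const.congr_of_eventuallyEq h2
  · filter_upwards [χ.eventuallyEq_one] with y hy
    rw [hy]; simp

end Cutoff

section Jets

set_option linter.unusedSectionVars false

variable {E : Type} [NormedAddCommGroup E] [NormedSpace ℝ E]
  {H : Type*} [TopologicalSpace H] {J : ModelWithCorners ℝ E H}
  {N : Type*} [TopologicalSpace N] [ChartedSpace H N] {x₀ : N}

/-- A function in the preferred chart at `x₀`. -/
def inChart (f : SmoothFn J N) (x₀ : N) : E → ℂ := fun y => f ((extChartAt J x₀).symm y)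

theorem inChart_self (f : SmoothFn J N) : inChart f x₀ (extChartAt J x₀ x₀) = f x₀ := by
  rw [inChart, extChartAt_to_inv]

theorem eventually_of_inChart {p : N → Prop}
    (h : ∀ᶠ y in 𝓝 (extChartAt J x₀ x₀), p ((extChartAt J x₀).symm y)) : ∀ᶠ x in 𝓝 x₀, p x := by
  have h1 := (continuousAt_extChartAt (I := J) x₀).eventually h
  filter_upwards [h1, extChartAt_source_mem_nhds (I := J) x₀] with x h2 h3
  rwa [(extChartAt J x₀).left_inv h3] at h2

theorem vanishesToOrder_zero (f : SmoothFn J N) (x : N) : VanishesToOrder 0 f x := by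
  rw [VanishesToOrder, pow_zero, Ideal.one_eq_top]; trivial

theorem mem_vanishingIdeal {f : SmoothFn J N} {x : N} :
    f ∈ (vanishingIdeal x : Ideal (SmoothFn J N)) ↔ f x = 0 := Iff.rfl

theorem vanishesToOrder_one {f : SmoothFn J N} {x : N} : VanishesToOrder 1 f x ↔ f x = 0 := by
  rw [VanishesToOrder, pow_one, mem_vanishingIdeal]

theorem VanishesToOrder.mono {f : SmoothFn J N} {x : N} {k l : ℕ} (h : VanishesToOrder k f x)
    (hl : l ≤ k) : VanishesToOrder l f x := Ideal.pow_le_pow_right hl h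

variable [IsManifold J ∞ N] [J.Boundaryless]

theorem smoothNear_inChart (f : SmoothFn J N) (x₀ : N) :
    SmoothNear (extChartAt J x₀ x₀) (inChart f x₀) := by
  have h := (f.contMDiff.comp_contMDiffOn (contMDiffOn_extChartAt_symm (I := J) x₀)).contDiffOn
  exact ContDiffOn.smoothNear h (isOpen_extChartAt_target x₀) (mem_extChartAt_target x₀)

variable {ι : Type*} [Fintype ι] (b : Module.Basis ι ℝ E)

/-- The Taylor series at `x₀` of a smooth function in the preferred chart. -/
def jet (x₀ : N) : SmoothFn J N →ₐ[ℂ] MvPowerSeries ι ℂ where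
  toFun f := taylor b (extChartAt J x₀ x₀) (inChart f x₀)
  map_one' := (taylor_const 1).trans (by simp)
  map_mul' f g := taylor_mul (smoothNear_inChart f x₀) (smoothNear_inChart g x₀)
  map_zero' := (taylor_const 0).trans (by simp)
  map_add' f g := taylor_add (smoothNear_inChart f x₀) (smoothNear_inChart g x₀)
  commutes' c := taylor_const c

variable {b}

theorem jet_apply (f : SmoothFn J N) :
    jet b x₀ f = taylor b (extChartAt J x₀ x₀) (inChart f x₀) := rfl

theorem constantCoeff_jet (f : SmoothFn J N) : constantCoeff (jet b x₀ f) = f x₀ := by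
  rw [jet_apply, constantCoeff_taylor, inChart_self]

theorem jet_congr {f : SmoothFn J N} {g : E → ℂ} (h : inChart f x₀ =ᶠ[𝓝 (extChartAt J x₀ x₀)] g) :
    jet b x₀ f = taylor b (extChartAt J x₀ x₀) g := by
  rw [jet_apply, taylor_congr h]

theorem VanishesToOrder.jet_mem {f : SmoothFn J N} {k : ℕ} (h : VanishesToOrder k f x₀) :
    jet b x₀ f ∈ orderGE ι k := by
  induction k generalizing f with
  | zero => exact orderGE_zero _
  | succ k ih =>
    rw [VanishesToOrder, pow_succ] at h
    refine Submodule.mul_induction_on h (fun p hp q hq => ?_) fun p q hp hq => ?_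
    · have hq' : jet b x₀ q ∈ orderGE ι 1 := by
        intro γ _ hγ
        have h0 : γ = 0 := by
          rw [← Finsupp.degree_eq_zero_iff]
          simp only at hγ; omega
        rw [h0, coeff_zero_eq_constantCoeff_apply, constantCoeff_jet]
        exact hq
      rw [map_mul]
      exact filt_mono (by push_cast; omega) (orderGE_mul (ih hp) hq')
    · rw [map_add]; exact AddSubgroup.add_mem _ hp hq

variable [FiniteDimensional ℝ E] [T2Space N]

/-- Two cutoffs are needed: one in the model space to make the germ globally smooth there, and one
on the manifold to extend the result outside the chart. -/
theorem exists_inChart_eq {g : E → ℂ} (hg : SmoothNear (extChartAt J x₀ x₀) g) :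
    ∃ f : SmoothFn J N, inChart f x₀ =ᶠ[𝓝 (extChartAt J x₀ x₀)] g := by
  obtain ⟨g', hg', he⟩ := hg.exists_contDiff
  obtain ⟨χ⟩ : Nonempty (SmoothBumpFunction J x₀) := inferInstance
  have h1 : ContMDiffOn J 𝓘(ℝ, ℂ) ∞ (fun x => g' (extChartAt J x₀ x)) (chartAt H x₀).source :=
    hg'.contMDiff.comp_contMDiffOn (contMDiffOn_extChartAt (I := J) (x := x₀))
  refine ⟨⟨fun x => χ x • g' (extChartAt J x₀ x), χ.contMDiff_smul h1⟩, ?_⟩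
  have h2 : ∀ᶠ y in 𝓝 (extChartAt J x₀ x₀), χ ((extChartAt J x₀).symm y) = 1 := by
    have hc : Filter.Tendsto (extChartAt J x₀).symm (𝓝 (extChartAt J x₀ x₀)) (𝓝 x₀) := by
      have := (continuousAt_extChartAt_symm (I := J) x₀).tendsto
      rwa [extChartAt_to_inv] at this
    exact hc.eventually χ.eventuallyEq_one
  filter_upwards [h2, he, extChartAt_target_mem_nhds (I := J) x₀] with y h3 h4 h5
  change χ ((extChartAt J x₀).symm y) • g' (extChartAt J x₀ ((extChartAt J x₀).symm y)) = g y
  rw [h3, one_smul, (extChartAt J x₀).right_inv h5, h4]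

/-- Borel's lemma on a manifold. -/
theorem jet_surjective (x₀ : N) :
    Function.Surjective (jet b x₀ : SmoothFn J N →ₐ[ℂ] MvPowerSeries ι ℂ) := by
  intro G
  obtain ⟨g, hg, hT⟩ := exists_taylor_eq b (extChartAt J x₀ x₀) G
  obtain ⟨f, hf⟩ := exists_inChart_eq (J := J) (N := N) (x₀ := x₀) (ContDiff.smoothNear hg)
  exact ⟨f, by rw [jet_congr hf, hT]⟩

/-- A function which vanishes near `x₀` vanishes to every order. -/
theorem vanishesToOrder_of_eventually {f : SmoothFn J N} (h : ∀ᶠ x in 𝓝 x₀, f x = 0) (k : ℕ) :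
    VanishesToOrder k f x₀ := by
  obtain ⟨χ, -, hχ⟩ := (SmoothBumpFunction.nhds_basis_support (I := J) h).mem_iff.mp h
  -- `η = 1 - χ` vanishes at the point and equals `1` wherever `f` is nonzero, so `f = η^k f` lies
  -- in every power of the ideal.
  let η : SmoothFn J N := ⟨fun x => ((1 - χ x : ℝ) : ℂ),
    (Complex.ofRealCLM.contDiff.contMDiff).comp
      (contMDiff_const.sub χ.contMDiff)⟩
  have hη : η ∈ (vanishingIdeal x₀ : Ideal (SmoothFn J N)) := by
    rw [mem_vanishingIdeal]
    change ((1 - χ x₀ : ℝ) : ℂ) = 0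
    rw [χ.eq_one]; simp
  have hf : η * f = f := by
    ext x
    change ((1 - χ x : ℝ) : ℂ) * f x = f x
    by_cases hx : x ∈ Function.support χ
    · have : f x = 0 := hχ hx
      rw [this, mul_zero]
    · rw [Function.notMem_support.mp hx]; simp
  have hfk : ∀ k : ℕ, η ^ k * f = f := by
    intro k
    induction k with
    | zero => rw [pow_zero, one_mul]
    | succ k ih => rw [pow_succ, mul_assoc, hf, ih]
  rw [VanishesToOrder, ← hfk k]
  exact Ideal.mul_mem_right _ _ (Ideal.pow_mem_pow hη k)

/-- The functions `z a` are the coordinates of the preferred chart near `x₀`, centered at `x₀`. -/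
def IsCoord (b : Module.Basis ι ℝ E) (x₀ : N) (z : ι → SmoothFn J N) : Prop :=
  ∀ a, inChart (z a) x₀ =ᶠ[𝓝 (extChartAt J x₀ x₀)] fun y => coordC b a (y - extChartAt J x₀ x₀)

theorem exists_isCoord (b : Module.Basis ι ℝ E) (x₀ : N) :
    ∃ z : ι → SmoothFn J N, IsCoord b x₀ z := by
  have h : ∀ a, ∃ f : SmoothFn J N, inChart f x₀ =ᶠ[𝓝 (extChartAt J x₀ x₀)]
      fun y => coordC b a (y - extChartAt J x₀ x₀) := fun a =>
    exists_inChart_eq (ContDiff.smoothNear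
      ((coordC b a).contDiff.comp (contDiff_id.sub contDiff_const)))
  choose z hz using h
  exact ⟨z, hz⟩

variable {z : ι → SmoothFn J N}

theorem IsCoord.jet (hz : IsCoord b x₀ z) (a : ι) : jet b x₀ (z a) = X a := by
  rw [jet_congr (hz a), taylor_coordC]

theorem IsCoord.apply_self (hz : IsCoord b x₀ z) (a : ι) : z a x₀ = 0 := by
  rw [← constantCoeff_jet (b := b), hz.jet]; simp

theorem IsCoord.jet_aeval (hz : IsCoord b x₀ z) (p : MvPolynomial ι ℂ) :
    StarFOI.jet b x₀ (MvPolynomial.aeval z p) = p := by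
  induction p using MvPolynomial.induction_on with
  | C c => rw [MvPolynomial.aeval_C, AlgHom.commutes, MvPolynomial.coe_C]; rfl
  | add p q hp hq => rw [map_add, map_add, hp, hq, MvPolynomial.coe_add]
  | mul_X p a hp =>
    rw [map_mul, map_mul, hp, MvPolynomial.aeval_X, hz.jet, MvPolynomial.coe_mul,
      MvPolynomial.coe_X]

/-- Taylor's formula. -/
theorem IsCoord.exists_aeval (hz : IsCoord b x₀ z) (k : ℕ) (f : SmoothFn J N) :
    ∃ p : MvPolynomial ι ℂ, VanishesToOrder k (f - MvPolynomial.aeval z p) x₀ := by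
  induction k generalizing f with
  | zero => exact ⟨0, vanishesToOrder_zero _ _⟩
  | succ k ih =>
    obtain ⟨g', hg', he⟩ := (smoothNear_inChart f x₀).exists_contDiff
    obtain ⟨h, hh, hg⟩ := exists_hadamard b (extChartAt J x₀ x₀) hg'
    choose g hgh using fun a => exists_inChart_eq (x₀ := x₀) (N := N) (J := J)
      (ContDiff.smoothNear (hh a))
    choose p hp using fun a => ih (g a)
    refine ⟨MvPolynomial.C (f x₀) + ∑ a, MvPolynomial.X a * p a, ?_⟩
    have h1 : VanishesToOrder (k + 1)
        (f - (algebraMap ℂ (SmoothFn J N) (f x₀) + ∑ a, z a * g a)) x₀ := by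
      refine vanishesToOrder_of_eventually (eventually_of_inChart (J := J) ?_) _
      filter_upwards [he, Filter.eventually_all.mpr hgh, Filter.eventually_all.mpr hz]
        with y e1 e2 e3
      have e4 := hg y
      rw [e1] at e4
      have e5 : g' (extChartAt J x₀ x₀) = f x₀ := by
        rw [he.self_of_nhds, inChart_self]
      have e6 : (f - (algebraMap ℂ (SmoothFn J N) (f x₀) + ∑ a, z a * g a))
          ((extChartAt J x₀).symm y) =
          inChart f x₀ y - (f x₀ + ∑ a, inChart (z a) x₀ y * inChart (g a) x₀ y) := by
        have : ∀ (s : Finset ι) (F : ι → SmoothFn J N) (x : N), (∑ a ∈ s, F a) x = ∑ a ∈ s, F a x :=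
          fun s F x => map_sum (ContMDiffMap.evalRingHom (n := ∞) (I := J) (I' := 𝓘(ℝ, ℂ))
            (R := ℂ) x) F s
        change f _ - (f x₀ + (∑ a, z a * g a) _) = _
        rw [this]
        rfl
      rw [e6, e4, e5]
      simp only [e2, e3, coordC_apply, sub_self]
    have h2 : f - MvPolynomial.aeval z (MvPolynomial.C (f x₀) + ∑ a, MvPolynomial.X a * p a) =
        (f - (algebraMap ℂ (SmoothFn J N) (f x₀) + ∑ a, z a * g a)) +
          ∑ a, z a * (g a - MvPolynomial.aeval z (p a)) := by
      rw [map_add, map_sum, MvPolynomial.aeval_C]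
      simp only [map_mul, MvPolynomial.aeval_X, mul_sub, Finset.sum_sub_distrib]
      ring
    rw [h2]
    refine Ideal.add_mem _ h1 (Ideal.sum_mem _ fun a _ => ?_)
    rw [pow_succ']
    exact Ideal.mul_mem_mul (hz.apply_self a) (hp a)

/-- Taylor's formula reduces the converse to polynomials in the coordinates, for which low
coefficients vanish exactly when all monomials lie in the power of the vanishing ideal. It links the
algebraic notion of order with Taylor coefficients. -/
theorem jet_mem_orderGE_iff {f : SmoothFn J N} {k : ℕ} :
    jet b x₀ f ∈ orderGE ι k ↔ VanishesToOrder k f x₀ := by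
  refine ⟨fun h => ?_, fun h => h.jet_mem⟩
  obtain ⟨z, hz⟩ := exists_isCoord (J := J) b x₀
  obtain ⟨p, hp⟩ := hz.exists_aeval k f
  have h1 : (p : MvPowerSeries ι ℂ) ∈ orderGE ι k := by
    have := AddSubgroup.sub_mem _ h (hp.jet_mem (b := b))
    rwa [map_sub, hz.jet_aeval, sub_sub_cancel] at this
  have h2 : VanishesToOrder k (MvPolynomial.aeval z p) x₀ := by
    rw [p.as_sum, map_sum]
    refine Ideal.sum_mem _ fun γ hγ => ?_
    rw [MvPolynomial.aeval_monomial]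
    refine Ideal.mul_mem_left _ _ ?_
    have hk : k ≤ γ.degree := by
      by_contra hlt
      have := h1 γ trivial (by simp only; omega)
      rw [MvPolynomial.coeff_coe] at this
      exact MvPolynomial.mem_support_iff.mp hγ this
    refine Ideal.pow_le_pow_right hk ?_
    rw [Finsupp.degree_apply, ← Finset.prod_pow_eq_pow_sum]
    exact Ideal.prod_mem_prod fun a _ => Ideal.pow_mem_pow (hz.apply_self a) _
  have h3 := Ideal.add_mem _ hp h2
  rwa [sub_add_cancel] at h3

theorem jet_eq_zero_iff {f : SmoothFn J N} :
    jet b x₀ f = 0 ↔ ∀ k, VanishesToOrder k f x₀ := by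
  refine ⟨fun h k => ?_, fun h => eq_zero_of_forall_orderGE fun k => (h k).jet_mem⟩
  rw [← jet_mem_orderGE_iff (b := b), h]
  exact AddSubgroup.zero_mem _

end Jets

end StarFOI

end

noncomputable section

namespace StarFOI

open MvPowerSeries Finset.HasAntidiagonal

/-! ### Vector fields in a chart -/

section Fields

set_option linter.unusedSectionVars false

variable {E : Type} [NormedAddCommGroup E] [NormedSpace ℝ E]
  {H : Type*} [TopologicalSpace H] {J : ModelWithCorners ℝ E H}
  {N : Type*} [TopologicalSpace N] [ChartedSpace H N] {x₀ : N}
  [IsManifold J ∞ N] [J.Boundaryless]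

theorem inChart_comp_extChartAt (f : SmoothFn J N) {x : N} (hx : x ∈ (extChartAt J x₀).source) :
    f =ᶠ[𝓝 x] inChart f x₀ ∘ extChartAt J x₀ := by
  filter_upwards [(isOpen_extChartAt_source (I := J) x₀).mem_nhds hx] with x' h
  rw [Function.comp_apply, inChart, (extChartAt J x₀).left_inv h]

theorem contDiffOn_inChart (f : SmoothFn J N) (x₀ : N) :
    ContDiffOn ℝ ∞ (inChart f x₀) (extChartAt J x₀).target :=
  (f.contMDiff.comp_contMDiffOn (contMDiffOn_extChartAt_symm (I := J) x₀)).contDiffOn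

theorem differential_eq (f : SmoothFn J N) {x : N} (hx : x ∈ (extChartAt J x₀).source)
    (w : TangentSpace J x) : differential f x w =
      fderiv ℝ (inChart f x₀) (extChartAt J x₀ x) (mfderiv J 𝓘(ℝ, E) (extChartAt J x₀) x w) := by
  have : IsManifold J 1 N := IsManifold.of_le (n := ∞) (by simp)
  have h0 : DifferentiableAt ℝ (inChart f x₀) (extChartAt J x₀ x) :=
    (((contDiffOn_inChart f x₀).contDiffAt
      ((isOpen_extChartAt_target x₀).mem_nhds ((extChartAt J x₀).map_source hx))).differentiableAt
      (by simp))
  have h1 := mfderiv_comp x h0.mdifferentiableAt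
    (mdifferentiableAt_extChartAt (I := J) (by rwa [extChartAt_source] at hx))
  rw [differential, (inChart_comp_extChartAt f hx).mfderiv_eq, h1, mfderiv_eq_fderiv]
  rfl

theorem inChart_lieFn (v : SmoothVectorField J N) (f : SmoothFn J N) {y : E}
    (hy : y ∈ (extChartAt J x₀).target) :
    inChart (lieFn v f) x₀ y = fderiv ℝ (inChart f x₀) y (vectorInChart v x₀ y) := by
  have := differential_eq f ((extChartAt J x₀).map_target hy) (v ((extChartAt J x₀).symm y))
  rw [(extChartAt J x₀).right_inv hy] at this
  exact this

theorem differential_self (f : SmoothFn J N) (w : TangentSpace J x₀) :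
    differential f x₀ w = fderiv ℝ (inChart f x₀) (extChartAt J x₀ x₀) w := by
  have : IsManifold J 1 N := IsManifold.of_le (n := ∞) (by simp)
  rw [differential_eq f (mem_extChartAt_source x₀), mfderiv_extChartAt_self]
  rfl

theorem vectorInChart_self (v : SmoothVectorField J N) :
    vectorInChart v x₀ (extChartAt J x₀ x₀) = v x₀ := by
  have : IsManifold J 1 N := IsManifold.of_le (n := ∞) (by simp)
  have h : ∀ x, x = x₀ → mfderiv J 𝓘(ℝ, E) (extChartAt J x₀) x (v x) = (v x₀ : E) := by
    rintro x rfl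
    rw [mfderiv_extChartAt_self]
    rfl
  exact h _ (extChartAt_to_inv x₀)

variable [FiniteDimensional ℝ E] [T2Space N]

theorem exists_vectorField (x₀ : N) (w : E) : ∃ v : SmoothVectorField J N, v x₀ = w := by
  obtain ⟨s, hs, hw⟩ := FiberBundle.exists_contMDiffOn_extend (k := ∞) J E
    (V := (TangentSpace J : N → Type _)) (x₀ := x₀) w
  obtain ⟨χ, hχ, hχs⟩ := (SmoothBumpFunction.nhds_basis_tsupport (I := J) x₀).mem_iff.mp
    (interior_mem_nhds.mpr hs)
  refine ⟨⟨_, ContMDiffOn.smul_section_of_tsupport (χ.contMDiff.contMDiffOn) isOpen_interior hχs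
    (hw.mono interior_subset)⟩, ?_⟩
  have h : χ x₀ • FiberBundle.extend E (E := (TangentSpace J : N → Type _)) (x := x₀)
      (w : TangentSpace J x₀) x₀ = (w : TangentSpace J x₀) := by
    rw [χ.eq_one, one_smul]
    exact FiberBundle.extend_apply_self E (E := (TangentSpace J : N → Type _)) _
  exact h

variable {ι : Type*} [Fintype ι] {b : Module.Basis ι ℝ E} {z : ι → SmoothFn J N}

theorem IsCoord.fderiv_eq (hz : IsCoord b x₀ z) (a : ι) :
    ∀ᶠ y in 𝓝 (extChartAt J x₀ x₀), fderiv ℝ (inChart (z a) x₀) y = coordC b a := by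
  filter_upwards [Filter.EventuallyEq.fderiv (𝕜 := ℝ) (hz a)] with y hy
  rw [hy]
  have : (fun y => coordC b a (y - extChartAt J x₀ x₀)) =
      fun y => coordC b a y - coordC b a (extChartAt J x₀ x₀) := by
    funext y; rw [map_sub]
  rw [this, fderiv_sub_const, ContinuousLinearMap.fderiv]

theorem IsCoord.inChart_lieFn (hz : IsCoord b x₀ z) (v : SmoothVectorField J N) (a : ι) :
    inChart (lieFn v (z a)) x₀ =ᶠ[𝓝 (extChartAt J x₀ x₀)]
      fun y => coordC b a (vectorInChart v x₀ y) := by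
  filter_upwards [hz.fderiv_eq a, extChartAt_target_mem_nhds (I := J) x₀] with y h1 h2
  rw [StarFOI.inChart_lieFn v _ h2, h1]

theorem sum_coordC_mul (b : Module.Basis ι ℝ E) (φ : E →L[ℝ] ℂ) (w : E) :
    φ w = ∑ a, coordC b a w * φ (b a) := by
  conv_lhs => rw [← b.sum_repr w]
  rw [map_sum]
  refine Finset.sum_congr rfl fun a _ => ?_
  rw [map_smul, coordC_apply, Complex.real_smul]

/-- The components of `v` are the functions `v z_a`, which avoids a separate notion of jets of
vector fields. -/
theorem IsCoord.jet_lieFn (hz : IsCoord b x₀ z) (v : SmoothVectorField J N) (f : SmoothFn J N) :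
    StarFOI.jet b x₀ (lieFn v f) =
      ∑ a, StarFOI.jet b x₀ (lieFn v (z a)) * pderiv ℂ a (StarFOI.jet b x₀ f) := by
  have h : inChart (lieFn v f) x₀ =ᶠ[𝓝 (extChartAt J x₀ x₀)]
      fun y => ∑ a, inChart (lieFn v (z a)) x₀ y * dirD (b a) (inChart f x₀) y := by
    filter_upwards [Filter.eventually_all.mpr (hz.inChart_lieFn v),
      extChartAt_target_mem_nhds (I := J) x₀] with y h1 h2
    rw [StarFOI.inChart_lieFn v _ h2, sum_coordC_mul b]
    exact Finset.sum_congr rfl fun a _ => by rw [h1 a]; rfl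
  rw [jet_congr h, taylor_sum fun a _ => (smoothNear_inChart _ x₀).mul
    ((smoothNear_inChart f x₀).dirD _)]
  refine Finset.sum_congr rfl fun a _ => ?_
  rw [taylor_mul (smoothNear_inChart _ x₀) ((smoothNear_inChart f x₀).dirD _), jet_apply f,
    pderiv_taylor (smoothNear_inChart f x₀)]
  rfl

theorem smoothNear_vectorInChart (v : SmoothVectorField J N) :
    SmoothNear (extChartAt J x₀ x₀) (vectorInChart v x₀) := by
  obtain ⟨z, hz⟩ := exists_isCoord (J := J) (Module.finBasis ℝ E) x₀
  set b := Module.finBasis ℝ E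
  have h : vectorInChart v x₀ =ᶠ[𝓝 (extChartAt J x₀ x₀)] fun y =>
      ∑ a, ContinuousLinearMap.smulRight Complex.reCLM (b a) (inChart (lieFn v (z a)) x₀ y) := by
    filter_upwards [Filter.eventually_all.mpr (hz.inChart_lieFn v)] with y h1
    conv_lhs => rw [← b.sum_repr (vectorInChart v x₀ y)]
    refine Finset.sum_congr rfl fun a _ => ?_
    rw [h1 a, coordC_apply]
    rfl
  refine SmoothNear.congr (SmoothNear.sum fun a _ => ?_) h
  filter_upwards [smoothNear_inChart (lieFn v (z a)) x₀] with y hy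
  exact (ContinuousLinearMap.contDiff _).contDiffAt.comp y hy

theorem IsCoord.trace_vectorInChart (hz : IsCoord b x₀ z) (v : SmoothVectorField J N) :
    ∀ᶠ y in 𝓝 (extChartAt J x₀ x₀),
      ((LinearMap.trace ℝ E (fderiv ℝ (vectorInChart v x₀) y : E →ₗ[ℝ] E) : ℝ) : ℂ) =
        ∑ a, dirD (b a) (inChart (lieFn v (z a)) x₀) y := by
  classical
  filter_upwards [Filter.eventually_all.mpr fun a => dirD_congr (hz.inChart_lieFn v a) (b a),
    (smoothNear_vectorInChart (x₀ := x₀) v)] with y h1 h2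
  rw [LinearMap.trace_eq_matrix_trace ℝ b, Matrix.trace, Complex.ofReal_sum]
  refine Finset.sum_congr rfl fun a _ => ?_
  rw [h1 a, dirD]
  have h3 := ((coordC b a).hasFDerivAt.comp y (h2.differentiableAt (by simp)).hasFDerivAt).fderiv
  change _ = fderiv ℝ ((coordC b a) ∘ vectorInChart v x₀) y (b a)
  rw [h3, ContinuousLinearMap.comp_apply, coordC_apply, Matrix.diag_apply, LinearMap.toMatrix_apply]
  rfl

theorem constantCoeff_pderiv_jet (f : SmoothFn J N) (a : ι) :
    constantCoeff (pderiv ℂ a (jet b x₀ f)) = differential f x₀ (b a) := by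
  rw [jet_apply, pderiv_taylor (smoothNear_inChart f x₀), constantCoeff_taylor]
  exact (differential_self f (b a)).symm

theorem constantCoeff_pderiv_pderiv_jet (f : SmoothFn J N) (a c : ι) :
    constantCoeff (pderiv ℂ a (pderiv ℂ c (jet b x₀ f))) =
      fderiv ℝ (fderiv ℝ (inChart f x₀)) (extChartAt J x₀ x₀) (b a) (b c) := by
  have hf := smoothNear_inChart f x₀
  rw [jet_apply, pderiv_taylor hf, pderiv_taylor (hf.dirD _), constantCoeff_taylor]
  have h1 := (hf.fderiv.differentiableAt.self_of_nhds.hasFDerivAt.clm_apply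
    (hasFDerivAt_const (b c) (extChartAt J x₀ x₀))).fderiv
  change fderiv ℝ (fun y => fderiv ℝ (inChart f x₀) y (b c)) _ _ = _
  rw [h1]
  simp

end Fields

end StarFOI

end

noncomputable section

namespace StarFOI

open MvPowerSeries Finset.HasAntidiagonal

/-! ### Formal oscillatory integrals and jets -/

section Formal

variable {ι : Type*} [Fintype ι]

theorem sub_linear_mem_orderGE {P : MvPowerSeries ι ℂ} (hP : constantCoeff P = 0) :
    P - ∑ d, constantCoeff (pderiv ℂ d P) • X d ∈ orderGE ι 2 := by
  classical
  intro γ _ hγ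
  simp only at hγ
  have hX : ∀ d, coeff γ (X d : MvPowerSeries ι ℂ) = if γ = Finsupp.single d 1 then 1 else 0 :=
    fun d => coeff_X γ d
  rw [map_sub, map_sum]
  simp only [map_smul, hX, smul_eq_mul, mul_ite, mul_one, mul_zero]
  by_cases h0 : γ = 0
  · subst h0
    rw [Finset.sum_eq_zero, sub_zero, coeff_zero_eq_constantCoeff_apply, hP]
    intro d _
    rw [if_neg]
    intro h
    have := congrArg Finsupp.degree h
    simp at this
  · obtain ⟨d, hd⟩ : ∃ d, γ = Finsupp.single d 1 := by
      have : γ.degree = 1 := by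
        have := (Finsupp.degree_eq_zero_iff γ).not.mpr h0
        omega
      obtain ⟨d, hd⟩ := Finsupp.ne_iff.mp h0
      obtain ⟨β, rfl⟩ := exists_eq_add_single hd
      refine ⟨d, ?_⟩
      rw [map_add, Finsupp.degree_single, Nat.add_eq_right, Finsupp.degree_eq_zero_iff] at this
      rw [this, zero_add]
    subst hd
    rw [Finset.sum_eq_single d, if_pos rfl, ← coeff_zero_eq_constantCoeff_apply, coeff_pderiv]
    · simp
    · intro e _ hne
      rw [if_neg]
      intro h
      exact hne ((Finsupp.single_left_inj one_ne_zero).mp h).symm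
    · simp

/-- A functional of order at most two sees only the linear part of `P` in `P X_c`. -/
theorem map_mul_X_of_order {L : MvPowerSeries ι ℂ →ₗ[ℂ] ℂ} (hL : ∀ F ∈ orderGE ι 3, L F = 0)
    {P : MvPowerSeries ι ℂ} (hP : constantCoeff P = 0) (c : ι) :
    L (P * X c) = ∑ d, constantCoeff (pderiv ℂ d P) * L (X d * X c) := by
  have h := hL _ (orderGE_mul (sub_linear_mem_orderGE hP) (X_mem_orderGE c))
  rw [sub_mul, map_sub, sub_eq_zero, Finset.sum_mul, map_sum] at h
  rw [h]
  simp only [smul_mul_assoc, map_smul, smul_eq_mul]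

end Formal

/-! ### The integral identity and the Hessian of the phase, read on jets -/

section FOI

set_option linter.unusedSectionVars false

variable {E : Type} [NormedAddCommGroup E] [NormedSpace ℝ E]
  {H : Type*} [TopologicalSpace H] {J : ModelWithCorners ℝ E H}
  {N : Type*} [TopologicalSpace N] [ChartedSpace H N] {x₀ : N}
  [IsManifold J ∞ N] [FiniteDimensional ℝ E]

variable (J) in
/-- The derivative at `x` of the preferred chart at `x₀`. -/
def chartDeriv (x₀ x : N) : E →L[ℝ] E := mfderiv J 𝓘(ℝ, E) (extChartAt J x₀) x

variable (J) in
/-- The density which is the Lebesgue density in the preferred chart at `x₀`. -/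
def flatDensity (x₀ : N) : Density J N where
  toFun x u := ((|LinearMap.det (chartDeriv J x₀ x : E →ₗ[ℝ] E) *
      (Module.finBasis ℝ E).det (fun i => (u i : E))| : ℝ) : ℂ)
  map_det x A u := by
    have h : (Module.finBasis ℝ E).det (fun i => (A (u i) : E)) =
        LinearMap.det (A : E →ₗ[ℝ] E) * (Module.finBasis ℝ E).det (fun i => (u i : E)) :=
      Module.Basis.det_comp (Module.finBasis ℝ E) (A : E →ₗ[ℝ] E) (fun i => (u i : E))
    rw [h, ← Complex.ofReal_mul, ← abs_mul]
    congr 2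
    exact mul_left_comm _ _ _

variable (J N) in
/-- The zero density. -/
def zeroDensity : Density J N where
  toFun _ _ := 0
  map_det _ _ _ := (mul_zero _).symm

theorem coeff_zeroDensity (x₀ : N) : (zeroDensity J N).coeff x₀ = fun _ => 0 := rfl

theorem lieCoeff_zeroDensity (v : SmoothVectorField J N) (x₀ : N) (y : E) :
    (zeroDensity J N).lieCoeff v x₀ y = 0 := by
  rw [Density.lieCoeff, coeff_zeroDensity]
  simp

variable [J.Boundaryless]

theorem coeff_flatDensity {y : E} (hy : y ∈ (extChartAt J x₀).target) :
    (flatDensity J x₀).coeff x₀ y = 1 := by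
  have : IsManifold J 1 N := IsManifold.of_le (n := ∞) (by simp)
  have h := mfderiv_extChartAt_comp_mfderivWithin_extChartAt_symm (I := J) hy
  rw [J.range_eq_univ, mfderivWithin_univ] at h
  set T : E →L[ℝ] E := chartDeriv J x₀ ((extChartAt J x₀).symm y) with hT
  set S : E →L[ℝ] E := mfderiv 𝓘(ℝ, E) J (extChartAt J x₀).symm y with hS
  have h1 : (T : E →ₗ[ℝ] E) ∘ₗ (S : E →ₗ[ℝ] E) = LinearMap.id := by
    ext w
    exact DFunLike.congr_fun h w
  have h2 : (Module.finBasis ℝ E).det (fun i => S (Module.finBasis ℝ E i)) =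
      LinearMap.det (S : E →ₗ[ℝ] E) := by
    have := Module.Basis.det_comp (Module.finBasis ℝ E) (S : E →ₗ[ℝ] E) (Module.finBasis ℝ E)
    rwa [Module.Basis.det_self, mul_one] at this
  change ((|LinearMap.det (T : E →ₗ[ℝ] E) *
    (Module.finBasis ℝ E).det (fun i => S (Module.finBasis ℝ E i))| : ℝ) : ℂ) = 1
  rw [h2, ← LinearMap.det_comp, h1, LinearMap.det_id]
  simp

variable (J) in
/-- The formal density with constant coefficient `1` in the preferred chart at `x₀`. -/
def flatFormalDensity (x₀ : N) : ℕ → Density J N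
  | 0 => flatDensity J x₀
  | _ + 1 => zeroDensity J N

theorem lieCoeff_flatDensity (v : SmoothVectorField J N) {y : E}
    (hy : y ∈ (extChartAt J x₀).target) : (flatDensity J x₀).lieCoeff v x₀ y =
      ((LinearMap.trace ℝ E (fderiv ℝ (vectorInChart v x₀) y : E →ₗ[ℝ] E) : ℝ) : ℂ) := by
  have h : (flatDensity J x₀).coeff x₀ =ᶠ[𝓝 y] fun _ => 1 := by
    filter_upwards [(isOpen_extChartAt_target (I := J) x₀).mem_nhds hy] with y' h'
    exact coeff_flatDensity h'
  rw [Density.lieCoeff, h.fderiv_eq, coeff_flatDensity hy]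
  simp

theorem eventually_of_isDivergence_flat {v : SmoothVectorField J N} {d : ℕ → SmoothFn J N}
    (hd : IsDivergence (flatFormalDensity J x₀) v x₀ d) (k : ℕ) :
    ∀ᶠ y in 𝓝 (extChartAt J x₀ x₀), inChart (d k) x₀ y =
      (flatFormalDensity J x₀ k).lieCoeff v x₀ y := by
  filter_upwards [hd k, extChartAt_target_mem_nhds (I := J) x₀] with y h1 h2
  rw [← h1, Finset.sum_eq_single (k, 0)]
  · rw [flatFormalDensity, coeff_flatDensity h2, mul_one]; rfl
  · rintro ⟨i, j⟩ hij hne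
    obtain _ | j := j
    · rw [mem_antidiagonal] at hij
      simp only [add_zero] at hij
      exact absurd (by rw [hij]) hne
    · rw [flatFormalDensity, coeff_zeroDensity, mul_zero]
  · intro h
    exact absurd (mem_antidiagonal.mpr (add_zero k)) h

variable [T2Space N] {ι : Type*} [Fintype ι] {b : Module.Basis ι ℝ E} {z : ι → SmoothFn J N}

theorem IsCoord.jet_divergence_zero (hz : IsCoord b x₀ z) {v : SmoothVectorField J N}
    {d : ℕ → SmoothFn J N} (hd : IsDivergence (flatFormalDensity J x₀) v x₀ d) :
    StarFOI.jet b x₀ (d 0) = ∑ a, pderiv ℂ a (StarFOI.jet b x₀ (lieFn v (z a))) := by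
  have h : inChart (d 0) x₀ =ᶠ[𝓝 (extChartAt J x₀ x₀)]
      fun y => ∑ a, dirD (b a) (inChart (lieFn v (z a)) x₀) y := by
    filter_upwards [eventually_of_isDivergence_flat hd 0, hz.trace_vectorInChart v,
      extChartAt_target_mem_nhds (I := J) x₀] with y h1 h2 h3
    rw [h1, flatFormalDensity, lieCoeff_flatDensity v h3, h2]
  rw [jet_congr h, taylor_sum fun a _ => (smoothNear_inChart _ x₀).dirD _]
  refine Finset.sum_congr rfl fun a _ => ?_
  rw [jet_apply, pderiv_taylor (smoothNear_inChart _ x₀)]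

theorem jet_divergence_succ {v : SmoothVectorField J N} {d : ℕ → SmoothFn J N}
    (hd : IsDivergence (flatFormalDensity J x₀) v x₀ d) (k : ℕ) : jet b x₀ (d (k + 1)) = 0 := by
  have h : inChart (d (k + 1)) x₀ =ᶠ[𝓝 (extChartAt J x₀ x₀)] fun _ => 0 := by
    filter_upwards [eventually_of_isDivergence_flat hd (k + 1)] with y h1
    rw [h1, flatFormalDensity, lieCoeff_zeroDensity]
  rw [jet_congr h, taylor_const]
  simp

/-- For the Lebesgue density of the chart, `v f + (div v) f = ∑ ∂_a (v^a f)`. Hence the integral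
identity for `v` and `f` is the sum over `a` of the formal identity for `∂_a` applied to `v^a f`. -/
theorem IsCoord.jet_integrand (hz : IsCoord b x₀ z) {v : SmoothVectorField J N}
    {d : ℕ → SmoothFn J N} (hd : IsDivergence (flatFormalDensity J x₀) v x₀ d)
    (φ : ℕ → SmoothFn J N) (f : SmoothFn J N) (j : ℕ) :
    StarFOI.jet b x₀ (integrand φ d v f j) =
      ∑ a, (pderiv ℂ a (StarFOI.jet b x₀ (φ j)) *
        (StarFOI.jet b x₀ (lieFn v (z a)) * StarFOI.jet b x₀ f) +
        if j = 1 then pderiv ℂ a (StarFOI.jet b x₀ (lieFn v (z a)) * StarFOI.jet b x₀ f) else 0) := by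
  match j with
  | 0 =>
    rw [integrand, map_mul, hz.jet_lieFn, Finset.sum_mul]
    refine Finset.sum_congr rfl fun a _ => ?_
    rw [if_neg (by omega), add_zero]; ring
  | 1 =>
    rw [integrand, map_add, map_mul, map_add, hz.jet_lieFn v f, hz.jet_lieFn v (φ 1),
      hz.jet_divergence_zero hd, ← Finset.sum_add_distrib, Finset.sum_mul,
      ← Finset.sum_add_distrib]
    refine Finset.sum_congr rfl fun a _ => ?_
    rw [if_pos rfl, Derivation.leibniz, smul_eq_mul, smul_eq_mul]; ring
  | k + 2 =>
    rw [integrand, map_mul, map_add, jet_divergence_succ hd, add_zero, hz.jet_lieFn, Finset.sum_mul]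
    refine Finset.sum_congr rfl fun a _ => ?_
    rw [if_neg (by omega), add_zero]; ring

theorem hessian_eq (b : Module.Basis ι ℝ E) (f : SmoothFn J N) : hessian f x₀ =
    ((b.toMatrix (Module.finBasis ℝ E)).map Complex.ofRealHom)ᵀ *
      (Matrix.of fun a c => constantCoeff (pderiv ℂ a (pderiv ℂ c (jet b x₀ f)))) *
      (b.toMatrix (Module.finBasis ℝ E)).map Complex.ofRealHom := by
  ext i j
  rw [Matrix.mul_apply]
  simp only [Matrix.mul_apply, Matrix.transpose_apply, Matrix.map_apply, Matrix.of_apply,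
    constantCoeff_pderiv_pderiv_jet, Module.Basis.toMatrix_apply, hessian]
  set B := fderiv ℝ (fderiv ℝ (inChart f x₀)) (extChartAt J x₀ x₀)
  change B (Module.finBasis ℝ E i) (Module.finBasis ℝ E j) = _
  rw [sum_coordC_mul b (B (Module.finBasis ℝ E i))]
  refine Finset.sum_congr rfl fun c _ => ?_
  have h := sum_coordC_mul b ((ContinuousLinearMap.apply ℝ ℂ (b c)).comp B) (Module.finBasis ℝ E i)
  simp only [ContinuousLinearMap.comp_apply, ContinuousLinearMap.apply_apply] at h
  rw [h, mul_comm]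
  simp only [coordC_apply]
  rfl

theorem hessian_det_ne_zero {f : SmoothFn J N} [DecidableEq ι] {B : Matrix ι ι ℂ}
    (hB : (Matrix.of fun a c => constantCoeff (pderiv ℂ a (pderiv ℂ c (jet b x₀ f)))) * B = -1) :
    (hessian f x₀).det ≠ 0 := by
  set Q := Matrix.of fun a c => constantCoeff (pderiv ℂ a (pderiv ℂ c (jet b x₀ f))) with hQ
  set e := Module.finBasis ℝ E
  set A := (b.toMatrix e).map Complex.ofRealHom
  set A' := (e.toMatrix b).map Complex.ofRealHom
  have h1 : A * A' = 1 := by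
    rw [← Matrix.map_mul, Module.Basis.toMatrix_mul_toMatrix_flip, Matrix.map_one _ (map_zero _)
      (map_one _)]
  have h2 : A' * A = 1 := by
    rw [← Matrix.map_mul, Module.Basis.toMatrix_mul_toMatrix_flip, Matrix.map_one _ (map_zero _)
      (map_one _)]
  have h3 : hessian f x₀ * (A' * B * A'ᵀ) = -1 := by
    rw [hessian_eq b f]
    calc Aᵀ * Q * A * (A' * B * A'ᵀ) = Aᵀ * Q * (A * A') * B * A'ᵀ := by
          simp only [Matrix.mul_assoc]
      _ = Aᵀ * (Q * B) * A'ᵀ := by rw [h1, Matrix.mul_one]; simp only [Matrix.mul_assoc]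
      _ = -(A' * A)ᵀ := by
          rw [hB, Matrix.transpose_mul, Matrix.mul_neg, Matrix.mul_one, Matrix.neg_mul]
      _ = -1 := by rw [h2, Matrix.transpose_one]
  intro h0
  have h4 := congrArg Matrix.det h3
  rw [Matrix.det_mul, h0, zero_mul, Matrix.det_neg, Matrix.det_one, mul_one] at h4
  exact pow_ne_zero _ (neg_ne_zero.mpr one_ne_zero) h4.symm

/-- A sequence of functionals on jets which satisfies the formal integration by parts identity
is a formal oscillatory integral. -/
theorem isFOI_of_phase {lam : ℕ → MvPowerSeries ι ℂ →ₗ[ℂ] ℂ}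
    (h0 : ∀ F, lam 0 F = constantCoeff F)
    (horder : ∀ (q : ℕ) (F), F ∈ orderGE ι (2 * q + 1 : ℕ) → lam q F = 0)
    {ψ : ℕ → MvPowerSeries ι ℂ} (hψ0 : constantCoeff (ψ 0) = 0)
    (hψ1 : ∀ a F, lam 0 (pderiv ℂ a (ψ 0) * F) = 0)
    (hψ : ∀ a p F, ∑ q ∈ antidiagonal (p + 1), lam q.1 (pderiv ℂ a (ψ q.2) * F) +
      lam p (pderiv ℂ a F) = 0)
    {Λ : FormalFunctional J N} (hΛ : ∀ q f, Λ q f = lam q (jet b x₀ f)) : IsFOI x₀ Λ := by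
  classical
  obtain ⟨z, hz⟩ := exists_isCoord (J := J) b x₀
  choose φ hφ using fun j => jet_surjective (J := J) (b := b) x₀ (ψ j)
  have hgrad : ∀ a, constantCoeff (pderiv ℂ a (ψ 0)) = 0 := fun a => by
    have := hψ1 a 1
    rwa [mul_one, h0] at this
  refine ⟨φ, flatFormalDensity J x₀, ⟨?_, ?_, ?_, ?_, ?_⟩, ⟨?_, ?_, ?_⟩⟩
  · rw [← constantCoeff_jet (b := b), hφ, hψ0]
  · ext w
    refine (sum_coordC_mul b (differential (φ 0) x₀ : E →L[ℝ] ℂ) w).trans ?_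
    refine Finset.sum_eq_zero fun a _ => ?_
    have := constantCoeff_pderiv_jet (b := b) (x₀ := x₀) (φ 0) a
    rw [hφ, hgrad] at this
    exact mul_eq_zero_of_right _ this.symm
  · refine hessian_det_ne_zero (b := b) (B := Matrix.of fun a c => lam 1 (X a * X c)) ?_
    ext a c
    -- With `F = z_c` at lowest order, the `λ_0` term with `ψ_1` vanishes because `z_c` does at the
    -- origin. What is left says that the Hessian of `ψ_0` times the second moments is `-1`.
    have h1 := hψ a 0 (X c)
    rw [Finset.Nat.sum_antidiagonal_succ, zero_add] at h1
    simp only [Finset.HasAntidiagonal.antidiagonal_zero, Finset.sum_singleton] at h1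
    rw [h0, h0, map_mul, constantCoeff_X, mul_zero, zero_add, zero_add,
      map_mul_X_of_order (fun F hF => horder 1 F hF) (hgrad a)] at h1
    rw [Matrix.mul_apply, hφ]
    simp only [Matrix.of_apply]
    have h2 : constantCoeff (pderiv ℂ a (X c : MvPowerSeries ι ℂ)) = (1 : Matrix ι ι ℂ) a c := by
      rw [Matrix.one_apply]
      split_ifs with h
      · subst h; rw [pderiv_X_self, map_one]
      · rw [pderiv_X_of_ne (Ne.symm h), map_zero]
    rw [Matrix.neg_apply, ← h2, ← eq_neg_of_add_eq_zero_left h1]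
    refine Finset.sum_congr rfl fun d _ => ?_
    congr 1
    have hc := constantCoeff_pderiv_pderiv_jet (b := b) (x₀ := x₀) (φ 0)
    rw [hφ] at hc
    have hs := (smoothNear_inChart (φ 0) x₀).contDiffAt
    rw [hc, hc]
    exact (hs.isSymmSndFDerivAt (by
      rw [minSmoothness_of_isRCLikeNormedField]
      exact WithTop.coe_le_coe.mpr (le_top : (2 : ℕ∞) ≤ ⊤))) _ _
  · intro k
    cases k with
    | zero => exact (contDiffOn_const (c := (1 : ℂ))).congr fun y hy => coeff_flatDensity hy
    | succ k => exact contDiffOn_const (c := (0 : ℂ))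
  · rw [flatFormalDensity, coeff_flatDensity (mem_extChartAt_target x₀)]
    exact one_ne_zero
  · intro r
    refine ⟨2 * r, fun f hf => ?_⟩
    rw [hΛ]
    exact horder r _ hf.jet_mem
  · intro h
    have := hΛ 0 1
    rw [h, h0, map_one (jet b x₀)] at this
    exact zero_ne_one (α := ℂ) (this.trans (map_one _))
  · intro v f d hd m
    simp only [hΛ, hz.jet_integrand hd, hφ, map_sum]
    rw [Finset.sum_comm]
    refine Finset.sum_eq_zero fun a _ => ?_
    simp only [map_add, Finset.sum_add_distrib]
    cases m with
    | zero => simp [hψ1]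
    | succ m =>
      rw [Finset.sum_eq_single (m, 1) (s := antidiagonal (m + 1))
        (f := fun p => lam p.1 (if p.2 = 1 then _ else 0))]
      · rw [if_pos rfl]; exact hψ a m _
      · rintro ⟨i, j⟩ hij hne
        rw [mem_antidiagonal] at hij
        simp only at hij
        rw [if_neg, map_zero]
        rintro rfl
        exact hne (by rw [Nat.add_right_cancel hij])
      · intro h
        exact absurd (mem_antidiagonal.mpr (show (m, 1).1 + (m, 1).2 = m + 1 from rfl)) h

/-- The integral identity only speaks about functions representing the divergence. They exist
because `ρ_0` is invertible near the point: divide formal series in `ν` pointwise, prove smoothness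
recursively, and extend the germs globally. -/
theorem exists_isDivergence {ρ : ℕ → Density J N}
    (hρ : ∀ k, ContDiffOn ℝ ∞ ((ρ k).coeff x₀) (extChartAt J x₀).target)
    (h0 : (ρ 0).coeff x₀ (extChartAt J x₀ x₀) ≠ 0) (v : SmoothVectorField J N) :
    ∃ d, IsDivergence ρ v x₀ d := by
  have hs : ∀ k, SmoothNear (extChartAt J x₀ x₀) ((ρ k).coeff x₀) := fun k =>
    ContDiffOn.smoothNear (hρ k) (isOpen_extChartAt_target x₀) (mem_extChartAt_target x₀)
  have hl : ∀ k, SmoothNear (extChartAt J x₀ x₀) ((ρ k).lieCoeff v x₀) := by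
    intro k
    obtain ⟨z, hz⟩ := exists_isCoord (J := J) (Module.finBasis ℝ E) x₀
    refine SmoothNear.add ((hs k).fderiv.clm_apply (smoothNear_vectorInChart v)) ((hs k).mul ?_)
    exact SmoothNear.congr (SmoothNear.sum fun a _ => (smoothNear_inChart _ x₀).dirD _)
      (hz.trace_vectorInChart v)
  have hne : ∀ᶠ y in 𝓝 (extChartAt J x₀ x₀), (ρ 0).coeff x₀ y ≠ 0 :=
    (hs 0).contDiffAt.continuousAt.eventually_ne h0
  let D : E → PowerSeries ℂ := fun y =>
    PowerSeries.mk (fun k => (ρ k).lieCoeff v x₀ y) * (PowerSeries.mk fun k => (ρ k).coeff x₀ y)⁻¹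
  have hD : ∀ᶠ y in 𝓝 (extChartAt J x₀ x₀), ∀ k,
      ∑ p ∈ antidiagonal k, PowerSeries.coeff p.1 (D y) * (ρ p.2).coeff x₀ y =
        (ρ k).lieCoeff v x₀ y := by
    filter_upwards [hne] with y hy k
    have h1 : D y * (PowerSeries.mk fun k => (ρ k).coeff x₀ y) =
        PowerSeries.mk (fun k => (ρ k).lieCoeff v x₀ y) := by
      simp only [D]
      rw [mul_assoc, PowerSeries.inv_mul_cancel _ (by simpa using hy), mul_one]
    have h2 := congrArg (PowerSeries.coeff k) h1
    simpa only [PowerSeries.coeff_mul, PowerSeries.coeff_mk] using h2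
  have hsm : ∀ k, SmoothNear (extChartAt J x₀ x₀) (fun y => PowerSeries.coeff k (D y)) := by
    intro k
    induction k using Nat.strong_induction_on with
    | _ k ih =>
      have he : (fun y => PowerSeries.coeff k (D y)) =ᶠ[𝓝 (extChartAt J x₀ x₀)]
          fun y => ((ρ k).lieCoeff v x₀ y + (-1) * ∑ p ∈ (antidiagonal k).erase (k, 0),
            PowerSeries.coeff p.1 (D y) * (ρ p.2).coeff x₀ y) * ((ρ 0).coeff x₀ y)⁻¹ := by
        filter_upwards [hD, hne] with y h1 h2
        have h3 := h1 k
        rw [← Finset.add_sum_erase _ _ (mem_antidiagonal.mpr (add_zero k) :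
          (k, 0) ∈ antidiagonal k)] at h3
        rw [← h3]
        field_simp
        ring
      refine SmoothNear.congr (SmoothNear.mul ((hl k).add ((SmoothNear.const _).mul
        (SmoothNear.sum fun p hp => ?_))) ?_) he
      · rw [Finset.mem_erase, mem_antidiagonal] at hp
        refine SmoothNear.mul (ih p.1 ?_) (hs _)
        by_contra hlt
        refine hp.1 (Prod.ext ?_ ?_) <;> simp only <;> omega
      · filter_upwards [hs 0, hne] with y h1 h2
        exact h1.inv h2
  choose d hd using fun k => exists_inChart_eq (J := J) (N := N) (hsm k)
  refine ⟨d, fun k => ?_⟩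
  filter_upwards [hD, (Filter.eventually_all_finset (antidiagonal k)).mpr
    fun p _ => hd p.1] with y h1 h2
  rw [← h1 k]
  refine Finset.sum_congr rfl fun p hp => ?_
  rw [← h2 p hp]
  rfl

/-- The second derivative of the phase of a formal oscillatory integral is inverse to the second
moments. -/
theorem IsFOI.exists_inverse [DecidableEq ι] {Λ : FormalFunctional J N} (hFOI : IsFOI x₀ Λ)
    (h0 : ∀ f, Λ 0 f = f x₀) {L : MvPowerSeries ι ℂ →ₗ[ℂ] ℂ}
    (hL : ∀ F ∈ orderGE ι 3, L F = 0) (hΛ : ∀ f, Λ 1 f = L (jet b x₀ f)) :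
    ∃ Q : Matrix ι ι ℂ, Q * (Matrix.of fun a c => L (X a * X c)) = -1 := by
  obtain ⟨φ, ρ, hpair, hfor⟩ := hFOI
  obtain ⟨z, hz⟩ := exists_isCoord (J := J) b x₀
  refine ⟨Matrix.of fun a d => constantCoeff (pderiv ℂ d (pderiv ℂ a (jet b x₀ (φ 0)))), ?_⟩
  ext a c
  obtain ⟨v, hv⟩ := exists_vectorField (J := J) x₀ (b a)
  obtain ⟨d, hd⟩ := exists_isDivergence hpair.smooth hpair.nonvanishing v
  -- The field equals `b_a` at the point, the function is the coordinate `z_c`, and index `1` is the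
  -- order `ν^0`: `Λ_1` meets `φ_{-1}`, and `Λ_0` only evaluates `v z_c`.
  have h := hfor.integral_lie v (z c) d hd 1
  have hgrad : ∀ e, constantCoeff (pderiv ℂ e (jet b x₀ (φ 0))) = 0 := fun e => by
    rw [constantCoeff_pderiv_jet, hpair.critical]; rfl
  have hw : ∀ e, constantCoeff (jet b x₀ (lieFn v (z e))) = (1 : Matrix ι ι ℂ) a e := by
    intro e
    have hv' : vectorInChart v x₀ (extChartAt J x₀ x₀) = b a := (vectorInChart_self v).trans hv
    rw [constantCoeff_jet, ← inChart_self (J := J), (hz.inChart_lieFn v e).self_of_nhds]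
    simp only
    rw [hv', coordC_apply, Module.Basis.repr_self, Finsupp.single_apply, Matrix.one_apply]
    split_ifs <;> simp
  rw [Finset.Nat.sum_antidiagonal_succ, zero_add] at h
  simp only [Finset.HasAntidiagonal.antidiagonal_zero, Finset.sum_singleton, integrand] at h
  rw [h0, hΛ, map_mul, hz.jet, hz.jet_lieFn] at h
  have h1 : (lieFn v (z c) + (lieFn v (φ 1) + d 0) * z c) x₀ = (1 : Matrix ι ι ℂ) a c := by
    rw [← hw c, constantCoeff_jet]
    change lieFn v (z c) x₀ + (lieFn v (φ 1) x₀ + d 0 x₀) * z c x₀ = _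
    rw [hz.apply_self, mul_zero, add_zero]
  rw [h1, map_mul_X_of_order hL] at h
  · rw [Matrix.neg_apply, Matrix.mul_apply, ← eq_neg_of_add_eq_zero_right h]
    refine Finset.sum_congr rfl fun e _ => ?_
    simp only [Matrix.of_apply]
    congr 1
    rw [map_sum, map_sum, Finset.sum_eq_single a]
    · rw [Derivation.leibniz, map_add, smul_eq_mul, smul_eq_mul, map_mul, map_mul, hgrad, hw]
      simp
    · intro e' _ hne
      rw [Derivation.leibniz, map_add, smul_eq_mul, smul_eq_mul, map_mul, map_mul, hgrad, hw,
        Matrix.one_apply_ne hne.symm]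
      simp
    · simp
  · rw [map_sum]
    refine Finset.sum_eq_zero fun e _ => ?_
    rw [map_mul, hgrad, mul_zero]

end FOI

end StarFOI

end

noncomputable section

namespace StarFOI

open MvPowerSeries Finset.HasAntidiagonal

/-! ### The formal star product at a point -/

section Order

variable {E : Type} [NormedAddCommGroup E] [NormedSpace ℝ E]
  {H : Type*} [TopologicalSpace H] {J : ModelWithCorners ℝ E H}
  {N : Type*} [TopologicalSpace N] [ChartedSpace H N]

/-- `D` has order at most `r` at every point. -/
def HasOrderLE (r : ℕ) (D : SmoothFn J N →ₗ[ℂ] SmoothFn J N) : Prop :=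
  ∀ (x : N) (f : SmoothFn J N), VanishesToOrder (r + 1) f x → D f x = 0

/-- The commutator of `D` with the multiplication by `h`. -/
def commMul (h : SmoothFn J N) (D : SmoothFn J N →ₗ[ℂ] SmoothFn J N) :
    SmoothFn J N →ₗ[ℂ] SmoothFn J N :=
  D ∘ₗ LinearMap.mulLeft ℂ h - LinearMap.mulLeft ℂ h ∘ₗ D

theorem commMul_apply (h : SmoothFn J N) (D : SmoothFn J N →ₗ[ℂ] SmoothFn J N)
    (f : SmoothFn J N) : commMul h D f = D (h * f) - h * D f := rfl

theorem smoothFn_mul_apply (f g : SmoothFn J N) (x : N) : (f * g) x = f x * g x := rfl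

theorem smoothFn_sub_apply (f g : SmoothFn J N) (x : N) : (f - g) x = f x - g x := rfl

theorem smoothFn_smul_apply (c : ℂ) (g : SmoothFn J N) (x : N) : (c • g) x = c * g x := by
  rw [Algebra.smul_def]; rfl

theorem sub_smul_one_mem (h : SmoothFn J N) (x : N) :
    h - h x • (1 : SmoothFn J N) ∈ (vanishingIdeal x : Ideal (SmoothFn J N)) := by
  rw [mem_vanishingIdeal, smoothFn_sub_apply, smoothFn_smul_apply]
  change h x - h x * 1 = 0
  ring

theorem HasOrderLE.commMul {r : ℕ} {D : SmoothFn J N →ₗ[ℂ] SmoothFn J N}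
    (hD : HasOrderLE (r + 1) D) (h : SmoothFn J N) : HasOrderLE r (commMul h D) := by
  intro x f hf
  have h1 : VanishesToOrder (r + 1 + 1) ((h - h x • (1 : SmoothFn J N)) * f) x := by
    rw [VanishesToOrder, pow_succ']
    exact Ideal.mul_mem_mul (sub_smul_one_mem h x) hf
  have h2 := hD x _ h1
  rw [sub_mul, map_sub, smul_mul_assoc, one_mul, map_smul, smoothFn_sub_apply,
    smoothFn_smul_apply] at h2
  rw [commMul_apply, smoothFn_sub_apply, smoothFn_mul_apply, h2]

theorem HasOrderLE.eq_mul {D : SmoothFn J N →ₗ[ℂ] SmoothFn J N} (hD : HasOrderLE 0 D)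
    (f : SmoothFn J N) : D f = D 1 * f := by
  ext x
  have h2 := hD x (f - f x • 1) (vanishesToOrder_one.mpr (sub_smul_one_mem f x))
  rw [map_sub, map_smul, smoothFn_sub_apply, smoothFn_smul_apply, sub_eq_zero] at h2
  rw [h2, smoothFn_mul_apply, mul_comm]

/-- Induction on `r` and `j`: for `h` in the vanishing ideal `D(h g) = h D g + [D, h] g`. The first
term gains a power through `h`, and the commutator has lower order. -/
theorem HasOrderLE.vanishesToOrder {r : ℕ} {D : SmoothFn J N →ₗ[ℂ] SmoothFn J N}
    (hD : HasOrderLE r D) (j : ℕ) {f : SmoothFn J N} {x : N} (hf : VanishesToOrder (j + r) f x) :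
    VanishesToOrder j (D f) x := by
  induction r generalizing D j f with
  | zero => rw [hD.eq_mul]; exact Ideal.mul_mem_left _ _ hf
  | succ r ih =>
    induction j generalizing f with
    | zero => exact vanishesToOrder_zero _ _
    | succ j ihj =>
      have hf' : f ∈ (vanishingIdeal x : Ideal (SmoothFn J N)) ^ 1 *
          (vanishingIdeal x : Ideal (SmoothFn J N)) ^ (j + (r + 1)) := by
        rw [← pow_add]
        exact hf.mono (by omega)
      refine Submodule.mul_induction_on hf' (fun h hh g hg => ?_) fun p q hp hq => ?_
      · have e : D (h * g) = h * D g + StarFOI.commMul h D g := by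
          rw [commMul_apply]; ring
        rw [e]
        refine Ideal.add_mem _ ?_ (ih (hD.commMul h) (j + 1) ?_)
        · rw [pow_succ']
          refine Ideal.mul_mem_mul ?_ (ihj hg)
          rwa [pow_one] at hh
        · exact VanishesToOrder.mono (k := j + (r + 1)) hg (by omega)
      · rw [map_add]; exact Ideal.add_mem _ hp hq

variable [IsManifold J ∞ N] [J.Boundaryless] [FiniteDimensional ℝ E] [T2Space N]
  {σ : Type*} [Fintype σ] {b : Module.Basis σ ℝ E} {x₀ : N}

/-- Commutators with coordinate functions induce commutators with `X_i` on jets, and every jet is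
attained. So the pointwise order bound becomes the commutator bound, and preservation of vanishing
orders supplies continuity. -/
theorem HasOrderLE.isDiffOp {r : ℕ} {D : SmoothFn J N →ₗ[ℂ] SmoothFn J N} (hD : HasOrderLE r D)
    {D' : Op σ} (h : ∀ f, D' (jet b x₀ f) = jet b x₀ (D f)) : IsDiffOp r D' := by
  refine isDiffOp_of_orderLT r D' ?_ ⟨r, fun j F hF => ?_⟩
  · obtain ⟨z, hz⟩ := exists_isCoord (J := J) b x₀
    have key : ∀ {D : SmoothFn J N →ₗ[ℂ] SmoothFn J N} {D' : Op σ},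
        (∀ f, D' (jet b x₀ f) = jet b x₀ (D f)) → ∀ i f,
        adX i D' (jet b x₀ f) = jet b x₀ (StarFOI.commMul (z i) D f) := by
      intro D D' h i f
      rw [adX_apply, commMul_apply, ← hz.jet i, ← map_mul, h, h, map_sub, map_mul _ (z i) (D f)]
    induction r generalizing D D' with
    | zero =>
      intro i
      refine LinearMap.ext fun F => ?_
      obtain ⟨f, rfl⟩ := jet_surjective (J := J) (b := b) x₀ F
      rw [key h, commMul_apply, hD.eq_mul, hD.eq_mul f, mul_left_comm, sub_self, map_zero]
      rfl
    | succ r ih => exact fun i => ih (hD.commMul (z i)) (key h i)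
  · obtain ⟨f, rfl⟩ := jet_surjective (J := J) (b := b) x₀ F
    rw [h, jet_mem_orderGE_iff]
    exact hD.vanishesToOrder j (jet_mem_orderGE_iff.mp hF)

end Order

/-! ### From a natural star product to a formal one on jets at a point -/

section FormalStarAt

variable {E : Type} [NormedAddCommGroup E] [NormedSpace ℝ E]
  {H : Type*} [TopologicalSpace H] {J : ModelWithCorners ℝ E H}
  {M : Type*} [TopologicalSpace M] [ChartedSpace H M]
  {P : PoissonBracket J M} {S : StarProduct P}

theorem StarProduct.IsNatural.apply_eq_zero (hS : S.IsNatural) (r : ℕ) {x : M}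
    {f g : SmoothFn J M} (h : VanishesToOrder (r + 1) f x ∨ VanishesToOrder (r + 1) g x) :
    S.C r f g x = 0 := by
  obtain _ | r := r
  · rw [zero_add, vanishesToOrder_one, vanishesToOrder_one] at h
    rw [S.C_zero, smoothFn_mul_apply, mul_eq_zero]
    exact h
  · exact hS _ (by omega) x f g h

theorem StarProduct.IsNatural.right (hS : S.IsNatural) (r : ℕ) (f : SmoothFn J M) :
    HasOrderLE r (S.C r f) := fun _ _ hg => hS.apply_eq_zero r (.inr hg)

theorem StarProduct.IsNatural.left (hS : S.IsNatural) (r : ℕ) (g : SmoothFn J M) :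
    HasOrderLE r ((S.C r).flip g) := fun _ _ hf => hS.apply_eq_zero r (.inl hf)

variable [IsManifold J ∞ M] [J.Boundaryless] [FiniteDimensional ℝ E] [T2Space M]
  {σ : Type*} [Fintype σ] {b : Module.Basis σ ℝ E} {x : M}

/-- An operator of finite order maps functions flat at `x` to functions flat at `x`; hence it
descends to jets. -/
theorem HasOrderLE.jet_congr {r : ℕ} {D : SmoothFn J M →ₗ[ℂ] SmoothFn J M} (hD : HasOrderLE r D)
    {f g : SmoothFn J M} (h : jet b x f = jet b x g) : jet b x (D f) = jet b x (D g) := by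
  rw [← sub_eq_zero, ← map_sub, jet_eq_zero_iff] at h
  rw [← sub_eq_zero, ← map_sub, ← map_sub, jet_eq_zero_iff]
  exact fun k => hD.vanishesToOrder k (h _)

theorem StarProduct.IsNatural.jet_congr (hS : S.IsNatural) (r : ℕ) {f f' g g' : SmoothFn J M}
    (hf : jet b x f = jet b x f') (hg : jet b x g = jet b x g') :
    jet b x (S.C r f g) = jet b x (S.C r f' g') :=
  ((hS.right r f).jet_congr hg).trans ((hS.left r g').jet_congr hf)

variable (b x) in
/-- A smooth function with the given jet. -/
def jetLift (F : MvPowerSeries σ ℂ) : SmoothFn J M :=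
  Function.surjInv (jet_surjective (J := J) (b := b) x) F

theorem jet_jetLift (F : MvPowerSeries σ ℂ) : jet b x (jetLift b x F : SmoothFn J M) = F :=
  Function.surjInv_eq _ F

/-- The operators of a natural star product on jets at `x`. -/
def StarProduct.IsNatural.jetC (hS : S.IsNatural) (b : Module.Basis σ ℝ E) (x : M) (r : ℕ) :
    MvPowerSeries σ ℂ →ₗ[ℂ] MvPowerSeries σ ℂ →ₗ[ℂ] MvPowerSeries σ ℂ :=
  LinearMap.mk₂ ℂ (fun F G => jet b x (S.C r (jetLift b x F) (jetLift b x G)))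
    (fun F F' G => by
      rw [← map_add, ← LinearMap.add_apply, ← map_add]
      exact hS.jet_congr r (by rw [map_add, jet_jetLift, jet_jetLift, jet_jetLift]) rfl)
    (fun c F G => by
      rw [← map_smul, ← LinearMap.smul_apply, ← map_smul]
      exact hS.jet_congr r (by rw [map_smul, jet_jetLift, jet_jetLift]) rfl)
    (fun F G G' => by
      rw [← map_add, ← map_add]
      exact hS.jet_congr r rfl (by rw [map_add, jet_jetLift, jet_jetLift, jet_jetLift]))
    (fun c F G => by
      rw [← map_smul, ← map_smul]
      exact hS.jet_congr r rfl (by rw [map_smul, jet_jetLift, jet_jetLift]))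

theorem StarProduct.IsNatural.jetC_jet (hS : S.IsNatural) (r : ℕ) (f g : SmoothFn J M) :
    hS.jetC b x r (jet b x f) (jet b x g) = jet b x (S.C r f g) :=
  hS.jet_congr r (jet_jetLift _) (jet_jetLift _)

/-- The formal star product on jets at `x`. -/
def StarProduct.IsNatural.formalStar (hS : S.IsNatural) (b : Module.Basis σ ℝ E) (x : M) :
    FormalStar σ where
  C := hS.jetC b x
  C_zero F G := by
    obtain ⟨f, rfl⟩ := jet_surjective (J := J) (b := b) x F
    obtain ⟨g, rfl⟩ := jet_surjective (J := J) (b := b) x G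
    rw [hS.jetC_jet, S.C_zero, map_mul]
  one_left r F hr := by
    obtain ⟨f, rfl⟩ := jet_surjective (J := J) (b := b) x F
    rw [← map_one (jet (J := J) b x), hS.jetC_jet, S.one_left r f hr, map_zero]
  one_right r F hr := by
    obtain ⟨f, rfl⟩ := jet_surjective (J := J) (b := b) x F
    rw [← map_one (jet (J := J) b x), hS.jetC_jet, S.one_right r f hr, map_zero]
  assoc m F G K := by
    obtain ⟨f, rfl⟩ := jet_surjective (J := J) (b := b) x F
    obtain ⟨g, rfl⟩ := jet_surjective (J := J) (b := b) x G
    obtain ⟨h, rfl⟩ := jet_surjective (J := J) (b := b) x K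
    simp only [hS.jetC_jet, ← map_sum]
    rw [S.assoc]
  diffOp r F := by
    obtain ⟨f, rfl⟩ := jet_surjective (J := J) (b := b) x F
    exact (hS.right r f).isDiffOp (b := b) (x₀ := x) (fun g => hS.jetC_jet r f g)

theorem StarProduct.IsNatural.formalStar_jet (hS : S.IsNatural) (r : ℕ) (f g : SmoothFn J M) :
    (hS.formalStar b x).C r (jet b x f) (jet b x g) = jet b x (S.C r f g) := hS.jetC_jet r f g

theorem StarProduct.IsNatural.constantCoeff_formalStar (hS : S.IsNatural) (r : ℕ)
    (f g : SmoothFn J M) :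
    constantCoeff ((hS.formalStar b x).C r (jet b x f) (jet b x g)) = S.C r f g x := by
  rw [hS.formalStar_jet, constantCoeff_jet]

theorem StarProduct.IsNatural.isNaturalAtZero (hS : S.IsNatural) :
    (hS.formalStar b x).IsNaturalAtZero := by
  intro r F G h
  obtain ⟨f, rfl⟩ := jet_surjective (J := J) (b := b) x F
  obtain ⟨g, rfl⟩ := jet_surjective (J := J) (b := b) x G
  rw [hS.constantCoeff_formalStar]
  rw [jet_mem_orderGE_iff, jet_mem_orderGE_iff] at h
  exact hS.apply_eq_zero r h

end FormalStarAt

end StarFOI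

end

noncomputable section

namespace StarFOI

open MvPowerSeries Finset.HasAntidiagonal

/-! ### The first order tensor -/

section Tensor

set_option linter.unusedSectionVars false

variable {E : Type} [NormedAddCommGroup E] [NormedSpace ℝ E] [FiniteDimensional ℝ E]
  {σ : Type*} [Fintype σ]

/-- The bilinear form `∑ κ i j α(b i) β(b j)` on the complexified dual of `E`. -/
def tensorOf (b : Module.Basis σ ℝ E) (κ : Matrix σ σ ℂ) : LinearMap.BilinForm ℂ (E →L[ℝ] ℂ) :=
  LinearMap.mk₂ ℂ (fun α β => ∑ i, ∑ j, κ i j * α (b i) * β (b j))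
    (fun α α' β => by
      simp only [← Finset.sum_add_distrib, add_apply]
      exact Finset.sum_congr rfl fun i _ => Finset.sum_congr rfl fun j _ => by ring)
    (fun c α β => by
      simp only [smul_apply, smul_eq_mul, Finset.mul_sum]
      exact Finset.sum_congr rfl fun i _ => Finset.sum_congr rfl fun j _ => by ring)
    (fun α β β' => by
      simp only [← Finset.sum_add_distrib, add_apply]
      exact Finset.sum_congr rfl fun i _ => Finset.sum_congr rfl fun j _ => by ring)
    (fun c α β => by
      simp only [smul_apply, smul_eq_mul, Finset.mul_sum]
      exact Finset.sum_congr rfl fun i _ => Finset.sum_congr rfl fun j _ => by ring)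

theorem tensorOf_apply (b : Module.Basis σ ℝ E) (κ : Matrix σ σ ℂ) (α β : E →L[ℝ] ℂ) :
    tensorOf b κ α β = ∑ i, ∑ j, κ i j * α (b i) * β (b j) := rfl

theorem coordC_basis [DecidableEq σ] (b : Module.Basis σ ℝ E) (i j : σ) :
    coordC b i (b j) = if i = j then 1 else 0 := by
  rw [coordC_apply, Module.Basis.repr_self, Finsupp.single_apply]
  split_ifs <;> simp_all

/-- A complex covector is determined by its values on a basis. -/
def covectorEquiv (b : Module.Basis σ ℝ E) : (E →L[ℝ] ℂ) ≃ₗ[ℂ] (σ → ℂ) where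
  toFun α i := α (b i)
  map_add' _ _ := rfl
  map_smul' _ _ := rfl
  invFun c := ∑ i, c i • coordC b i
  left_inv α := by
    ext w
    rw [sum_coordC_mul b α w]
    simp [mul_comm]
  right_inv c := by
    classical
    funext j
    simp [coordC_basis]

theorem nondegenerate_tensorOf_iff [DecidableEq σ] (b : Module.Basis σ ℝ E) (κ : Matrix σ σ ℂ) :
    (tensorOf b κ).Nondegenerate ↔ κ.det ≠ 0 := by
  let β : Module.Basis σ ℂ (E →L[ℝ] ℂ) := Module.Basis.ofEquivFun (covectorEquiv b)
  have h : LinearMap.BilinForm.toMatrix β (tensorOf b κ) = κ := by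
    ext i j
    have hβ : ∀ i, β i = coordC b i := by
      intro i
      rw [Module.Basis.coe_ofEquivFun]
      change ∑ k, (Pi.single i (1 : ℂ) : σ → ℂ) k • coordC b k = _
      rw [Finset.sum_eq_single i]
      · simp
      · intro k _ hk
        rw [Pi.single_eq_of_ne hk]; exact zero_smul ℂ (coordC b k)
      · simp
    rw [LinearMap.BilinForm.toMatrix_apply, hβ, hβ, tensorOf_apply]
    simp [coordC_basis]
  rw [← LinearMap.BilinForm.nondegenerate_toMatrix_iff β, h, Matrix.nondegenerate_iff_det_ne_zero]

end Tensor

section FirstTensor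

set_option linter.unusedSectionVars false

variable {E : Type} [NormedAddCommGroup E] [NormedSpace ℝ E]
  {H : Type*} [TopologicalSpace H] {J : ModelWithCorners ℝ E H}
  {M : Type*} [TopologicalSpace M] [ChartedSpace H M]
  {P : PoissonBracket J M} {S : StarProduct P}
  [IsManifold J ∞ M] [J.Boundaryless] [FiniteDimensional ℝ E] [T2Space M]
  {σ : Type*} [Fintype σ] {b : Module.Basis σ ℝ E} {x : M}

/-- `C_1` has order at most one in each argument at the origin and kills constants, so only the
linear parts of both arguments contribute. -/
theorem FormalStar.constantCoeff_C_one {T : FormalStar σ} (hT : T.IsNaturalAtZero)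
    (F G : MvPowerSeries σ ℂ) : constantCoeff (T.C 1 F G) = ∑ i, ∑ j,
      constantCoeff (T.C 1 (X i) (X j)) * constantCoeff (pderiv ℂ i F) *
        constantCoeff (pderiv ℂ j G) := by
  have hmem : ∀ F : MvPowerSeries σ ℂ, F - constantCoeff F • 1 -
      ∑ d, constantCoeff (pderiv ℂ d F) • X d ∈ orderGE σ (1 + 1 : ℕ) := by
    intro F
    have h1 : constantCoeff (F - constantCoeff F • (1 : MvPowerSeries σ ℂ)) = 0 := by
      rw [map_sub, constantCoeff_smul]; simp
    have h2 := sub_linear_mem_orderGE h1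
    have h3 : ∀ d, pderiv ℂ d (F - constantCoeff F • (1 : MvPowerSeries σ ℂ)) = pderiv ℂ d F := by
      intro d
      rw [map_sub, Derivation.map_smul, Derivation.map_one_eq_zero, smul_zero, sub_zero]
    simp only [h3] at h2
    exact h2
  have hF := hT 1 _ G (.inl (hmem F))
  rw [map_sub, map_sub, map_smul, map_sum, LinearMap.sub_apply, LinearMap.sub_apply,
    LinearMap.smul_apply, T.one_left 1 _ le_rfl, smul_zero, sub_zero, map_sub, sub_eq_zero,
    LinearMap.sum_apply, map_sum] at hF
  rw [hF]
  refine Finset.sum_congr rfl fun i _ => ?_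
  have hG := hT 1 (X i) _ (.inr (hmem G))
  rw [map_sub (T.C 1 (X i)), map_sub (T.C 1 (X i)), map_smul, map_sum, T.one_right 1 _ le_rfl,
    smul_zero, sub_zero, map_sub, sub_eq_zero, map_sum] at hG
  rw [map_smul, LinearMap.smul_apply, constantCoeff_smul, hG, smul_eq_mul, Finset.mul_sum]
  refine Finset.sum_congr rfl fun j _ => ?_
  rw [map_smul, constantCoeff_smul, smul_eq_mul]
  ring

variable (b) in
/-- The matrix of `C₁` at `x` in the preferred chart at `x`. -/
def StarProduct.IsNatural.firstMatrix (hS : S.IsNatural) (x : M) : Matrix σ σ ℂ :=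
  Matrix.of fun i j => constantCoeff ((hS.formalStar b x).C 1 (X i) (X j))

variable (b) in
/-- The tensor of `C₁`. -/
def StarProduct.IsNatural.firstTensor (hS : S.IsNatural) : ContravariantTensor J M :=
  fun x => tensorOf (E := E) b (hS.firstMatrix b x)

theorem StarProduct.IsNatural.isFirstTensor (hS : S.IsNatural) :
    S.IsFirstTensor (hS.firstTensor b) := by
  intro f g x
  rw [← hS.constantCoeff_formalStar (b := b), FormalStar.constantCoeff_C_one hS.isNaturalAtZero]
  refine Finset.sum_congr rfl fun i _ => Finset.sum_congr rfl fun j _ => ?_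
  rw [constantCoeff_pderiv_jet, constantCoeff_pderiv_jet]
  rfl

/-- Every complex covector at a point is the differential of a global function; this yields
uniqueness of the tensor `K`. -/
theorem exists_differential_eq (b : Module.Basis σ ℝ E) (x : M) (α : TangentSpace J x →L[ℝ] ℂ) :
    ∃ f : SmoothFn J M, differential f x = α := by
  classical
  obtain ⟨f, hf⟩ := jet_surjective (J := J) (b := b) x (∑ i, (α (b i)) • X i)
  refine ⟨f, ?_⟩
  have h : covectorEquiv b (differential f x : E →L[ℝ] ℂ) = covectorEquiv b (α : E →L[ℝ] ℂ) := by
    funext j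
    refine (constantCoeff_pderiv_jet (b := b) f j).symm.trans ?_
    rw [hf, map_sum, map_sum, Finset.sum_eq_single j]
    · rw [Derivation.map_smul, pderiv_X_self, constantCoeff_smul, map_one, smul_eq_mul, mul_one]
      rfl
    · intro i _ hi
      rw [Derivation.map_smul, pderiv_X_of_ne hi, smul_zero, map_zero]
    · simp
  exact (covectorEquiv b).injective h

theorem StarProduct.IsFirstTensor.unique (b : Module.Basis σ ℝ E) {K K' : ContravariantTensor J M}
    (hK : S.IsFirstTensor K) (hK' : S.IsFirstTensor K') : K = K' := by
  funext x
  refine LinearMap.ext₂ fun α β => ?_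
  obtain ⟨f, rfl⟩ := exists_differential_eq b x α
  obtain ⟨g, rfl⟩ := exists_differential_eq b x β
  rw [← hK, ← hK']

theorem StarProduct.IsNatural.nondegenerate_firstTensor_iff [DecidableEq σ] (hS : S.IsNatural) :
    (hS.firstTensor b x).Nondegenerate ↔ (hS.firstMatrix b x).det ≠ 0 :=
  nondegenerate_tensorOf_iff b (hS.firstMatrix b x)

end FirstTensor

/-! ### The point distribution of a natural star product -/

section Point

set_option linter.unusedSectionVars false

variable {E : Type} [NormedAddCommGroup E] [NormedSpace ℝ E]
  {H : Type*} [TopologicalSpace H] {J : ModelWithCorners ℝ E H}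
  {M : Type*} [TopologicalSpace M] [ChartedSpace H M]
  {P : PoissonBracket J M} {S : StarProduct P}
  {σ : Type*} [Fintype σ] {b : Module.Basis σ ℝ E} {x : M}

theorem VanishesToOrder.comp_fst {k : ℕ} {f : SmoothFn J M} {x y : M} (h : VanishesToOrder k f x) :
    VanishesToOrder k (f.comp ContMDiffMap.fst : SmoothFn (J.prod J) (M × M)) (x, y) := by
  let Φ : SmoothFn J M →+* SmoothFn (J.prod J) (M × M) :=
    { toFun := fun f => f.comp ContMDiffMap.fst
      map_one' := rfl, map_mul' := fun _ _ => rfl, map_zero' := rfl, map_add' := fun _ _ => rfl }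
  have h1 : (vanishingIdeal x : Ideal (SmoothFn J M)).map Φ ≤ vanishingIdeal (x, y) :=
    Ideal.map_le_iff_le_comap.mpr fun g hg => hg
  have h2 := Ideal.mem_map_of_mem Φ h
  rw [Ideal.map_pow] at h2
  exact Ideal.pow_right_mono h1 k h2

theorem VanishesToOrder.comp_snd {k : ℕ} {f : SmoothFn J M} {x y : M} (h : VanishesToOrder k f y) :
    VanishesToOrder k (f.comp ContMDiffMap.snd : SmoothFn (J.prod J) (M × M)) (x, y) := by
  let Φ : SmoothFn J M →+* SmoothFn (J.prod J) (M × M) :=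
    { toFun := fun f => f.comp ContMDiffMap.snd
      map_one' := rfl, map_mul' := fun _ _ => rfl, map_zero' := rfl, map_add' := fun _ _ => rfl }
  have h1 : (vanishingIdeal y : Ideal (SmoothFn J M)).map Φ ≤ vanishingIdeal (x, y) :=
    Ideal.map_le_iff_le_comap.mpr fun g hg => hg
  have h2 := Ideal.mem_map_of_mem Φ h
  rw [Ideal.map_pow] at h2
  exact Ideal.pow_right_mono h1 k h2

/-- The exterior product of functions as a bilinear map. -/
def tensorBilin : SmoothFn J M →ₗ[ℂ] SmoothFn J M →ₗ[ℂ] SmoothFn (J.prod J) (M × M) :=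
  LinearMap.mk₂ ℂ tensorFn
    (fun f f' g => by
      ext p
      change (f p.1 + f' p.1) * g p.2 = f p.1 * g p.2 + f' p.1 * g p.2
      ring)
    (fun c f g => by
      ext p
      rw [smoothFn_smul_apply]
      change (c • f) p.1 * g p.2 = c * (f p.1 * g p.2)
      rw [smoothFn_smul_apply, mul_assoc])
    (fun f g g' => by
      ext p
      change f p.1 * (g p.2 + g' p.2) = f p.1 * g p.2 + f p.1 * g' p.2
      ring)
    (fun c f g => by
      ext p
      rw [smoothFn_smul_apply]
      change f p.1 * (c • g) p.2 = c * (f p.1 * g p.2)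
      rw [smoothFn_smul_apply]
      ring)

/-- Coordinates on `M × M`. -/
def prodCoord (z : σ → SmoothFn J M) : σ ⊕ σ → SmoothFn (J.prod J) (M × M) :=
  Sum.elim (fun i => (z i).comp ContMDiffMap.fst) (fun i => (z i).comp ContMDiffMap.snd)

theorem tensorFn_prod_pow (z : σ → SmoothFn J M) (δ : σ ⊕ σ →₀ ℕ) :
    tensorFn (∏ i, z i ^ δ (Sum.inl i)) (∏ i, z i ^ δ (Sum.inr i)) = ∏ a, prodCoord z a ^ δ a := by
  let Φ : SmoothFn J M →+* SmoothFn (J.prod J) (M × M) :=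
    { toFun := fun f => f.comp ContMDiffMap.fst
      map_one' := rfl, map_mul' := fun _ _ => rfl, map_zero' := rfl, map_add' := fun _ _ => rfl }
  let Ψ : SmoothFn J M →+* SmoothFn (J.prod J) (M × M) :=
    { toFun := fun f => f.comp ContMDiffMap.snd
      map_one' := rfl, map_mul' := fun _ _ => rfl, map_zero' := rfl, map_add' := fun _ _ => rfl }
  rw [Fintype.prod_sum_type]
  change Φ _ * Ψ _ = _
  simp only [map_prod, map_pow]
  rfl

variable [IsManifold J ∞ M] [J.Boundaryless] [FiniteDimensional ℝ E] [T2Space M]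

/-- By Taylor's formula a functional of finite order at a point is determined by its values on
monomials in local coordinates. -/
theorem IsCoord.functional_ext {N : Type*} [TopologicalSpace N] [ChartedSpace H N]
    [IsManifold J ∞ N] [T2Space N] {x₀ : N} {z : σ → SmoothFn J N} (hz : IsCoord b x₀ z) {k : ℕ}
    {L L' : SmoothFn J N →ₗ[ℂ] ℂ} (hL : ∀ f, VanishesToOrder k f x₀ → L f = 0)
    (hL' : ∀ f, VanishesToOrder k f x₀ → L' f = 0)
    (h : ∀ γ : σ →₀ ℕ, L (∏ i, z i ^ γ i) = L' (∏ i, z i ^ γ i)) : L = L' := by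
  refine LinearMap.ext fun f => ?_
  obtain ⟨p, hp⟩ := hz.exists_aeval k f
  have h1 := hL _ hp
  have h2 := hL' _ hp
  rw [map_sub, sub_eq_zero] at h1 h2
  rw [h1, h2]
  conv_lhs => rw [p.as_sum]
  conv_rhs => rw [p.as_sum]
  rw [map_sum, map_sum, map_sum]
  refine Finset.sum_congr rfl fun γ _ => ?_
  rw [MvPolynomial.aeval_monomial, ← Algebra.smul_def, map_smul, map_smul,
    Finsupp.prod_fintype _ _ (fun i => pow_zero _), h]

theorem IsCoord.prodCoord {z : σ → SmoothFn J M} (hz : IsCoord b x z) :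
    IsCoord (b.prod b) (x, x) (prodCoord z) := by
  have hE : extChartAt (J.prod J) (x, x) = (extChartAt J x).prod (extChartAt J x) :=
    extChartAt_prod (x, x)
  have hp : (extChartAt (J.prod J) (x, x)) (x, x) = (extChartAt J x x, extChartAt J x x) := by
    rw [hE]; rfl
  rintro (i | i)
  · rw [hp]
    have h := (continuous_fst.tendsto (extChartAt J x x, extChartAt J x x)).eventually (hz i)
    filter_upwards [h] with y hy
    have h1 : inChart (StarFOI.prodCoord z (Sum.inl i)) (x, x) y = inChart (z i) x y.1 := by
      rw [inChart, hE]; rfl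
    rw [h1, hy, coordC_apply, coordC_apply, Module.Basis.prod_repr_inl]
    rfl
  · rw [hp]
    have h := (continuous_snd.tendsto (extChartAt J x x, extChartAt J x x)).eventually (hz i)
    filter_upwards [h] with y hy
    have h1 : inChart (StarFOI.prodCoord z (Sum.inr i)) (x, x) y = inChart (z i) x y.2 := by
      rw [inChart, hE]; rfl
    rw [h1, hy, coordC_apply, coordC_apply, Module.Basis.prod_repr_inr]
    rfl

variable (b) in
/-- The distribution `f ⊗ g ↦ (f ⋆ g)(x)`. -/
def StarProduct.IsNatural.pointDistribution (hS : S.IsNatural) (x : M) :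
    FormalFunctional (J.prod J) (M × M) :=
  fun r => (hS.formalStar b x).lam r ∘ₗ (jet (b.prod b) (x, x)).toLinearMap

theorem StarProduct.IsNatural.pointDistribution_apply (hS : S.IsNatural) (r : ℕ)
    (f : SmoothFn (J.prod J) (M × M)) : hS.pointDistribution b x r f =
      (hS.formalStar b x).lam r (jet (b.prod b) (x, x) f) := rfl

theorem StarProduct.IsNatural.pointDistribution_eq_zero (hS : S.IsNatural) (r : ℕ)
    {f : SmoothFn (J.prod J) (M × M)} (hf : VanishesToOrder (2 * r + 1) f (x, x)) :
    hS.pointDistribution b x r f = 0 := by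
  rw [hS.pointDistribution_apply]
  exact (hS.formalStar b x).lam_eq_zero r hf.jet_mem

theorem StarProduct.IsNatural.isPointDistribution (hS : S.IsNatural) :
    S.IsPointDistribution x (hS.pointDistribution b x) := by
  refine ⟨fun r => ⟨2 * r, fun f hf => hS.pointDistribution_eq_zero r hf⟩, fun r f g => ?_⟩
  obtain ⟨z, hz⟩ := exists_isCoord (J := J) b x
  let ev : SmoothFn J M →ₗ[ℂ] ℂ :=
    { toFun := fun f => f x, map_add' := fun _ _ => rfl, map_smul' := fun c f =>
        smoothFn_smul_apply c f x }
  let A : SmoothFn J M →ₗ[ℂ] SmoothFn J M →ₗ[ℂ] ℂ :=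
    tensorBilin.compr₂ (hS.pointDistribution b x r)
  -- Both bilinear forms have finite order in each argument separately; they agree on coordinate
  -- monomials by construction of `lam`, and the equality is extended in one argument after the
  -- other.
  let B : SmoothFn J M →ₗ[ℂ] SmoothFn J M →ₗ[ℂ] ℂ := (S.C r).compr₂ ev
  have hA : ∀ f g, A f g = hS.pointDistribution b x r (tensorFn f g) := fun _ _ => rfl
  have hB : ∀ f g, B f g = S.C r f g x := fun _ _ => rfl
  have hA1 : ∀ f g, VanishesToOrder (2 * r + 1) f x → A f g = 0 := fun f g hf =>
    hS.pointDistribution_eq_zero r (Ideal.mul_mem_right _ _ hf.comp_fst)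
  have hA2 : ∀ f g, VanishesToOrder (2 * r + 1) g x → A f g = 0 := fun f g hg =>
    hS.pointDistribution_eq_zero r (Ideal.mul_mem_left _ _ hg.comp_snd)
  have hB1 : ∀ f g, VanishesToOrder (2 * r + 1) f x → B f g = 0 := fun f g hf =>
    hS.apply_eq_zero r (.inl (hf.mono (by omega)))
  have hB2 : ∀ f g, VanishesToOrder (2 * r + 1) g x → B f g = 0 := fun f g hg =>
    hS.apply_eq_zero r (.inr (hg.mono (by omega)))
  have hm : ∀ γ δ : σ →₀ ℕ, A (∏ i, z i ^ γ i) (∏ i, z i ^ δ i) =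
      B (∏ i, z i ^ γ i) (∏ i, z i ^ δ i) := by
    intro γ δ
    have e := tensorFn_prod_pow z (Finsupp.sumElim γ δ)
    simp only [Finsupp.sumElim_inl, Finsupp.sumElim_inr] at e
    have hj : jet (b.prod b) (x, x) (∏ a, prodCoord z a ^ (Finsupp.sumElim γ δ) a) =
        monomial (Finsupp.sumElim γ δ) 1 := by
      rw [map_prod]
      simp only [map_pow, hz.prodCoord.jet]
      rw [monomial_one_eq, Finsupp.prod_fintype _ _ (fun i => pow_zero _)]
    rw [hA, hB, e, hS.pointDistribution_apply, hj, FormalStar.lam_monomial hS.isNaturalAtZero,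
      ← hS.constantCoeff_formalStar (b := b)]
    simp only [Finsupp.sumElim_inl, Finsupp.sumElim_inr, map_prod, map_pow, hz.jet]
  have h1 : ∀ γ : σ →₀ ℕ, A (∏ i, z i ^ γ i) = B (∏ i, z i ^ γ i) := fun γ =>
    hz.functional_ext (hA2 _) (hB2 _) (hm γ)
  have h2 : A.flip g = B.flip g :=
    hz.functional_ext (fun f hf => hA1 f g hf) (fun f hf => hB1 f g hf) fun γ => by
      rw [LinearMap.flip_apply, LinearMap.flip_apply, h1]
  exact DFunLike.congr_fun h2 f

theorem StarProduct.IsPointDistribution.unique (b : Module.Basis σ ℝ E)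
    {Λ Λ' : FormalFunctional (J.prod J) (M × M)}
    (h : S.IsPointDistribution x Λ) (h' : S.IsPointDistribution x Λ') : Λ = Λ' := by
  funext r
  obtain ⟨z, hz⟩ := exists_isCoord (J := J) b x
  obtain ⟨k, hk⟩ := h.1 r
  obtain ⟨l, hl⟩ := h'.1 r
  refine hz.prodCoord.functional_ext (k := k + l + 1) (fun f hf => hk f (hf.mono (by omega)))
    (fun f hf => hl f (hf.mono (by omega))) fun δ => ?_
  rw [← tensorFn_prod_pow, h.2, h'.2]

theorem StarProduct.IsNatural.pointDistribution_zero (hS : S.IsNatural)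
    (f : SmoothFn (J.prod J) (M × M)) : hS.pointDistribution b x 0 f = f (x, x) := by
  rw [hS.pointDistribution_apply,
    (FormalStar.isPointFunctional_lam hS.isNaturalAtZero).zero, constantCoeff_jet]

/-- If `K` is invertible, the formal phase exists. Conversely the Hessian of any phase inverts, up
to sign, the matrix of second moments, whose off-diagonal blocks are `K` and `Kᵀ`. -/
theorem StarProduct.IsNatural.isFOI_iff [DecidableEq σ] (hS : S.IsNatural) :
    IsFOI (x, x) (hS.pointDistribution b x) ↔ (hS.firstMatrix b x).det ≠ 0 := by
  have hN := hS.isNaturalAtZero (b := b) (x := x)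
  constructor
  · intro h hdet
    obtain ⟨Q, hQ⟩ := h.exists_inverse (b := b.prod b) hS.pointDistribution_zero
      (L := (hS.formalStar b x).lam 1)
      (fun F hF => (hS.formalStar b x).lam_eq_zero 1 hF) (fun f => rfl)
    have hB : (Matrix.of fun a c => (hS.formalStar b x).lam 1 (X a * X c)) =
        Matrix.fromBlocks 0 (hS.firstMatrix b x) (hS.firstMatrix b x)ᵀ 0 := by
      ext a c
      exact FormalStar.lam_one_X_mul_X hN a c
    obtain ⟨v, hv, hv0⟩ := Matrix.exists_mulVec_eq_zero_iff.mpr hdet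
    rw [hB] at hQ
    -- A vector `v` in the kernel of `K` gives `(0, v)` in the kernel of the block matrix, which has
    -- a left inverse up to sign; so `v = 0`.
    have h1 := congrArg (fun A => A *ᵥ (Sum.elim 0 v : σ ⊕ σ → ℂ)) hQ
    simp only [← Matrix.mulVec_mulVec, Matrix.fromBlocks_mulVec, Matrix.neg_mulVec,
      Matrix.one_mulVec] at h1
    apply hv
    funext i
    have h2 := congrFun h1 (Sum.inr i)
    simp [hv0] at h2
    simpa using h2
  · intro hdet
    obtain ⟨ψ, h1, h2, h3⟩ := FormalStar.exists_phase hN hdet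
    exact isFOI_of_phase (b := b.prod b)
      (fun F => (FormalStar.isPointFunctional_lam hN).zero F)
      (fun q F hF => (hS.formalStar b x).lam_eq_zero q hF) h1 h2 h3 fun q f => rfl

end Point

end StarFOI

end

noncomputable section

namespace StarFOI

open MvPowerSeries Finset.HasAntidiagonal

/-! ### Coefficients of the Moyal product -/

section Moyal

variable {n : ℕ}

/-- The multi-index of a sequence of indices. -/
def multiIndex {s : ℕ} (i : Fin s → Fin n) : Fin n →₀ ℕ := ∑ t, Finsupp.single (i t) 1

theorem degree_multiIndex {s : ℕ} (i : Fin s → Fin n) : (multiIndex i).degree = s := by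
  rw [multiIndex, map_sum]
  simp

theorem iterPderiv_zero (i : Fin 0 → Fin n) (F : MvPowerSeries (Fin n) ℂ) : iterPderiv i F = F := by
  rw [iterPderiv, List.ofFn_zero]; rfl

theorem iterPderiv_succ {s : ℕ} (i : Fin (s + 1) → Fin n) (F : MvPowerSeries (Fin n) ℂ) :
    iterPderiv i F = pderiv ℂ (i 0) (iterPderiv (fun t => i t.succ) F) := by
  rw [iterPderiv, List.ofFn_succ]; rfl

theorem iterPderiv_add {s : ℕ} (i : Fin s → Fin n) (F G : MvPowerSeries (Fin n) ℂ) :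
    iterPderiv i (F + G) = iterPderiv i F + iterPderiv i G := by
  induction s with
  | zero => simp only [iterPderiv_zero]
  | succ s ih => rw [iterPderiv_succ, iterPderiv_succ, iterPderiv_succ, ih, map_add]

/-- The coefficients of iterated derivatives. -/
def iterCoeff : ∀ {s : ℕ}, (Fin s → Fin n) → (Fin n →₀ ℕ) → ℂ
  | 0, _, _ => 1
  | _ + 1, i, κ => iterCoeff (fun t => i t.succ) (κ + Finsupp.single (i 0) 1) * (κ (i 0) + 1)

theorem coeff_iterPderiv {s : ℕ} (i : Fin s → Fin n) (κ : Fin n →₀ ℕ)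
    (F : MvPowerSeries (Fin n) ℂ) :
    coeff κ (iterPderiv i F) = iterCoeff i κ * coeff (κ + multiIndex i) F := by
  induction s generalizing κ with
  | zero => rw [iterPderiv_zero, iterCoeff, one_mul, multiIndex, Finset.univ_eq_empty,
      Finset.sum_empty, add_zero]
  | succ s ih =>
    have h : multiIndex i = Finsupp.single (i 0) 1 + multiIndex (fun t => i t.succ) := by
      rw [multiIndex, Fin.sum_univ_succ]; rfl
    rw [iterPderiv_succ, coeff_pderiv, ih, iterCoeff, h, ← add_assoc]
    ring

theorem wcoeff_moyal (π : Matrix (Fin n) (Fin n) ℝ) (a b : FormalWeyl n) (m : ℕ)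
    (μ : Fin n →₀ ℕ) : wcoeff m μ (moyal π a b) =
      ∑ p ∈ antidiagonal m, ∑ q ∈ antidiagonal p.2, ∑ i : Fin p.1 → Fin n, ∑ j : Fin p.1 → Fin n,
        ∑ κ ∈ antidiagonal μ, ((1 : ℂ) / (2 ^ p.1 * (p.1.factorial : ℂ)) * iterCoeff i κ.1 *
          iterCoeff j κ.2) * ((∏ t, (π (i t) (j t) : ℂ)) *
            (wcoeff q.1 (κ.1 + multiIndex i) a * wcoeff q.2 (κ.2 + multiIndex j) b)) := by
  rw [wcoeff, moyal, PowerSeries.coeff_mk, map_sum]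
  refine Finset.sum_congr rfl fun p _ => ?_
  rw [map_sum]
  refine Finset.sum_congr rfl fun q _ => ?_
  rw [map_smul, map_sum, smul_eq_mul, Finset.mul_sum]
  refine Finset.sum_congr rfl fun i _ => ?_
  rw [map_sum, Finset.mul_sum]
  refine Finset.sum_congr rfl fun j _ => ?_
  rw [map_smul, coeff_mul, smul_eq_mul, Finset.mul_sum, Finset.mul_sum]
  refine Finset.sum_congr rfl fun κ _ => ?_
  rw [coeff_iterPderiv, coeff_iterPderiv]
  simp only [wcoeff]
  ring

theorem moyal_add_left (π : Matrix (Fin n) (Fin n) ℝ) (a a' b : FormalWeyl n) :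
    moyal π (a + a') b = moyal π a b + moyal π a' b := by
  ext m : 1
  rw [map_add]
  simp only [moyal, PowerSeries.coeff_mk, map_add, iterPderiv_add, add_mul, smul_add,
    Finset.sum_add_distrib]

theorem moyal_add_right (π : Matrix (Fin n) (Fin n) ℝ) (a b b' : FormalWeyl n) :
    moyal π a (b + b') = moyal π a b + moyal π a b' := by
  ext m : 1
  rw [map_add]
  simp only [moyal, PowerSeries.coeff_mk, map_add, iterPderiv_add, mul_add, smul_add,
    Finset.sum_add_distrib]

theorem wcomm_add_left (π : Matrix (Fin n) (Fin n) ℝ) (a a' b : FormalWeyl n) :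
    wcomm π (a + a') b = wcomm π a b + wcomm π a' b := by
  rw [wcomm, wcomm, wcomm, moyal_add_left, moyal_add_right]
  ring

/-- A linear form in the generators of the Weyl algebra. -/
def linearWeyl (w : Fin n → ℂ) : FormalWeyl n := ∑ i, wconst (w i) * wvar i

theorem linearWeyl_eq (w : Fin n → ℂ) : linearWeyl w = PowerSeries.C (∑ i, w i • X i) := by
  rw [linearWeyl, map_sum]
  refine Finset.sum_congr rfl fun i _ => ?_
  rw [wconst, wvar, ← map_mul, ← smul_eq_C_mul]

theorem pderiv_linear (w : Fin n → ℂ) (k : Fin n) :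
    pderiv ℂ k (∑ i, w i • X i : MvPowerSeries (Fin n) ℂ) = MvPowerSeries.C (w k) := by
  rw [map_sum, Finset.sum_eq_single k]
  · rw [Derivation.map_smul, pderiv_X_self, smul_eq_C_mul, mul_one]
  · intro i _ hi
    rw [Derivation.map_smul, pderiv_X_of_ne hi, smul_zero]
  · simp

theorem pderiv_C_eq_zero (k : Fin n) (c : ℂ) :
    pderiv ℂ k (MvPowerSeries.C c : MvPowerSeries (Fin n) ℂ) = 0 :=
  (pderiv ℂ k).map_algebraMap c

theorem iterPderiv_linear {s : ℕ} (w : Fin n → ℂ) (i : Fin (s + 2) → Fin n) :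
    iterPderiv i (∑ i, w i • X i : MvPowerSeries (Fin n) ℂ) = 0 := by
  induction s with
  | zero =>
    rw [iterPderiv_succ, iterPderiv_succ, iterPderiv_zero, pderiv_linear, pderiv_C_eq_zero]
  | succ s ih => rw [iterPderiv_succ, ih, map_zero]

theorem sum_fin_one_fun {R : Type*} [AddCommMonoid R] (φ : (Fin 1 → Fin n) → R) :
    ∑ i : Fin 1 → Fin n, φ i = ∑ k : Fin n, φ fun _ => k :=
  (Equiv.sum_comp (Equiv.funUnique (Fin 1) (Fin n)).symm φ).symm

theorem iterPderiv_one (k : Fin n) (F : MvPowerSeries (Fin n) ℂ) :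
    iterPderiv (fun _ : Fin 1 => k) F = pderiv ℂ k F := by
  rw [iterPderiv_succ, iterPderiv_zero]

/-- Second derivatives of a linear form vanish, so the exponential series of the product stops after
first order. -/
theorem coeff_moyal_linear_left (π : Matrix (Fin n) (Fin n) ℝ) (w : Fin n → ℂ) (a : FormalWeyl n)
    (m : ℕ) : PowerSeries.coeff (m + 1) (moyal π (linearWeyl w) a) =
      (∑ i, w i • X i) * PowerSeries.coeff (m + 1) a +
        (1 / 2 : ℂ) • ∑ i, ∑ j, ((π i j : ℂ) * w i) • pderiv ℂ j (PowerSeries.coeff m a) := by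
  rw [moyal, PowerSeries.coeff_mk, linearWeyl_eq]
  have h1 : ∀ p : ℕ × ℕ, ∀ F : ℕ × ℕ → MvPowerSeries (Fin n) ℂ,
      (∀ q, q.1 ≠ 0 → F q = 0) → ∑ q ∈ antidiagonal p.2, F q = F (0, p.2) := by
    intro p F hF
    refine Finset.sum_eq_single (0, p.2) (fun q hq hne => hF q fun h0 => hne ?_) fun h => ?_
    · rw [mem_antidiagonal, h0, zero_add] at hq
      exact Prod.ext h0 hq
    · exact absurd (mem_antidiagonal.mpr (zero_add _)) h
  have h2 : ∀ p : ℕ × ℕ, _ := fun p => h1 p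
    (fun q => ((1 : ℂ) / (2 ^ p.1 * (p.1.factorial : ℂ))) • ∑ i : Fin p.1 → Fin n,
      ∑ j : Fin p.1 → Fin n, (∏ t, (π (i t) (j t) : ℂ)) •
        (iterPderiv i (PowerSeries.coeff q.1 (PowerSeries.C (∑ i, w i • X i))) *
          iterPderiv j (PowerSeries.coeff q.2 a))) (fun q hq => by
      rw [PowerSeries.coeff_C, if_neg hq]
      have h0 : ∀ i : Fin p.1 → Fin n, iterPderiv i (0 : MvPowerSeries (Fin n) ℂ) = 0 := by
        intro i
        ext κ
        rw [coeff_iterPderiv]; simp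
      simp [h0])
  rw [Finset.sum_congr rfl fun p _ => h2 p]
  simp only [PowerSeries.coeff_zero_C]
  rw [Finset.Nat.sum_antidiagonal_succ]
  congr 1
  · simp [iterPderiv_zero]
  · rw [Finset.sum_eq_single (0, m)]
    · change ((1 : ℂ) / (2 ^ 1 * ((1 : ℕ).factorial : ℂ))) • ∑ i : Fin 1 → Fin n,
        ∑ j : Fin 1 → Fin n, (∏ t, (π (i t) (j t) : ℂ)) •
          (iterPderiv i (∑ i, w i • X i) * iterPderiv j (PowerSeries.coeff m a)) = _
      rw [pow_one, Nat.factorial_one, Nat.cast_one, mul_one]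
      simp only [sum_fin_one_fun, iterPderiv_one, pderiv_linear, Finset.univ_unique,
        Finset.prod_singleton, ← smul_eq_C_mul, smul_smul]
    · rintro ⟨s, t⟩ hst hne
      obtain _ | s := s
      · rw [mem_antidiagonal] at hst
        simp only [zero_add] at hst
        exact absurd (by rw [hst]) hne
      · simp only [iterPderiv_linear]
        simp
    · intro h
      exact absurd (mem_antidiagonal.mpr (zero_add m)) h

theorem iterPderiv_const_mul_comm {s : ℕ} (π : Matrix (Fin n) (Fin n) ℝ)
    (F G : MvPowerSeries (Fin n) ℂ) :
    ∑ i : Fin s → Fin n, ∑ j : Fin s → Fin n, (∏ t, (π (i t) (j t) : ℂ)) •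
      (iterPderiv i F * iterPderiv j G) =
    ∑ i : Fin s → Fin n, ∑ j : Fin s → Fin n, (∏ t, (πᵀ (i t) (j t) : ℂ)) •
      (iterPderiv i G * iterPderiv j F) := by
  rw [Finset.sum_comm]
  refine Finset.sum_congr rfl fun i _ => Finset.sum_congr rfl fun j _ => ?_
  rw [mul_comm]
  rfl

/-- Interchanging the factors interchanges the two indices of each `π`; for skew `π` this changes
the sign of the odd terms. -/
theorem moyal_swap (π : Matrix (Fin n) (Fin n) ℝ) (a b : FormalWeyl n) :
    moyal π a b = moyal πᵀ b a := by
  ext m : 1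
  rw [moyal, moyal, PowerSeries.coeff_mk, PowerSeries.coeff_mk]
  refine Finset.sum_congr rfl fun p _ => ?_
  rw [← Finset.Nat.sum_antidiagonal_swap]
  refine Finset.sum_congr rfl fun q _ => ?_
  rw [iterPderiv_const_mul_comm]
  rfl

/-- The pointwise products cancel and the two first-order terms add up. Up to the factor `ν` the
commutator with a linear form is a constant vector field in `y`. -/
theorem coeff_wcomm_linear {π : Matrix (Fin n) (Fin n) ℝ} (hπ : πᵀ = -π) (w : Fin n → ℂ)
    (a : FormalWeyl n) (m : ℕ) : PowerSeries.coeff (m + 1) (wcomm π (linearWeyl w) a) =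
      ∑ j, (∑ i, w i * (π i j : ℂ)) • pderiv ℂ j (PowerSeries.coeff m a) := by
  rw [wcomm, moyal_swap π a, map_sub, coeff_moyal_linear_left, coeff_moyal_linear_left, hπ,
    add_sub_add_left_eq_sub, ← smul_sub, ← Finset.sum_sub_distrib, Finset.smul_sum]
  simp only [Finset.sum_smul]
  rw [Finset.sum_comm (s := Finset.univ) (t := Finset.univ) (f := fun j i =>
    (w i * (π i j : ℂ)) • pderiv ℂ j (PowerSeries.coeff m a))]
  refine Finset.sum_congr rfl fun i _ => ?_
  rw [← Finset.sum_sub_distrib, Finset.smul_sum]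
  refine Finset.sum_congr rfl fun j _ => ?_
  rw [← sub_smul, smul_smul, Matrix.neg_apply]
  congr 1
  push_cast
  ring

end Moyal

end StarFOI

end

noncomputable section

namespace StarFOI

open MvPowerSeries Finset.HasAntidiagonal

/-! ### Coordinate fields, Christoffel symbols and symplectic forms in a chart -/

section CoordFields

set_option linter.unusedSectionVars false

variable {E : Type} [NormedAddCommGroup E] [NormedSpace ℝ E]
  {H : Type*} [TopologicalSpace H] {J : ModelWithCorners ℝ E H}
  {N : Type*} [TopologicalSpace N] [ChartedSpace H N]
  [IsManifold J ∞ N] [J.Boundaryless] [FiniteDimensional ℝ E] [T2Space N]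

theorem mfderiv_extChartAt_symm_self (x₀ : N) (w : E) :
    mfderiv 𝓘(ℝ, E) J (extChartAt J x₀).symm (extChartAt J x₀ x₀) w = w := by
  have : IsManifold J 1 N := IsManifold.of_le (n := ∞) (by simp)
  have h := mfderivWithin_range_extChartAt_symm (I := J) (x := x₀)
  rw [J.range_eq_univ, mfderivWithin_univ] at h
  exact DFunLike.congr_fun h w

/-- A global vector field which is a coordinate field near `x₀`. -/
theorem exists_coordVectorField (x₀ : N) (w : E) : ∃ v : SmoothVectorField J N,
    ∀ᶠ x in 𝓝 x₀, v x = mfderiv 𝓘(ℝ, E) J (extChartAt J x₀).symm (extChartAt J x₀ x) w := by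
  have : IsManifold J 1 N := IsManifold.of_le (n := ∞) (by simp)
  obtain ⟨s, hs, hw⟩ := FiberBundle.exists_contMDiffOn_extend (k := ∞) J E
    (V := (TangentSpace J : N → Type _)) (x₀ := x₀) w
  obtain ⟨χ, hχ, hχs⟩ := (SmoothBumpFunction.nhds_basis_tsupport (I := J) x₀).mem_iff.mp
    (interior_mem_nhds.mpr hs)
  refine ⟨⟨_, ContMDiffOn.smul_section_of_tsupport (χ.contMDiff.contMDiffOn) isOpen_interior hχs
    (hw.mono interior_subset)⟩, ?_⟩
  filter_upwards [χ.eventuallyEq_one, (chartAt H x₀).open_source.mem_nhds (mem_chart_source H x₀)]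
    with x h1 h2
  have h3 : ∀ w : TangentSpace J x₀,
      χ x • FiberBundle.extend E (E := (TangentSpace J : N → Type _)) w x =
        mfderiv 𝓘(ℝ, E) J (extChartAt J x₀).symm (extChartAt J x₀ x) w := by
    intro w
    rw [h1, Pi.one_apply, one_smul]
    have h4 := TangentBundle.symmL_trivializationAt (I := J) h2
    rw [J.range_eq_univ, mfderivWithin_univ] at h4
    have h5 : (trivializationAt E (TangentSpace J : N → Type _) x₀ ⟨x₀, w⟩).2 = w := by
      have h6 := TangentBundle.continuousLinearMapAt_trivializationAt (I := J)
        (mem_chart_source H x₀)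
      rw [mfderiv_extChartAt_self] at h6
      have h7 := DFunLike.congr_fun h6 w
      rwa [Bundle.Trivialization.continuousLinearMapAt_apply,
        Bundle.Trivialization.linearMapAt_apply, if_pos
          (FiberBundle.mem_baseSet_trivializationAt' x₀)] at h7
    refine Eq.trans ?_ (DFunLike.congr_fun h4 w)
    have h8 := (trivializationAt E (TangentSpace J : N → Type _) x₀).symmL_apply (R := ℝ) (b := x)
      (by rw [TangentBundle.trivializationAt_baseSet]; exact h2) (w : E)
    refine Eq.trans ?_ h8.symm
    unfold FiberBundle.extend
    exact congrArg ((trivializationAt E (TangentSpace J : N → Type _) x₀).symm x) h5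
  exact h3 w

end CoordFields

section Symplectic

set_option linter.unusedSectionVars false

variable {n : ℕ} {M : Type*} [TopologicalSpace M] [ChartedSpace (EuclideanSpace ℝ (Fin n)) M]

/-- The standard basis of `ℝ ^ n`, as a basis. -/
def stdBasis (n : ℕ) : Module.Basis (Fin n) ℝ (EuclideanSpace ℝ (Fin n)) :=
  (EuclideanSpace.basisFun (Fin n) ℝ).toBasis

theorem stdBasis_apply (i : Fin n) : stdBasis n i = stdVec i := by
  rw [stdBasis, OrthonormalBasis.coe_toBasis, EuclideanSpace.basisFun_apply, stdVec]

theorem coordC_stdBasis (i : Fin n) (u : EuclideanSpace ℝ (Fin n)) :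
    coordC (stdBasis n) i u = ((u i : ℝ) : ℂ) := by
  rw [coordC_apply, stdBasis, OrthonormalBasis.coe_toBasis_repr_apply,
    EuclideanSpace.basisFun_repr]

theorem twoForm_add_left {V F : Type*} [AddCommGroup V] [Module ℝ V] [TopologicalSpace V]
    [NormedAddCommGroup F] [NormedSpace ℝ F] (α : V [⋀^Fin 2]→L[ℝ] F) (u u' w : V) :
    α ![u + u', w] = α ![u, w] + α ![u', w] :=
  α.toContinuousMultilinearMap.cons_add ![w] u u'

theorem twoForm_smul_left {V F : Type*} [AddCommGroup V] [Module ℝ V] [TopologicalSpace V]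
    [NormedAddCommGroup F] [NormedSpace ℝ F] (α : V [⋀^Fin 2]→L[ℝ] F) (c : ℝ) (u w : V) :
    α ![c • u, w] = c • α ![u, w] :=
  α.toContinuousMultilinearMap.cons_smul ![w] c u

theorem twoForm_swap {V F : Type*} [AddCommGroup V] [Module ℝ V] [TopologicalSpace V]
    [NormedAddCommGroup F] [NormedSpace ℝ F] (α : V [⋀^Fin 2]→L[ℝ] F) (u w : V) :
    α ![u, w] = -α ![w, u] := by
  have h := α.toAlternatingMap.map_swap ![w, u] (i := 0) (j := 1) (by simp)
  have e : (![w, u] ∘ (Equiv.swap (0 : Fin 2) 1)) = ![u, w] := by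
    ext i; fin_cases i <;> rfl
  rw [e] at h
  exact h

/-- The map `u ↦ α(u, w)`. -/
def twoFormLeft {V F : Type*} [AddCommGroup V] [Module ℝ V] [TopologicalSpace V]
    [NormedAddCommGroup F] [NormedSpace ℝ F] (α : V [⋀^Fin 2]→L[ℝ] F) (w : V) : V →ₗ[ℝ] F where
  toFun u := α ![u, w]
  map_add' u u' := twoForm_add_left α u u' w
  map_smul' c u := twoForm_smul_left α c u w

theorem det_ne_zero_of_nondegenerate (α : EuclideanSpace ℝ (Fin n) [⋀^Fin 2]→L[ℝ] ℝ)
    (h : ∀ u, (∀ w, α ![u, w] = 0) → u = 0) :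
    (Matrix.of fun i j => α ![stdVec i, stdVec j]).det ≠ 0 := by
  intro h0
  obtain ⟨v, hv, hv0⟩ := Matrix.exists_vecMul_eq_zero_iff.mpr h0
  apply hv
  have hu : ∑ i, v i • stdVec i = 0 := by
    refine h _ fun w => ?_
    have h1 : ∀ j, α ![∑ i, v i • stdVec i, stdVec j] = 0 := by
      intro j
      have h2 := congrFun hv0 j
      change twoFormLeft α (stdVec j) (∑ i, v i • stdVec i) = 0
      rw [map_sum]
      simp only [map_smul, smul_eq_mul]
      exact h2
    rw [twoForm_swap, neg_eq_zero]
    change twoFormLeft α (∑ i, v i • stdVec i) w = 0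
    rw [← (stdBasis n).sum_repr w, map_sum]
    refine Finset.sum_eq_zero fun j _ => ?_
    rw [map_smul, stdBasis_apply]
    change _ • α ![stdVec j, ∑ i, v i • stdVec i] = 0
    rw [twoForm_swap, h1, neg_zero, smul_zero]
  have h3 : ∑ i, v i • stdBasis n i = 0 := by simpa only [stdBasis_apply] using hu
  funext i
  exact (Fintype.linearIndependent_iff.mp (stdBasis n).linearIndependent) v h3 i

section Det

variable {E : Type*} [NormedAddCommGroup E] [NormedSpace ℝ E]

theorem contDiffAt_det {W : E → Matrix (Fin n) (Fin n) ℝ} {y : E}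
    (h : ∀ i j, ContDiffAt ℝ ∞ (fun y => W y i j) y) : ContDiffAt ℝ ∞ (fun y => (W y).det) y := by
  simp only [Matrix.det_apply']
  refine ContDiffAt.sum fun s _ => ?_
  exact contDiffAt_const.mul (contDiffAt_prod fun i _ => h _ _)

theorem contDiffAt_inv_apply {W : E → Matrix (Fin n) (Fin n) ℝ} {y : E}
    (h : ∀ i j, ContDiffAt ℝ ∞ (fun y => W y i j) y) (h0 : (W y).det ≠ 0) (i j : Fin n) :
    ContDiffAt ℝ ∞ (fun y => (W y)⁻¹ i j) y := by
  have e : (fun y => (W y)⁻¹ i j) = fun y => ((W y).det)⁻¹ *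
      ((W y).updateRow j (Pi.single i 1)).det := by
    funext y
    rw [Matrix.inv_def, Ring.inverse_eq_inv', Matrix.smul_apply, Matrix.adjugate_apply, smul_eq_mul]
  rw [e]
  refine ((contDiffAt_det h).inv h0).mul (contDiffAt_det fun k l => ?_)
  by_cases hk : k = j
  · subst hk
    simp only [Matrix.updateRow_self]
    exact contDiffAt_const
  · simp only [Matrix.updateRow_ne hk]
    exact h k l

end Det

theorem TwoForm.comp_skew (α : TwoForm n M ℝ) (x₀ : M) (y : EuclideanSpace ℝ (Fin n)) :
    (Matrix.of (α.comp x₀ y))ᵀ = -Matrix.of (α.comp x₀ y) := by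
  ext i j
  exact twoForm_swap (α.inChart x₀ y) _ _

theorem poissonMatrix_transpose {w : Fin n → Fin n → ℝ} (h : (Matrix.of w)ᵀ = -Matrix.of w)
    (h0 : (Matrix.of w).det ≠ 0) : (poissonMatrix w)ᵀ = -poissonMatrix w := by
  have hu : IsUnit (Matrix.of w).det := isUnit_iff_ne_zero.mpr h0
  rw [poissonMatrix, Matrix.transpose_neg, Matrix.transpose_nonsing_inv, h, neg_inj]
  refine Matrix.inv_eq_right_inv ?_
  rw [Matrix.neg_mul, Matrix.mul_neg, neg_neg, Matrix.mul_nonsing_inv _ hu]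

theorem sum_mul_poissonMatrix {w : Fin n → Fin n → ℝ} (h0 : (Matrix.of w).det ≠ 0) (k j : Fin n) :
    ∑ i, (w k i : ℂ) * (poissonMatrix w i j : ℂ) = if k = j then -1 else 0 := by
  have hu : IsUnit (Matrix.of w).det := isUnit_iff_ne_zero.mpr h0
  have h1 : Matrix.of w * poissonMatrix w = -1 := by
    rw [poissonMatrix, Matrix.mul_neg, Matrix.mul_nonsing_inv _ hu]
  have h2 := congrFun (congrFun h1 k) j
  rw [Matrix.mul_apply, Matrix.neg_apply, Matrix.one_apply] at h2
  have h3 := congrArg (fun t : ℝ => (t : ℂ)) h2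
  simp only [Matrix.of_apply] at h3
  push_cast at h3
  rw [h3]
  split_ifs <;> simp

variable [IsManifold (𝓡 n) ∞ M] [T2Space M]

theorem TwoForm.comp_self (α : TwoForm n M ℝ) (x₀ : M) :
    α.comp x₀ (extChartAt (𝓡 n) x₀ x₀) = fun i j => α x₀ ![stdVec i, stdVec j] := by
  funext i j
  have h : ∀ x, x = x₀ → ∀ u : Fin 2 → EuclideanSpace ℝ (Fin n), α x u = α x₀ u := by
    rintro x rfl u; rfl
  refine Eq.trans ?_ (h _ (extChartAt_to_inv (I := 𝓡 n) x₀) ![stdVec i, stdVec j])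
  refine congrArg (α ((extChartAt (𝓡 n) x₀).symm (extChartAt (𝓡 n) x₀ x₀))) ?_
  funext t
  exact mfderiv_extChartAt_symm_self x₀ _

variable {ω₀ : TwoForm n M ℝ}

theorem TwoForm.IsClosedForm.contDiffOn_comp (h : ω₀.IsClosedForm) (x₀ : M) (i j : Fin n) :
    ContDiffOn ℝ ∞ (fun y => ω₀.comp x₀ y i j) (extChartAt (𝓡 n) x₀).target :=
  (ContinuousAlternatingMap.apply ℝ (EuclideanSpace ℝ (Fin n)) ℝ
    ![stdVec i, stdVec j]).contDiff.comp_contDiffOn (h.smooth x₀)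

theorem IsSymplectic.det_ne_zero (h : IsSymplectic ω₀) (x : M) :
    (Matrix.of fun i j => ω₀ x ![stdVec i, stdVec j]).det ≠ 0 :=
  det_ne_zero_of_nondegenerate (n := n) (ω₀ x) (h.nondegenerate x)

theorem IsSymplectic.eventually_det_ne_zero (h : IsSymplectic ω₀) (x₀ : M) :
    ∀ᶠ y in 𝓝 (extChartAt (𝓡 n) x₀ x₀), (Matrix.of (ω₀.comp x₀ y)).det ≠ 0 := by
  have h1 : ContDiffAt ℝ ∞ (fun y => (Matrix.of (ω₀.comp x₀ y)).det) (extChartAt (𝓡 n) x₀ x₀) :=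
    contDiffAt_det fun i j => (h.toIsClosedForm.contDiffOn_comp x₀ i j).contDiffAt
      (extChartAt_target_mem_nhds x₀)
  refine h1.continuousAt.eventually_ne ?_
  rw [TwoForm.comp_self]
  exact h.det_ne_zero x₀

theorem smoothNear_ofReal {E : Type*} [NormedAddCommGroup E] [NormedSpace ℝ E] {y₀ : E} {g : E → ℝ}
    (h : ∀ᶠ y in 𝓝 y₀, ContDiffAt ℝ ∞ g y) : SmoothNear y₀ fun y => ((g y : ℝ) : ℂ) := by
  filter_upwards [h] with y hy
  exact Complex.ofRealCLM.contDiff.contDiffAt.comp y hy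

theorem IsSymplectic.smoothNear_poissonInChart (h : IsSymplectic ω₀) (x₀ : M) (i j : Fin n) :
    SmoothNear (extChartAt (𝓡 n) x₀ x₀) fun y => ((poissonInChart ω₀ x₀ y i j : ℝ) : ℂ) := by
  refine smoothNear_ofReal ?_
  filter_upwards [h.eventually_det_ne_zero x₀,
    (isOpen_extChartAt_target (I := 𝓡 n) x₀).mem_nhds (mem_extChartAt_target x₀)] with y h1 h2
  exact (contDiffAt_inv_apply (fun i j => (h.toIsClosedForm.contDiffOn_comp x₀ i j).contDiffAt
    ((isOpen_extChartAt_target x₀).mem_nhds h2)) h1 i j).neg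

/-- The coordinate fields are replaced by global smooth fields that agree with them near `x₀`, to
which smoothness of the connection applies. -/
theorem smoothNear_christoffel {D : Connection n M}
    (hD : CovariantDerivative.ContMDiffCovariantDerivative D ∞) (x₀ : M) (k j i : Fin n) :
    SmoothNear (extChartAt (𝓡 n) x₀ x₀) fun y => ((christoffel D x₀ y k j i : ℝ) : ℂ) := by
  obtain ⟨vj, hvj⟩ := exists_coordVectorField (J := 𝓡 n) x₀ (stdVec j)
  obtain ⟨vk, hvk⟩ := exists_coordVectorField (J := 𝓡 n) x₀ (stdVec k)
  have h1 := hD.contMDiff.contMDiff (σ := vj) (vj.contMDiff.contMDiffOn)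
  let V : SmoothVectorField (𝓡 n) M := ⟨fun x => D vj x (vk x),
    ContMDiff.clm_bundle_apply (contMDiffOn_univ.mp h1) vk.contMDiff⟩
  have h2 := smoothNear_vectorInChart (x₀ := x₀) V
  have h3 : (fun y => ((christoffel D x₀ y k j i : ℝ) : ℂ)) =ᶠ[𝓝 (extChartAt (𝓡 n) x₀ x₀)]
      fun y => coordC (stdBasis n) i (vectorInChart V x₀ y) := by
    have hc : Filter.Tendsto (extChartAt (𝓡 n) x₀).symm (𝓝 (extChartAt (𝓡 n) x₀ x₀)) (𝓝 x₀) := by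
      have := (continuousAt_extChartAt_symm (I := 𝓡 n) x₀).tendsto
      rwa [extChartAt_to_inv] at this
    filter_upwards [hc.eventually hvk, hc.eventually (eventually_eventually_nhds.mpr hvj)]
      with y e1 e2
    -- A covariant derivative is local, so changing the field away from the point is harmless.
    have e3 : D (coordField x₀ j) ((extChartAt (𝓡 n) x₀).symm y) =
        D vj ((extChartAt (𝓡 n) x₀).symm y) := by
      have hd : MDifferentiableAt (𝓡 n) ((𝓡 n).prod 𝓘(ℝ, EuclideanSpace ℝ (Fin n)))
          (fun x => (⟨x, vj x⟩ : TangentBundle (𝓡 n) M)) ((extChartAt (𝓡 n) x₀).symm y) :=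
        (vj.contMDiff _).mdifferentiableAt (by simp)
      refine (D.isCovariantDerivativeOn (s := Set.univ)).congr_of_eventuallyEq ?_ hd
        Filter.univ_mem ?_
      · refine hd.congr_of_eventuallyEq ?_
        filter_upwards [e2] with x' hx'
        rw [hx']
        rfl
      · filter_upwards [e2] with x' hx'
        rw [hx']
        rfl
    have e4 : coordField x₀ k ((extChartAt (𝓡 n) x₀).symm y) =
        vk ((extChartAt (𝓡 n) x₀).symm y) := e1.symm
    rw [coordC_stdBasis, christoffel, e3, e4]
    rfl
  refine SmoothNear.congr ?_ h3
  filter_upwards [h2] with y hy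
  exact (coordC (stdBasis n) i).contDiff.contDiffAt.comp y hy

end Symplectic

end StarFOI

end

noncomputable section

namespace StarFOI

open MvPowerSeries Finset.HasAntidiagonal

/-! ### Germs vanishing to a given order -/

section Germs

variable {E : Type} [NormedAddCommGroup E] [NormedSpace ℝ E] {ι : Type*} [Fintype ι]
  {b : ι → E} {y₀ : E}

/-- The germ of `g` at `y₀` is smooth and vanishes to order `K`. -/
def GermGE (b : ι → E) (y₀ : E) (K : ℤ) (g : E → ℂ) : Prop :=
  SmoothNear y₀ g ∧ taylor b y₀ g ∈ orderGE ι K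

theorem GermGE.congr {K : ℤ} {g g' : E → ℂ} (h : GermGE b y₀ K g) (he : g' =ᶠ[𝓝 y₀] g) :
    GermGE b y₀ K g' :=
  ⟨h.1.congr he, by rw [taylor_congr he]; exact h.2⟩

theorem GermGE.mono {K K' : ℤ} {g : E → ℂ} (h : GermGE b y₀ K g) (hK : K' ≤ K) :
    GermGE b y₀ K' g := ⟨h.1, filt_mono hK h.2⟩

theorem GermGE.zero (K : ℤ) : GermGE b y₀ K fun _ => 0 := by
  refine ⟨SmoothNear.const 0, ?_⟩
  rw [taylor_const, map_zero]
  exact AddSubgroup.zero_mem _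

theorem GermGE.add {K : ℤ} {g h : E → ℂ} (hg : GermGE b y₀ K g) (hh : GermGE b y₀ K h) :
    GermGE b y₀ K fun y => g y + h y :=
  ⟨hg.1.add hh.1, by rw [taylor_add hg.1 hh.1]; exact AddSubgroup.add_mem _ hg.2 hh.2⟩

theorem GermGE.sum {K : ℤ} {κ : Type*} {s : Finset κ} {g : κ → E → ℂ}
    (h : ∀ k ∈ s, GermGE b y₀ K (g k)) : GermGE b y₀ K fun y => ∑ k ∈ s, g k y :=
  ⟨SmoothNear.sum fun k hk => (h k hk).1, by
    rw [taylor_sum fun k hk => (h k hk).1]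
    exact AddSubgroup.sum_mem _ fun k hk => (h k hk).2⟩

theorem GermGE.mul_left {K : ℤ} {g h : E → ℂ} (hh : SmoothNear y₀ h) (hg : GermGE b y₀ K g) :
    GermGE b y₀ K fun y => h y * g y :=
  ⟨hh.mul hg.1, by rw [taylor_mul hh hg.1]; exact orderGE_mul_left hg.2⟩

theorem GermGE.mul_right {K : ℤ} {g h : E → ℂ} (hh : SmoothNear y₀ h) (hg : GermGE b y₀ K g) :
    GermGE b y₀ K fun y => g y * h y :=
  (GermGE.mul_left hh hg).congr (.of_forall fun _ => mul_comm _ _)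

theorem GermGE.dirD {K : ℤ} {g : E → ℂ} (hg : GermGE b y₀ K g) (a : ι) :
    GermGE b y₀ (K - 1) (dirD (b a) g) :=
  ⟨hg.1.dirD _, by rw [← pderiv_taylor hg.1]; exact orderGE_pderiv hg.2 a⟩

theorem GermGE.apply_eq_zero {K : ℤ} {g : E → ℂ} (hg : GermGE b y₀ K g) (hK : 0 < K) :
    g y₀ = 0 := by
  rw [← constantCoeff_taylor (b := b) (g := g), ← coeff_zero_eq_constantCoeff_apply]
  exact hg.2 0 trivial (by simpa using hK)

end Germs

/-! ### Fedosov star products are natural -/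

section MoyalGerm

variable {n : ℕ} {ι : Type*} [Fintype ι] {E : Type} [NormedAddCommGroup E] [NormedSpace ℝ E]
  {b : ι → E} {y₀ : E}

/-- The product is a finite sum of products of coefficients with smooth factors `π`. In the term
with `s` contractions, both factors have degree at least `s` in `y`, and together `2s` more than the
result. -/
theorem germGE_moyal {π : E → Matrix (Fin n) (Fin n) ℝ}
    (hπ : ∀ i j, SmoothNear y₀ fun y => ((π y i j : ℝ) : ℂ)) {a c : E → FormalWeyl n} {K : ℤ}
    {m : ℕ} {μ : Fin n →₀ ℕ}
    (h : ∀ (s q t : ℕ) (κ η : Fin n →₀ ℕ), s + (q + t) = m →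
      κ.degree + η.degree = μ.degree + 2 * s → s ≤ κ.degree → s ≤ η.degree →
      GermGE b y₀ K fun y => wcoeff q κ (a y) * wcoeff t η (c y)) :
    GermGE b y₀ K fun y => wcoeff m μ (moyal (π y) (a y) (c y)) := by
  simp only [wcoeff_moyal]
  refine GermGE.sum fun p hp => GermGE.sum fun q hq => GermGE.sum fun i _ => GermGE.sum fun j _ =>
    GermGE.sum fun κ hκ => ?_
  rw [mem_antidiagonal] at hp hq hκ
  refine GermGE.mul_left (SmoothNear.const _) (GermGE.mul_left ?_ (h p.1 q.1 q.2 _ _ ?_ ?_ ?_ ?_))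
  · have key : ∀ s : Finset (Fin p.1), SmoothNear y₀ fun y => ∏ t ∈ s, ((π y (i t) (j t) : ℝ) : ℂ) := by
      intro s
      classical
      induction s using Finset.induction_on with
      | empty => simpa using SmoothNear.const (1 : ℂ)
      | insert t s ht ih =>
        simp only [Finset.prod_insert ht]
        exact (hπ _ _).mul ih
    exact key Finset.univ
  · omega
  · rw [map_add, map_add, degree_multiIndex, degree_multiIndex, ← hκ, map_add]; omega
  · rw [map_add, degree_multiIndex]; omega
  · rw [map_add, degree_multiIndex]; omega

theorem wcoeff_one_zero_moyal (π : Matrix (Fin n) (Fin n) ℝ) (a c : FormalWeyl n) :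
    wcoeff 1 0 (moyal π a c) = wcoeff 0 0 a * wcoeff 1 0 c + wcoeff 1 0 a * wcoeff 0 0 c +
      (1 / 2 : ℂ) * ∑ i, ∑ j, (π i j : ℂ) *
        (wcoeff 0 (Finsupp.single i 1) a * wcoeff 0 (Finsupp.single j 1) c) := by
  have h1 : PowerSeries.coeff 1 (moyal π a c) =
      (PowerSeries.coeff 0 a * PowerSeries.coeff 1 c + PowerSeries.coeff 1 a * PowerSeries.coeff 0 c) +
      (1 / 2 : ℂ) • ∑ i, ∑ j, (π i j : ℂ) •
        (pderiv ℂ i (PowerSeries.coeff 0 a) * pderiv ℂ j (PowerSeries.coeff 0 c)) := by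
    rw [moyal, PowerSeries.coeff_mk, Finset.Nat.sum_antidiagonal_succ]
    simp only [Finset.HasAntidiagonal.antidiagonal_zero, Finset.sum_singleton]
    congr 1
    · rw [Finset.Nat.sum_antidiagonal_succ]
      simp [iterPderiv_zero]
    · change ((1 : ℂ) / (2 ^ 1 * ((1 : ℕ).factorial : ℂ))) • ∑ i : Fin 1 → Fin n,
        ∑ j : Fin 1 → Fin n, (∏ t, (π (i t) (j t) : ℂ)) •
          (iterPderiv i (PowerSeries.coeff 0 a) * iterPderiv j (PowerSeries.coeff 0 c)) = _
      rw [pow_one, Nat.factorial_one, Nat.cast_one, mul_one]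
      simp only [sum_fin_one_fun, iterPderiv_one, Finset.univ_unique, Finset.prod_singleton]
  have h2 : ∀ (i : Fin n) (F : MvPowerSeries (Fin n) ℂ),
      constantCoeff (pderiv ℂ i F) = coeff (Finsupp.single i 1) F := by
    intro i F
    rw [← coeff_zero_eq_constantCoeff_apply, coeff_pderiv]
    simp
  simp only [wcoeff]
  rw [h1, map_add, map_add, map_smul, map_sum]
  simp only [map_sum, map_smul, coeff_zero_eq_constantCoeff_apply, map_mul, h2, smul_eq_mul]

end MoyalGerm

section Fedosov

set_option linter.unusedSectionVars false

variable {n : ℕ} {M : Type*} [TopologicalSpace M] [ChartedSpace (EuclideanSpace ℝ (Fin n)) M]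
  [IsManifold (𝓡 n) ∞ M]

theorem wcoeff_covWeyl (G : EuclideanSpace ℝ (Fin n) → Fin n → Fin n → Fin n → ℝ) (k : Fin n)
    (a : EuclideanSpace ℝ (Fin n) → FormalWeyl n) (y : EuclideanSpace ℝ (Fin n)) (m : ℕ)
    (μ : Fin n →₀ ℕ) : wcoeff m μ (covWeyl G k a y) =
      dirD (stdBasis n k) (fun z => wcoeff m μ (a z)) y - ∑ i, ∑ j, (G y k j i : ℂ) *
        coeff μ (X j * pderiv ℂ i (PowerSeries.coeff m (a y))) := by
  have h : ∀ i j, wcoeff m μ (wconst (G y k j i : ℂ) * wvar j * wpderiv i (a y)) =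
      (G y k j i : ℂ) * coeff μ (X j * pderiv ℂ i (PowerSeries.coeff m (a y))) := by
    intro i j
    rw [wcoeff, wconst, wvar, mul_assoc, PowerSeries.coeff_C_mul, PowerSeries.coeff_C_mul,
      wpderiv, PowerSeries.coeff_mk, ← smul_eq_C_mul, map_smul, smul_eq_mul]
  have h1 : wcoeff m μ (baseDeriv k a y) = dirD (stdBasis n k) (fun z => wcoeff m μ (a z)) y := by
    have h2 : PowerSeries.coeff m (baseDeriv k a y) = (fun μ =>
        fderiv ℝ (fun z => wcoeff m μ (a z)) y (stdVec k) : MvPowerSeries (Fin n) ℂ) :=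
      PowerSeries.coeff_mk _ _
    rw [wcoeff, h2, stdBasis_apply]
    rfl
  rw [← h1]
  simp only [← h]
  simp only [wcoeff, covWeyl, map_sub, map_sum]

variable {ω₀ : TwoForm n M ℝ} {D : Connection n M} {Ω : ℕ → TwoForm n M ℂ} {x₀ : M}
  {r : Fin n → EuclideanSpace ℝ (Fin n) → FormalWeyl n} {f : SmoothFn (𝓡 n) M}
  {a : EuclideanSpace ℝ (Fin n) → FormalWeyl n}

/-- The flatness equation as a recursion for the coefficients of the flat section. -/
theorem IsFlatLift.recursion (ha : IsFlatLift ω₀ D x₀ r f a) {y : EuclideanSpace ℝ (Fin n)}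
    (hy : y ∈ (extChartAt (𝓡 n) x₀).target) (hdet : (Matrix.of (ω₀.comp x₀ y)).det ≠ 0)
    (k : Fin n) (m : ℕ) (μ : Fin n →₀ ℕ) :
    wcoeff m (μ + Finsupp.single k 1) (a y) * (μ k + 1) =
      dirD (stdBasis n k) (fun z => wcoeff m μ (a z)) y +
      (-1) * ∑ i, ∑ j, (christoffel D x₀ y k j i : ℂ) *
        coeff μ (X j * pderiv ℂ i (PowerSeries.coeff m (a y))) +
      (wcoeff (m + 1) μ (moyal (poissonInChart ω₀ x₀ y) (r k y) (a y)) +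
        (-1) * wcoeff (m + 1) μ (moyal (poissonInChart ω₀ x₀ y) (a y) (r k y))) := by
  have h := congrArg (fun c => wcoeff (m + 1) μ c) (ha.flat y hy k)
  have hπ : (poissonInChart ω₀ x₀ y)ᵀ = -poissonInChart ω₀ x₀ y :=
    poissonMatrix_transpose (ω₀.comp_skew x₀ y) hdet
  have hform : fedosovForm ω₀ x₀ r k y =
      linearWeyl (fun i => ((ω₀.comp x₀ y k i : ℝ) : ℂ)) + r k y := rfl
  -- Since `π = -ω⁻¹`, the linear part `ω_{ki} y^i` of `γ_k` acts as `-∂/∂y^k`. This is the term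
  -- that lets the flatness equation be solved for the higher coefficient.
  have hlin : PowerSeries.coeff (m + 1) (wcomm (poissonInChart ω₀ x₀ y)
      (linearWeyl (fun i => ((ω₀.comp x₀ y k i : ℝ) : ℂ))) (a y)) =
      -pderiv ℂ k (PowerSeries.coeff m (a y)) := by
    rw [coeff_wcomm_linear hπ]
    simp only [poissonInChart, sum_mul_poissonMatrix hdet]
    rw [Finset.sum_eq_single k]
    · simp
    · intro j _ hj
      rw [if_neg hj.symm, zero_smul]
    · simp
  rw [hform, wcomm_add_left] at h
  simp only [wcoeff, map_add, PowerSeries.coeff_succ_X_mul, hlin, map_neg, coeff_pderiv, map_zero]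
    at h
  have hc := wcoeff_covWeyl (christoffel D x₀) k a y m μ
  rw [wcoeff] at hc
  rw [hc, wcomm, map_sub, map_sub] at h
  simp only [wcoeff] at h ⊢
  linear_combination -h

variable [T2Space M]

theorem IsFedosovForm.smoothNear (hr : IsFedosovForm ω₀ D Ω x₀ r) (k : Fin n) (m : ℕ)
    (μ : Fin n →₀ ℕ) : SmoothNear (extChartAt (𝓡 n) x₀ x₀) fun y => wcoeff m μ (r k y) :=
  ContDiffOn.smoothNear (hr.smooth k m μ) (isOpen_extChartAt_target x₀) (mem_extChartAt_target x₀)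

/-- If `f` vanishes to order `N`, then the coefficient of `ν ^ m y ^ μ` in its flat lift vanishes to
order `N - m - |μ|`. -/
theorem IsFlatLift.germGE (hω : IsSymplectic ω₀) (hD : IsSymplecticConnection ω₀ D)
    (hr : IsFedosovForm ω₀ D Ω x₀ r) (ha : IsFlatLift ω₀ D x₀ r f a) {N : ℕ}
    (hf : VanishesToOrder N f x₀) (m : ℕ) (μ : Fin n →₀ ℕ) :
    GermGE (stdBasis n) (extChartAt (𝓡 n) x₀ x₀) ((N : ℤ) - m - μ.degree)
      fun y => wcoeff m μ (a y) := by
  have htarget := (isOpen_extChartAt_target (I := 𝓡 n) x₀).mem_nhds (mem_extChartAt_target x₀)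
  -- Induction on the Fedosov degree. The symbol condition settles `μ = 0`; otherwise the recursion
  -- expresses the coefficient through coefficients of smaller degree.
  induction h : 2 * m + μ.degree using Nat.strong_induction_on generalizing m μ with
  | _ d ih =>
    subst h
    by_cases h0 : μ = 0
    · subst h0
      have he : (fun y => wcoeff m 0 (a y)) =ᶠ[𝓝 (extChartAt (𝓡 n) x₀ x₀)]
          fun y => if m = 0 then inChart f x₀ y else 0 := by
        filter_upwards [htarget] with y hy
        exact ha.symbol y hy m
      refine GermGE.congr ?_ he
      by_cases hm : m = 0
      · simp only [if_pos hm]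
        refine GermGE.mono (K := N) ⟨smoothNear_inChart f x₀, ?_⟩ (by simp)
        exact hf.jet_mem (b := stdBasis n)
      · simp only [if_neg hm]
        exact GermGE.zero _
    · obtain ⟨k, hk⟩ := Finsupp.ne_iff.mp h0
      obtain ⟨μ, rfl⟩ := exists_eq_add_single hk
      have hdeg : (μ + Finsupp.single k 1).degree = μ.degree + 1 := by simp
      rw [hdeg] at ih ⊢
      set K : ℤ := (N : ℤ) - m - (μ.degree + 1 : ℕ) with hKdef
      have hrec : (fun y => wcoeff m (μ + Finsupp.single k 1) (a y))
          =ᶠ[𝓝 (extChartAt (𝓡 n) x₀ x₀)] fun y => ((μ k + 1 : ℂ)⁻¹) *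
          ((dirD (stdBasis n k) (fun z => wcoeff m μ (a z)) y +
          (-1) * ∑ i, ∑ j, (christoffel D x₀ y k j i : ℂ) *
            coeff μ (X j * pderiv ℂ i (PowerSeries.coeff m (a y)))) +
          (wcoeff (m + 1) μ (moyal (poissonInChart ω₀ x₀ y) (r k y) (a y)) +
            (-1) * wcoeff (m + 1) μ (moyal (poissonInChart ω₀ x₀ y) (a y) (r k y)))) := by
        filter_upwards [htarget, hω.eventually_det_ne_zero x₀] with y hy hdet
        rw [← ha.recursion hy hdet]
        have hne : (μ k + 1 : ℂ) ≠ 0 := Nat.cast_add_one_ne_zero _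
        field_simp
      refine GermGE.congr (GermGE.mul_left (SmoothNear.const _) (GermGE.add (GermGE.add ?_
        (GermGE.mul_left (SmoothNear.const _) ?_)) (GermGE.add ?_
          (GermGE.mul_left (SmoothNear.const _) ?_)))) hrec
      · exact ((ih _ (by omega) m μ rfl).dirD k).mono (by rw [hKdef]; push_cast; omega)
      · refine GermGE.sum fun i _ => GermGE.sum fun j _ =>
          GermGE.mul_left (smoothNear_christoffel hD.smooth x₀ k j i) ?_
        by_cases hj : μ j = 0
        · simp only [coeff_X_mul_of_eq_zero hj]
          exact GermGE.zero _
        · obtain ⟨η, rfl⟩ := exists_eq_add_single hj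
          simp only [coeff_X_mul_add_single, coeff_pderiv]
          refine GermGE.mul_right (SmoothNear.const _) ?_
          have hd : (η + Finsupp.single i 1).degree = (η + Finsupp.single j 1).degree := by simp
          refine (ih _ ?_ m (η + Finsupp.single i 1) rfl).mono ?_
          · rw [hd]; omega
          · rw [hKdef, hd]; push_cast; omega
      all_goals
        refine germGE_moyal (fun i j => hω.smoothNear_poissonInChart x₀ i j) ?_
        intro s q t κ η h1 h2 h3 h4
      -- The two degrees add up to `2(m + 1) + |μ|`, and `r` has degree at least `3`, so the
      -- coefficient of the lift has smaller degree than the one sought. Since `s ≤ |κ|`, the order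
      -- lost is at most `m + |μ| + 1`.
      · by_cases hlow : 2 * q + κ.degree < 3
        · refine (GermGE.zero K).congr ?_
          filter_upwards [htarget] with y hy
          rw [hr.degree y hy k q κ hlow, zero_mul]
        · refine GermGE.mul_left (hr.smoothNear k q κ) ((ih _ ?_ t η rfl).mono ?_)
          · omega
          · rw [hKdef]; push_cast; omega
      · by_cases hlow : 2 * t + η.degree < 3
        · refine (GermGE.zero K).congr ?_
          filter_upwards [htarget] with y hy
          rw [hr.degree y hy k t η hlow, mul_zero]
        · refine GermGE.mul_right (hr.smoothNear k t η) ((ih _ ?_ q κ rfl).mono ?_)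
          · omega
          · rw [hKdef]; push_cast; omega

/-- The recursion at lowest order: the contributions of `r` vanish because its degree is at least
three, and the Christoffel term vanishes at `y = 0`. -/
theorem IsFlatLift.wcoeff_single (hω : IsSymplectic ω₀) (hr : IsFedosovForm ω₀ D Ω x₀ r)
    (ha : IsFlatLift ω₀ D x₀ r f a) (k : Fin n) :
    wcoeff 0 (Finsupp.single k 1) (a (extChartAt (𝓡 n) x₀ x₀)) = differential f x₀ (stdVec k) := by
  have hy := mem_extChartAt_target (I := 𝓡 n) x₀
  have htarget := (isOpen_extChartAt_target (I := 𝓡 n) x₀).mem_nhds hy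
  have h := ha.recursion hy (hω.eventually_det_ne_zero x₀).self_of_nhds k 0 0
  rw [wcoeff_one_zero_moyal, wcoeff_one_zero_moyal] at h
  have hr0 : ∀ m (μ : Fin n →₀ ℕ), 2 * m + μ.degree < 3 →
      wcoeff m μ (r k (extChartAt (𝓡 n) x₀ x₀)) = 0 := fun m μ hm => hr.degree _ hy k m μ hm
  have e1 : wcoeff 0 0 (r k (extChartAt (𝓡 n) x₀ x₀)) = 0 := hr0 _ _ (by simp)
  have e2 : wcoeff 1 0 (r k (extChartAt (𝓡 n) x₀ x₀)) = 0 := hr0 _ _ (by simp)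
  have e3 : ∀ i, wcoeff 0 (Finsupp.single i 1) (r k (extChartAt (𝓡 n) x₀ x₀)) = 0 :=
    fun i => hr0 _ _ (by simp)
  have e4 : (fun z => wcoeff 0 0 (a z)) =ᶠ[𝓝 (extChartAt (𝓡 n) x₀ x₀)] inChart f x₀ := by
    filter_upwards [htarget] with y hy
    exact ha.symbol y hy 0
  simp only [e1, e2, e3, coeff_zero_eq_constantCoeff_apply, map_mul, constantCoeff_X, zero_mul,
    mul_zero, Finset.sum_const_zero, add_zero, zero_add] at h
  rw [(dirD_congr e4 _).self_of_nhds] at h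
  simp only [Finsupp.coe_zero, Pi.zero_apply, Nat.cast_zero, zero_add, mul_one] at h
  rw [h, stdBasis_apply]
  exact (differential_self f (stdVec k)).symm

variable {P : PoissonBracket (𝓡 n) M} {S : StarProduct P}

/-- In the term of order `ν^m` with `s` contractions at `y = 0`, the lift of `f` enters through a
coefficient of `ν^q y^κ` with `|κ| = s` and `q + s ≤ m`, hence through at most `m` derivatives of
`f`; likewise for `g`. -/
theorem StarProduct.IsFedosov.isNatural (hS : S.IsFedosov ω₀) (hω : IsSymplectic ω₀) :
    S.IsNatural := by
  intro m _ x f g h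
  obtain ⟨D, Ω, hD, -, hx⟩ := hS
  obtain ⟨r, hr, hfg⟩ := hx x
  obtain ⟨a, c, ha, hc, hC⟩ := hfg f g
  have h1 := hC _ (mem_extChartAt_target (I := 𝓡 n) x) m
  rw [extChartAt_to_inv] at h1
  rw [h1, wcoeff_moyal]
  refine Finset.sum_eq_zero fun p hp => Finset.sum_eq_zero fun q hq => Finset.sum_eq_zero fun i _ =>
    Finset.sum_eq_zero fun j _ => Finset.sum_eq_zero fun κ hκ => ?_
  rw [mem_antidiagonal] at hp hq hκ
  have hdeg : κ.1.degree + κ.2.degree = 0 := by rw [← map_add, hκ, map_zero]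
  refine mul_eq_zero_of_right _ (mul_eq_zero_of_right _ ?_)
  rcases h with h | h
  · refine mul_eq_zero_of_left ?_ _
    refine (ha.germGE hω hD hr h q.1 (κ.1 + multiIndex i)).apply_eq_zero ?_
    rw [map_add, degree_multiIndex]; push_cast; omega
  · refine mul_eq_zero_of_right _ ?_
    refine (hc.germGE hω hD hr h q.2 (κ.2 + multiIndex j)).apply_eq_zero ?_
    rw [map_add, degree_multiIndex]; push_cast; omega

/-- The lifts have no term of order `ν` at `y = 0`, so only the single contraction of the
differentials of `f` and `g` with `π / 2` remains. -/
theorem StarProduct.IsFedosov.C_one_eq (hS : S.IsFedosov ω₀) (hω : IsSymplectic ω₀)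
    (hP : P.IsInducedBy ω₀) (f g : SmoothFn (𝓡 n) M) :
    S.C 1 f g = (1 / 2 : ℂ) • P.bracket f g := by
  ext x
  obtain ⟨D, Ω, hD, -, hx⟩ := hS
  obtain ⟨r, hr, hfg⟩ := hx x
  obtain ⟨a, c, ha, hc, hC⟩ := hfg f g
  have hy := mem_extChartAt_target (I := 𝓡 n) x
  have h1 := hC _ hy 1
  rw [extChartAt_to_inv] at h1
  have ea : wcoeff 1 0 (a (extChartAt (𝓡 n) x x)) = 0 :=
    (ha.symbol _ hy 1).trans (if_neg one_ne_zero)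
  have ec : wcoeff 1 0 (c (extChartAt (𝓡 n) x x)) = 0 :=
    (hc.symbol _ hy 1).trans (if_neg one_ne_zero)
  rw [h1, wcoeff_one_zero_moyal, ea, ec, zero_mul,
    mul_zero, add_zero, zero_add, smoothFn_smul_apply, hP f g x]
  congr 1
  refine Finset.sum_congr rfl fun i _ => Finset.sum_congr rfl fun j _ => ?_
  rw [ha.wcoeff_single hω hr, hc.wcoeff_single hω hr, poissonInChart, TwoForm.comp_self, mul_assoc]

/-- The matrix of `C_1` is half the Poisson matrix, so its product with the matrix of `ω` is `-1/2`
times the identity. -/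
theorem StarProduct.IsNatural.det_firstMatrix_ne_zero (hS : S.IsNatural) (hω : IsSymplectic ω₀)
    (hP : P.IsInducedBy ω₀) (h : ∀ f g, S.C 1 f g = (1 / 2 : ℂ) • P.bracket f g) (x : M) :
    (hS.firstMatrix (stdBasis n) x).det ≠ 0 := by
  obtain ⟨z, hz⟩ := exists_isCoord (J := 𝓡 n) (stdBasis n) x
  set w : Fin n → Fin n → ℝ := fun i j => ω₀ x ![stdVec i, stdVec j] with hw
  have hd : ∀ i k, differential (z i) x (stdVec k) = if i = k then 1 else 0 := by
    intro i k
    have h1 := constantCoeff_pderiv_jet (b := stdBasis n) (x₀ := x) (z i) k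
    rw [stdBasis_apply] at h1
    rw [← h1, hz.jet]
    split_ifs with hik
    · subst hik; rw [pderiv_X_self, map_one]
    · rw [pderiv_X_of_ne hik, map_zero]
  have hK : ∀ i j, hS.firstMatrix (stdBasis n) x i j = (1 / 2 : ℂ) * (poissonMatrix w i j : ℂ) := by
    intro i j
    rw [IsNatural.firstMatrix, Matrix.of_apply, ← hz.jet i, ← hz.jet j,
      hS.constantCoeff_formalStar, h, smoothFn_smul_apply, hP]
    congr 1
    simp only [hd]
    simp
    rfl
  intro h0
  have h1 : (Matrix.of fun i j => (w i j : ℂ)) * hS.firstMatrix (stdBasis n) x =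
      (-(1 / 2) : ℂ) • (1 : Matrix (Fin n) (Fin n) ℂ) := by
    ext k j
    rw [Matrix.mul_apply, Matrix.smul_apply, Matrix.one_apply]
    simp only [Matrix.of_apply, hK]
    have h2 := sum_mul_poissonMatrix (hω.det_ne_zero x) k j
    have h3 : ∑ i, (w k i : ℂ) * ((1 / 2 : ℂ) * (poissonMatrix w i j : ℂ)) =
        (1 / 2 : ℂ) * ∑ i, (w k i : ℂ) * (poissonMatrix w i j : ℂ) := by
      rw [Finset.mul_sum]
      exact Finset.sum_congr rfl fun i _ => by ring
    rw [h3, h2]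
    split_ifs <;> simp
  have h4 := congrArg Matrix.det h1
  rw [Matrix.det_mul, h0, mul_zero, Matrix.det_smul, Matrix.det_one, mul_one] at h4
  exact pow_ne_zero _ (by norm_num) h4.symm

end Fedosov

end StarFOI

end

open StarFOI in
theorem mainTheorem5 {n : ℕ} {M : Type*} [TopologicalSpace M] [T2Space M] [SigmaCompactSpace M]
    [ChartedSpace (EuclideanSpace ℝ (Fin n)) M] [IsManifold (𝓡 n) ∞ M]
    (P : PoissonBracket (𝓡 n) M) (S : StarProduct P) :
    (S.IsNatural →
      ∃ K : ContravariantTensor (𝓡 n) M, (∀ K', S.IsFirstTensor K' ↔ K' = K) ∧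
        ∀ x : M, ∃ Λ : FormalFunctional ((𝓡 n).prod (𝓡 n)) (M × M),
          (∀ Λ', S.IsPointDistribution x Λ' ↔ Λ' = Λ) ∧
          (IsFOI (x, x) Λ ↔ (K x).Nondegenerate)) ∧
    (∀ ω₀ : TwoForm n M ℝ, IsSymplectic ω₀ → P.IsInducedBy ω₀ →
      (S.IsNatural → (∀ f g, S.C 1 f g = (1 / 2 : ℂ) • P.bracket f g) →
        ∃ K : ContravariantTensor (𝓡 n) M, S.IsFirstTensor K ∧ ∀ x : M, (K x).Nondegenerate ∧
          ∃ Λ : FormalFunctional ((𝓡 n).prod (𝓡 n)) (M × M),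
            S.IsPointDistribution x Λ ∧ IsFOI (x, x) Λ) ∧
      (S.IsFedosov ω₀ →
        ∀ x : M, ∃ Λ : FormalFunctional ((𝓡 n).prod (𝓡 n)) (M × M),
          S.IsPointDistribution x Λ ∧ IsFOI (x, x) Λ)) := by
  have main : ∀ hS : S.IsNatural, ∀ x, (hS.firstMatrix (stdBasis n) x).det ≠ 0 →
      (hS.firstTensor (stdBasis n) x).Nondegenerate ∧
      ∃ Λ : FormalFunctional ((𝓡 n).prod (𝓡 n)) (M × M),
        S.IsPointDistribution x Λ ∧ IsFOI (x, x) Λ := fun hS x hdet =>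
    ⟨hS.nondegenerate_firstTensor_iff.mpr hdet, hS.pointDistribution (stdBasis n) x,
      hS.isPointDistribution, hS.isFOI_iff.mpr hdet⟩
  refine ⟨fun hS => ⟨hS.firstTensor (stdBasis n), fun K' => ⟨fun h => ?_, ?_⟩, fun x =>
    ⟨hS.pointDistribution (stdBasis n) x, fun Λ' => ⟨fun h => ?_, ?_⟩, ?_⟩⟩,
    fun ω₀ hω hP => ⟨fun hS h => ⟨hS.firstTensor (stdBasis n), hS.isFirstTensor, fun x =>
      main hS x (hS.det_firstMatrix_ne_zero hω hP h x)⟩, fun hF x =>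
      (main (hF.isNatural hω) x ((hF.isNatural hω).det_firstMatrix_ne_zero hω hP
        (hF.C_one_eq hω hP) x)).2⟩⟩
  · exact h.unique (stdBasis n) hS.isFirstTensor
  · rintro rfl
    exact hS.isFirstTensor
  · exact h.unique (stdBasis n) hS.isPointDistribution
  · rintro rfl
    exact hS.isPointDistribution
  · exact hS.isFOI_iff.trans hS.nondegenerate_firstTensor_iff.symm
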